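/- **Setting.** Let $K$ be a compact connected simply-connected Lie group, realised as a closed subgroup of some $U(n)$, let $T\subseteq K$ be a maximal torus with Lie algebra $\mathfrak t$ of dimension $r$ and Weyl group $W=N_K(T)/T$, and let $\langle\cdot,\cdot\rangle$ be an $\mathrm{Ad}$-invariant inner product on $\mathfrak k$ such that the class of the 3-form $\frac1{12}\langle\theta\wedge[\theta\wedge\theta]\rangle$ lies in $H^3(K,2\pi\mathbb Z)$. Fix $t=k+is$ with $k\in\mathbb Z_{>0}$, $s\in\mathbb R$. Let $\mathcal A_0=\mathfrak t\,dx\oplus\mathfrak t\,dy$ and $\mathcal A_0^{\mathbb C}=\mathcal A_0\otimes\mathbb C$ be the spaces of translation-invariant connection forms on $\mathbb R^2/\mathbb Z^2$, with $\omega(A,B)=\int\langle A\wedge B\rangle$, $\omega^{\mathbb C}$ its complexification and $\omega_t=\mathrm{Re}(t\,\omega^{\mathbb C})$. The trivial line bundles $\mathcal L_k\to\mathcal A_0$ and $\mathcal L_t^{\mathbb C}\to\mathcal A_0^{\mathbb C}$ carry the connections $d-\frac{ik}2\omega(A,\cdot)$ and $d-\frac i2\omega_t(A,\cdot)$. The group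 $\mathcal K_0=\ker(\exp|_{\mathfrak t})^2\rtimes W$ acts on both spaces; equivariant sections are the $W$-invariant functions with $\varphi(A+\lambda)=e^{\frac i2(k\langle\lambda_1,\lambda_2\rangle+\omega_t(\lambda,A))}\varphi(A)$ for $\lambda=\lambda_1dx+\lambda_2dy$ in the lattice. They are the sections over the moduli spaces $\mathcal M=\mathcal A_0/\mathcal K_0$ and $\mathcal M^{\mathbb C}=\mathcal A_0^{\mathbb C}/\mathcal K_0$, with $L^2$-norms computed on a fundamental domain. For $\tau=\tau_1+i\tau_2$ in the upper half-plane $\mathcal T$ let $I_\tau$ be the Hodge operator of $\mathbb C/(\mathbb Z\oplus\tau\mathbb Z)$ on $\mathcal A_0$ and $I_{\tau,t}A=\frac{\bar t}{|t|}\,{*_\tau}\bar A$ the complex structure on $\mathcal A_0^{\mathbb C}$, with metrics $g_\tau=\omega(\cdot,I_\tau\cdot)$ and $g^{\mathbb C}_\tau=|t|^{-1}\omega_t(\cdot,I_{\tau,t}\cdot)$. For a real tangent vector $V$ of $\mathcal T$ write $-V[g_\tau^{-1}]=G(V)+\overline G(V)$ and $-V[(g_\tau^{\mathbb C})^{-1}]=G^{\mathbb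 C}(V)+\overline G^{\mathbb C}(V)$ for the decompositions into types $(2,0)$ and $(0,2)$, and for a bivector $G$ write $\Delta_G=\mathrm{Tr}(\nabla G\nabla)$. The Hitchin–Witten and complexified Hitchin connections are $$\nabla^{HW}_V=V-\tfrac12\Bigl(\tfrac1{\bar t}\Delta_{\overline G(V)}-\tfrac1t\Delta_{G(V)}\Bigr),\qquad \nabla^{\mathbb C}_V=V+\tfrac1{4|t|}\Delta_{G^{\mathbb C}(V)} .$$ Let $\mathcal S$ be the Schwartz space of sections of $\mathcal L_k\to\mathcal A_0$, and $\mathcal S_{\mathbb C}=\mathcal S_{\tau,t,\mathbb C}$ the space of Schwartz-class $I_{\tau,t}$-holomorphic sections of $\mathcal L^{\mathbb C}_t\to\mathcal A_0^{\mathbb C}$; let $\mathcal S'$, $\mathcal S'_{\mathbb C}$ be the spaces of continuous antilinear functionals on them. A section $\psi$ defines the regular distribution $(\psi\,|\,\chi)=\int\psi\bar\chi$ if all these integrals converge absolutely. A family $S_\tau\in\mathcal S'$ is smooth if $(S_\tau|\psi)$ is smooth in $\tau$ for every $\psi\in\mathcal S$, and a family $S_\tau\in\mathcal S'_{\mathbb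 C}$ is smooth if $(S_\tau|\chi_\tau)$ is smooth for every smooth family of test sections $\chi_\tau\in\mathcal S_{\tau,t,\mathbb C}$ (jointly smooth in $(\tau,A)$, with all derivatives rapidly decreasing in $A$, locally uniformly in $\tau$). The dual connections are $$(\check\nabla^{HW}_VS\,|\,\psi)=V[(S|\psi)]-(S\,|\,\nabla^{HW}_V\psi),\qquad(\check\nabla^{\mathbb C}_VS\,|\,\chi_\tau)=V[(S|\chi)]-(S\,|\,\nabla^{\mathbb C}_V\chi),$$ for $\psi\in\mathcal S$ constant in $\tau$ and for smooth families $\chi$ of test sections. Let $(T_j)_{j\le r}$ be an orthonormal basis of $\mathfrak t$, $X_j=(2\tau_2)^{-1/2}T_j(dx+\tau dy)$, $X_{j+r}=iX_j$, let $(\mathbf p,\mathbf q)\in\mathbb R^{2r}\times\mathbb R^{2r}$ be the real coordinates on $\mathcal A_0^{\mathbb C}$ in the basis $(X_a,I_{\tau,t}X_a)_{a\le 2r}$, and put $\mathbf z=\mathbf p+i\mathbf q$, $\rho_\tau=e^{-\frac{i|t|}2\mathbf p\cdot\mathbf q}$. For $\psi\in\mathcal S$ let $\psi(\mathbf q)$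 be the quotient $\psi/\rho_\tau$ on $\mathcal A_0$, expressed through the coordinates $\mathbf q$ of $\mathcal A_0$. The Bargmann transform is $$(\mathcal B_\tau\psi)(\mathbf z)=\Bigl(\frac{|t|}\pi\Bigr)^{r/2}\int_{\mathbb R^{2r}}\psi(\mathbf q)\,\exp\Bigl(-\frac{|t|}4\bigl(2|\mathbf q|^2+4i\,\mathbf q\cdot\mathbf z+|\mathbf z|^2-\mathbf z\cdot\mathbf z\bigr)\Bigr)d\mathbf q .$$ **Theorem 3.** 1. Every bounded measurable equivariant section over $\mathcal A_0$ is an $L^2$ section over $\mathcal M$. The $L^2$ sections over $\mathcal M$ define regular distributions in $\mathcal S'$, and two such sections with the same distribution agree almost everywhere. For every $\tau$, the $I_{\tau,t}$-holomorphic $L^2$ sections over $\mathcal M^{\mathbb C}$ define regular distributions in $\mathcal S'_{\mathbb C}$, and two such sections with the same distribution are equal. 2. For smooth families, both dual connections are well defined by the formulas above: the derivatives exist and are unique as elements of $\mathcal S'$ and $\mathcal S'_{\mathbb C}$. For every $\tau$, the Bargmann transform is a continuous linear map $\mathcal B_\tau:\mathcal S\to\mathcal S_{\mathbb C}$. Its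 transpose ${}^t\mathcal B_\tau:\mathcal S'_{\mathbb C}\to\mathcal S'$ takes smooth families to smooth families and intertwines the dual connections: ${}^t\mathcal B_\tau(\check\nabla^{\mathbb C}_VS)=\check\nabla^{HW}_V({}^t\mathcal B_\tau S)$ for every smooth family $S$ in $\mathcal S'_{\mathbb C}$ and every real tangent vector $V$ of $\mathcal T$. 3. If $\Psi$ is a smooth $\mathcal T$-family of sections over $\mathcal M$, then its regular distributions form a smooth family in $\mathcal S'$, and $\check\nabla^{HW}_V\Psi$ is the regular distribution of $\nabla^{HW}_V\Psi$. If $\Phi$ is a smooth $\mathcal T$-family of $I_{\tau,t}$-holomorphic $L^2$ sections over $\mathcal M^{\mathbb C}$ whose derivatives of all orders along $\mathcal T$ have locally uniformly bounded $L^2$-norm over $\mathcal M^{\mathbb C}$, then its regular distributions form a smooth family in $\mathcal S'_{\mathbb C}$, and $\check\nabla^{\mathbb C}_V\Phi$ is the regular distribution of $\nabla^{\mathbb C}_V\Phi$. -/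

import Mathlib

open MeasureTheory Topology
open scoped SchwartzMap ContDiff

noncomputable section

namespace GenusOne

/-! ### The group, its maximal torus and the invariant pairing -/

/-- Complex square matrices. -/
abbrev Mat (n : ℕ) := Matrix (Fin n) (Fin n) ℂ

/-- The unitary group. Compact Lie groups are the closed subgroups of the groups `U n`. -/
abbrev U (n : ℕ) := Matrix.unitaryGroup (Fin n) ℂ

/-- The Lie algebra of a closed subgroup of `U n`. -/
def lieAlg {n : ℕ} (S : Subgroup (U n)) : Set (Mat n) :=
  {X | ∀ x : ℝ, ∃ g ∈ S, (g : Mat n) = NormedSpace.exp (x • X)}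

/-- `T` is a maximal torus of `K`: maximal among closed connected abelian subgroups. -/
def IsMaximalTorus {n : ℕ} (K T : Subgroup (U n)) : Prop :=
  Maximal (fun S : Subgroup (U n) =>
    S ≤ K ∧ IsClosed (S : Set (U n)) ∧ IsConnected (S : Set (U n)) ∧
      ∀ g ∈ S, ∀ h ∈ S, g * h = h * g) T

/-- Left logarithmic derivative `f⁻¹ ∂ᵢ f` of a map into the unitary matrices. -/
def maurerCartan {n : ℕ} (f : (Fin 3 → ℝ) → Fin n → Fin n → ℂ) (i : Fin 3)
    (x : Fin 3 → ℝ) : Mat n :=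
  (Matrix.of (f x)).conjTranspose * Matrix.of (fderiv ℝ f x (Pi.single i 1))

/-- The pairing on the Lie algebra of `K`: an `Ad`-invariant inner product such that the class of
the canonical 3-form `(1/12) ⟨θ ∧ [θ ∧ θ]⟩`, i.e. `(X, Y, Z) ↦ (1/2) ⟨X, [Y, Z]⟩`, lies in
`H³(K, 2πℤ)`. As `K` is 2-connected, this is tested on smooth maps of 3-spheres, given as maps on
the cube which are trivial near its outside. Only the values of `B` on the Lie algebra
of `K` matter. -/
structure IsInvariantPairing {n : ℕ} (K : Subgroup (U n)) (B : Mat n →ₗ[ℝ] Mat n →ₗ[ℝ] ℝ) :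
    Prop where
  symm : ∀ X ∈ lieAlg K, ∀ Y ∈ lieAlg K, B X Y = B Y X
  pos : ∀ X ∈ lieAlg K, X ≠ 0 → 0 < B X X
  invariant : ∀ g ∈ K, ∀ X ∈ lieAlg K, ∀ Y ∈ lieAlg K,
    B ((g : Mat n) * X * ((g⁻¹ : U n) : Mat n)) ((g : Mat n) * Y * ((g⁻¹ : U n) : Mat n)) = B X Y
  integral : ∀ f : (Fin 3 → ℝ) → Fin n → Fin n → ℂ, ContDiff ℝ ∞ f →
    (∀ x, ∃ g ∈ K, (g : Mat n) = Matrix.of (f x)) →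
    (∀ x, x ∉ Set.Icc (0 : Fin 3 → ℝ) 1 → Matrix.of (f x) = 1) →
    ∃ m : ℤ, ∫ x, (1 / 2) * B (maurerCartan f 0 x) ⁅maurerCartan f 1 x, maurerCartan f 2 x⁆
      = 2 * Real.pi * m

/-- `e` is an orthonormal basis of the Lie algebra of `T`. -/
def IsOrthonormalFrame {n r : ℕ} (T : Subgroup (U n)) (B : Mat n →ₗ[ℝ] Mat n →ₗ[ℝ] ℝ)
    (e : Fin r → Mat n) : Prop :=
  (∀ X, X ∈ lieAlg T ↔ X ∈ Submodule.span ℝ (Set.range e)) ∧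
    ∀ i j, B (e i) (e j) = if i = j then 1 else 0

/-! ### The covering spaces of the moduli spaces -/

/-- The index of the linear coordinates `u_j` (left) and `u_{j+r}` (right). -/
abbrev Idx (r : ℕ) := Fin r ⊕ Fin r

/-- Translation-invariant connection forms with values in the Lie algebra of `T`:
`u` stands for `∑ⱼ u_j T_j dx + u_{j+r} T_j dy`, where `(T_j)` is the chosen frame. -/
abbrev A0 (r : ℕ) := Idx r → ℝ

/-- The complexification of `A0`, with coordinates `w = u + i v`. -/
abbrev AC (r : ℕ) := Idx r → ℂ

/-- The inclusion of `A0` in `AC`. -/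
def incl (r : ℕ) : A0 r →ₗ[ℝ] AC r := Complex.ofRealCLM.toLinearMap.compLeft (Idx r)

/-- The two matrix-valued components (along `dx` and `dy`) of a connection form. -/
def comp {n r : ℕ} (e : Fin r → Mat n) (A : AC r) : Mat n × Mat n :=
  (∑ j, A (Sum.inl j) • e j, ∑ j, A (Sum.inr j) • e j)

/-- The lattice of translations of `A0` by gauge transformations `Σ → T`, i.e. pairs of elements of
the kernel of `exp` on the Lie algebra of `T` (which is a group). -/
def lattice {n r : ℕ} (e : Fin r → Mat n) : AddSubgroup (A0 r) :=
  AddSubgroup.closure {u | NormedSpace.exp (comp e (incl r u)).1 = 1 ∧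
    NormedSpace.exp (comp e (incl r u)).2 = 1}

/-- The lattice, acting on the complexification. -/
def latticeC {n r : ℕ} (e : Fin r → Mat n) : AddSubgroup (AC r) :=
  (lattice e).map (incl r).toAddMonoidHom

/-- `A' = Ad_g A`. -/
def IsConj {n r : ℕ} (e : Fin r → Mat n) (g : U n) (A A' : AC r) : Prop :=
  (comp e A').1 = (g : Mat n) * (comp e A).1 * ((g⁻¹ : U n) : Mat n) ∧
  (comp e A').2 = (g : Mat n) * (comp e A).2 * ((g⁻¹ : U n) : Mat n)

/-- `g` lies in the normaliser of `T` in `K`. -/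
def InNormalizer {n : ℕ} (K T : Subgroup (U n)) (g : U n) : Prop :=
  g ∈ K ∧ ∀ h, h ∈ T ↔ g * h * g⁻¹ ∈ T

/-! ### Symplectic forms, complex structures, prequantum connections -/

/-- The Atiyah–Bott form on `A0`. -/
def omega {r : ℕ} (A B : A0 r) : ℝ :=
  ∑ j : Fin r, (A (Sum.inl j) * B (Sum.inr j) - A (Sum.inr j) * B (Sum.inl j))

/-- The holomorphic symplectic form on `AC`. -/
def omegaC {r : ℕ} (A B : AC r) : ℂ :=
  ∑ j : Fin r, (A (Sum.inl j) * B (Sum.inr j) - A (Sum.inr j) * B (Sum.inl j))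

/-- The real symplectic form `ω_t = Re (t ω^ℂ)`. -/
def omegaT {r : ℕ} (t : ℂ) (A B : AC r) : ℝ := (t * omegaC A B).re

/-- The Teichmüller space of the torus: the upper half-plane. -/
def teich : Set ℂ := {τ | 0 < τ.im}

/-- The complex structure `I_τ` on `A0`: the Hodge operator, determined by
`∗dx = (τ₁ dx + |τ|² dy) / τ₂` and `∗dy = -(dx + τ₁ dy) / τ₂`. -/
def hodge {r : ℕ} (τ : ℂ) (A : A0 r) : A0 r :=
  Sum.elim (fun j => (τ.re * A (Sum.inl j) - A (Sum.inr j)) / τ.im)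
    (fun j => (Complex.normSq τ * A (Sum.inl j) - τ.re * A (Sum.inr j)) / τ.im)

/-- The complex-linear Hodge operator on `AC`. -/
def hodgeC {r : ℕ} (τ : ℂ) (A : AC r) : AC r :=
  Sum.elim (fun j => ((τ.re : ℂ) * A (Sum.inl j) - A (Sum.inr j)) / (τ.im : ℂ))
    (fun j => ((Complex.normSq τ : ℂ) * A (Sum.inl j) - (τ.re : ℂ) * A (Sum.inr j)) / (τ.im : ℂ))

/-- The complex structure on `AC` with Kähler form `Re ω^ℂ`: it is `I_τ` on `A0` and
anticommutes with the multiplication by `i`. -/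
def IC {r : ℕ} (τ : ℂ) (A : AC r) : AC r := hodgeC τ (star A)

/-- The complex structure `I_{τ,t} = (k/|t|) I_τ^ℂ + (s/|t|) I_τ^ℂ ∘ J` with `t = k + i s` and `J`
the multiplication by `i`. -/
def IT {r : ℕ} (τ t : ℂ) (A : AC r) : AC r :=
  (t.re / ‖t‖) • IC τ A + (t.im / ‖t‖) • IC τ (Complex.I • A)

/-- The prequantum connection on the trivial line bundle over `A0`, with curvature `-i k ω`. -/
def nabla {r : ℕ} (k : ℝ) (X : A0 r) (ψ : A0 r → ℂ) (A : A0 r) : ℂ :=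
  fderiv ℝ ψ A X - Complex.I / 2 * ((k * omega A X : ℝ) : ℂ) * ψ A

/-- The prequantum connection on the trivial line bundle over `AC`, with curvature `-i ω_t`. -/
def nablaT {r : ℕ} (t : ℂ) (X : AC r) (φ : AC r → ℂ) (A : AC r) : ℂ :=
  fderiv ℝ φ A X - Complex.I / 2 * (omegaT t A X : ℂ) * φ A

/-- The (1,0)-part of `nabla` with respect to `I_τ`. -/
def nabla10 {r : ℕ} (k : ℝ) (τ : ℂ) (X : A0 r) (ψ : A0 r → ℂ) (A : A0 r) : ℂ :=
  (nabla k X ψ A - Complex.I * nabla k (hodge τ X) ψ A) / 2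

/-- The (0,1)-part of `nabla` with respect to `I_τ`. -/
def nabla01 {r : ℕ} (k : ℝ) (τ : ℂ) (X : A0 r) (ψ : A0 r → ℂ) (A : A0 r) : ℂ :=
  (nabla k X ψ A + Complex.I * nabla k (hodge τ X) ψ A) / 2

/-- The (1,0)-part of `nablaT` with respect to `I_{τ,t}`. -/
def nablaT10 {r : ℕ} (τ t : ℂ) (X : AC r) (φ : AC r → ℂ) (A : AC r) : ℂ :=
  (nablaT t X φ A - Complex.I * nablaT t (IT τ t X) φ A) / 2

/-- The (0,1)-part of `nablaT` with respect to `I_{τ,t}`. -/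
def nablaT01 {r : ℕ} (τ t : ℂ) (X : AC r) (φ : AC r → ℂ) (A : AC r) : ℂ :=
  (nablaT t X φ A + Complex.I * nablaT t (IT τ t X) φ A) / 2

/-- Holomorphic sections of the prequantum line bundle over `AC`. -/
def IsHolomorphic {r : ℕ} (τ t : ℂ) (φ : AC r → ℂ) : Prop :=
  Differentiable ℝ φ ∧ ∀ X A, nablaT01 τ t X φ A = 0

/-! ### The Hitchin–Witten connection and the complexified Hitchin connection -/

/-- The coordinate basis of `A0`. -/
def basis0 {r : ℕ} (a : Idx r) : A0 r := Pi.single a 1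

/-- The coordinate basis of `AC` as a real vector space. -/
def basisC {r : ℕ} : Idx r ⊕ Idx r → AC r :=
  Sum.elim (fun a => Pi.single a 1) (fun a => Pi.single a Complex.I)

/-- The Kähler metric `ω (·, I_τ ·)` on `A0`. -/
def metric0 (r : ℕ) (τ : ℂ) : Matrix (Idx r) (Idx r) ℝ :=
  Matrix.of fun a b => omega (basis0 a) (hodge τ (basis0 b))

/-- The hyperkähler metric `|t|⁻¹ ω_t (·, I_{τ,t} ·)` on `AC`. -/
def metricC (r : ℕ) (τ t : ℂ) : Matrix (Idx r ⊕ Idx r) (Idx r ⊕ Idx r) ℝ :=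
  Matrix.of fun a b => omegaT t (basisC a) (IT τ t (basisC b)) / ‖t‖

/-- The components of the bivector `G̃(V)`, minus the `V`-derivative of the inverse metric. -/
def G0 (r : ℕ) (V τ : ℂ) (a b : Idx r) : ℝ :=
  -fderiv ℝ (fun τ' => (metric0 r τ')⁻¹ a b) τ V

/-- The components of the bivector `G̃^ℂ(V)`, minus the `V`-derivative of the inverse metric. -/
def GC (r : ℕ) (t V τ : ℂ) (a b : Idx r ⊕ Idx r) : ℝ :=
  -fderiv ℝ (fun τ' => (metricC r τ' t)⁻¹ a b) τ V

/-- The Laplacian `Tr (∇^{1,0} G(V) ∇^{1,0})`. -/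
def laplaceG {r : ℕ} (k : ℝ) (V τ : ℂ) (ψ : A0 r → ℂ) (A : A0 r) : ℂ :=
  ∑ a, ∑ b, (G0 r V τ a b : ℂ) * nabla10 k τ (basis0 a) (nabla10 k τ (basis0 b) ψ) A

/-- The Laplacian `Tr (∇^{0,1} Ḡ(V) ∇^{0,1})`. -/
def laplaceGbar {r : ℕ} (k : ℝ) (V τ : ℂ) (ψ : A0 r → ℂ) (A : A0 r) : ℂ :=
  ∑ a, ∑ b, (G0 r V τ a b : ℂ) * nabla01 k τ (basis0 a) (nabla01 k τ (basis0 b) ψ) A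

/-- The Laplacian `Tr (∇_t^{1,0} G^ℂ(V) ∇_t^{1,0})`. -/
def laplaceC {r : ℕ} (t V τ : ℂ) (φ : AC r → ℂ) (A : AC r) : ℂ :=
  ∑ a, ∑ b, (GC r t V τ a b : ℂ) * nablaT10 τ t (basisC a) (nablaT10 τ t (basisC b) φ) A

/-- The 1-form `u^HW`. -/
def uHW {r : ℕ} (t V τ : ℂ) (ψ : A0 r → ℂ) (A : A0 r) : ℂ :=
  1 / star t * laplaceGbar t.re V τ ψ A - 1 / t * laplaceG t.re V τ ψ A

/-- The 1-form `u^ℂ`. -/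
def uC {r : ℕ} (t V τ : ℂ) (φ : AC r → ℂ) (A : AC r) : ℂ := -laplaceC t V τ φ A

/-- The Hitchin–Witten connection `∇^Tr - u^HW / 2`, acting on families over Teichmüller space
of sections over `A0`; here `V` is a real tangent vector at `τ`. -/
def covHW {r : ℕ} (t V : ℂ) (Ψ : ℂ → A0 r → ℂ) (τ : ℂ) (A : A0 r) : ℂ :=
  fderiv ℝ (fun τ' => Ψ τ' A) τ V - 1 / 2 * uHW t V τ (Ψ τ) A

/-- The complexified Hitchin connection `∇^Tr - u^ℂ / (4 |t|)`. -/
def covC {r : ℕ} (t V : ℂ) (Φ : ℂ → AC r → ℂ) (τ : ℂ) (A : AC r) : ℂ :=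
  fderiv ℝ (fun τ' => Φ τ' A) τ V - 1 / (4 * (‖t‖ : ℂ)) * uC t V τ (Φ τ) A

/-! ### Sections over the moduli spaces -/

/-- The multiplier of the lift of the lattice translations to the prequantum line bundles. -/
def multiplier {r : ℕ} (t : ℂ) (l : A0 r) (A : AC r) : ℂ :=
  Complex.exp (Complex.I / 2 *
    ((t.re * ∑ j : Fin r, l (Sum.inl j) * l (Sum.inr j) + omegaT t (incl r l) A : ℝ) : ℂ))

/-- Sections over `A0` equivariant for the residual gauge group, generated by the lattice
translations and the Weyl group. -/
def IsEquivariant0 {n r : ℕ} (K T : Subgroup (U n)) (e : Fin r → Mat n) (t : ℂ)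
    (ψ : A0 r → ℂ) : Prop :=
  (∀ l ∈ lattice e, ∀ A, ψ (A + l) = multiplier t l (incl r A) * ψ A) ∧
  ∀ g, InNormalizer K T g → ∀ A A', IsConj e g (incl r A) (incl r A') → ψ A' = ψ A

/-- Sections over `AC` equivariant for the residual gauge group. -/
def IsEquivariantC {n r : ℕ} (K T : Subgroup (U n)) (e : Fin r → Mat n) (t : ℂ)
    (φ : AC r → ℂ) : Prop :=
  (∀ l ∈ lattice e, ∀ A, φ (A + incl r l) = multiplier t l A * φ A) ∧
  ∀ g, InNormalizer K T g → ∀ A A', IsConj e g A A' → φ A' = φ A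

/-- `L²` sections over the moduli space of flat `K`-connections. The norm is computed on a
fundamental domain of the lattice, that is up to the order of the Weyl group. -/
def IsL2Section {n r : ℕ} (K T : Subgroup (U n)) (e : Fin r → Mat n) (t : ℂ)
    (ψ : A0 r → ℂ) : Prop :=
  AEStronglyMeasurable ψ volume ∧ IsEquivariant0 K T e t ψ ∧
    ∃ D : Set (A0 r), IsAddFundamentalDomain (lattice e) D volume ∧
      MemLp ψ 2 (volume.restrict D)

/-- Holomorphic `L²` sections over the moduli space of flat `K^ℂ`-connections. -/
def IsL2Holomorphic {n r : ℕ} (K T : Subgroup (U n)) (e : Fin r → Mat n) (τ t : ℂ)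
    (φ : AC r → ℂ) : Prop :=
  IsHolomorphic τ t φ ∧ IsEquivariantC K T e t φ ∧
    ∃ D : Set (AC r), IsAddFundamentalDomain (latticeC e) D volume ∧
      MemLp φ 2 (volume.restrict D)

/-- Smooth families over Teichmüller space of sections over the moduli space of flat
`K`-connections. -/
def IsSmoothFamily0 {n r : ℕ} (K T : Subgroup (U n)) (e : Fin r → Mat n) (t : ℂ)
    (Ψ : ℂ → A0 r → ℂ) : Prop :=
  ContDiffOn ℝ ∞ (fun p : ℂ × A0 r => Ψ p.1 p.2) (teich ×ˢ Set.univ) ∧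
    ∀ τ ∈ teich, IsEquivariant0 K T e t (Ψ τ)

/-- Smooth families over Teichmüller space of holomorphic `L²` sections over the moduli space
of flat `K^ℂ`-connections: all derivatives along Teichmüller space are `L²`, locally uniformly. -/
def IsSmoothFamilyC {n r : ℕ} (K T : Subgroup (U n)) (e : Fin r → Mat n) (t : ℂ)
    (Φ : ℂ → AC r → ℂ) : Prop :=
  ContDiffOn ℝ ∞ (fun p : ℂ × AC r => Φ p.1 p.2) (teich ×ˢ Set.univ) ∧
    (∀ τ ∈ teich, IsHolomorphic τ t (Φ τ) ∧ IsEquivariantC K T e t (Φ τ)) ∧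
    ∃ D : Set (AC r), IsAddFundamentalDomain (latticeC e) D volume ∧
      ∀ m : ℕ, ∀ τ₀ ∈ teich, ∃ C : NNReal, ∀ᶠ τ in 𝓝 τ₀,
        eLpNorm (fun A => iteratedFDeriv ℝ m (fun τ' => Φ τ' A) τ) 2 (volume.restrict D) ≤ C

/-! ### Schwartz-class sections, tempered distributions, dual connections -/

theorem isHolomorphic_add {r : ℕ} {τ t : ℂ} {φ χ : AC r → ℂ} (hφ : IsHolomorphic τ t φ)
    (hχ : IsHolomorphic τ t χ) : IsHolomorphic τ t (fun A => φ A + χ A) := by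
  refine ⟨hφ.1.add hχ.1, fun X A => ?_⟩
  have h1 := hφ.2 X A
  have h2 := hχ.2 X A
  have h3 : fderiv ℝ (fun A => φ A + χ A) A = fderiv ℝ φ A + fderiv ℝ χ A :=
    fderiv_fun_add (hφ.1 A) (hχ.1 A)
  simp only [nablaT01, nablaT, h3, add_apply] at *
  linear_combination h1 + h2

theorem isHolomorphic_smul {r : ℕ} {τ t : ℂ} {φ : AC r → ℂ} (c : ℂ)
    (hφ : IsHolomorphic τ t φ) : IsHolomorphic τ t (fun A => c * φ A) := by
  refine ⟨hφ.1.const_mul c, fun X A => ?_⟩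
  have h1 := hφ.2 X A
  have h3 : fderiv ℝ (fun A => c * φ A) A = c • fderiv ℝ φ A := fderiv_const_mul (hφ.1 A) c
  simp only [nablaT01, nablaT, h3, smul_apply, smul_eq_mul] at *
  linear_combination c * h1

theorem isHolomorphic_zero {r : ℕ} {τ t : ℂ} :
    IsHolomorphic τ t (fun _ : AC r => (0 : ℂ)) := by
  refine ⟨differentiable_const 0, fun X A => ?_⟩
  simp [nablaT01, nablaT]

/-- Schwartz-class sections over `A0`. -/
abbrev S0 (r : ℕ) := 𝓢(A0 r, ℂ)

/-- Schwartz-class holomorphic sections over `AC`, with the subspace topology. -/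
def SC (r : ℕ) (τ t : ℂ) : Submodule ℂ 𝓢(AC r, ℂ) where
  carrier := {χ | IsHolomorphic τ t (fun A => χ A)}
  add_mem' h1 h2 := isHolomorphic_add h1 h2
  zero_mem' := isHolomorphic_zero
  smul_mem' c _ h := isHolomorphic_smul c h

/-- Tempered distributions on `A0`: continuous antilinear functionals. -/
abbrev S0' (r : ℕ) := S0 r →L⋆[ℂ] ℂ

/-- Continuous antilinear functionals on the Schwartz-class holomorphic sections. -/
abbrev SC' (r : ℕ) (τ t : ℂ) := SC r τ t →L⋆[ℂ] ℂ

/-- `S` is the regular distribution `(ψ | ·)` of a section `ψ` over `A0`. -/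
def IsRegular0 {r : ℕ} (S : S0' r) (ψ : A0 r → ℂ) : Prop :=
  ∀ χ : S0 r, Integrable (fun A => ψ A * star (χ A)) ∧ S χ = ∫ A, ψ A * star (χ A)

/-- `T` is the regular distribution `(φ | ·)` of a section `φ` over `AC`. -/
def IsRegularC {r : ℕ} {τ t : ℂ} (T : SC' r τ t) (φ : AC r → ℂ) : Prop :=
  ∀ χ : SC r τ t, Integrable (fun A => φ A * star (χ.1 A)) ∧ T χ = ∫ A, φ A * star (χ.1 A)

/-- Smooth families of tempered distributions on `A0`. -/
def IsSmoothDist0 {r : ℕ} (S : ℂ → S0' r) : Prop :=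
  ∀ χ : S0 r, ContDiffOn ℝ ∞ (fun τ => S τ χ) teich

/-- Smooth families of Schwartz-class holomorphic sections: jointly smooth, and all derivatives
decay rapidly, locally uniformly over Teichmüller space. -/
def IsSmoothTest {r : ℕ} {t : ℂ} (χ : ∀ τ : ℂ, SC r τ t) : Prop :=
  ContDiffOn ℝ ∞ (fun p : ℂ × AC r => (χ p.1).1 p.2) (teich ×ˢ Set.univ) ∧
    ∀ m l : ℕ, ∀ τ₀ ∈ teich, ∃ C : ℝ, ∀ᶠ τ in 𝓝 τ₀, ∀ A : AC r,
      ‖A‖ ^ m * ‖iteratedFDeriv ℝ l (fun p : ℂ × AC r => (χ p.1).1 p.2) (τ, A)‖ ≤ C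

/-- Smooth families of distributions on the Schwartz-class holomorphic sections. -/
def IsSmoothDistC {r : ℕ} {t : ℂ} (T : ∀ τ : ℂ, SC' r τ t) : Prop :=
  ∀ χ : ∀ τ : ℂ, SC r τ t, IsSmoothTest χ → ContDiffOn ℝ ∞ (fun τ => T τ (χ τ)) teich

/-- `S'` is the covariant derivative at `τ`, in the direction of the real tangent vector `V`, of the
family `S` for the dual Hitchin–Witten connection:
`(S' | ψ) = V[(S | ψ)] - (S | ∇^HW_V ψ)` for all test sections `ψ` (constant in `τ`). -/
def IsDualHW {r : ℕ} (t V : ℂ) (S : ℂ → S0' r) (τ : ℂ) (S' : S0' r) : Prop :=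
  ∀ ψ : S0 r, ∃ η : S0 r, (∀ A, η A = covHW t V (fun _ => ψ) τ A) ∧
    S' ψ = fderiv ℝ (fun τ' => S τ' ψ) τ V - S τ η

/-- `T'` is the covariant derivative at `τ`, in the direction of the real tangent vector `V`, of the
family `T` for the dual complexified Hitchin connection:
`(T' | χ) = V[(T | χ)] - (T | ∇^ℂ_V χ)` for all families `χ` of test sections. -/
def IsDualC {r : ℕ} {t : ℂ} (V : ℂ) (T : ∀ τ : ℂ, SC' r τ t) (τ : ℂ) (T' : SC' r τ t) : Prop :=
  ∀ χ : ∀ τ : ℂ, SC r τ t, IsSmoothTest χ →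
    ∃ η : SC r τ t, (∀ A, η.1 A = covC t V (fun τ' => (χ τ').1) τ A) ∧
      T' (χ τ) = fderiv ℝ (fun τ' => T τ' (χ τ')) τ V - T τ η

/-! ### The Bargmann transform -/

/-- The frame `X_j = (2τ₂)^{-1/2} T_j (dx + τ dy)`, `X_{j+r} = i X_j` of the real polarisation. -/
def frameX {r : ℕ} (τ : ℂ) : Idx r → AC r :=
  Sum.elim
    (fun j => ((Real.sqrt (2 * τ.im))⁻¹ : ℝ) •
      (Pi.single (Sum.inl j) 1 + Pi.single (Sum.inr j) τ : AC r))
    (fun j => ((Real.sqrt (2 * τ.im))⁻¹ : ℝ) • Complex.I •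
      (Pi.single (Sum.inl j) 1 + Pi.single (Sum.inr j) τ : AC r))

/-- The coordinates `p` in the basis `(X_a, Y_a = I_{τ,t} X_a)`, which is a Darboux basis
for `ω_t / |t|`. -/
def coordP {r : ℕ} (τ t : ℂ) (A : AC r) (a : Idx r) : ℝ :=
  omegaT t A (IT τ t (frameX τ a)) / ‖t‖

/-- The coordinates `q` in the same basis. -/
def coordQ {r : ℕ} (τ t : ℂ) (A : AC r) (a : Idx r) : ℝ :=
  omegaT t (frameX τ a) A / ‖t‖

/-- The holomorphic coordinates `z = p + i q`. -/
def coordZ {r : ℕ} (τ t : ℂ) (A : AC r) (a : Idx r) : ℂ :=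
  (coordP τ t A a : ℂ) + Complex.I * (coordQ τ t A a : ℂ)

/-- The polarised frame `ρ_τ = exp (-(i |t| / 2) p · q)` of the prequantum line bundle. -/
def frameRho {r : ℕ} (τ t : ℂ) (A : AC r) : ℂ :=
  Complex.exp (-(Complex.I / 2) * ((‖t‖ * ∑ a, coordP τ t A a * coordQ τ t A a : ℝ) : ℂ))

/-- The Bargmann kernel, as a function of `q` and of the point `A` with holomorphic
coordinates `z`; it contains the frame `exp (-|t| |z|² / 4)`. -/
def bargKernel {r : ℕ} (τ t : ℂ) (q : Idx r → ℝ) (A : AC r) : ℂ :=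
  Complex.exp (-((‖t‖ : ℂ) / 4) *
    (2 * ∑ a, (q a : ℂ) ^ 2 + 4 * Complex.I * ∑ a, (q a : ℂ) * coordZ τ t A a +
      ∑ a, ((‖coordZ τ t A a‖ ^ 2 : ℝ) : ℂ) - ∑ a, coordZ τ t A a ^ 2))

/-- The Bargmann transform of a section `ψ` over `A0`. The polarised section extending `ψ` is
`(ψ / ρ_τ)(q) ρ_τ`, and the integral `dq` over the values `q` of the coordinates is written as an
integral over `A0`, where `dq = 2^{-r} du`. -/
def bargmann {r : ℕ} (τ t : ℂ) (ψ : A0 r → ℂ) (A : AC r) : ℂ :=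
  (((‖t‖ / Real.pi) ^ ((r : ℝ) / 2) * (1 / 2) ^ r : ℝ) : ℂ) *
    ∫ u : A0 r, ψ u / frameRho τ t (incl r u) * bargKernel τ t (coordQ τ t (incl r u)) A

end GenusOne

end

noncomputable section
namespace GenusOne
open Filter

section SchwartzComplete
variable {E F : Type*} [NormedAddCommGroup E] [NormedSpace ℝ E] [NormedAddCommGroup F]
  [NormedSpace ℝ F]

theorem schwartz_cauchySeq_seminorm {u : ℕ → 𝓢(E, F)} (hu : CauchySeq u) (k n : ℕ) {ε : ℝ}
    (hε : 0 < ε) : ∃ N, ∀ i ≥ N, ∀ j ≥ N, SchwartzMap.seminorm ℝ k n (u i - u j) < ε := by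
  have h1 : Tendsto (fun p : ℕ × ℕ => u p.1 - u p.2) (atTop ×ˢ atTop) (𝓝 0) := by
    have := hu
    rw [CauchySeq, cauchy_map_iff] at this
    have h2 := this.2
    rw [uniformity_eq_comap_nhds_zero_swapped, tendsto_comap_iff] at h2
    exact h2
  have h2 := ((schwartz_withSeminorms ℝ E F).tendsto_nhds _ _).1 h1 (k, n) ε hε
  rw [prod_atTop_atTop_eq, eventually_atTop] at h2
  obtain ⟨⟨a, b⟩, hab⟩ := h2
  refine ⟨max a b, fun i hi j hj => ?_⟩
  have := hab (i, j) ⟨le_trans (le_max_left _ _) hi, le_trans (le_max_right _ _) hj⟩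
  simpa using this

theorem schwartz_completeSpace [CompleteSpace F] : CompleteSpace 𝓢(E, F) := by
  have : (uniformity 𝓢(E, F)).IsCountablyGenerated :=
    IsUniformAddGroup.uniformity_countably_generated
  refine UniformSpace.complete_of_cauchySeq_tendsto fun u hu => ?_
  have hsub : ∀ n i j x, iteratedFDeriv ℝ n (⇑(u i)) x - iteratedFDeriv ℝ n (⇑(u j)) x =
      iteratedFDeriv ℝ n (⇑(u i - u j)) x := by
    intro n i j x
    have : ⇑(u i - u j) = ⇑(u i) - ⇑(u j) := by ext; simp
    rw [this, iteratedFDeriv_sub_apply ((u i).contDiffAt n) ((u j).contDiffAt n)]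
  have hunif : ∀ n (ε : ℝ), 0 < ε → ∃ N, ∀ i ≥ N, ∀ j ≥ N, ∀ x,
      dist (iteratedFDeriv ℝ n (⇑(u i)) x) (iteratedFDeriv ℝ n (⇑(u j)) x) < ε := by
    intro n ε hε
    obtain ⟨N, hN⟩ := schwartz_cauchySeq_seminorm hu 0 n hε
    refine ⟨N, fun i hi j hj x => ?_⟩
    rw [dist_eq_norm, hsub]
    have := SchwartzMap.le_seminorm ℝ 0 n (u i - u j) x
    simp only [pow_zero, one_mul] at this
    exact this.trans_lt (hN i hi j hj)
  have hlim : ∀ n x, ∃ l, Tendsto (fun i => iteratedFDeriv ℝ n (⇑(u i)) x) atTop (𝓝 l) := by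
    intro n x
    refine cauchySeq_tendsto_of_complete (Metric.cauchySeq_iff.2 fun ε hε => ?_)
    obtain ⟨N, hN⟩ := hunif n ε hε
    exact ⟨N, fun i hi j hj => hN i hi j hj x⟩
  choose P hP using hlim
  have hPu : ∀ n, TendstoUniformly (fun i => iteratedFDeriv ℝ n (⇑(u i))) (P n) atTop := by
    intro n
    have hc : UniformCauchySeqOn (fun i => iteratedFDeriv ℝ n (⇑(u i))) atTop Set.univ := by
      rw [Metric.uniformCauchySeqOn_iff]
      intro ε hε
      obtain ⟨N, hN⟩ := hunif n ε hε
      exact ⟨N, fun i hi j hj x _ => hN i hi j hj x⟩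
    rw [← tendstoUniformlyOn_univ]
    exact hc.tendstoUniformlyOn_of_tendsto fun x _ => hP n x
  let f : E → F := fun x => (P 0 x).curry0
  have hP' : ∀ n x, HasFDerivAt (P n) ((P (n + 1) x).curryLeft) x := by
    intro n x
    let L := (continuousMultilinearCurryLeftEquiv ℝ (fun _ : Fin (n + 1) => E) F)
    refine hasFDerivAt_of_tendstoUniformly (l := atTop)
      (f := fun i => iteratedFDeriv ℝ n (⇑(u i)))
      (f' := fun i x => (iteratedFDeriv ℝ (n + 1) (⇑(u i)) x).curryLeft)
      (g' := fun x => (P (n + 1) x).curryLeft) ?_ ?_ ?_ x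
    · exact L.isometry.uniformContinuous.comp_tendstoUniformly (hPu (n + 1))
    · intro i x
      have h := ((u i).smooth ((n + 1 : ℕ) : ℕ∞)).ftaylorSeries
      exact h.fderiv n (by exact_mod_cast Nat.lt_succ_self n) x
    · exact fun x => hP n x
  have hT : HasFTaylorSeriesUpTo ∞ f (fun x n => P n x) :=
    ⟨fun x => rfl, fun m _ x => hP' m x, fun m _ =>
      continuous_iff_continuousAt.2 fun x => (hP' m x).continuousAt⟩
  have hf : ContDiff ℝ ∞ f := hT.contDiff
  have hfP : ∀ n x, iteratedFDeriv ℝ n f x = P n x := by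
    intro n x
    exact (hT.eq_iteratedFDeriv (by exact_mod_cast le_top) x).symm
  have hbound : ∀ k n (ε : ℝ), 0 < ε → ∃ N, ∀ i ≥ N, ∀ x,
      ‖x‖ ^ k * ‖iteratedFDeriv ℝ n (⇑(u i)) x - iteratedFDeriv ℝ n f x‖ ≤ ε := by
    intro k n ε hε
    obtain ⟨N, hN⟩ := schwartz_cauchySeq_seminorm hu k n hε
    refine ⟨N, fun i hi x => ?_⟩
    have ht : Tendsto (fun j => ‖x‖ ^ k * ‖iteratedFDeriv ℝ n (⇑(u i)) x -
        iteratedFDeriv ℝ n (⇑(u j)) x‖) atTop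
        (𝓝 (‖x‖ ^ k * ‖iteratedFDeriv ℝ n (⇑(u i)) x - iteratedFDeriv ℝ n f x‖)) := by
      rw [hfP]
      exact ((tendsto_const_nhds.sub (hP n x)).norm).const_mul _
    refine le_of_tendsto ht (eventually_atTop.2 ⟨N, fun j hj => ?_⟩)
    rw [hsub]
    exact (SchwartzMap.le_seminorm ℝ k n (u i - u j) x).trans (hN i hi j hj).le
  let g : 𝓢(E, F) := ⟨f, hf, fun k n => by
    obtain ⟨N, hN⟩ := hbound k n 1 one_pos
    refine ⟨SchwartzMap.seminorm ℝ k n (u N) + 1, fun x => ?_⟩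
    have h1 := hN N le_rfl x
    have h2 := SchwartzMap.le_seminorm ℝ k n (u N) x
    have h3 : ‖iteratedFDeriv ℝ n f x‖ ≤ ‖iteratedFDeriv ℝ n (⇑(u N)) x‖ +
        ‖iteratedFDeriv ℝ n (⇑(u N)) x - iteratedFDeriv ℝ n f x‖ := norm_le_insert _ _
    calc ‖x‖ ^ k * ‖iteratedFDeriv ℝ n f x‖ ≤ ‖x‖ ^ k * (‖iteratedFDeriv ℝ n (⇑(u N)) x‖ +
        ‖iteratedFDeriv ℝ n (⇑(u N)) x - iteratedFDeriv ℝ n f x‖) := by gcongr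
      _ ≤ _ := by rw [mul_add]; exact add_le_add h2 h1⟩
  refine ⟨g, ((schwartz_withSeminorms ℝ E F).tendsto_nhds_atTop _ _).2 fun ⟨k, n⟩ ε hε => ?_⟩
  obtain ⟨N, hN⟩ := hbound k n (ε / 2) (half_pos hε)
  refine ⟨N, fun i hi => ?_⟩
  refine lt_of_le_of_lt (SchwartzMap.seminorm_le_bound ℝ k n _ (half_pos hε).le fun x => ?_)
    (half_lt_self hε)
  have : ⇑(u i - g) = ⇑(u i) - f := rfl
  rw [this, iteratedFDeriv_sub_apply ((u i).contDiffAt n) (hf.contDiffAt.of_le (by exact_mod_cast le_top))]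
  exact hN i hi x

end SchwartzComplete

theorem schwartz_baireSpace {E F : Type*} [NormedAddCommGroup E] [NormedSpace ℝ E]
    [NormedAddCommGroup F] [NormedSpace ℝ F] [NormedSpace ℂ F] [CompleteSpace F]
    {p : Submodule ℂ 𝓢(E, F)}
    (hp : IsClosed (p : Set 𝓢(E, F))) : BaireSpace p := by
  have : CompleteSpace 𝓢(E, F) := schwartz_completeSpace
  have : CompleteSpace p := hp.completeSpace_coe
  have : (uniformity 𝓢(E, F)).IsCountablyGenerated :=
    IsUniformAddGroup.uniformity_countably_generated
  have : (uniformity p).IsCountablyGenerated :=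
    Filter.comap.isCountablyGenerated (uniformity 𝓢(E, F)) _
  infer_instance

section BanachSteinhaus
variable {E : Type*} [AddCommGroup E] [Module ℂ E] [UniformSpace E] [IsUniformAddGroup E]
  [ContinuousSMul ℂ E] [BarrelledSpace ℂ E]

/-- The difference quotients of a weakly differentiable family of functionals converge to a
continuous functional. -/
theorem exists_deriv_functional (Q : ℂ → E →L⋆[ℂ] ℂ) (τ V : ℂ)
    (hQ : ∀ f, DifferentiableAt ℝ (fun τ' => Q τ' f) τ) :
    ∃ D : E →L⋆[ℂ] ℂ, ∀ f, D f = fderiv ℝ (fun τ' => Q τ' f) τ V := by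
  let g : ℝ → E →L⋆[ℂ] ℂ := fun c => (c : ℂ) • (Q (τ + c⁻¹ • V) - Q τ)
  have h : Tendsto (fun c f => g c f) atTop (𝓝 fun f => fderiv ℝ (fun τ' => Q τ' f) τ V) := by
    rw [tendsto_pi_nhds]
    intro f
    have := (hQ f).hasFDerivAt.lim_real V
    simpa [g] using this
  exact ⟨continuousLinearMapOfTendsto g h, fun f => rfl⟩

/-- Product rule for a weakly differentiable family of functionals evaluated at a moving vector. -/
theorem fderiv_functional_apply (Q : ℂ → E →L⋆[ℂ] ℂ) (ξ : ℂ → E) (τ V : ℂ) (θ : E)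
    (hQ : ∀ f, DifferentiableAt ℝ (fun τ' => Q τ' f) τ)
    (hξ : Tendsto (fun n : ℕ => ((n : ℝ) : ℂ) • (ξ (τ + (n : ℝ)⁻¹ • V) - ξ τ)) atTop (𝓝 θ))
    (hQξ : DifferentiableAt ℝ (fun τ' => Q τ' (ξ τ')) τ) :
    fderiv ℝ (fun τ' => Q τ' (ξ τ')) τ V =
      fderiv ℝ (fun τ' => Q τ' (ξ τ)) τ V + Q τ θ := by
  have hn : Tendsto (fun n : ℕ => (n : ℝ)) atTop atTop := tendsto_natCast_atTop_atTop
  have h1 := (hQξ.hasFDerivAt.lim_real V).comp hn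
  have h2 := ((hQ (ξ τ)).hasFDerivAt.lim_real V).comp hn
  have hconv : ∀ f, Tendsto (fun n : ℕ => Q (τ + (n : ℝ)⁻¹ • V) f) atTop (𝓝 (Q τ f)) := by
    intro f
    have hc := (hQ f).continuousAt
    have ht : Tendsto (fun n : ℕ => τ + (n : ℝ)⁻¹ • V) atTop (𝓝 τ) := by
      have := (tendsto_inv_atTop_zero.comp hn).smul_const V
      simpa using this.const_add τ
    exact hc.tendsto.comp ht
  have heq : UniformEquicontinuous ((↑) ∘ fun n : ℕ => Q (τ + (n : ℝ)⁻¹ • V)) := by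
    refine (norm_withSeminorms ℂ ℂ).banach_steinhaus fun _ x => ?_
    exact (hconv x).norm.bddAbove_range
  have h3 : Tendsto (fun n : ℕ => Q (τ + (n : ℝ)⁻¹ • V)
      (((n : ℝ) : ℂ) • (ξ (τ + (n : ℝ)⁻¹ • V) - ξ τ))) atTop (𝓝 (Q τ θ)) := by
    have h4 := heq.equicontinuous θ
    rw [Metric.tendsto_atTop]
    intro ε hε
    rw [Metric.equicontinuousAt_iff_right] at h4
    have h5 := hξ.eventually (h4 (ε / 2) (half_pos hε))
    have h6 := (Metric.tendsto_nhds.1 (hconv θ)) (ε / 2) (half_pos hε)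
    obtain ⟨N, hN⟩ := eventually_atTop.1 (h5.and h6)
    refine ⟨N, fun n hn => ?_⟩
    obtain ⟨h7, h8⟩ := hN n hn
    have h7 := h7 n
    rw [dist_comm] at h7
    simp only [Function.comp] at h7
    linarith [dist_triangle (Q (τ + (n : ℝ)⁻¹ • V)
      (((n : ℝ) : ℂ) • (ξ (τ + (n : ℝ)⁻¹ • V) - ξ τ))) (Q (τ + (n : ℝ)⁻¹ • V) θ) (Q τ θ)]
  refine tendsto_nhds_unique h1 (((h2.add h3)).congr fun n => ?_)
  simp [mul_sub]

end BanachSteinhaus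
end GenusOne

end

noncomputable section
namespace GenusOne
open Filter

section Rapid
variable {X X' G : Type} [NormedAddCommGroup X] [NormedSpace ℝ X] [NormedAddCommGroup X']
  [NormedSpace ℝ X'] [NormedAddCommGroup G] [NormedSpace ℝ G]

theorem isOpen_teich : IsOpen teich := isOpen_lt continuous_const Complex.continuous_im

variable (X) in
/-- The product of Teichmüller space with a vector space. -/
def strip : Set (ℂ × X) := teich ×ˢ Set.univ

theorem isOpen_strip : IsOpen (strip X) := isOpen_teich.prod isOpen_univ

theorem mem_strip {τ : ℂ} (hτ : τ ∈ teich) (A : X) : (τ, A) ∈ strip X := ⟨hτ, Set.mem_univ _⟩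

theorem strip_contDiffAt {F : ℂ × X → G} (hF : ContDiffOn ℝ ∞ F (strip X)) {p : ℂ × X}
    (hp : p ∈ strip X) : ContDiffAt ℝ ∞ F p := hF.contDiffAt (isOpen_strip.mem_nhds hp)

/-- Smooth families of functions all of whose derivatives decay rapidly, locally uniformly. -/
def RapidFamily (F : ℂ × X → G) : Prop :=
  ContDiffOn ℝ ∞ F (strip X) ∧
    ∀ m l : ℕ, ∀ τ₀ ∈ teich, ∃ C : ℝ, ∀ᶠ τ in 𝓝 τ₀, ∀ A : X,
      ‖A‖ ^ m * ‖iteratedFDeriv ℝ l F (τ, A)‖ ≤ C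

theorem RapidFamily.congr {F F' : ℂ × X → G} (hF : RapidFamily F)
    (h : ∀ τ ∈ teich, ∀ A, F' (τ, A) = F (τ, A)) : RapidFamily F' := by
  have he : Set.EqOn F' F (strip X) := fun p hp => h p.1 hp.1 p.2
  refine ⟨hF.1.congr he, fun m l τ₀ hτ₀ => ?_⟩
  obtain ⟨C, hC⟩ := hF.2 m l τ₀ hτ₀
  refine ⟨C, ?_⟩
  filter_upwards [hC, isOpen_teich.mem_nhds hτ₀] with τ h1 h2 A
  rw [((he.eventuallyEq_of_mem (isOpen_strip.mem_nhds (mem_strip h2 A))).iteratedFDeriv ℝ l).eq_of_nhds]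
  exact h1 A

/-- The directional derivative commutes with the iterated derivatives. -/
theorem fderiv_iteratedFDeriv_apply {E : Type} [NormedAddCommGroup E] [NormedSpace ℝ E]
    {S : Set E} (hS : IsOpen S) (V : E) (l : ℕ) : ∀ {G : Type} [NormedAddCommGroup G]
    [NormedSpace ℝ G] {F : E → G}, ContDiffOn ℝ ∞ F S → ∀ p ∈ S,
      fderiv ℝ (iteratedFDeriv ℝ l F) p V = iteratedFDeriv ℝ l (fun q => fderiv ℝ F q V) p := by
  induction l with
  | zero =>
    intro G _ _ F hF p hp
    ext m
    rw [iteratedFDeriv_zero_apply, iteratedFDeriv_zero_eq_comp]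
    rw [LinearIsometryEquiv.comp_fderiv]
    rfl
  | succ l ih =>
    intro G _ _ F hF p hp
    have hF' : ContDiffOn ℝ ∞ (fderiv ℝ F) S := hF.fderiv_of_isOpen hS (by simp)
    have hd : ∀ q ∈ S, DifferentiableAt ℝ (fderiv ℝ F) q := fun q hq =>
      (hF'.contDiffAt (hS.mem_nhds hq)).differentiableAt (by simp)
    ext m
    rw [iteratedFDeriv_succ_apply_right]
    have h1 : (fun q => fderiv ℝ (fun q => fderiv ℝ F q V) q) =ᶠ[𝓝 p]
        fun q => fderiv ℝ (fderiv ℝ F) q V := by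
      filter_upwards [hS.mem_nhds hp] with q hq
      ext w
      rw [fderiv_clm_apply (hd q hq) (differentiableAt_const V)]
      have hs := (hF.contDiffAt (hS.mem_nhds hq)).isSymmSndFDerivAt (n := ∞) (by simpa using WithTop.coe_le_coe.2 (le_top : (2 : ℕ∞) ≤ ⊤))
      simpa using! hs w V
    rw [(h1.iteratedFDeriv ℝ l).eq_of_nhds, ← ih hF' p hp]
    have h2 : ∀ q, iteratedFDeriv ℝ (l + 1) F q =
        (continuousMultilinearCurryRightEquiv' ℝ l E G).symm (iteratedFDeriv ℝ l (fderiv ℝ F) q) := by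
      intro q
      rw [iteratedFDeriv_succ_eq_comp_right]
      rfl
    have h3 : iteratedFDeriv ℝ (l + 1) F =
        (continuousMultilinearCurryRightEquiv' ℝ l E G).symm ∘ (iteratedFDeriv ℝ l (fderiv ℝ F)) :=
      funext h2
    rw [h3]
    have h4 := (continuousMultilinearCurryRightEquiv' ℝ l E G).symm.comp_fderiv
      (f := iteratedFDeriv ℝ l (fderiv ℝ F)) (x := p)
    have h5 := congrArg (fun L => (L V) m) h4
    exact h5

theorem iteratedFDeriv_slice {F : ℂ × X → G} (hF : ContDiffOn ℝ ∞ F (strip X)) {τ : ℂ}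
    (hτ : τ ∈ teich) (l : ℕ) (A : X) : iteratedFDeriv ℝ l (fun A => F (τ, A)) A =
      (iteratedFDeriv ℝ l F (τ, A)).compContinuousLinearMap
        fun _ => ContinuousLinearMap.inr ℝ ℂ X := by
  let g : ℂ × X → G := fun p => F ((τ, 0) + p)
  have hg : ∀ q, iteratedFDeriv ℝ l g q = iteratedFDeriv ℝ l F ((τ, 0) + q) := fun q =>
    iteratedFDeriv_comp_add_left l _ q
  let S : Set (ℂ × X) := (fun p => (τ, 0) + p) ⁻¹' strip X
  have hS : IsOpen S := isOpen_strip.preimage (by fun_prop)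
  have hgS : ContDiffOn ℝ ∞ g S := hF.comp (by fun_prop) (fun p hp => hp)
  have hmem : ∀ A : X, ContinuousLinearMap.inr ℝ ℂ X A ∈ S := fun A => by
    simpa [S] using mem_strip hτ A
  have hS' : IsOpen (ContinuousLinearMap.inr ℝ ℂ X ⁻¹' S) := hS.preimage (by fun_prop)
  have := (ContinuousLinearMap.inr ℝ ℂ X).iteratedFDerivWithin_comp_right hgS hS.uniqueDiffOn
    hS'.uniqueDiffOn (hmem A) (i := l) (by exact_mod_cast le_top)
  rw [iteratedFDerivWithin_of_isOpen l hS' (hmem A),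
    iteratedFDerivWithin_of_isOpen l hS (hmem A), hg] at this
  have h1 : (g ∘ ContinuousLinearMap.inr ℝ ℂ X) = fun A => F (τ, A) := by
    ext A; simp [g]
  rw [h1] at this
  simpa using this

theorem norm_compContinuousLinearMap_inr_le {l : ℕ} (f : (ℂ × X) [×l]→L[ℝ] G) :
    ‖f.compContinuousLinearMap fun _ => ContinuousLinearMap.inr ℝ ℂ X‖ ≤ ‖f‖ := by
  refine (ContinuousMultilinearMap.norm_compContinuousLinearMap_le _ _).trans ?_
  refine mul_le_of_le_one_right (norm_nonneg _) ?_
  exact Finset.prod_le_one (fun _ _ => norm_nonneg _)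
    fun _ _ => ContinuousLinearMap.norm_inr_le_one ℝ ℂ X

theorem norm_iteratedFDeriv_slice_le {F : ℂ × X → G} (hF : ContDiffOn ℝ ∞ F (strip X)) {τ : ℂ}
    (hτ : τ ∈ teich) (l : ℕ) (A : X) :
    ‖iteratedFDeriv ℝ l (fun A => F (τ, A)) A‖ ≤ ‖iteratedFDeriv ℝ l F (τ, A)‖ := by
  rw [iteratedFDeriv_slice hF hτ]
  exact norm_compContinuousLinearMap_inr_le _

theorem contDiff_slice {F : ℂ × X → G} (hF : ContDiffOn ℝ ∞ F (strip X)) {τ : ℂ}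
    (hτ : τ ∈ teich) : ContDiff ℝ ∞ fun A => F (τ, A) := by
  rw [← contDiffOn_univ]
  exact hF.comp (by fun_prop) fun A _ => mem_strip hτ A

/-- The member of a rapidly decreasing family over a given point, as a Schwartz function. -/
def RapidFamily.slice {F : ℂ × X → G} (hF : RapidFamily F) {τ : ℂ} (hτ : τ ∈ teich) : 𝓢(X, G) where
  toFun A := F (τ, A)
  smooth' := contDiff_slice hF.1 hτ
  decay' k n := by
    obtain ⟨C, hC⟩ := hF.2 k n τ hτ
    refine ⟨C, fun A => le_trans ?_ (hC.self_of_nhds A)⟩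
    gcongr
    exact norm_iteratedFDeriv_slice_le hF.1 hτ n A

theorem RapidFamily.fderiv_apply {F : ℂ × X → G} (hF : RapidFamily F) (V : ℂ × X) :
    RapidFamily fun p => fderiv ℝ F p V := by
  have hF' : ContDiffOn ℝ ∞ (fderiv ℝ F) (strip X) := hF.1.fderiv_of_isOpen isOpen_strip (by simp)
  refine ⟨hF'.clm_apply contDiffOn_const, fun m l τ₀ hτ₀ => ?_⟩
  obtain ⟨C, hC⟩ := hF.2 m (l + 1) τ₀ hτ₀
  refine ⟨C * ‖V‖, ?_⟩
  filter_upwards [hC, isOpen_teich.mem_nhds hτ₀] with τ h1 h2 A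
  rw [← fderiv_iteratedFDeriv_apply isOpen_strip V l hF.1 _ (mem_strip h2 A)]
  have h3 : ‖fderiv ℝ (iteratedFDeriv ℝ l F) (τ, A) V‖ ≤
      ‖iteratedFDeriv ℝ (l + 1) F (τ, A)‖ * ‖V‖ := by
    rw [← norm_fderiv_iteratedFDeriv]
    exact ContinuousLinearMap.le_opNorm _ _
  calc ‖A‖ ^ m * ‖fderiv ℝ (iteratedFDeriv ℝ l F) (τ, A) V‖
      ≤ ‖A‖ ^ m * (‖iteratedFDeriv ℝ (l + 1) F (τ, A)‖ * ‖V‖) := by gcongr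
    _ = (‖A‖ ^ m * ‖iteratedFDeriv ℝ (l + 1) F (τ, A)‖) * ‖V‖ := by ring
    _ ≤ C * ‖V‖ := by gcongr; exact h1 A

theorem iteratedFDeriv_slope {f₁ f₂ f₃ : X → ℂ} (h₁ : ContDiff ℝ ∞ f₁) (h₂ : ContDiff ℝ ∞ f₂)
    (h₃ : ContDiff ℝ ∞ f₃) (c h : ℝ) (l : ℕ) (A : X) :
    iteratedFDeriv ℝ l (c • (f₁ - f₂ - h • f₃)) A =
      c • (iteratedFDeriv ℝ l f₁ A - iteratedFDeriv ℝ l f₂ A - h • iteratedFDeriv ℝ l f₃ A) := by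
  have hle : ∀ {f : X → ℂ}, ContDiff ℝ ∞ f → ContDiffAt ℝ l f A := fun hf =>
    hf.contDiffAt.of_le (by exact_mod_cast le_top)
  have d₃ : ContDiffAt ℝ l (h • f₃) A := (hle h₃).const_smul h
  have d₁ : ContDiffAt ℝ l (f₁ - f₂) A := (hle h₁).sub (hle h₂)
  have d : ContDiffAt ℝ l (f₁ - f₂ - h • f₃) A := d₁.sub d₃
  rw [iteratedFDeriv_const_smul_apply d, iteratedFDeriv_sub_apply d₁ d₃,
    iteratedFDeriv_sub_apply (hle h₁) (hle h₂), iteratedFDeriv_const_smul_apply (hle h₃)]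

/-- The difference quotients of a rapidly decreasing family converge in the Schwartz space. -/
theorem RapidFamily.tendsto_slope {F : ℂ × X → ℂ}
    (hF : RapidFamily F) {τ : ℂ} (hτ : τ ∈ teich)
    (V : ℂ) (ξ : ℂ → 𝓢(X, ℂ)) (hξ : ∀ τ' ∈ teich, ∀ A, ξ τ' A = F (τ', A)) (θ : 𝓢(X, ℂ))
    (hθ : ∀ A, θ A = fderiv ℝ F (τ, A) (V, 0)) :
    Tendsto (fun n : ℕ => ((n : ℝ) : ℂ) • (ξ (τ + (n : ℝ)⁻¹ • V) - ξ τ)) atTop (𝓝 θ) := by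
  rw [(schwartz_withSeminorms ℝ X ℂ).tendsto_nhds_atTop _ _]
  rintro ⟨k, l⟩ ε hε
  let F' : ℂ × X → ℂ := fun p => fderiv ℝ F p (V, 0)
  have hF' : RapidFamily F' := hF.fderiv_apply (V, 0)
  obtain ⟨C, hC⟩ := hF'.2 k (l + 1) τ hτ
  obtain ⟨δ, hδ, hball⟩ := Metric.eventually_nhds_iff.1 (hC.and (isOpen_teich.mem_nhds hτ))
  have hC0 : 0 ≤ C := le_trans (by positivity) (hC.self_of_nhds 0)
  have hlim : Tendsto (fun n : ℕ => (n : ℝ)⁻¹) atTop (𝓝 0) :=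
    tendsto_inv_atTop_zero.comp tendsto_natCast_atTop_atTop
  have h1 : ∀ᶠ n : ℕ in atTop, (n : ℝ)⁻¹ * ‖V‖ < δ := by
    have := hlim.mul_const ‖V‖
    rw [zero_mul] at this
    exact this.eventually (gt_mem_nhds hδ)
  have h2 : ∀ᶠ n : ℕ in atTop, (n : ℝ)⁻¹ * (C * ‖V‖) < ε := by
    have := hlim.mul_const (C * ‖V‖)
    rw [zero_mul] at this
    exact this.eventually (gt_mem_nhds hε)
  obtain ⟨N, hN⟩ := eventually_atTop.1 ((h1.and h2).and (eventually_gt_atTop 0))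
  refine ⟨N, fun n hn => ?_⟩
  obtain ⟨⟨h3, h4⟩, h5⟩ := hN n hn
  have hn0 : (0 : ℝ) < n := by exact_mod_cast h5
  set h : ℝ := (n : ℝ)⁻¹ with hh
  have hhp : 0 < h := inv_pos.2 hn0
  have hpath : ∀ s ∈ Set.Icc 0 h, (∀ A, ‖A‖ ^ k * ‖iteratedFDeriv ℝ (l + 1) F' (τ + s • V, A)‖ ≤ C) ∧
      τ + s • V ∈ teich := by
    intro s hs
    refine hball ?_
    rw [dist_self_add_left, norm_smul, Real.norm_of_nonneg hs.1]
    exact lt_of_le_of_lt (by gcongr; exact hs.2) h3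
  have hcurve : ∀ (A : X) (s : ℝ), HasDerivAt (fun s : ℝ => (τ + s • V, A)) (V, 0) s := by
    intro A s
    have : HasDerivAt (fun s : ℝ => τ + s • V) V s := by
      simpa using ((hasDerivAt_id s).smul_const V).const_add τ
    exact this.prodMk (hasDerivAt_const s A)
  have hd : ∀ {H : ℂ × X → ℂ}, ContDiffOn ℝ ∞ H (strip X) → ∀ (A : X), ∀ s ∈ Set.Icc 0 h,
      HasDerivWithinAt (fun s : ℝ => iteratedFDeriv ℝ l H (τ + s • V, A))
        (iteratedFDeriv ℝ l (fun p => fderiv ℝ H p (V, 0)) (τ + s • V, A)) (Set.Icc 0 h) s := by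
    intro H hH A s hs
    have hm := mem_strip (hpath s hs).2 A
    rw [← fderiv_iteratedFDeriv_apply isOpen_strip (V, (0 : X)) l hH _ hm]
    have h6 : DifferentiableAt ℝ (iteratedFDeriv ℝ l H) (τ + s • V, A) :=
      (strip_contDiffAt hH hm).differentiableAt_iteratedFDeriv
        (by exact_mod_cast WithTop.coe_lt_top _)
    exact (h6.hasFDerivAt.comp_hasDerivAt s (hcurve A s)).hasDerivWithinAt
  have hb1 : ∀ A, ∀ s ∈ Set.Icc 0 h, ‖A‖ ^ k * ‖iteratedFDeriv ℝ l F' (τ + s • V, A) -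
      iteratedFDeriv ℝ l F' (τ, A)‖ ≤ C * ‖V‖ * h := by
    intro A s hs
    have h7 := norm_image_sub_le_of_norm_deriv_le_segment' (a := 0) (b := h)
      (f := fun s : ℝ => (‖A‖ ^ k) • iteratedFDeriv ℝ l F' (τ + s • V, A))
      (C := C * ‖V‖) (fun s hs => (hd hF'.1 A s hs).const_smul (‖A‖ ^ k)) ?_ s hs
    · simp only [zero_smul, add_zero, sub_zero] at h7
      rw [← smul_sub, norm_smul, Real.norm_of_nonneg (by positivity)] at h7
      refine h7.trans ?_
      have := hs.2
      gcongr
    · intro s hs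
      have hs' := Set.Ico_subset_Icc_self hs
      rw [norm_smul, Real.norm_of_nonneg (by positivity),
        ← fderiv_iteratedFDeriv_apply isOpen_strip (V, (0 : X)) l hF'.1 _
        (mem_strip (hpath s hs').2 A)]
      have h8 : ‖fderiv ℝ (iteratedFDeriv ℝ l F') (τ + s • V, A) (V, 0)‖ ≤
          ‖iteratedFDeriv ℝ (l + 1) F' (τ + s • V, A)‖ * ‖V‖ := by
        rw [← norm_fderiv_iteratedFDeriv]
        refine (ContinuousLinearMap.le_opNorm _ _).trans ?_
        simp
      calc _ ≤ ‖A‖ ^ k * (‖iteratedFDeriv ℝ (l + 1) F' (τ + s • V, A)‖ * ‖V‖) := by gcongr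
        _ = ‖A‖ ^ k * ‖iteratedFDeriv ℝ (l + 1) F' (τ + s • V, A)‖ * ‖V‖ := by ring
        _ ≤ C * ‖V‖ := by gcongr; exact (hpath s hs').1 A
  have hb2 : ∀ A, ‖A‖ ^ k * ‖iteratedFDeriv ℝ l F (τ + h • V, A) - iteratedFDeriv ℝ l F (τ, A) -
      h • iteratedFDeriv ℝ l F' (τ, A)‖ ≤ C * ‖V‖ * h * h := by
    intro A
    have h7 := norm_image_sub_le_of_norm_deriv_le_segment' (a := 0) (b := h)
      (f := fun s : ℝ => (‖A‖ ^ k) • (iteratedFDeriv ℝ l F (τ + s • V, A) -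
        s • iteratedFDeriv ℝ l F' (τ, A)))
      (f' := fun s : ℝ => (‖A‖ ^ k) • (iteratedFDeriv ℝ l F' (τ + s • V, A) -
        iteratedFDeriv ℝ l F' (τ, A)))
      (C := C * ‖V‖ * h) (fun s hs => ?_) ?_ h ⟨hhp.le, le_rfl⟩
    · simp only [zero_smul, add_zero, sub_zero] at h7
      rw [← smul_sub, norm_smul, Real.norm_of_nonneg (by positivity)] at h7
      refine le_trans (le_of_eq ?_) h7
      congr 2
      abel
    · have h9 := (hd hF.1 A s hs).sub
        ((hasDerivWithinAt_id s _).smul_const (iteratedFDeriv ℝ l F' (τ, A)))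
      rw [one_smul] at h9
      exact h9.const_smul (‖A‖ ^ k)
    · intro s hs
      rw [norm_smul, Real.norm_of_nonneg (by positivity)]
      exact hb1 A s (Set.Ico_subset_Icc_self hs)
  refine lt_of_le_of_lt (SchwartzMap.seminorm_le_bound ℝ k l _ (M := h * (C * ‖V‖)) (by positivity)
    fun A => ?_) h4
  have hτh : τ + h • V ∈ teich := (hpath h ⟨hhp.le, le_rfl⟩).2
  have e1 : ⇑(((n : ℝ) : ℂ) • (ξ (τ + h • V) - ξ τ) - θ) =
      (n : ℝ) • ((fun A => F (τ + h • V, A)) - (fun A => F (τ, A)) - h • fun A => F' (τ, A)) := by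
    ext A
    change ((n : ℝ) : ℂ) • (ξ (τ + h • V) A - ξ τ A) - θ A =
      (n : ℝ) • (F (τ + h • V, A) - F (τ, A) - h • F' (τ, A))
    rw [hξ _ hτh, hξ _ hτ, hθ, smul_sub (n : ℝ), smul_smul, hh, mul_inv_cancel₀ hn0.ne', one_smul,
      Complex.coe_smul]
  have c1 := contDiff_slice hF.1 hτh
  have c2 := contDiff_slice hF.1 hτ
  have c3 := contDiff_slice hF'.1 hτ
  rw [e1, iteratedFDeriv_slope c1 c2 c3,
    iteratedFDeriv_slice hF.1 hτh, iteratedFDeriv_slice hF.1 hτ, iteratedFDeriv_slice hF'.1 hτ]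
  have e2 : (iteratedFDeriv ℝ l F (τ + h • V, A)).compContinuousLinearMap
      (fun _ => ContinuousLinearMap.inr ℝ ℂ X) - (iteratedFDeriv ℝ l F (τ, A)).compContinuousLinearMap
      (fun _ => ContinuousLinearMap.inr ℝ ℂ X) - h • (iteratedFDeriv ℝ l F' (τ, A)).compContinuousLinearMap
      (fun _ => ContinuousLinearMap.inr ℝ ℂ X) = (iteratedFDeriv ℝ l F (τ + h • V, A) -
      iteratedFDeriv ℝ l F (τ, A) - h • iteratedFDeriv ℝ l F' (τ, A)).compContinuousLinearMap
      (fun _ => ContinuousLinearMap.inr ℝ ℂ X) := rfl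
  rw [e2, norm_smul, Real.norm_of_nonneg hn0.le]
  calc _ ≤ ‖A‖ ^ k * (n * ‖iteratedFDeriv ℝ l F (τ + h • V, A) -
      iteratedFDeriv ℝ l F (τ, A) - h • iteratedFDeriv ℝ l F' (τ, A)‖) := by
        gcongr; exact norm_compContinuousLinearMap_inr_le _
    _ = n * (‖A‖ ^ k * ‖iteratedFDeriv ℝ l F (τ + h • V, A) -
      iteratedFDeriv ℝ l F (τ, A) - h • iteratedFDeriv ℝ l F' (τ, A)‖) := by ring
    _ ≤ n * (C * ‖V‖ * h * h) := mul_le_mul_of_nonneg_left (hb2 A) hn0.le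
    _ = (n * h) * (h * (C * ‖V‖)) := by ring
    _ = h * (C * ‖V‖) := by rw [hh, mul_inv_cancel₀ hn0.ne', one_mul]

end Rapid
end GenusOne

end

noncomputable section
namespace GenusOne
open Filter

section Slow
variable {X X' G H : Type} [NormedAddCommGroup X] [NormedSpace ℝ X] [NormedAddCommGroup X']
  [NormedSpace ℝ X'] [NormedAddCommGroup G] [NormedSpace ℝ G] [NormedAddCommGroup H]
  [NormedSpace ℝ H]

theorem eventually_norm_le_of_continuousOn {c : ℂ → G} (hc : ContinuousOn c teich) {τ₀ : ℂ}
    (hτ₀ : τ₀ ∈ teich) : ∃ C : ℝ, ∀ᶠ τ in 𝓝 τ₀, ‖c τ‖ ≤ C := by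
  refine ⟨‖c τ₀‖ + 1, ?_⟩
  have := (hc.continuousAt (isOpen_teich.mem_nhds hτ₀)).norm
  exact this.eventually (Iic_mem_nhds (lt_add_one _))

theorem uniqueDiffOn_strip : UniqueDiffOn ℝ (strip X) := isOpen_strip.uniqueDiffOn

theorem iteratedFDerivWithin_strip {F : ℂ × X → G} {l : ℕ} {p : ℂ × X} (hp : p ∈ strip X) :
    iteratedFDerivWithin ℝ l F (strip X) p = iteratedFDeriv ℝ l F p :=
  iteratedFDerivWithin_of_isOpen l isOpen_strip hp

theorem RapidFamily.bound {F : ℂ × X → G} (hF : RapidFamily F) (m n : ℕ) {τ₀ : ℂ}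
    (hτ₀ : τ₀ ∈ teich) : ∃ C : ℝ, 0 ≤ C ∧ ∀ᶠ τ in 𝓝 τ₀, ∀ A : X, ∀ l ≤ n,
      (1 + ‖A‖) ^ m * ‖iteratedFDeriv ℝ l F (τ, A)‖ ≤ C := by
  choose C hC using fun (q : ℕ × ℕ) => hF.2 q.1 q.2 τ₀ hτ₀
  refine ⟨∑ l ∈ Finset.range (n + 1), 2 ^ m * (|C (0, l)| + |C (m, l)|),
    Finset.sum_nonneg fun _ _ => by positivity, ?_⟩
  have h : ∀ᶠ τ in 𝓝 τ₀, ∀ l ∈ Finset.range (n + 1), ∀ A : X,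
      (1 + ‖A‖) ^ m * ‖iteratedFDeriv ℝ l F (τ, A)‖ ≤ 2 ^ m * (|C (0, l)| + |C (m, l)|) := by
    rw [eventually_all_finset]
    intro l _
    filter_upwards [hC (0, l), hC (m, l)] with τ h1 h2 A
    have h3 := (h1 A).trans (le_abs_self _)
    have h4 := (h2 A).trans (le_abs_self _)
    simp only [pow_zero, one_mul] at h3
    have h5 : (1 + ‖A‖) ^ m ≤ 2 ^ m * (1 + ‖A‖ ^ m) := by
      refine (add_pow_le zero_le_one (norm_nonneg A) m).trans ?_
      rw [one_pow]
      gcongr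
      · norm_num
      · omega
    calc _ ≤ 2 ^ m * (1 + ‖A‖ ^ m) * ‖iteratedFDeriv ℝ l F (τ, A)‖ := by gcongr
      _ = 2 ^ m * (‖iteratedFDeriv ℝ l F (τ, A)‖ + ‖A‖ ^ m * ‖iteratedFDeriv ℝ l F (τ, A)‖) := by
        ring
      _ ≤ _ := by gcongr
  filter_upwards [h] with τ h1 A l hl
  have hl' : l ∈ Finset.range (n + 1) := Finset.mem_range.2 (by omega)
  exact (h1 l hl' A).trans (Finset.single_le_sum
    (f := fun l => 2 ^ m * (|C (0, l)| + |C (m, l)|)) (fun _ _ => by positivity) hl')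

/-- Smooth families of functions all of whose derivatives grow at most polynomially, locally
uniformly. -/
def SlowFamily (g : ℂ × X → G) : Prop :=
  ContDiffOn ℝ ∞ g (strip X) ∧
    ∀ l : ℕ, ∀ τ₀ ∈ teich, ∃ (N : ℕ) (C : ℝ), ∀ᶠ τ in 𝓝 τ₀, ∀ A : X,
      ‖iteratedFDeriv ℝ l g (τ, A)‖ ≤ C * (1 + ‖A‖) ^ N

theorem SlowFamily.bound {g : ℂ × X → G} (hg : SlowFamily g) (n : ℕ) {τ₀ : ℂ}
    (hτ₀ : τ₀ ∈ teich) : ∃ (N : ℕ) (C : ℝ), 1 ≤ C ∧ ∀ᶠ τ in 𝓝 τ₀, ∀ A : X, ∀ l ≤ n,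
      ‖iteratedFDeriv ℝ l g (τ, A)‖ ≤ C * (1 + ‖A‖) ^ N := by
  choose N C hC using fun l => hg.2 l τ₀ hτ₀
  refine ⟨∑ l ∈ Finset.range (n + 1), N l, 1 + ∑ l ∈ Finset.range (n + 1), |C l|,
    le_add_of_nonneg_right (Finset.sum_nonneg fun _ _ => abs_nonneg _), ?_⟩
  have h := (eventually_all_finset (Finset.range (n + 1))).2 fun l _ => hC l
  filter_upwards [h] with τ h1 A l hl
  have hl' : l ∈ Finset.range (n + 1) := Finset.mem_range.2 (by omega)
  refine (h1 l hl' A).trans ?_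
  have h2 : |C l| ≤ 1 + ∑ l ∈ Finset.range (n + 1), |C l| :=
    (Finset.single_le_sum (f := fun l => |C l|) (fun _ _ => abs_nonneg _) hl').trans
      (le_add_of_nonneg_left zero_le_one)
  have h3 : N l ≤ ∑ l ∈ Finset.range (n + 1), N l :=
    Finset.single_le_sum (f := N) (fun _ _ => Nat.zero_le _) hl'
  have h4 : 1 ≤ 1 + ‖A‖ := le_add_of_nonneg_right (norm_nonneg _)
  calc C l * (1 + ‖A‖) ^ N l ≤ |C l| * (1 + ‖A‖) ^ N l := by gcongr; exact le_abs_self _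
    _ ≤ _ := by gcongr

theorem slowFamily_comp_fst {c : ℂ → G} (hc : ContDiffOn ℝ ∞ c teich) :
    SlowFamily (fun p : ℂ × X => c p.1) := by
  refine ⟨hc.comp (by fun_prop) fun p hp => hp.1, fun l τ₀ hτ₀ => ?_⟩
  have h1 : ContinuousOn (iteratedFDeriv ℝ l c) teich :=
    (hc.continuousOn_iteratedFDerivWithin (m := l) (by exact_mod_cast le_top)
      isOpen_teich.uniqueDiffOn).congr fun x hx => (iteratedFDerivWithin_of_isOpen l isOpen_teich hx).symm
  obtain ⟨C, hC⟩ := eventually_norm_le_of_continuousOn h1 hτ₀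
  refine ⟨0, C, ?_⟩
  filter_upwards [hC, isOpen_teich.mem_nhds hτ₀] with τ h2 h3 A
  have hS : ContinuousLinearMap.fst ℝ ℂ X ⁻¹' teich = strip X := by
    ext p; simp [strip]
  have h4 := (ContinuousLinearMap.fst ℝ ℂ X).iteratedFDerivWithin_comp_right hc
    isOpen_teich.uniqueDiffOn (by rw [hS]; exact uniqueDiffOn_strip) (x := (τ, A)) h3 (i := l)
    (by exact_mod_cast le_top)
  rw [hS, iteratedFDerivWithin_strip (mem_strip h3 A),
    iteratedFDerivWithin_of_isOpen l isOpen_teich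
      (show ContinuousLinearMap.fst ℝ ℂ X (τ, A) ∈ teich from h3)] at h4
  change ‖iteratedFDeriv ℝ l (c ∘ ContinuousLinearMap.fst ℝ ℂ X) (τ, A)‖ ≤ _
  rw [h4, pow_zero, mul_one]
  refine (ContinuousMultilinearMap.norm_compContinuousLinearMap_le _ _).trans ?_
  refine le_trans (mul_le_of_le_one_right (norm_nonneg _) ?_) h2
  exact Finset.prod_le_one (fun _ _ => norm_nonneg _)
    fun _ _ => ContinuousLinearMap.norm_fst_le ℝ ℂ X

theorem norm_iteratedFDeriv_comp_snd_le {f : X → G} (hf : ContDiff ℝ ∞ f) (l : ℕ) (p : ℂ × X) :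
    ‖iteratedFDeriv ℝ l (fun p : ℂ × X => f p.2) p‖ ≤ ‖iteratedFDeriv ℝ l f p.2‖ := by
  have h := (ContinuousLinearMap.snd ℝ ℂ X).iteratedFDeriv_comp_right hf p (i := l)
    (by exact_mod_cast le_top)
  change ‖iteratedFDeriv ℝ l (f ∘ ContinuousLinearMap.snd ℝ ℂ X) p‖ ≤ _
  rw [h]
  refine (ContinuousMultilinearMap.norm_compContinuousLinearMap_le _ _).trans ?_
  refine mul_le_of_le_one_right (norm_nonneg _) ?_
  exact Finset.prod_le_one (fun _ _ => norm_nonneg _)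
    fun _ _ => ContinuousLinearMap.norm_snd_le ℝ ℂ X

theorem slowFamily_comp_snd {f : X → G} (hf : f.HasTemperateGrowth) :
    SlowFamily (fun p : ℂ × X => f p.2) := by
  refine ⟨(hf.1.comp contDiff_snd).contDiffOn, fun l τ₀ _ => ?_⟩
  obtain ⟨N, C, hC⟩ := hf.2 l
  exact ⟨N, C, Eventually.of_forall fun τ A => (norm_iteratedFDeriv_comp_snd_le hf.1 l _).trans (hC A)⟩

theorem rapidFamily_comp_snd (f : 𝓢(X, G)) : RapidFamily (fun p : ℂ × X => f p.2) := by
  refine ⟨((f.smooth ⊤).comp contDiff_snd).contDiffOn, fun m l τ₀ _ => ?_⟩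
  obtain ⟨C, hC⟩ := f.decay m l
  refine ⟨C, Eventually.of_forall fun τ A => le_trans ?_ (hC.2 A)⟩
  gcongr
  exact norm_iteratedFDeriv_comp_snd_le (f.smooth ⊤) l _

theorem SlowFamily.add {f g : ℂ × X → G} (hf : SlowFamily f) (hg : SlowFamily g) :
    SlowFamily (fun p => f p + g p) := by
  refine ⟨hf.1.add hg.1, fun l τ₀ hτ₀ => ?_⟩
  obtain ⟨N, C, hC1, hC⟩ := hf.bound l hτ₀
  obtain ⟨N', C', hC1', hC'⟩ := hg.bound l hτ₀
  refine ⟨N + N', C + C', ?_⟩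
  filter_upwards [hC, hC', isOpen_teich.mem_nhds hτ₀] with τ h1 h2 h3 A
  have hle : ∀ {F : ℂ × X → G}, ContDiffOn ℝ ∞ F (strip X) → ContDiffAt ℝ l F (τ, A) := fun hF =>
    (strip_contDiffAt hF (mem_strip h3 A)).of_le (by exact_mod_cast le_top)
  have h4 : 1 ≤ 1 + ‖A‖ := le_add_of_nonneg_right (norm_nonneg _)
  have h5 : iteratedFDeriv ℝ l (fun p => f p + g p) (τ, A) = iteratedFDeriv ℝ l f (τ, A) +
      iteratedFDeriv ℝ l g (τ, A) := iteratedFDeriv_add_apply (hle hf.1) (hle hg.1)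
  rw [h5, add_mul]
  refine (norm_add_le _ _).trans (add_le_add ((h1 A l le_rfl).trans ?_) ((h2 A l le_rfl).trans ?_))
  · gcongr
    omega
  · gcongr
    omega

theorem SlowFamily.bilin {f : ℂ × X → G} {g : ℂ × X → H} (B : G →L[ℝ] H →L[ℝ] X') (hf : SlowFamily f)
    (hg : SlowFamily g) : SlowFamily (fun p => B (f p) (g p)) := by
  refine ⟨B.isBoundedBilinearMap.contDiff.comp_contDiffOn (hf.1.prodMk hg.1), fun l τ₀ hτ₀ => ?_⟩
  obtain ⟨N, C, hC1, hC⟩ := hf.bound l hτ₀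
  obtain ⟨N', C', hC1', hC'⟩ := hg.bound l hτ₀
  refine ⟨N + N', ‖B‖ * ∑ i ∈ Finset.range (l + 1), (l.choose i) * C * C', ?_⟩
  filter_upwards [hC, hC', isOpen_teich.mem_nhds hτ₀] with τ h1 h2 h3 A
  have h5 := B.norm_iteratedFDerivWithin_le_of_bilinear hf.1 hg.1 uniqueDiffOn_strip
    (mem_strip h3 A) (n := l) (by exact_mod_cast le_top)
  rw [iteratedFDerivWithin_strip (mem_strip h3 A)] at h5
  refine h5.trans ?_
  rw [mul_assoc, Finset.sum_mul]
  refine mul_le_mul_of_nonneg_left (Finset.sum_le_sum fun i hi => ?_) (norm_nonneg B)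
  have hi' : i ≤ l := Nat.lt_succ_iff.1 (Finset.mem_range.1 hi)
  rw [iteratedFDerivWithin_strip (mem_strip h3 A), iteratedFDerivWithin_strip (mem_strip h3 A)]
  calc _ ≤ (l.choose i) * (C * (1 + ‖A‖) ^ N) * (C' * (1 + ‖A‖) ^ N') := by
        gcongr
        · exact h1 A i hi'
        · exact h2 A (l - i) (by omega)
    _ = _ := by rw [pow_add]; ring

theorem SlowFamily.mul {f g : ℂ × X → ℂ} (hf : SlowFamily f) (hg : SlowFamily g) :
    SlowFamily (fun p => f p * g p) := hf.bilin (ContinuousLinearMap.mul ℝ ℂ) hg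

theorem slowFamily_clm (M : ℂ → X →L[ℝ] X') (hM : ContDiffOn ℝ ∞ M teich) :
    SlowFamily (fun p : ℂ × X => (p.1, M p.1 p.2)) := by
  have h1 : SlowFamily (fun p : ℂ × X => M p.1) := slowFamily_comp_fst hM
  have h2 : SlowFamily (fun p : ℂ × X => p.2) :=
    slowFamily_comp_snd Function.HasTemperateGrowth.id'
  have h3 : SlowFamily (fun p : ℂ × X => M p.1 p.2) := h1.bilin (ContinuousLinearMap.id ℝ _) h2
  have h4 : SlowFamily (fun p : ℂ × X => p.1) := slowFamily_comp_fst contDiffOn_id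
  have hc : ∀ {Y : Type} [NormedAddCommGroup Y] [NormedSpace ℝ Y] (L : Y →L[ℝ] ℂ × X')
      {f : ℂ × X → Y}, SlowFamily f → SlowFamily (fun p => L (f p)) := by
    intro Y _ _ L f hf
    exact SlowFamily.bilin (g := f) (ContinuousLinearMap.id ℝ _)
      (slowFamily_comp_fst (c := fun _ => L) contDiffOn_const) hf
  have := (hc (ContinuousLinearMap.inl ℝ ℂ X') h4).add (hc (ContinuousLinearMap.inr ℝ ℂ X') h3)
  simpa using this

/-- Rapidly decreasing families are stable under smooth families of linear coordinate changes. -/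
theorem RapidFamily.comp_clm {F : ℂ × X' → G} (hF : RapidFamily F) (M : ℂ → X →L[ℝ] X')
    (N : ℂ → X' →L[ℝ] X) (hM : ContDiffOn ℝ ∞ M teich) (hN : ContinuousOn N teich)
    (hNM : ∀ τ ∈ teich, ∀ A, N τ (M τ A) = A) : RapidFamily (fun p : ℂ × X => F (p.1, M p.1 p.2)) := by
  have hΘ := slowFamily_clm M hM
  have hmaps : Set.MapsTo (fun p : ℂ × X => (p.1, M p.1 p.2)) (strip X) (strip X') :=
    fun p hp => ⟨hp.1, trivial⟩
  refine ⟨hF.1.comp hΘ.1 hmaps, fun m l τ₀ hτ₀ => ?_⟩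
  obtain ⟨K, D, hD1, hD⟩ := hΘ.bound l hτ₀
  obtain ⟨c, hc⟩ := eventually_norm_le_of_continuousOn hN hτ₀
  obtain ⟨C, hC0, hC⟩ := hF.bound (m + K * l) l hτ₀
  have hc0 : 0 ≤ c := (norm_nonneg _).trans hc.self_of_nhds
  refine ⟨(1 + c) ^ (m + K * l) * l.factorial * D ^ l * C, ?_⟩
  filter_upwards [hD, hc, hC, isOpen_teich.mem_nhds hτ₀] with τ h1 h2 h3 h4 A
  have hA : 1 + ‖A‖ ≤ (1 + c) * (1 + ‖M τ A‖) := by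
    have : ‖A‖ ≤ c * ‖M τ A‖ := by
      conv_lhs => rw [← hNM τ h4 A]
      exact (ContinuousLinearMap.le_opNorm _ _).trans (by gcongr)
    nlinarith [norm_nonneg (M τ A), norm_nonneg A]
  have hA1 : 1 ≤ 1 + ‖A‖ := le_add_of_nonneg_right (norm_nonneg _)
  have hb := norm_iteratedFDerivWithin_comp_le (n := l) hF.1 hΘ.1 (by exact_mod_cast le_top)
    uniqueDiffOn_strip uniqueDiffOn_strip hmaps (mem_strip h4 A)
    (C := C / (1 + ‖M τ A‖) ^ (m + K * l)) (D := D * (1 + ‖A‖) ^ K) (fun i hi => ?_)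
    (fun i h1i hi => ?_)
  · rw [iteratedFDerivWithin_strip (mem_strip h4 A)] at hb
    calc ‖A‖ ^ m * ‖iteratedFDeriv ℝ l (fun p : ℂ × X => F (p.1, M p.1 p.2)) (τ, A)‖
        ≤ (1 + ‖A‖) ^ m * (l.factorial * (C / (1 + ‖M τ A‖) ^ (m + K * l)) *
          (D * (1 + ‖A‖) ^ K) ^ l) := by
          gcongr
          · linarith
          · exact hb
      _ = l.factorial * D ^ l * C * ((1 + ‖A‖) ^ (m + K * l) / (1 + ‖M τ A‖) ^ (m + K * l)) := by
          rw [mul_pow, ← pow_mul, pow_add (1 + ‖A‖)]; ring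
      _ ≤ l.factorial * D ^ l * C * (1 + c) ^ (m + K * l) := by
          gcongr
          rw [div_le_iff₀ (by positivity), ← mul_pow]
          gcongr
      _ = _ := by ring
  · rw [iteratedFDerivWithin_strip (mem_strip h4 _), le_div_iff₀ (by positivity), mul_comm]
    exact h3 (M τ A) i hi
  · rw [iteratedFDerivWithin_strip (mem_strip h4 A)]
    refine (h1 A i hi).trans (le_self_pow₀ ?_ (by omega))
    exact one_le_mul_of_one_le_of_one_le hD1 (one_le_pow₀ hA1)

end Slow

section Module
variable {X P κ ι : Type} [NormedAddCommGroup X] [NormedSpace ℝ X] [Fintype ι]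

/-- A collection of functions, closed under differentiation up to slowly growing factors and
decaying rapidly, consists of smooth functions. -/
theorem contDiffOn_of_hasFDerivAt_sum {I : P → ℂ × X → ℂ} {g : ι → ℂ × X → ℂ} {T : ι → P → P}
    {L : ι → (ℂ × X →L[ℝ] ℂ)} (hg : ∀ i, SlowFamily (g i))
    (hI : ∀ ψ, ∀ p ∈ strip X, HasFDerivAt (I ψ) (∑ i, (g i p * I (T i ψ) p) • L i) p) (ψ : P) :
    ContDiffOn ℝ ∞ (I ψ) (strip X) := by
  rw [contDiffOn_infty]
  intro n
  induction n generalizing ψ with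
  | zero =>
    exact contDiffOn_zero.2 fun p hp => (hI ψ p hp).continuousAt.continuousWithinAt
  | succ n ih =>
    rw [Nat.cast_add, Nat.cast_one, contDiffOn_succ_iff_fderiv_of_isOpen isOpen_strip]
    refine ⟨fun p hp => (hI ψ p hp).differentiableAt.differentiableWithinAt, by simp, ?_⟩
    have h1 : ContDiffOn ℝ n (fun p => ∑ i, (g i p * I (T i ψ) p) • L i) (strip X) :=
      ContDiffOn.sum fun i _ => (((hg i).1.of_le (by exact_mod_cast le_top)).mul
        (ih (T i ψ))).smul contDiffOn_const
    exact h1.congr fun p hp => (hI ψ p hp).fderiv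

theorem bound_iteratedFDeriv_of_hasFDerivAt_sum {I : P → ℂ × X → ℂ} {g : ι → ℂ × X → ℂ}
    {T : ι → P → P} {L : ι → (ℂ × X →L[ℝ] ℂ)} (size : κ → P → ℝ)
    (hsize : ∀ k ψ, 0 ≤ size k ψ)
    (hdir : ∀ s : Finset κ, ∃ k', ∀ k ∈ s, ∀ ψ, size k ψ ≤ size k' ψ)
    (hT : ∀ i k, ∃ k', ∃ C : ℝ, 0 ≤ C ∧ ∀ ψ, size k (T i ψ) ≤ C * size k' ψ)
    (hg : ∀ i, SlowFamily (g i))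
    (hI : ∀ ψ, ∀ p ∈ strip X, HasFDerivAt (I ψ) (∑ i, (g i p * I (T i ψ) p) • L i) p)
    {τ₀ : ℂ} (hτ₀ : τ₀ ∈ teich)
    (hb : ∀ m : ℕ, ∃ k, ∃ C : ℝ, 0 ≤ C ∧ ∀ᶠ τ in 𝓝 τ₀, ∀ ψ, ∀ A : X,
      (1 + ‖A‖) ^ m * ‖I ψ (τ, A)‖ ≤ C * size k ψ) (l : ℕ) :
    ∀ m : ℕ, ∃ k, ∃ C : ℝ, 0 ≤ C ∧ ∀ᶠ τ in 𝓝 τ₀, ∀ ψ, ∀ A : X,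
      (1 + ‖A‖) ^ m * ‖iteratedFDeriv ℝ l (I ψ) (τ, A)‖ ≤ C * size k ψ := by
  classical
  induction l using Nat.strong_induction_on with
  | _ l ih =>
  intro m
  cases l with
  | zero =>
    obtain ⟨k, C, hC0, hC⟩ := hb m
    refine ⟨k, C, hC0, ?_⟩
    simpa only [norm_iteratedFDeriv_zero] using hC
  | succ l =>
    have hsm := contDiffOn_of_hasFDerivAt_sum hg hI
    choose N c hc1 hc using fun i => (hg i).bound l hτ₀
    have h1 : ∀ i : ι, ∀ a : Fin (l + 1), ∃ k, ∃ C : ℝ, 0 ≤ C ∧ ∀ᶠ τ in 𝓝 τ₀, ∀ ψ, ∀ A : X,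
        (1 + ‖A‖) ^ (m + N i) * ‖iteratedFDeriv ℝ (l - a) (I (T i ψ)) (τ, A)‖ ≤ C * size k ψ := by
      intro i a
      obtain ⟨k, C, hC0, hC⟩ := ih (l - a) (by omega) (m + N i)
      obtain ⟨k', C', hC0', hC'⟩ := hT i k
      refine ⟨k', C * C', by positivity, ?_⟩
      filter_upwards [hC] with τ h ψ A
      refine (h (T i ψ) A).trans ?_
      rw [mul_assoc]
      gcongr
      exact hC' ψ
    choose k C hC0 hC using h1
    obtain ⟨k', hk'⟩ := hdir (Finset.univ.image fun q : ι × Fin (l + 1) => k q.1 q.2)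
    refine ⟨k', ∑ i, (∑ a : Fin (l + 1), (l.choose a) * c i * C i a) * ‖L i‖,
      Finset.sum_nonneg fun i _ => mul_nonneg (Finset.sum_nonneg fun a _ => ?_) (norm_nonneg _), ?_⟩
    · have := hC0 i a
      have := hc1 i
      positivity
    have h2 : ∀ᶠ τ in 𝓝 τ₀, ∀ i : ι, ∀ a : Fin (l + 1), ∀ ψ, ∀ A : X,
        (1 + ‖A‖) ^ (m + N i) * ‖iteratedFDeriv ℝ (l - a) (I (T i ψ)) (τ, A)‖ ≤
          C i a * size (k i a) ψ :=
      eventually_all.2 fun i => eventually_all.2 fun a => hC i a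
    filter_upwards [h2, eventually_all.2 hc, isOpen_teich.mem_nhds hτ₀] with τ h3 h4 h5 ψ A
    have hp := mem_strip h5 A
    have h6 : fderiv ℝ (I ψ) =ᶠ[𝓝 (τ, A)] fun p => ∑ i, (g i p * I (T i ψ) p) • L i := by
      filter_upwards [isOpen_strip.mem_nhds hp] with p hp' using (hI ψ p hp').fderiv
    rw [← norm_iteratedFDeriv_fderiv, (h6.iteratedFDeriv ℝ l).eq_of_nhds]
    have hgI : ∀ i, ContDiffOn ℝ ∞ (fun p => g i p * I (T i ψ) p) (strip X) := fun i =>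
      (hg i).1.mul (hsm (T i ψ))
    have hterm : ∀ i, ContDiffOn ℝ ∞ (fun p => (g i p * I (T i ψ) p) • L i) (strip X) := fun i =>
      (hgI i).smul contDiffOn_const
    have h7 : ‖iteratedFDeriv ℝ l (fun p => ∑ i, (g i p * I (T i ψ) p) • L i) (τ, A)‖ ≤
        ∑ i, ‖iteratedFDeriv ℝ l (fun p => g i p * I (T i ψ) p) (τ, A)‖ * ‖L i‖ := by
      have e1 := iteratedFDerivWithin_sum_apply (f := fun i p => (g i p * I (T i ψ) p) • L i)
        (u := Finset.univ) (i := l) uniqueDiffOn_strip hp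
        (fun i _ => ((hterm i) _ hp).of_le (by exact_mod_cast le_top))
      have e2 : (∑ i, fun p => (g i p * I (T i ψ) p) • L i) =
          fun p => ∑ i, (g i p * I (T i ψ) p) • L i := by ext1 p; simp
      rw [e2, iteratedFDerivWithin_strip hp] at e1
      rw [e1]
      refine (norm_sum_le _ _).trans (Finset.sum_le_sum fun i _ => ?_)
      rw [iteratedFDerivWithin_strip hp]
      let Λ : ℂ →L[ℝ] (ℂ × X →L[ℝ] ℂ) :=
        (ContinuousLinearMap.lsmul ℝ ℂ (E := (ℂ × X →L[ℝ] ℂ))).flip (L i)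
      have e3 := Λ.norm_iteratedFDeriv_comp_left (strip_contDiffAt (hgI i) hp) (n := l)
        (by exact_mod_cast le_top)
      have e4 : ‖Λ‖ ≤ ‖L i‖ := by
        refine ContinuousLinearMap.opNorm_le_bound _ (norm_nonneg _) fun z => ?_
        simp [Λ, norm_smul, mul_comm]
      rw [mul_comm]
      exact e3.trans (by gcongr)
    have hA1 : 1 ≤ 1 + ‖A‖ := le_add_of_nonneg_right (norm_nonneg _)
    have h8 : ∀ i, (1 + ‖A‖) ^ m * ‖iteratedFDeriv ℝ l (fun p => g i p * I (T i ψ) p) (τ, A)‖ ≤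
        (∑ a : Fin (l + 1), (l.choose a) * c i * C i a) * size k' ψ := by
      intro i
      have e1 := norm_iteratedFDerivWithin_mul_le (hg i).1 (hsm (T i ψ)) uniqueDiffOn_strip hp
        (n := l) (by exact_mod_cast le_top)
      simp only [iteratedFDerivWithin_strip hp] at e1
      rw [Finset.sum_range] at e1
      calc _ ≤ (1 + ‖A‖) ^ m * ∑ a : Fin (l + 1), (l.choose a) *
            ‖iteratedFDeriv ℝ a (g i) (τ, A)‖ * ‖iteratedFDeriv ℝ (l - a) (I (T i ψ)) (τ, A)‖ := by
            gcongr
        _ ≤ _ := by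
          rw [Finset.mul_sum, Finset.sum_mul]
          refine Finset.sum_le_sum fun a _ => ?_
          calc _ ≤ (1 + ‖A‖) ^ m * ((l.choose a) * (c i * (1 + ‖A‖) ^ N i) *
                ‖iteratedFDeriv ℝ (l - a) (I (T i ψ)) (τ, A)‖) := by
                gcongr
                exact h4 i A a (by omega)
            _ = (l.choose a) * c i * ((1 + ‖A‖) ^ (m + N i) *
                ‖iteratedFDeriv ℝ (l - a) (I (T i ψ)) (τ, A)‖) := by rw [pow_add]; ring
            _ ≤ (l.choose a) * c i * (C i a * size k' ψ) := by
                have := hc1 i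
                have := hC0 i a
                refine mul_le_mul_of_nonneg_left ((h3 i a ψ A).trans ?_) (by positivity)
                gcongr
                exact hk' _ (Finset.mem_image.2 ⟨(i, a), Finset.mem_univ _, rfl⟩) ψ
            _ = _ := by ring
    calc _ ≤ (1 + ‖A‖) ^ m * ∑ i, ‖iteratedFDeriv ℝ l (fun p => g i p * I (T i ψ) p) (τ, A)‖ *
          ‖L i‖ := by gcongr
      _ = ∑ i, ((1 + ‖A‖) ^ m * ‖iteratedFDeriv ℝ l (fun p => g i p * I (T i ψ) p) (τ, A)‖) *
          ‖L i‖ := by rw [Finset.mul_sum]; exact Finset.sum_congr rfl fun i _ => by ring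
      _ ≤ ∑ i, ((∑ a : Fin (l + 1), (l.choose a) * c i * C i a) * size k' ψ) * ‖L i‖ := by
          exact Finset.sum_le_sum fun i _ => mul_le_mul_of_nonneg_right (h8 i) (norm_nonneg _)
      _ = _ := by
          rw [Finset.sum_mul]
          exact Finset.sum_congr rfl fun i _ => by ring

end Module
end GenusOne

end

noncomputable section
namespace GenusOne
open Filter

open ComplexConjugate in
/-- The complex coordinates on `AC` adapted to `IT`, as a real-linear map. -/
def yco {r : ℕ} (t τ : ℂ) : AC r →L[ℝ] AC r := LinearMap.toContinuousLinearMap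
  { toFun := fun A => Sum.elim
      (fun j => ((Real.sqrt τ.im)⁻¹ : ℝ) * (((A (Sum.inr j) - conj (t / ‖t‖) * conj (A (Sum.inr j)))
        - conj τ * (A (Sum.inl j) - conj (t / ‖t‖) * conj (A (Sum.inl j)))) * (-Complex.I / 2)))
      (fun j => ((Real.sqrt τ.im)⁻¹ : ℝ) * (((conj (A (Sum.inr j)) + (t / ‖t‖) * A (Sum.inr j))
        - τ * (conj (A (Sum.inl j)) + (t / ‖t‖) * A (Sum.inl j))) * (Complex.I / 2)))
    map_add' := fun A B => by
      ext (j | j) <;> simp <;> ring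
    map_smul' := fun c A => by
      ext (j | j) <;> simp <;> ring }

open ComplexConjugate in
/-- The inverse of `yco`. -/
def yinv {r : ℕ} (t τ : ℂ) : AC r →L[ℝ] AC r := LinearMap.toContinuousLinearMap
  { toFun := fun y => Sum.elim
      (fun j => ((2 * Real.sqrt τ.im)⁻¹ : ℝ) * (y (Sum.inl j) - conj (t / ‖t‖) * conj (y (Sum.inl j))
        + conj (t / ‖t‖) * y (Sum.inr j) + conj (y (Sum.inr j))))
      (fun j => ((2 * Real.sqrt τ.im)⁻¹ : ℝ) * (τ * y (Sum.inl j)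
        - conj τ * conj (t / ‖t‖) * conj (y (Sum.inl j))
        + conj (t / ‖t‖) * conj τ * y (Sum.inr j) + τ * conj (y (Sum.inr j))))
    map_add' := fun A B => by
      ext (j | j) <;> simp <;> ring
    map_smul' := fun c A => by
      ext (j | j) <;> simp <;> ring }

section formulas
open ComplexConjugate

variable {r : ℕ} {t τ : ℂ}

theorem yco_inl (A : AC r) (j : Fin r) : yco t τ A (Sum.inl j) =
    ((Real.sqrt τ.im)⁻¹ : ℝ) * (((A (Sum.inr j) - conj (t / ‖t‖) * conj (A (Sum.inr j)))
        - conj τ * (A (Sum.inl j) - conj (t / ‖t‖) * conj (A (Sum.inl j)))) * (-Complex.I / 2)) := rfl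

theorem yco_inr (A : AC r) (j : Fin r) : yco t τ A (Sum.inr j) =
    ((Real.sqrt τ.im)⁻¹ : ℝ) * (((conj (A (Sum.inr j)) + (t / ‖t‖) * A (Sum.inr j))
        - τ * (conj (A (Sum.inl j)) + (t / ‖t‖) * A (Sum.inl j))) * (Complex.I / 2)) := rfl

theorem yinv_inl (y : AC r) (j : Fin r) : yinv t τ y (Sum.inl j) =
    ((2 * Real.sqrt τ.im)⁻¹ : ℝ) * (y (Sum.inl j) - conj (t / ‖t‖) * conj (y (Sum.inl j))
        + conj (t / ‖t‖) * y (Sum.inr j) + conj (y (Sum.inr j))) := rfl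

theorem yinv_inr (y : AC r) (j : Fin r) : yinv t τ y (Sum.inr j) =
    ((2 * Real.sqrt τ.im)⁻¹ : ℝ) * (τ * y (Sum.inl j)
        - conj τ * conj (t / ‖t‖) * conj (y (Sum.inl j))
        + conj (t / ‖t‖) * conj τ * y (Sum.inr j) + τ * conj (y (Sum.inr j))) := rfl

theorem phase_mul_conj (ht : t ≠ 0) : (t / ‖t‖) * conj (t / ‖t‖) = 1 := by
  have h : (‖t‖ : ℂ) ≠ 0 := by simpa using ht
  rw [map_div₀, Complex.conj_ofReal, div_mul_div_comm, Complex.mul_conj, Complex.normSq_eq_norm_sq]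
  field_simp
  push_cast; ring

theorem phase_mul_norm (ht : t ≠ 0) : (t / ‖t‖) * ‖t‖ = t := by
  have h : (‖t‖ : ℂ) ≠ 0 := by simpa using ht
  field_simp

theorem sqrt_im_mul_self (hτ : τ ∈ teich) :
    2 * Complex.I * ((Real.sqrt τ.im : ℝ) : ℂ) ^ 2 = τ - conj τ := by
  rw [← Complex.ofReal_pow, Real.sq_sqrt (le_of_lt hτ)]
  apply Complex.ext <;> simp <;> ring

theorem sqrt_im_mul_inv (hτ : τ ∈ teich) :
    ((Real.sqrt τ.im : ℝ) : ℂ) * (((Real.sqrt τ.im)⁻¹ : ℝ) : ℂ) = 1 := by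
  have : Real.sqrt τ.im ≠ 0 := (Real.sqrt_pos.2 hτ).ne'
  rw [← Complex.ofReal_mul, mul_inv_cancel₀ this]; simp

theorem two_sqrt_inv (τ : ℂ) : (((2 * Real.sqrt τ.im)⁻¹ : ℝ) : ℂ) =
    (((Real.sqrt τ.im)⁻¹ : ℝ) : ℂ) / 2 := by
  push_cast; rw [mul_inv]; ring

theorem yinv_yco (ht : t ≠ 0) (hτ : τ ∈ teich) (A : AC r) : yinv t τ (yco t τ A) = A := by
  have h1 := phase_mul_conj ht
  have h2 := sqrt_im_mul_self hτ
  have h3 := sqrt_im_mul_inv hτ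
  have h4 := Complex.I_mul_I
  ext (j | j)
  · rw [yinv_inl, yco_inl, yco_inr, two_sqrt_inv]
    simp only [map_mul, map_sub, map_add, Complex.conj_conj, Complex.conj_ofReal, map_div₀,
      map_neg, Complex.conj_I, map_ofNat] at h1 ⊢
    generalize (t / (‖t‖ : ℂ)) = κ at *
    generalize (conj t / (‖t‖ : ℂ)) = κ' at *
    generalize conj τ = τ' at *
    generalize ((Real.sqrt τ.im : ℝ) : ℂ) = w at *
    generalize (((Real.sqrt τ.im)⁻¹ : ℝ) : ℂ) = w' at *
    generalize conj (A (Sum.inl j)) = a' at *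
    generalize conj (A (Sum.inr j)) = b' at *
    generalize A (Sum.inl j) = a at *
    generalize A (Sum.inr j) = b at *
    grind
  · rw [yinv_inr, yco_inl, yco_inr, two_sqrt_inv]
    simp only [map_mul, map_sub, map_add, Complex.conj_conj, Complex.conj_ofReal, map_div₀,
      map_neg, Complex.conj_I, map_ofNat] at h1 ⊢
    generalize (t / (‖t‖ : ℂ)) = κ at *
    generalize (conj t / (‖t‖ : ℂ)) = κ' at *
    generalize conj τ = τ' at *
    generalize ((Real.sqrt τ.im : ℝ) : ℂ) = w at *
    generalize (((Real.sqrt τ.im)⁻¹ : ℝ) : ℂ) = w' at *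
    generalize conj (A (Sum.inl j)) = a' at *
    generalize conj (A (Sum.inr j)) = b' at *
    generalize A (Sum.inl j) = a at *
    generalize A (Sum.inr j) = b at *
    grind

theorem yco_yinv (ht : t ≠ 0) (hτ : τ ∈ teich) (y : AC r) : yco t τ (yinv t τ y) = y := by
  have h := (mul_eq_one_comm (a := ((yinv t τ : AC r →L[ℝ] AC r).toLinearMap : Module.End ℝ (AC r)))
    (b := (yco t τ : AC r →L[ℝ] AC r).toLinearMap)).1 (LinearMap.ext fun A => yinv_yco ht hτ A)
  exact LinearMap.congr_fun h y

/-- `yco` as an equivalence. -/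
def yEquiv (ht : t ≠ 0) (hτ : τ ∈ teich) : AC r ≃L[ℝ] AC r :=
  ContinuousLinearEquiv.equivOfInverse (yco t τ) (yinv t τ) (yinv_yco ht hτ) (yco_yinv ht hτ)

theorem IT_inl (ht : t ≠ 0) (A : AC r) (j : Fin r) : IT τ t A (Sum.inl j) =
    conj (t / ‖t‖) * ((((τ.re : ℝ) : ℂ) * conj (A (Sum.inl j)) - conj (A (Sum.inr j))) / τ.im) := by
  have h : (‖t‖ : ℂ) ≠ 0 := by simpa using ht
  have e : conj (t / ‖t‖) = (t.re - Complex.I * t.im) / ‖t‖ := by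
    rw [map_div₀, Complex.conj_ofReal]; congr 1; apply Complex.ext <;> simp
  rw [e]
  simp [IT, IC, hodgeC, Pi.star_apply, RCLike.star_def]
  ring

theorem IT_inr (ht : t ≠ 0) (A : AC r) (j : Fin r) : IT τ t A (Sum.inr j) =
    conj (t / ‖t‖) * (((τ * conj τ) * conj (A (Sum.inl j)) - ((τ.re : ℝ) : ℂ) * conj (A (Sum.inr j)))
      / τ.im) := by
  have h : (‖t‖ : ℂ) ≠ 0 := by simpa using ht
  have e : conj (t / ‖t‖) = (t.re - Complex.I * t.im) / ‖t‖ := by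
    rw [map_div₀, Complex.conj_ofReal]; congr 1; apply Complex.ext <;> simp
  rw [e, Complex.mul_conj]
  simp [IT, IC, hodgeC, Pi.star_apply, RCLike.star_def]
  ring

theorem yco_IT (ht : t ≠ 0) (hτ : τ ∈ teich) (A : AC r) :
    yco t τ (IT τ t A) = Complex.I • yco t τ A := by
  have h1 := phase_mul_conj ht
  have h4 := Complex.I_mul_I
  have h5 : ((τ.re : ℝ) : ℂ) = (τ + conj τ) / 2 := by
    apply Complex.ext <;> simp
  have h6 : 2 * Complex.I * ((τ.im : ℝ) : ℂ) = τ - conj τ := by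
    apply Complex.ext <;> simp <;> ring
  have h7 : ((τ.im : ℝ) : ℂ) * (((τ.im : ℝ) : ℂ))⁻¹ = 1 :=
    mul_inv_cancel₀ (by simpa using (show τ.im ≠ 0 from hτ.ne'))
  ext (j | j)
  · rw [yco_inl, Pi.smul_apply, yco_inl, IT_inl ht, IT_inr ht, h5, smul_eq_mul]
    simp only [map_mul, map_sub, map_add, Complex.conj_conj, Complex.conj_ofReal, map_div₀,
      map_neg, Complex.conj_I, map_ofNat, div_eq_mul_inv _ ((τ.im : ℝ) : ℂ), map_inv₀] at h1 ⊢
    generalize (t / (‖t‖ : ℂ)) = κ at *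
    generalize (conj t / (‖t‖ : ℂ)) = κ' at *
    generalize conj τ = τ' at *
    generalize (((Real.sqrt τ.im)⁻¹ : ℝ) : ℂ) = w' at *
    generalize ((τ.im : ℝ) : ℂ)⁻¹ = v' at *
    generalize ((τ.im : ℝ) : ℂ) = v at *
    generalize conj (A (Sum.inl j)) = a' at *
    generalize conj (A (Sum.inr j)) = b' at *
    generalize A (Sum.inl j) = a at *
    generalize A (Sum.inr j) = b at *
    grind
  · rw [yco_inr, Pi.smul_apply, yco_inr, IT_inl ht, IT_inr ht, h5, smul_eq_mul]
    simp only [map_mul, map_sub, map_add, Complex.conj_conj, Complex.conj_ofReal, map_div₀,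
      map_neg, Complex.conj_I, map_ofNat, div_eq_mul_inv _ ((τ.im : ℝ) : ℂ), map_inv₀] at h1 ⊢
    generalize (t / (‖t‖ : ℂ)) = κ at *
    generalize (conj t / (‖t‖ : ℂ)) = κ' at *
    generalize conj τ = τ' at *
    generalize (((Real.sqrt τ.im)⁻¹ : ℝ) : ℂ) = w' at *
    generalize ((τ.im : ℝ) : ℂ)⁻¹ = v' at *
    generalize ((τ.im : ℝ) : ℂ) = v at *
    generalize conj (A (Sum.inl j)) = a' at *
    generalize conj (A (Sum.inr j)) = b' at *
    generalize A (Sum.inl j) = a at *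
    generalize A (Sum.inr j) = b at *
    grind

theorem omegaT_eq (ht : t ≠ 0) (hτ : τ ∈ teich) (A B : AC r) :
    omegaT t A B = ‖t‖ * (∑ a, conj (yco t τ A a) * yco t τ B a).im := by
  have key : t * omegaC A B + conj (t * omegaC A B) =
      ‖t‖ * (-Complex.I) * (∑ a, conj (yco t τ A a) * yco t τ B a -
        conj (∑ a, conj (yco t τ A a) * yco t τ B a)) := by
    rw [omegaC]
    simp only [Fintype.sum_sum_type, map_mul, map_sum, map_add, map_sub, Finset.mul_sum,
      ← Finset.sum_add_distrib, ← Finset.sum_sub_distrib, Complex.conj_conj]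
    refine Finset.sum_congr rfl fun j _ => ?_
    have h1 := phase_mul_conj ht
    have h0 := phase_mul_norm ht
    have h0' : conj (t / ‖t‖) * ‖t‖ = conj t := by
      have := congrArg conj h0
      rwa [map_mul, Complex.conj_ofReal] at this
    have h2 := sqrt_im_mul_self hτ
    have h3 := sqrt_im_mul_inv hτ
    have h4 := Complex.I_mul_I
    rw [yco_inl, yco_inl, yco_inr, yco_inr]
    simp only [map_mul, map_sub, map_add, Complex.conj_conj, Complex.conj_ofReal, map_div₀,
      map_neg, Complex.conj_I, map_ofNat] at h1 h0' ⊢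
    generalize (t / (‖t‖ : ℂ)) = κ at *
    generalize (conj t / (‖t‖ : ℂ)) = κ' at *
    generalize (‖t‖ : ℂ) = nt at *
    rw [← h0', ← h0]
    generalize conj τ = τ' at *
    generalize ((Real.sqrt τ.im : ℝ) : ℂ) = w at *
    generalize (((Real.sqrt τ.im)⁻¹ : ℝ) : ℂ) = w' at *
    generalize conj (A (Sum.inl j)) = a' at *
    generalize conj (A (Sum.inr j)) = b' at *
    generalize A (Sum.inl j) = a at *
    generalize A (Sum.inr j) = b at *
    generalize conj (B (Sum.inl j)) = c' at *
    generalize conj (B (Sum.inr j)) = d' at *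
    generalize B (Sum.inl j) = c at *
    generalize B (Sum.inr j) = d at *
    clear h0 h0'
    grind
  rw [Complex.add_conj, Complex.sub_conj] at key
  generalize (∑ a, conj (yco t τ A a) * yco t τ B a) = w at *
  have := congrArg Complex.re key
  simp at this
  simp only [omegaT, Complex.mul_re]
  linarith

end formulas
end GenusOne

end

noncomputable section
namespace GenusOne
open Filter

theorem contDiffOn_sqrt_im_inv : ContDiffOn ℝ ∞ (fun τ : ℂ => (Real.sqrt τ.im)⁻¹) teich := by
  have h1 : ContDiffOn ℝ ∞ (fun τ : ℂ => τ.im) teich := Complex.imCLM.contDiff.contDiffOn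
  refine ContDiffOn.inv (h1.sqrt fun τ hτ => ne_of_gt hτ) fun τ hτ => (Real.sqrt_pos.2 hτ).ne'

theorem contDiffOn_ofReal {f : ℂ → ℝ} {s : Set ℂ} (hf : ContDiffOn ℝ ∞ f s) :
    ContDiffOn ℝ ∞ (fun τ => (f τ : ℂ)) s :=
  Complex.ofRealCLM.contDiff.comp_contDiffOn hf

open ComplexConjugate in
theorem contDiff_conj' : ContDiff ℝ ∞ (fun τ : ℂ => conj τ) :=
  Complex.conjCLE.contDiff

section formulas
open ComplexConjugate

variable {r : ℕ} {t τ : ℂ}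

theorem yco_contDiffOn : ContDiffOn ℝ ∞ (fun τ => (yco t τ : AC r →L[ℝ] AC r)) teich := by
  refine contDiffOn_clm_apply.2 fun A => contDiffOn_pi.2 ?_
  have h1 := contDiffOn_ofReal contDiffOn_sqrt_im_inv
  have h2 : ContDiffOn ℝ ∞ (fun τ : ℂ => conj τ) teich := contDiff_conj'.contDiffOn
  rintro (j | j)
  · simp only [yco_inl]
    exact h1.mul (((contDiffOn_const).sub (h2.mul contDiffOn_const)).mul contDiffOn_const)
  · simp only [yco_inr]
    exact h1.mul (((contDiffOn_const).sub (contDiffOn_id.mul contDiffOn_const)).mul contDiffOn_const)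

theorem yinv_contDiffOn : ContDiffOn ℝ ∞ (fun τ => (yinv t τ : AC r →L[ℝ] AC r)) teich := by
  refine contDiffOn_clm_apply.2 fun A => contDiffOn_pi.2 ?_
  have h1 : ContDiffOn ℝ ∞ (fun τ : ℂ => (((2 * Real.sqrt τ.im)⁻¹ : ℝ) : ℂ)) teich := by
    simp only [two_sqrt_inv]
    exact (contDiffOn_ofReal contDiffOn_sqrt_im_inv).div_const _
  have h2 : ContDiffOn ℝ ∞ (fun τ : ℂ => conj τ) teich := contDiff_conj'.contDiffOn
  rintro (j | j)
  · simp only [yinv_inl]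
    exact h1.mul contDiffOn_const
  · simp only [yinv_inr]
    exact h1.mul ((((contDiffOn_id.mul contDiffOn_const).sub
      ((h2.mul contDiffOn_const).mul contDiffOn_const)).add
      ((contDiffOn_const.mul h2).mul contDiffOn_const)).add (contDiffOn_id.mul contDiffOn_const))

/-- The coefficients of the type (2,0) part of the variation of the coordinates `yco`. -/
def yMu (r : ℕ) (t τ V : ℂ) : Idx r → ℂ := Sum.elim
  (fun _ => conj (t / ‖t‖) * conj (Complex.I * V / (2 * τ.im)))
  (fun _ => -((t / ‖t‖) * (Complex.I * V / (2 * τ.im))))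

/-- The coefficients of the rotational part of the variation of the coordinates `yco`. -/
def yNu (r : ℕ) (τ V : ℂ) : Idx r → ℂ := Sum.elim
  (fun _ => Complex.I * (V.re / (2 * τ.im)))
  (fun _ => -(Complex.I * (V.re / (2 * τ.im))))

/-- The variation of the coordinates `yco` in the direction `V`. -/
def yVar (r : ℕ) (t τ V : ℂ) (y : AC r) : AC r := fun a => yNu r τ V a * y a + yMu r t τ V a * conj (y a)

theorem hasDerivAt_sqrt_im_inv (hτ : τ ∈ teich) (V : ℂ) :
    HasDerivAt (fun s : ℝ => (((Real.sqrt (τ.im + s * V.im))⁻¹ : ℝ) : ℂ))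
      (-(V.im / (2 * τ.im) : ℝ) * ((Real.sqrt τ.im)⁻¹ : ℝ)) 0 := by
  have hpos : 0 < τ.im := hτ
  have h0 : HasDerivAt (fun s : ℝ => τ.im + s * V.im) V.im 0 := by
    simpa using ((hasDerivAt_id (0 : ℝ)).mul_const V.im).const_add τ.im
  have h1 := ((h0.sqrt (by simpa using hpos.ne')).inv (by simpa using (Real.sqrt_pos.2 hpos).ne')).ofReal_comp
  refine h1.congr_deriv ?_
  have h2 : Real.sqrt τ.im ≠ 0 := (Real.sqrt_pos.2 hpos).ne'
  rw [← Complex.ofReal_neg, ← Complex.ofReal_mul]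
  congr 1
  simp only [zero_mul, add_zero]
  rw [Real.sq_sqrt hpos.le]
  field_simp

theorem hasDerivAt_affine (a b : ℂ) : HasDerivAt (fun s : ℝ => a + s * b) b 0 := by
  simpa using ((Complex.ofRealCLM.hasDerivAt (x := (0 : ℝ))).mul_const b).const_add a

theorem lineDeriv_yco (hτ : τ ∈ teich) (ht : t ≠ 0) (V : ℂ) (A : AC r) (a : Idx r) :
    HasDerivAt (fun s : ℝ => yco t (τ + s • V) A a) (yVar r t τ V (yco t τ A) a) 0 := by
  have hpos : 0 < τ.im := hτ
  have h1 := phase_mul_conj ht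
  have h4 := Complex.I_mul_I
  have h6 : 2 * Complex.I * ((τ.im : ℝ) : ℂ) = τ - conj τ := by
    apply Complex.ext <;> simp <;> ring
  have h7 : ((τ.im : ℝ) : ℂ) * (((τ.im : ℝ) : ℂ))⁻¹ = 1 :=
    mul_inv_cancel₀ (by simpa using (show τ.im ≠ 0 from hτ.ne'))
  have h8 : (V.im : ℂ) = (V - conj V) * (-Complex.I / 2) := by
    apply Complex.ext <;> simp <;> ring
  have h9 : (V.re : ℂ) = (V + conj V) / 2 := by
    apply Complex.ext <;> simp
  rcases a with j | j
  · simp only [yco_inl]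
    have := (hasDerivAt_sqrt_im_inv hτ V).mul
      ((((hasDerivAt_affine (conj τ) (conj V)).mul_const
        (A (Sum.inl j) - conj (t / ‖t‖) * conj (A (Sum.inl j)))).const_sub
          (A (Sum.inr j) - conj (t / ‖t‖) * conj (A (Sum.inr j)))).mul_const (-Complex.I / 2))
    refine (this.congr_of_eventuallyEq (Eventually.of_forall fun s => ?_)).congr_deriv ?_
    · simp
    · simp only [yVar, yNu, yMu, Sum.elim_inl, yco_inl, zero_mul, add_zero, Complex.ofReal_zero]
      push_cast
      rw [h8, h9]
      simp only [map_mul, map_sub, map_add, Complex.conj_conj, Complex.conj_ofReal, map_div₀,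
        map_neg, Complex.conj_I, map_ofNat, map_inv₀] at h1 ⊢
      generalize (t / (‖t‖ : ℂ)) = κ at *
      generalize (conj t / (‖t‖ : ℂ)) = κ' at *
      generalize conj τ = τ' at *
      generalize conj V = V' at *
      generalize ((Real.sqrt τ.im : ℝ) : ℂ)⁻¹ = w' at *
      generalize conj (A (Sum.inl j)) = a' at *
      generalize conj (A (Sum.inr j)) = b' at *
      generalize A (Sum.inl j) = a at *
      generalize A (Sum.inr j) = b at *
      have h10 : ∀ x y z : ℂ, x / (y * z) = x * (y⁻¹ * z⁻¹) := fun x y z => by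
        rw [div_eq_mul_inv, mul_inv]
      simp only [h10]
      generalize ((τ.im : ℝ) : ℂ)⁻¹ = v' at *
      generalize ((τ.im : ℝ) : ℂ) = v at *
      clear this h8 h9
      grind
  · simp only [yco_inr]
    have := (hasDerivAt_sqrt_im_inv hτ V).mul
      ((((hasDerivAt_affine τ V).mul_const
        (conj (A (Sum.inl j)) + (t / ‖t‖) * A (Sum.inl j))).const_sub
          (conj (A (Sum.inr j)) + (t / ‖t‖) * A (Sum.inr j))).mul_const (Complex.I / 2))
    refine (this.congr_of_eventuallyEq (Eventually.of_forall fun s => ?_)).congr_deriv ?_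
    · simp
    · simp only [yVar, yNu, yMu, Sum.elim_inr, yco_inr, zero_mul, add_zero, Complex.ofReal_zero]
      push_cast
      rw [h8, h9]
      simp only [map_mul, map_sub, map_add, Complex.conj_conj, Complex.conj_ofReal, map_div₀,
        map_neg, Complex.conj_I, map_ofNat, map_inv₀] at h1 ⊢
      generalize (t / (‖t‖ : ℂ)) = κ at *
      generalize (conj t / (‖t‖ : ℂ)) = κ' at *
      generalize conj τ = τ' at *
      generalize conj V = V' at *
      generalize ((Real.sqrt τ.im : ℝ) : ℂ)⁻¹ = w' at *
      generalize conj (A (Sum.inl j)) = a' at *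
      generalize conj (A (Sum.inr j)) = b' at *
      generalize A (Sum.inl j) = a at *
      generalize A (Sum.inr j) = b at *
      have h10 : ∀ x y z : ℂ, x / (y * z) = x * (y⁻¹ * z⁻¹) := fun x y z => by
        rw [div_eq_mul_inv, mul_inv]
      simp only [h10]
      generalize ((τ.im : ℝ) : ℂ)⁻¹ = v' at *
      generalize ((τ.im : ℝ) : ℂ) = v at *
      clear this h8 h9
      grind

theorem yco_differentiableAt (hτ : τ ∈ teich) :
    DifferentiableAt ℝ (fun τ => (yco t τ : AC r →L[ℝ] AC r)) τ :=
  (yco_contDiffOn.contDiffAt (isOpen_teich.mem_nhds hτ)).differentiableAt (by simp)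

theorem fderiv_yco (hτ : τ ∈ teich) (ht : t ≠ 0) (V : ℂ) (A : AC r) :
    fderiv ℝ (fun τ' => yco t τ' A) τ V = yVar r t τ V (yco t τ A) := by
  have hd : DifferentiableAt ℝ (fun τ' => yco t τ' A) τ :=
    (yco_differentiableAt hτ).clm_apply (differentiableAt_const A)
  rw [← hd.lineDeriv_eq_fderiv]
  exact (hasDerivAt_pi.2 fun a => lineDeriv_yco hτ ht V A a).deriv

theorem sqrt_two_im (hτ : τ ∈ teich) : (((Real.sqrt (2 * τ.im))⁻¹ : ℝ) : ℂ) =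
    ((Real.sqrt 2)⁻¹ : ℝ) * ((Real.sqrt τ.im)⁻¹ : ℝ) := by
  rw [Real.sqrt_mul (by norm_num), mul_inv]; push_cast; rfl

theorem frameX_inl_inl (j i : Fin r) : frameX τ (Sum.inl j) (Sum.inl i) =
    (((Real.sqrt (2 * τ.im))⁻¹ : ℝ) : ℂ) * (if i = j then 1 else 0) := by
  simp [frameX, Pi.single_apply]

theorem frameX_inl_inr (j i : Fin r) : frameX τ (Sum.inl j) (Sum.inr i) =
    (((Real.sqrt (2 * τ.im))⁻¹ : ℝ) : ℂ) * (if i = j then τ else 0) := by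
  simp [frameX, Pi.single_apply]

theorem frameX_inr_inl (j i : Fin r) : frameX τ (Sum.inr j) (Sum.inl i) =
    (((Real.sqrt (2 * τ.im))⁻¹ : ℝ) : ℂ) * (if i = j then Complex.I else 0) := by
  simp [frameX, Pi.single_apply]

theorem frameX_inr_inr (j i : Fin r) : frameX τ (Sum.inr j) (Sum.inr i) =
    (((Real.sqrt (2 * τ.im))⁻¹ : ℝ) : ℂ) * (if i = j then Complex.I * τ else 0) := by
  simp [frameX, Pi.single_apply]

theorem coordZ_eq_sum (ht : t ≠ 0) (hτ : τ ∈ teich) (A : AC r) (a : Idx r) :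
    coordZ τ t A a = ∑ b, conj (yco t τ (frameX τ a) b) * yco t τ A b := by
  have hn : ‖t‖ ≠ 0 := by simpa using ht
  rw [coordZ, coordP, coordQ, omegaT_eq ht hτ, omegaT_eq ht hτ, yco_IT ht hτ]
  have h1 : ∑ b, conj (yco t τ A b) * (Complex.I • yco t τ (frameX τ a)) b =
      Complex.I * conj (∑ b, conj (yco t τ (frameX τ a) b) * yco t τ A b) := by
    simp only [map_sum, map_mul, Complex.conj_conj, Finset.mul_sum, Pi.smul_apply, smul_eq_mul]
    exact Finset.sum_congr rfl fun b _ => by ring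
  rw [h1]
  generalize ∑ b, conj (yco t τ (frameX τ a) b) * yco t τ A b = w
  rw [mul_div_cancel_left₀ _ hn, mul_div_cancel_left₀ _ hn]
  apply Complex.ext <;> simp

theorem yco_frameX_inl (ht : t ≠ 0) (hτ : τ ∈ teich) (j : Fin r) (b : Idx r) :
    yco t τ (frameX τ (Sum.inl j)) b = ((Real.sqrt 2)⁻¹ : ℝ) *
      (if b = Sum.inl j ∨ b = Sum.inr j then 1 else 0) := by
  have h2 := sqrt_im_mul_self hτ
  have h3 := sqrt_im_mul_inv hτ
  have h4 := Complex.I_mul_I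
  rcases b with i | i
  · rw [yco_inl, frameX_inl_inl, frameX_inl_inr, sqrt_two_im hτ]
    by_cases h : i = j
    · simp only [h, if_true, true_or, map_mul, Complex.conj_ofReal, map_one]
      generalize conj (t / (‖t‖ : ℂ)) = κ at *
      generalize conj τ = τ' at *
      generalize ((Real.sqrt τ.im : ℝ) : ℂ) = w at *
      generalize (((Real.sqrt τ.im)⁻¹ : ℝ) : ℂ) = w' at *
      generalize (((Real.sqrt 2)⁻¹ : ℝ) : ℂ) = q at *
      grind
    · simp [h]
  · rw [yco_inr, frameX_inl_inl, frameX_inl_inr, sqrt_two_im hτ]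
    by_cases h : i = j
    · simp only [h, if_true, or_true, map_mul, Complex.conj_ofReal, map_one]
      generalize (t / (‖t‖ : ℂ)) = κ at *
      generalize conj τ = τ' at *
      generalize ((Real.sqrt τ.im : ℝ) : ℂ) = w at *
      generalize (((Real.sqrt τ.im)⁻¹ : ℝ) : ℂ) = w' at *
      generalize (((Real.sqrt 2)⁻¹ : ℝ) : ℂ) = q at *
      grind
    · simp [h]

theorem yco_frameX_inr (ht : t ≠ 0) (hτ : τ ∈ teich) (j : Fin r) (b : Idx r) :
    yco t τ (frameX τ (Sum.inr j)) b = ((Real.sqrt 2)⁻¹ : ℝ) *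
      (if b = Sum.inl j then Complex.I else if b = Sum.inr j then -Complex.I else 0) := by
  have h2 := sqrt_im_mul_self hτ
  have h3 := sqrt_im_mul_inv hτ
  have h4 := Complex.I_mul_I
  rcases b with i | i
  · rw [yco_inl, frameX_inr_inl, frameX_inr_inr, sqrt_two_im hτ]
    by_cases h : i = j
    · simp only [h, if_true, map_mul, Complex.conj_ofReal, Complex.conj_I]
      generalize conj (t / (‖t‖ : ℂ)) = κ at *
      generalize conj τ = τ' at *
      generalize ((Real.sqrt τ.im : ℝ) : ℂ) = w at *
      generalize (((Real.sqrt τ.im)⁻¹ : ℝ) : ℂ) = w' at *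
      generalize (((Real.sqrt 2)⁻¹ : ℝ) : ℂ) = q at *
      grind
    · simp [h]
  · rw [yco_inr, frameX_inr_inl, frameX_inr_inr, sqrt_two_im hτ]
    by_cases h : i = j
    · simp only [h, if_true, map_mul, Complex.conj_ofReal, Complex.conj_I, reduceCtorEq, if_false]
      generalize (t / (‖t‖ : ℂ)) = κ at *
      generalize conj τ = τ' at *
      generalize ((Real.sqrt τ.im : ℝ) : ℂ) = w at *
      generalize (((Real.sqrt τ.im)⁻¹ : ℝ) : ℂ) = w' at *
      generalize (((Real.sqrt 2)⁻¹ : ℝ) : ℂ) = q at *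
      grind
    · simp [h]

theorem coordZ_inl (ht : t ≠ 0) (hτ : τ ∈ teich) (A : AC r) (j : Fin r) :
    coordZ τ t A (Sum.inl j) = ((Real.sqrt 2)⁻¹ : ℝ) *
      (yco t τ A (Sum.inl j) + yco t τ A (Sum.inr j)) := by
  rw [coordZ_eq_sum ht hτ, Fintype.sum_sum_type]
  simp [yco_frameX_inl ht hτ, apply_ite]; ring

theorem coordZ_inr (ht : t ≠ 0) (hτ : τ ∈ teich) (A : AC r) (j : Fin r) :
    coordZ τ t A (Sum.inr j) = ((Real.sqrt 2)⁻¹ : ℝ) * Complex.I *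
      (yco t τ A (Sum.inr j) - yco t τ A (Sum.inl j)) := by
  rw [coordZ_eq_sum ht hτ, Fintype.sum_sum_type]
  simp [yco_frameX_inr ht hτ, apply_ite]; ring

end formulas
end GenusOne

end

noncomputable section
namespace GenusOne
open Filter

section formulas
open ComplexConjugate

variable {r : ℕ} {t τ : ℂ}

/-- Holomorphic sections in the coordinates `yco`, for the weight `exp (-c |y|² / 4)`. -/
def IsHol (c : ℝ) (f : AC r → ℂ) : Prop :=
  Differentiable ℝ f ∧ ∀ X y, fderiv ℝ f y X + Complex.I * fderiv ℝ f y (Complex.I • X) +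
    c / 2 * (∑ a, y a * conj (X a)) * f y = 0

/-- The covariant derivative of type (1,0) in the coordinates `yco`. -/
def dHol (c : ℝ) (a : Idx r) (f : AC r → ℂ) (y : AC r) : ℂ :=
  (fderiv ℝ f y (Pi.single a 1) - Complex.I * fderiv ℝ f y (Pi.single a Complex.I)) / 2
    - c / 4 * conj (y a) * f y

theorem fderiv_comp_yco {f : AC r → ℂ} (hf : Differentiable ℝ f) (A X : AC r) :
    fderiv ℝ (fun A => f (yco t τ A)) A X = fderiv ℝ f (yco t τ A) (yco t τ X) := by
  have : HasFDerivAt (fun A => f (yco t τ A)) ((fderiv ℝ f (yco t τ A)).comp (yco t τ)) A :=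
    (hf (yco t τ A)).hasFDerivAt.comp A (yco t τ).hasFDerivAt
  rw [this.fderiv]; rfl

theorem sum_conj_smul (y X : AC r) : (∑ a, conj (y a) * (Complex.I • X) a) =
    Complex.I * ∑ a, conj (y a) * X a := by
  rw [Finset.mul_sum]
  exact Finset.sum_congr rfl fun a _ => by simp; ring

theorem nablaT01_comp_yco (ht : t ≠ 0) (hτ : τ ∈ teich) {f : AC r → ℂ} (hf : Differentiable ℝ f)
    (A X : AC r) : nablaT01 τ t X (fun A => f (yco t τ A)) A =
      (fderiv ℝ f (yco t τ A) (yco t τ X) + Complex.I * fderiv ℝ f (yco t τ A) (Complex.I • yco t τ X)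
        + ‖t‖ / 2 * (∑ a, yco t τ A a * conj (yco t τ X a)) * f (yco t τ A)) / 2 := by
  have e : ∑ a, yco t τ A a * conj (yco t τ X a) = conj (∑ a, conj (yco t τ A a) * yco t τ X a) := by
    simp only [map_sum, map_mul, Complex.conj_conj]
  rw [nablaT01, nablaT, nablaT, fderiv_comp_yco hf, fderiv_comp_yco hf, omegaT_eq ht hτ,
    omegaT_eq ht hτ, yco_IT ht hτ, sum_conj_smul, e]
  generalize ∑ a, conj (yco t τ A a) * yco t τ X a = S
  have : conj S = -Complex.I * ((S.im : ℂ) + Complex.I * ((Complex.I * S).im : ℂ)) := by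
    apply Complex.ext <;> simp
  rw [this]
  push_cast
  ring

theorem sum_mul_basis (L : AC r →L[ℝ] ℂ) (X : AC r) :
    L X - Complex.I * L (Complex.I • X) =
      ∑ a, X a * (L (Pi.single a 1) - Complex.I * L (Pi.single a Complex.I)) := by
  have h1 : ∀ X : AC r, L X = ∑ a, ((X a).re * L (Pi.single a 1) + (X a).im * L (Pi.single a Complex.I)) := by
    intro X
    have : X = ∑ a, ((X a).re • (Pi.single a 1 : AC r) + (X a).im • (Pi.single a Complex.I : AC r)) := by
      ext b
      simp [Finset.sum_apply, Pi.single_apply, Finset.sum_add_distrib]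
    conv_lhs => rw [this]
    rw [map_sum]
    exact Finset.sum_congr rfl fun a _ => by rw [map_add, map_smul, map_smul]; simp
  rw [h1 X, h1 (Complex.I • X), Finset.mul_sum, ← Finset.sum_sub_distrib]
  refine Finset.sum_congr rfl fun a _ => ?_
  generalize L (Pi.single a 1) = u
  generalize L (Pi.single a Complex.I) = v
  have h := Complex.re_add_im (X a)
  have := Complex.I_mul_I
  simp
  linear_combination (u - Complex.I * v) * h + (X a).im * v * this

theorem nablaT10_comp_yco (ht : t ≠ 0) (hτ : τ ∈ teich) {f : AC r → ℂ} (hf : Differentiable ℝ f)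
    (A X : AC r) : nablaT10 τ t X (fun A => f (yco t τ A)) A =
      ∑ a, yco t τ X a * dHol ‖t‖ a f (yco t τ A) := by
  rw [nablaT10, nablaT, nablaT, fderiv_comp_yco hf, fderiv_comp_yco hf, omegaT_eq ht hτ,
    omegaT_eq ht hτ, yco_IT ht hτ, sum_conj_smul]
  have h := sum_mul_basis (fderiv ℝ f (yco t τ A)) (yco t τ X)
  have h2 : ∑ a, yco t τ X a * dHol ‖t‖ a f (yco t τ A) =
      (∑ a, yco t τ X a * (fderiv ℝ f (yco t τ A) (Pi.single a 1) -
        Complex.I * fderiv ℝ f (yco t τ A) (Pi.single a Complex.I))) / 2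
      - ‖t‖ / 4 * (∑ a, conj (yco t τ A a) * yco t τ X a) * f (yco t τ A) := by
    rw [Finset.sum_div, Finset.mul_sum, Finset.sum_mul, ← Finset.sum_sub_distrib]
    exact Finset.sum_congr rfl fun a _ => by rw [dHol]; ring
  rw [h2, ← h]
  generalize ∑ a, conj (yco t τ A a) * yco t τ X a = S
  have : S = Complex.I * ((S.im : ℂ) - Complex.I * ((Complex.I * S).im : ℂ)) := by
    apply Complex.ext <;> simp
  conv_rhs => rw [this]
  push_cast
  ring

theorem isHolomorphic_comp_yco (ht : t ≠ 0) (hτ : τ ∈ teich) {f : AC r → ℂ} :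
    IsHolomorphic τ t (fun A => f (yco t τ A)) ↔ IsHol ‖t‖ f := by
  constructor
  · intro h
    have hf : Differentiable ℝ f := by
      have : f = (fun A => f (yco t τ A)) ∘ (yinv t τ) := by
        ext y; simp [yco_yinv ht hτ]
      rw [this]
      exact h.1.comp (yinv t τ).differentiable
    refine ⟨hf, fun X y => ?_⟩
    have := h.2 (yinv t τ X) (yinv t τ y)
    rw [nablaT01_comp_yco ht hτ hf, yco_yinv ht hτ, yco_yinv ht hτ] at this
    simpa using this
  · intro h
    refine ⟨h.1.comp (yco t τ).differentiable, fun X A => ?_⟩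
    rw [nablaT01_comp_yco ht hτ h.1, h.2]; simp

/-! ### The metrics -/

/-- The inverse of `metric0`. -/
def metricInv (r : ℕ) (τ : ℂ) : Matrix (Idx r) (Idx r) ℝ :=
  Matrix.fromBlocks ((1 / τ.im) • 1) ((τ.re / τ.im) • 1) ((τ.re / τ.im) • 1)
    ((Complex.normSq τ / τ.im) • 1)

theorem metric0_eq (r : ℕ) (τ : ℂ) : metric0 r τ =
    Matrix.fromBlocks ((Complex.normSq τ / τ.im) • 1) ((-(τ.re / τ.im)) • 1) ((-(τ.re / τ.im)) • 1)
    ((1 / τ.im) • 1) := by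
  ext (i | i) (j | j) <;>
  · by_cases h : i = j
    · subst h
      simp [metric0, omega, basis0, hodge, Pi.single_apply, Matrix.one_apply]
      try ring
    · simp [metric0, omega, basis0, hodge, Pi.single_apply, Matrix.one_apply, h, Ne.symm h]

theorem metric0_inv (hτ : τ ∈ teich) : (metric0 r τ)⁻¹ = metricInv r τ := by
  apply Matrix.inv_eq_right_inv
  have h : τ.im ≠ 0 := ne_of_gt hτ
  rw [metric0_eq, metricInv, Matrix.fromBlocks_multiply, ← Matrix.fromBlocks_one]
  congr 1 <;>
  · simp only [Matrix.smul_mul, Matrix.mul_smul, mul_one, smul_smul, ← add_smul]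
    first
    | (refine (congrArg (· • (1 : Matrix (Fin r) (Fin r) ℝ)) (?_ : _ = (1 : ℝ))).trans (one_smul ℝ _); rw [Complex.normSq_apply]; field_simp; ring)
    | (refine (congrArg (· • (1 : Matrix (Fin r) (Fin r) ℝ)) (?_ : _ = (0 : ℝ))).trans (zero_smul ℝ _); field_simp; ring)

theorem omegaT_IT (ht : t ≠ 0) (A B : AC r) :
    omegaT t A (IT τ t B) = ‖t‖ * (omegaC A (hodgeC τ (star B))).re := by
  have h0 := phase_mul_norm ht
  have h1 := phase_mul_conj ht
  have h2 : IT τ t B = conj (t / ‖t‖) • hodgeC τ (star B) := by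
    ext (j | j)
    · rw [IT_inl ht]; simp [hodgeC, Pi.star_apply, RCLike.star_def]
    · rw [IT_inr ht, Complex.mul_conj]; simp [hodgeC, Pi.star_apply, RCLike.star_def]
  have h3 : omegaC A (conj (t / ‖t‖) • hodgeC τ (star B)) =
      conj (t / ‖t‖) * omegaC A (hodgeC τ (star B)) := by
    simp only [omegaC, Finset.mul_sum, Pi.smul_apply, smul_eq_mul]
    exact Finset.sum_congr rfl fun _ _ => by ring
  rw [omegaT, h2, h3, ← Complex.re_ofReal_mul]
  congr 1
  calc t * (conj (t / ‖t‖) * omegaC A (hodgeC τ (star B)))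
      = t / ‖t‖ * ‖t‖ * (conj (t / ‖t‖) * omegaC A (hodgeC τ (star B))) := by rw [h0]
    _ = (t / ‖t‖ * conj (t / ‖t‖)) * (‖t‖ * omegaC A (hodgeC τ (star B))) := by ring
    _ = _ := by rw [h1, one_mul]

theorem metricC_eq (ht : t ≠ 0) : metricC r τ t =
    Matrix.fromBlocks (metric0 r τ) 0 0 (metric0 r τ) := by
  have hn : ‖t‖ ≠ 0 := by simpa using ht
  ext a b
  have e : ∀ a b : Idx r ⊕ Idx r, metricC r τ t a b = (omegaC (basisC a) (hodgeC τ (star (basisC b)))).re := by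
    intro a b
    rw [metricC, Matrix.of_apply, omegaT_IT ht, mul_div_cancel_left₀ _ hn]
  rw [e, metric0_eq]
  rcases a with (i | i) | (i | i) <;> rcases b with (j | j) | (j | j) <;>
  · by_cases h : i = j
    · subst h
      simp [omegaC, basisC, hodgeC, Pi.single_apply, Pi.star_apply, RCLike.star_def,
        apply_ite, Finset.sum_ite_eq, Complex.div_re, Complex.div_im, Complex.normSq_apply]
      try (field_simp)
      try ring
    · simp [omegaC, basisC, hodgeC, Pi.single_apply, Pi.star_apply, RCLike.star_def,
        apply_ite, Finset.sum_ite_eq, h, Ne.symm h, Matrix.one_apply]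

theorem metricC_inv (ht : t ≠ 0) (hτ : τ ∈ teich) : (metricC r τ t)⁻¹ =
    Matrix.fromBlocks (metricInv r τ) 0 0 (metricInv r τ) := by
  apply Matrix.inv_eq_right_inv
  have h : metric0 r τ * metricInv r τ = 1 := by
    have h : τ.im ≠ 0 := ne_of_gt hτ
    rw [metric0_eq, metricInv, Matrix.fromBlocks_multiply, ← Matrix.fromBlocks_one]
    congr 1 <;>
    · simp only [Matrix.smul_mul, Matrix.mul_smul, mul_one, smul_smul, ← add_smul]
      first
      | (refine (congrArg (· • (1 : Matrix (Fin r) (Fin r) ℝ)) (?_ : _ = (1 : ℝ))).trans (one_smul ℝ _); rw [Complex.normSq_apply]; field_simp; ring)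
      | (refine (congrArg (· • (1 : Matrix (Fin r) (Fin r) ℝ)) (?_ : _ = (0 : ℝ))).trans (zero_smul ℝ _); field_simp; ring)
  rw [metricC_eq ht, Matrix.fromBlocks_multiply, ← Matrix.fromBlocks_one]
  simp [h]

/-- The components of `G0`. -/
def gVar (r : ℕ) (V τ : ℂ) : Matrix (Idx r) (Idx r) ℝ :=
  Matrix.fromBlocks ((V.im / τ.im ^ 2) • 1) (((τ.re * V.im - τ.im * V.re) / τ.im ^ 2) • 1)
    (((τ.re * V.im - τ.im * V.re) / τ.im ^ 2) • 1)
    (((Complex.normSq τ * V.im - 2 * τ.im * (τ.re * V.re + τ.im * V.im)) / τ.im ^ 2) • 1)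

theorem fderiv_metricInv (hτ : τ ∈ teich) (V : ℂ) (a b : Idx r) :
    fderiv ℝ (fun τ' => metricInv r τ' a b) τ V = -gVar r V τ a b := by
  have h : τ.im ≠ 0 := ne_of_gt hτ
  have hre : HasFDerivAt (fun τ : ℂ => τ.re) Complex.reCLM τ := Complex.reCLM.hasFDerivAt
  have him : HasFDerivAt (fun τ : ℂ => τ.im) Complex.imCLM τ := Complex.imCLM.hasFDerivAt
  have hinv : HasFDerivAt (fun τ : ℂ => (τ.im)⁻¹) (-((τ.im ^ 2)⁻¹) • Complex.imCLM) τ :=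
    (hasDerivAt_inv h).comp_hasFDerivAt τ him
  have h1 := hre.mul hinv
  have h2 := ((hre.mul hre).add (him.mul him)).mul hinv
  rcases a with i | i <;> rcases b with j | j
  · simp only [metricInv, gVar, Matrix.fromBlocks_apply₁₁, Matrix.smul_apply, smul_eq_mul, one_div]
    refine (DFunLike.congr_fun (HasFDerivAt.fderiv (hinv.mul_const ((1 : Matrix (Fin r) (Fin r) ℝ) i j))) V).trans ?_
    simp; field_simp
  · simp only [metricInv, gVar, Matrix.fromBlocks_apply₁₂, Matrix.smul_apply, smul_eq_mul, div_eq_mul_inv]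
    refine (DFunLike.congr_fun (HasFDerivAt.fderiv (h1.mul_const ((1 : Matrix (Fin r) (Fin r) ℝ) i j))) V).trans ?_
    simp; field_simp; ring
  · simp only [metricInv, gVar, Matrix.fromBlocks_apply₂₁, Matrix.smul_apply, smul_eq_mul, div_eq_mul_inv]
    refine (DFunLike.congr_fun (HasFDerivAt.fderiv (h1.mul_const ((1 : Matrix (Fin r) (Fin r) ℝ) i j))) V).trans ?_
    simp; field_simp; ring
  · simp only [metricInv, gVar, Matrix.fromBlocks_apply₂₂, Matrix.smul_apply, smul_eq_mul,
      div_eq_mul_inv, Complex.normSq_apply]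
    refine (DFunLike.congr_fun (HasFDerivAt.fderiv (h2.mul_const ((1 : Matrix (Fin r) (Fin r) ℝ) i j))) V).trans ?_
    simp; field_simp; ring

theorem G0_eq (hτ : τ ∈ teich) (V : ℂ) (a b : Idx r) : G0 r V τ a b = gVar r V τ a b := by
  rw [G0, ← neg_neg (gVar r V τ a b), ← fderiv_metricInv hτ]
  congr 2
  apply Filter.EventuallyEq.fderiv_eq
  filter_upwards [isOpen_teich.mem_nhds hτ] with τ' h
  rw [metric0_inv h]

theorem GC_eq (ht : t ≠ 0) (hτ : τ ∈ teich) (V : ℂ) (a b : Idx r ⊕ Idx r) :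
    GC r t V τ a b = Matrix.fromBlocks (gVar r V τ) 0 0 (gVar r V τ) a b := by
  have e : fderiv ℝ (fun τ' => (metricC r τ' t)⁻¹ a b) τ =
      fderiv ℝ (fun τ' => Matrix.fromBlocks (metricInv r τ') 0 0 (metricInv r τ') a b) τ := by
    apply Filter.EventuallyEq.fderiv_eq
    filter_upwards [isOpen_teich.mem_nhds hτ] with τ' h
    rw [metricC_inv ht h]
  rw [GC, e]
  rcases a with a | a <;> rcases b with b | b
  · simp only [Matrix.fromBlocks_apply₁₁]; rw [fderiv_metricInv hτ, neg_neg]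
  · simp
  · simp
  · simp only [Matrix.fromBlocks_apply₂₂]; rw [fderiv_metricInv hτ, neg_neg]

end formulas
end GenusOne

end

noncomputable section
namespace GenusOne
open Filter

section formulas
open ComplexConjugate

variable {r : ℕ} {t τ : ℂ}

theorem contDiff_fderiv_const {E F : Type*} [NormedAddCommGroup E] [NormedSpace ℝ E]
    [NormedAddCommGroup F] [NormedSpace ℝ F] {f : E → F} (hf : ContDiff ℝ ∞ f) (v : E) :
    ContDiff ℝ ∞ (fun x => fderiv ℝ f x v) :=
  (hf.fderiv_right (m := ∞) (by simp)).clm_apply contDiff_const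

theorem contDiff_conj_apply (a : Idx r) : ContDiff ℝ ∞ (fun y : AC r => conj (y a)) :=
  contDiff_conj'.comp (contDiff_apply ℝ ℂ a)

theorem dHol_contDiff {c : ℝ} {f : AC r → ℂ} (hf : ContDiff ℝ ∞ f) (a : Idx r) :
    ContDiff ℝ ∞ (dHol c a f) := by
  unfold dHol
  exact (((contDiff_fderiv_const hf _).sub (contDiff_const.mul (contDiff_fderiv_const hf _))).div_const _).sub
    ((contDiff_const.mul (contDiff_conj_apply a)).mul hf)

theorem dHol_sum {c : ℝ} {ι : Type*} (s : Finset ι) (k : ι → ℂ) {h : ι → AC r → ℂ}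
    (hh : ∀ i, Differentiable ℝ (h i)) (a : Idx r) (y : AC r) :
    dHol c a (fun y => ∑ i ∈ s, k i * h i y) y = ∑ i ∈ s, k i * dHol c a (h i) y := by
  have e : fderiv ℝ (fun y => ∑ i ∈ s, k i * h i y) y = ∑ i ∈ s, k i • fderiv ℝ (h i) y := by
    rw [fderiv_fun_sum fun i _ => (hh i y).const_mul _]
    exact Finset.sum_congr rfl fun i _ => fderiv_const_mul (hh i y) _
  simp only [dHol, e, ContinuousLinearMap.sum_apply, ContinuousLinearMap.smul_apply, smul_eq_mul,
    Finset.mul_sum, ← Finset.sum_sub_distrib, Finset.sum_div]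
  exact Finset.sum_congr rfl fun i _ => by ring

theorem yco_single_inl_inl (j i : Fin r) (z : ℂ) : yco t τ (Pi.single (Sum.inl j) z) (Sum.inl i) =
    if i = j then ((Real.sqrt τ.im)⁻¹ : ℝ) * conj τ * (z - conj (t / ‖t‖) * conj z) * (Complex.I / 2) else 0 := by
  rw [yco_inl]; by_cases h : i = j
  · simp [h]; ring
  · simp [h]

theorem yco_single_inl_inr (j i : Fin r) (z : ℂ) : yco t τ (Pi.single (Sum.inl j) z) (Sum.inr i) =
    if i = j then -((Real.sqrt τ.im)⁻¹ : ℝ) * τ * (conj z + (t / ‖t‖) * z) * (Complex.I / 2) else 0 := by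
  rw [yco_inr]; by_cases h : i = j
  · simp [h]; ring
  · simp [h]

theorem yco_single_inr_inl (j i : Fin r) (z : ℂ) : yco t τ (Pi.single (Sum.inr j) z) (Sum.inl i) =
    if i = j then -((Real.sqrt τ.im)⁻¹ : ℝ) * (z - conj (t / ‖t‖) * conj z) * (Complex.I / 2) else 0 := by
  rw [yco_inl]; by_cases h : i = j
  · simp [h]; ring
  · simp [h]

theorem yco_single_inr_inr (j i : Fin r) (z : ℂ) : yco t τ (Pi.single (Sum.inr j) z) (Sum.inr i) =
    if i = j then ((Real.sqrt τ.im)⁻¹ : ℝ) * (conj z + (t / ‖t‖) * z) * (Complex.I / 2) else 0 := by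
  rw [yco_inr]; by_cases h : i = j
  · simp [h]; ring
  · simp [h]

theorem sum_gVar (V : ℂ) (H : Idx r → Idx r → ℂ) : ∑ a, ∑ b, (gVar r V τ a b : ℂ) * H a b =
    ∑ j : Fin r, ((V.im / τ.im ^ 2 : ℝ) * H (Sum.inl j) (Sum.inl j)
      + ((τ.re * V.im - τ.im * V.re) / τ.im ^ 2 : ℝ) *
        (H (Sum.inl j) (Sum.inr j) + H (Sum.inr j) (Sum.inl j))
      + ((Complex.normSq τ * V.im - 2 * τ.im * (τ.re * V.re + τ.im * V.im)) / τ.im ^ 2 : ℝ) *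
        H (Sum.inr j) (Sum.inr j)) := by
  simp only [Fintype.sum_sum_type, gVar, Matrix.fromBlocks_apply₁₁, Matrix.fromBlocks_apply₁₂,
    Matrix.fromBlocks_apply₂₁, Matrix.fromBlocks_apply₂₂, Matrix.smul_apply, Matrix.one_apply,
    ← Finset.sum_add_distrib]
  refine Finset.sum_congr rfl fun j _ => ?_
  simp only [smul_eq_mul, mul_ite, mul_one, mul_zero, apply_ite Complex.ofReal, Complex.ofReal_zero,
    ite_mul, zero_mul, Finset.sum_add_distrib, Finset.sum_ite_eq, Finset.mem_univ, if_true]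
  ring

theorem gl_eq (V : ℂ) : ((V.im / τ.im ^ 2 : ℝ) : ℂ) =
    ((τ.im : ℂ)⁻¹) ^ 2 * ((V - conj V) * (-Complex.I / 2)) := by
  have h8 : (V.im : ℂ) = (V - conj V) * (-Complex.I / 2) := by
    apply Complex.ext <;> simp <;> ring
  push_cast; rw [h8]; ring

theorem gm_eq (V : ℂ) : (((τ.re * V.im - τ.im * V.re) / τ.im ^ 2 : ℝ) : ℂ) =
    ((τ.im : ℂ)⁻¹) ^ 2 * ((τ + conj τ) / 2 * ((V - conj V) * (-Complex.I / 2)) - τ.im * ((V + conj V) / 2)) := by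
  have h8 : (V.im : ℂ) = (V - conj V) * (-Complex.I / 2) := by
    apply Complex.ext <;> simp <;> ring
  have h9 : (V.re : ℂ) = (V + conj V) / 2 := by
    apply Complex.ext <;> simp
  have h5 : ((τ.re : ℝ) : ℂ) = (τ + conj τ) / 2 := by
    apply Complex.ext <;> simp
  push_cast; rw [h8, h9, h5]; ring

theorem gr_eq (V : ℂ) : (((Complex.normSq τ * V.im - 2 * τ.im * (τ.re * V.re + τ.im * V.im)) / τ.im ^ 2 : ℝ) : ℂ) =
    ((τ.im : ℂ)⁻¹) ^ 2 * (τ * conj τ * ((V - conj V) * (-Complex.I / 2))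
      - 2 * τ.im * ((τ + conj τ) / 2 * ((V + conj V) / 2) + τ.im * ((V - conj V) * (-Complex.I / 2)))) := by
  have h8 : (V.im : ℂ) = (V - conj V) * (-Complex.I / 2) := by
    apply Complex.ext <;> simp <;> ring
  have h9 : (V.re : ℂ) = (V + conj V) / 2 := by
    apply Complex.ext <;> simp
  have h5 : ((τ.re : ℝ) : ℂ) = (τ + conj τ) / 2 := by
    apply Complex.ext <;> simp
  rw [Complex.mul_conj]
  push_cast; rw [h8, h9, h5]; ring

/-- The contraction of the bivector `GC` with two type (1,0) forms, up to normalisation. -/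
theorem gC_contract_aux {i w w' z z' V V' : ℂ} (h2 : 2 * i * w ^ 2 = z - z') (h3 : w * w' = 1) (h4 : i * i = -1)
    (Q : ℂ → ℂ → ℂ) (hQ : ∀ x y, Q x y = (w' ^ 2) ^ 2 * ((V - V') * (-i / 2)) * (x * y) -
      (w' ^ 2) ^ 2 * ((z + z') / 2 * ((V - V') * (-i / 2)) - w ^ 2 * ((V + V') / 2)) * (x + y) +
      (w' ^ 2) ^ 2 * (z * z' * ((V - V') * (-i / 2)) -
        2 * w ^ 2 * ((z + z') / 2 * ((V + V') / 2) + w ^ 2 * ((V - V') * (-i / 2))))) :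
    Q z' z' = -2 * i * V' ∧ Q z z = 2 * i * V ∧ Q z z' = 0 := by
  obtain rfl : z = z' + 2 * i * w ^ 2 := by linear_combination -h2
  simp only [hQ]
  refine ⟨?_, ?_, ?_⟩
  · linear_combination (-2 * i * V') * ((w * w') ^ 3 + (w * w') ^ 2 + w * w' + 1) * h3
  · linear_combination (2 * i * V) * ((w * w') ^ 3 + (w * w') ^ 2 + w * w' + 1) * h3
  · linear_combination w' ^ 4 * (V - V') * i * w ^ 4 * h4

theorem gC_contract (ht : t ≠ 0) (hτ : τ ∈ teich) (V : ℂ) (c d : Idx r) :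
    ∑ a, ∑ b, (GC r t V τ a b : ℂ) * (yco t τ (basisC a) c * yco t τ (basisC b) d) =
      if c = d then 4 * yMu r t τ V c else 0 := by
  have e : ∑ a, ∑ b, (GC r t V τ a b : ℂ) * (yco t τ (basisC a) c * yco t τ (basisC b) d) =
      ∑ a, ∑ b, (gVar r V τ a b : ℂ) * (yco t τ (Pi.single a 1) c * yco t τ (Pi.single b 1) d)
      + ∑ a, ∑ b, (gVar r V τ a b : ℂ) *
        (yco t τ (Pi.single a Complex.I) c * yco t τ (Pi.single b Complex.I) d) := by
    simp only [GC_eq ht hτ]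
    rw [Fintype.sum_sum_type]
    congr 1
    · refine Finset.sum_congr rfl fun a _ => ?_
      rw [Fintype.sum_sum_type]; simp [basisC]
    · refine Finset.sum_congr rfl fun a _ => ?_
      rw [Fintype.sum_sum_type]; simp [basisC]
  rw [e, sum_gVar V fun a b => yco t τ (Pi.single a 1) c * yco t τ (Pi.single b 1) d,
    sum_gVar V fun a b => yco t τ (Pi.single a Complex.I) c * yco t τ (Pi.single b Complex.I) d, ← Finset.sum_add_distrib, gl_eq, gm_eq, gr_eq]
  have h1 := phase_mul_conj ht
  have h2 := sqrt_im_mul_self hτ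
  have h3 := sqrt_im_mul_inv hτ
  have h4 := Complex.I_mul_I
  have h6 : 2 * Complex.I * ((τ.im : ℝ) : ℂ) = τ - conj τ := by
    apply Complex.ext <;> simp <;> ring
  have h7 : ((τ.im : ℝ) : ℂ) * (((τ.im : ℝ) : ℂ))⁻¹ = 1 :=
    mul_inv_cancel₀ (by simpa using (show τ.im ≠ 0 from hτ.ne'))
  have h10 : ∀ x y z : ℂ, x / (y * z) = x * (y⁻¹ * z⁻¹) := fun x y z => by
    rw [div_eq_mul_inv, mul_inv]
  rcases c with i | i <;> rcases d with i' | i' <;>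
  · simp only [yco_single_inl_inl, yco_single_inl_inr, yco_single_inr_inl, yco_single_inr_inr,
      Sum.inl.injEq, Sum.inr.injEq, reduceCtorEq, if_false]
    by_cases hi : i = i'
    · subst hi
      rw [Finset.sum_eq_single i (fun j _ hj => by simp [Ne.symm hj]) (by simp)]
      simp only [if_true, yMu, Sum.elim_inl, Sum.elim_inr, h10]
      simp only [map_mul, map_sub, map_add, Complex.conj_conj, Complex.conj_ofReal, map_div₀,
        map_neg, Complex.conj_I, map_ofNat, map_inv₀, map_one] at h1 ⊢
      generalize (t / (‖t‖ : ℂ)) = κ at *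
      generalize (conj t / (‖t‖ : ℂ)) = κ' at *
      generalize conj τ = τ' at *
      generalize conj V = V' at *
      generalize (((Real.sqrt τ.im)⁻¹ : ℝ) : ℂ) = w' at *
      generalize ((Real.sqrt τ.im : ℝ) : ℂ) = w at *
      generalize ((τ.im : ℝ) : ℂ)⁻¹ = v' at *
      generalize ((τ.im : ℝ) : ℂ) = v at *
      generalize Complex.I = i at *
      clear e h10
      have h11 : v = w ^ 2 := by linear_combination (-i / 2) * h6 - (-i / 2) * h2 + (v - w ^ 2) * h4
      have h12 : v' = w' ^ 2 := by
        linear_combination (- v' * (w * w' + 1)) * h3 + w' ^ 2 * h7 - v' * w' ^ 2 * h11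
      clear h6 h7
      subst h12 h11
      obtain ⟨q1, q2, q3⟩ := gC_contract_aux (V := V) (V' := V') h2 h3 h4 _ fun _ _ => rfl
      first
        | linear_combination (w' * i / 2) ^ 2 * ((1 - κ') ^ 2 + (i + κ' * i) ^ 2) * q1 +
            (-2 * i * V' * w' ^ 2) * ((1 + κ') ^ 2 * i ^ 2 / 4 - κ') * h4
        | linear_combination -(w' * i / 2) ^ 2 * ((1 - κ') * (1 + κ) + (i + κ' * i) * (-i + κ * i)) * q3
        | linear_combination (w' * i / 2) ^ 2 * ((1 + κ) ^ 2 + (-i + κ * i) ^ 2) * q2 +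
            (2 * i * V * w' ^ 2) * ((1 - κ) ^ 2 * i ^ 2 / 4 + κ) * h4
    · refine (Finset.sum_eq_zero fun j _ => ?_).trans ?_
      · by_cases hj : i = j
        · subst hj; simp [hi, Ne.symm hi]
        · simp [hj]
      · first | rfl | simp [hi]

theorem laplaceC_comp_yco (ht : t ≠ 0) (hτ : τ ∈ teich) (V : ℂ) {f : AC r → ℂ} (hf : ContDiff ℝ ∞ f)
    (A : AC r) : laplaceC t V τ (fun A => f (yco t τ A)) A =
      ∑ c, 4 * yMu r t τ V c * dHol ‖t‖ c (dHol ‖t‖ c f) (yco t τ A) := by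
  have hD : ∀ c, Differentiable ℝ (dHol ‖t‖ c f) := fun c => (dHol_contDiff hf c).differentiable (by simp)
  have e : ∀ b, nablaT10 τ t (basisC b) (fun A => f (yco t τ A)) =
      fun A => (fun y => ∑ d, yco t τ (basisC b) d * dHol ‖t‖ d f y) (yco t τ A) := fun b =>
    funext fun A => nablaT10_comp_yco ht hτ (hf.differentiable (by simp)) A _
  have e2 : ∀ a b, nablaT10 τ t (basisC a) (nablaT10 τ t (basisC b) (fun A => f (yco t τ A))) A =
      ∑ c, ∑ d, (yco t τ (basisC a) c * yco t τ (basisC b) d) * dHol ‖t‖ c (dHol ‖t‖ d f) (yco t τ A) := by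
    intro a b
    rw [e, nablaT10_comp_yco (f := fun y => ∑ d, yco t τ (basisC b) d * dHol ‖t‖ d f y) ht hτ]
    · refine Finset.sum_congr rfl fun c _ => ?_
      rw [dHol_sum _ _ hD, Finset.mul_sum]
      exact Finset.sum_congr rfl fun d _ => by ring
    · exact Differentiable.fun_sum fun d _ => (hD d).const_mul _
  simp only [laplaceC, e2, Finset.mul_sum]
  calc _ = ∑ a, ∑ c, ∑ d, ∑ b, (GC r t V τ a b : ℂ) * ((yco t τ (basisC a) c * yco t τ (basisC b) d) * dHol ‖t‖ c (dHol ‖t‖ d f) (yco t τ A)) := by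
        refine Finset.sum_congr rfl fun a _ => ?_
        rw [Finset.sum_comm]
        refine Finset.sum_congr rfl fun c _ => Finset.sum_comm
    _ = ∑ c, ∑ d, ∑ a, ∑ b, (GC r t V τ a b : ℂ) * ((yco t τ (basisC a) c * yco t τ (basisC b) d) * dHol ‖t‖ c (dHol ‖t‖ d f) (yco t τ A)) := by
        rw [Finset.sum_comm]
        refine Finset.sum_congr rfl fun c _ => Finset.sum_comm
    _ = ∑ c, ∑ d, (if c = d then 4 * yMu r t τ V c else 0) * dHol ‖t‖ c (dHol ‖t‖ d f) (yco t τ A) := by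
        refine Finset.sum_congr rfl fun c _ => Finset.sum_congr rfl fun d _ => ?_
        rw [← gC_contract ht hτ, Finset.sum_mul]
        refine Finset.sum_congr rfl fun a _ => ?_
        rw [Finset.sum_mul]
        exact Finset.sum_congr rfl fun b _ => by ring
    _ = _ := by simp [ite_mul]

/-! ### The Laplacians on `A0` -/

/-- The covariant derivative along the complex vector `∂_l + z ∂_r`. -/
def pDer (k : ℝ) (z : ℂ) (j : Fin r) (ψ : A0 r → ℂ) (u : A0 r) : ℂ :=
  nabla k (basis0 (Sum.inl j)) ψ u + z * nabla k (basis0 (Sum.inr j)) ψ u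

theorem nabla_add_smul (k : ℝ) (a b : ℝ) (X Y : A0 r) (ψ : A0 r → ℂ) (u : A0 r) :
    nabla k (a • X + b • Y) ψ u = a * nabla k X ψ u + b * nabla k Y ψ u := by
  have : omega u (a • X + b • Y) = a * omega u X + b * omega u Y := by
    simp only [omega, Finset.mul_sum, ← Finset.sum_add_distrib, Pi.add_apply, Pi.smul_apply, smul_eq_mul]
    exact Finset.sum_congr rfl fun _ _ => by ring
  simp only [nabla, this, map_add, map_smul]
  push_cast
  simp only [Complex.real_smul]
  ring

theorem hodge_basis0_inl (j : Fin r) : hodge τ (basis0 (Sum.inl j)) =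
    (τ.re / τ.im) • basis0 (Sum.inl j) + (Complex.normSq τ / τ.im) • basis0 (Sum.inr j) := by
  ext (i | i) <;> by_cases h : i = j <;> simp [hodge, basis0, h]

theorem hodge_basis0_inr (j : Fin r) : hodge τ (basis0 (Sum.inr j)) =
    (-1 / τ.im) • basis0 (Sum.inl j) + (-(τ.re / τ.im)) • basis0 (Sum.inr j) := by
  ext (i | i) <;> by_cases h : i = j <;> simp [hodge, basis0, h]
  ring

theorem nabla10_inl (hτ : τ ∈ teich) (k : ℝ) (j : Fin r) (ψ : A0 r → ℂ) (u : A0 r) :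
    nabla10 k τ (basis0 (Sum.inl j)) ψ u = -(Complex.I * τ / (2 * τ.im)) * pDer k (conj τ) j ψ u := by
  have h : (τ.im : ℂ) ≠ 0 := by simpa using ne_of_gt hτ
  have h2 := Complex.re_add_im τ
  have h4 := Complex.I_mul_I
  rw [nabla10, hodge_basis0_inl, nabla_add_smul, pDer]
  push_cast
  rw [← Complex.mul_conj]
  field_simp
  linear_combination (-Complex.I * nabla k (basis0 (Sum.inl j)) ψ u) * h2 - (nabla k (basis0 (Sum.inl j)) ψ u * τ.im) * (-h4)

theorem nabla01_inl (hτ : τ ∈ teich) (k : ℝ) (j : Fin r) (ψ : A0 r → ℂ) (u : A0 r) :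
    nabla01 k τ (basis0 (Sum.inl j)) ψ u = (Complex.I * conj τ / (2 * τ.im)) * pDer k τ j ψ u := by
  have h : (τ.im : ℂ) ≠ 0 := by simpa using ne_of_gt hτ
  have h2 : (τ.re : ℂ) - τ.im * Complex.I = conj τ := by apply Complex.ext <;> simp
  have h4 := Complex.I_mul_I
  rw [nabla01, hodge_basis0_inl, nabla_add_smul, pDer]
  push_cast
  rw [← Complex.mul_conj]
  field_simp
  linear_combination (Complex.I * nabla k (basis0 (Sum.inl j)) ψ u) * h2 - (nabla k (basis0 (Sum.inl j)) ψ u * τ.im) * (-h4)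

theorem nabla10_inr (hτ : τ ∈ teich) (k : ℝ) (j : Fin r) (ψ : A0 r → ℂ) (u : A0 r) :
    nabla10 k τ (basis0 (Sum.inr j)) ψ u = (Complex.I / (2 * τ.im)) * pDer k (conj τ) j ψ u := by
  have h : (τ.im : ℂ) ≠ 0 := by simpa using ne_of_gt hτ
  have h2 : (τ.re : ℂ) - τ.im * Complex.I = conj τ := by apply Complex.ext <;> simp
  have h4 := Complex.I_mul_I
  rw [nabla10, hodge_basis0_inr, nabla_add_smul, pDer, ← h2]
  push_cast
  field_simp
  linear_combination (nabla k (basis0 (Sum.inr j)) ψ u * τ.im) * (h4)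

theorem nabla01_inr (hτ : τ ∈ teich) (k : ℝ) (j : Fin r) (ψ : A0 r → ℂ) (u : A0 r) :
    nabla01 k τ (basis0 (Sum.inr j)) ψ u = -(Complex.I / (2 * τ.im)) * pDer k τ j ψ u := by
  have h : (τ.im : ℂ) ≠ 0 := by simpa using ne_of_gt hτ
  have h2 := Complex.re_add_im τ
  have h4 := Complex.I_mul_I
  rw [nabla01, hodge_basis0_inr, nabla_add_smul, pDer]
  push_cast
  simp
  field_simp
  linear_combination (-Complex.I * nabla k (basis0 (Sum.inr j)) ψ u) * h2 + (nabla k (basis0 (Sum.inr j)) ψ u * τ.im) * (h4)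

theorem nabla_const_mul (k : ℝ) (X : A0 r) (c : ℂ) {ψ : A0 r → ℂ} (hψ : Differentiable ℝ ψ) (u : A0 r) :
    nabla k X (fun u => c * ψ u) u = c * nabla k X ψ u := by
  rw [nabla, nabla, fderiv_const_mul (hψ u)]
  simp; ring

theorem pDer_const_mul (k : ℝ) (z : ℂ) (j : Fin r) (c : ℂ) {ψ : A0 r → ℂ} (hψ : Differentiable ℝ ψ)
    (u : A0 r) : pDer k z j (fun u => c * ψ u) u = c * pDer k z j ψ u := by
  rw [pDer, pDer, nabla_const_mul _ _ _ hψ, nabla_const_mul _ _ _ hψ]; ring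

theorem omega_contDiff (X : A0 r) : ContDiff ℝ ∞ (fun u : A0 r => omega u X) := by
  unfold omega
  exact ContDiff.sum fun j _ => ((contDiff_apply ℝ ℝ _).mul contDiff_const).sub
    ((contDiff_apply ℝ ℝ _).mul contDiff_const)

theorem nabla_contDiff (k : ℝ) (X : A0 r) {ψ : A0 r → ℂ} (hψ : ContDiff ℝ ∞ ψ) :
    ContDiff ℝ ∞ (nabla k X ψ) := by
  unfold nabla
  refine (contDiff_fderiv_const hψ X).sub ((contDiff_const.mul ?_).mul hψ)
  exact Complex.ofRealCLM.contDiff.comp (contDiff_const.mul (omega_contDiff X))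

theorem pDer_contDiff (k : ℝ) (z : ℂ) (j : Fin r) {ψ : A0 r → ℂ} (hψ : ContDiff ℝ ∞ ψ) :
    ContDiff ℝ ∞ (pDer k z j ψ) :=
  (nabla_contDiff k _ hψ).add (contDiff_const.mul (nabla_contDiff k _ hψ))

theorem laplaceG_eq (hτ : τ ∈ teich) (k : ℝ) (V : ℂ) {ψ : A0 r → ℂ} (hψ : ContDiff ℝ ∞ ψ) (u : A0 r) :
    laplaceG k V τ ψ u = -(Complex.I * V / (2 * τ.im ^ 2)) *
      ∑ j, pDer k (conj τ) j (pDer k (conj τ) j ψ) u := by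
  have hd : ∀ j : Fin r, Differentiable ℝ (pDer k (conj τ) j ψ) := fun j =>
    (pDer_contDiff k _ j hψ).differentiable (by simp)
  have e1 : ∀ j : Fin r, nabla10 k τ (basis0 (Sum.inl j)) ψ = fun u => _ := fun j =>
    funext fun u => nabla10_inl hτ k j ψ u
  have e2 : ∀ j : Fin r, nabla10 k τ (basis0 (Sum.inr j)) ψ = fun u => _ := fun j =>
    funext fun u => nabla10_inr hτ k j ψ u
  simp only [laplaceG, G0_eq hτ]
  rw [sum_gVar V fun a b => nabla10 k τ (basis0 a) (nabla10 k τ (basis0 b) ψ) u, Finset.mul_sum,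
    gl_eq, gm_eq, gr_eq]
  refine Finset.sum_congr rfl fun j _ => ?_
  simp only [e1, e2, nabla10_inl hτ, nabla10_inr hτ, pDer_const_mul _ _ _ _ (hd j)]
  have h4 := Complex.I_mul_I
  have h6 : 2 * Complex.I * ((τ.im : ℝ) : ℂ) = τ - conj τ := by
    apply Complex.ext <;> simp <;> ring
  have h7 : ((τ.im : ℝ) : ℂ) * (((τ.im : ℝ) : ℂ))⁻¹ = 1 :=
    mul_inv_cancel₀ (by simpa using (show τ.im ≠ 0 from hτ.ne'))
  have h10 : ∀ x y z : ℂ, x / (y * z) = x * (y⁻¹ * z⁻¹) := fun x y z => by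
    rw [div_eq_mul_inv, mul_inv]
  simp only [h10, inv_pow]
  rw [← inv_pow]
  generalize pDer k (conj τ) j (pDer k (conj τ) j ψ) u = q at *
  generalize conj τ = τ' at *
  generalize conj V = V' at *
  generalize ((τ.im : ℝ) : ℂ)⁻¹ = v' at *
  generalize ((τ.im : ℝ) : ℂ) = v at *
  clear e1 e2 h10 hd
  grind

theorem laplaceGbar_eq (hτ : τ ∈ teich) (k : ℝ) (V : ℂ) {ψ : A0 r → ℂ} (hψ : ContDiff ℝ ∞ ψ) (u : A0 r) :
    laplaceGbar k V τ ψ u = (Complex.I * conj V / (2 * τ.im ^ 2)) *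
      ∑ j, pDer k τ j (pDer k τ j ψ) u := by
  have hd : ∀ j : Fin r, Differentiable ℝ (pDer k τ j ψ) := fun j =>
    (pDer_contDiff k _ j hψ).differentiable (by simp)
  have e1 : ∀ j : Fin r, nabla01 k τ (basis0 (Sum.inl j)) ψ = fun u => _ := fun j =>
    funext fun u => nabla01_inl hτ k j ψ u
  have e2 : ∀ j : Fin r, nabla01 k τ (basis0 (Sum.inr j)) ψ = fun u => _ := fun j =>
    funext fun u => nabla01_inr hτ k j ψ u
  simp only [laplaceGbar, G0_eq hτ]
  rw [sum_gVar V fun a b => nabla01 k τ (basis0 a) (nabla01 k τ (basis0 b) ψ) u, Finset.mul_sum,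
    gl_eq, gm_eq, gr_eq]
  refine Finset.sum_congr rfl fun j _ => ?_
  simp only [e1, e2, nabla01_inl hτ, nabla01_inr hτ, pDer_const_mul _ _ _ _ (hd j)]
  have h4 := Complex.I_mul_I
  have h6 : 2 * Complex.I * ((τ.im : ℝ) : ℂ) = τ - conj τ := by
    apply Complex.ext <;> simp <;> ring
  have h7 : ((τ.im : ℝ) : ℂ) * (((τ.im : ℝ) : ℂ))⁻¹ = 1 :=
    mul_inv_cancel₀ (by simpa using (show τ.im ≠ 0 from hτ.ne'))
  have h10 : ∀ x y z : ℂ, x / (y * z) = x * (y⁻¹ * z⁻¹) := fun x y z => by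
    rw [div_eq_mul_inv, mul_inv]
  simp only [h10, inv_pow]
  rw [← inv_pow]
  generalize pDer k τ j (pDer k τ j ψ) u = q at *
  generalize conj τ = τ' at *
  generalize conj V = V' at *
  generalize ((τ.im : ℝ) : ℂ)⁻¹ = v' at *
  generalize ((τ.im : ℝ) : ℂ) = v at *
  clear e1 e2 h10 hd
  grind

end formulas
end GenusOne

end

noncomputable section
namespace GenusOne
open Filter

section formulas
open ComplexConjugate

variable {r : ℕ} {t τ : ℂ}

/-- The covariant derivative of type (0,1) in the coordinates `yco`, up to a factor. -/
def dBar (c : ℝ) (a : Idx r) (f : AC r → ℂ) (y : AC r) : ℂ :=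
  fderiv ℝ f y (Pi.single a 1) + Complex.I * fderiv ℝ f y (Pi.single a Complex.I) + c / 2 * y a * f y

theorem clm_eq_sum (L : AC r →L[ℝ] ℂ) (X : AC r) :
    L X = ∑ a, ((X a).re * L (Pi.single a 1) + (X a).im * L (Pi.single a Complex.I)) := by
  have : X = ∑ a, ((X a).re • (Pi.single a 1 : AC r) + (X a).im • (Pi.single a Complex.I : AC r)) := by
    ext b
    simp [Finset.sum_apply, Pi.single_apply, Finset.sum_add_distrib]
  conv_lhs => rw [this]
  rw [map_sum]
  exact Finset.sum_congr rfl fun a _ => by rw [map_add, map_smul, map_smul]; simp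

theorem sum_conj_mul_basis (L : AC r →L[ℝ] ℂ) (X : AC r) :
    L X + Complex.I * L (Complex.I • X) =
      ∑ a, conj (X a) * (L (Pi.single a 1) + Complex.I * L (Pi.single a Complex.I)) := by
  rw [clm_eq_sum L X, clm_eq_sum L (Complex.I • X), Finset.mul_sum, ← Finset.sum_add_distrib]
  refine Finset.sum_congr rfl fun a _ => ?_
  generalize L (Pi.single a 1) = u
  generalize L (Pi.single a Complex.I) = v
  have h : ((X a).re : ℂ) - (X a).im * Complex.I = conj (X a) := by
    apply Complex.ext <;> simp
  have := Complex.I_mul_I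
  simp
  linear_combination (u + Complex.I * v) * h + (X a).im * v * this

theorem isHol_iff (c : ℝ) (f : AC r → ℂ) : IsHol c f ↔ Differentiable ℝ f ∧ ∀ a y, dBar c a f y = 0 := by
  refine and_congr_right fun hf => ⟨fun h a y => ?_, fun h X y => ?_⟩
  · have := h (Pi.single a 1) y
    rw [← this, dBar, ← Pi.single_smul]
    congr 2
    · simp
    · rw [Finset.sum_eq_single a (fun b _ hb => by simp [hb]) (by simp)]; simp
  · rw [sum_conj_mul_basis, Finset.mul_sum, Finset.sum_mul, ← Finset.sum_add_distrib]
    refine Finset.sum_eq_zero fun a _ => ?_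
    have := h a y
    rw [dBar] at this
    linear_combination conj (X a) * this

theorem fderiv_fderiv_comm {f : AC r → ℂ} (hf : ContDiff ℝ ∞ f) (y v w : AC r) :
    fderiv ℝ (fun y => fderiv ℝ f y v) y w = fderiv ℝ (fun y => fderiv ℝ f y w) y v := by
  have h1 : DifferentiableAt ℝ (fderiv ℝ f) y :=
    ((hf.fderiv_right (m := ∞) (by simp)).differentiable (by simp)) y
  have h2 : ∀ v w, fderiv ℝ (fun y => fderiv ℝ f y v) y w = fderiv ℝ (fderiv ℝ f) y w v := by
    intro v w
    rw [fderiv_clm_apply h1 (differentiableAt_const v)]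
    simp
  rw [h2, h2]
  exact (hf.contDiffAt.isSymmSndFDerivAt (by simp; exact ENat.LEInfty.out)) _ _

theorem hasFDerivAt_conj_apply (a : Idx r) (y : AC r) : HasFDerivAt (fun y : AC r => conj (y a))
    (Complex.conjCLE.toContinuousLinearMap.comp (ContinuousLinearMap.proj a : AC r →L[ℝ] ℂ)) y :=
  (Complex.conjCLE.toContinuousLinearMap.comp (ContinuousLinearMap.proj a : AC r →L[ℝ] ℂ)).hasFDerivAt

theorem hasFDerivAt_coord (a : Idx r) (y : AC r) : HasFDerivAt (fun y : AC r => y a)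
    (ContinuousLinearMap.proj a : AC r →L[ℝ] ℂ) y :=
  (ContinuousLinearMap.proj a : AC r →L[ℝ] ℂ).hasFDerivAt

theorem fderiv_dHol {c : ℝ} {f : AC r → ℂ} (hf : ContDiff ℝ ∞ f) (a : Idx r) (y w : AC r) :
    fderiv ℝ (dHol c a f) y w = (fderiv ℝ (fun y => fderiv ℝ f y (Pi.single a 1)) y w
      - Complex.I * fderiv ℝ (fun y => fderiv ℝ f y (Pi.single a Complex.I)) y w) / 2
      - c / 4 * (conj (w a) * f y + conj (y a) * fderiv ℝ f y w) := by
  have hd : ∀ v, HasFDerivAt (fun y => fderiv ℝ f y v) (fderiv ℝ (fun y => fderiv ℝ f y v) y) y :=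
    fun v => ((contDiff_fderiv_const hf v).differentiable (by simp) y).hasFDerivAt
  have h := (((hd (Pi.single a 1)).sub ((hd (Pi.single a Complex.I)).const_mul Complex.I)).mul_const
    ((2 : ℂ)⁻¹)).sub (((hasFDerivAt_conj_apply a y).const_mul (c / 4 : ℂ)).mul
      (hf.differentiable (by simp) y).hasFDerivAt)
  refine (DFunLike.congr_fun (HasFDerivAt.fderiv h) w).trans ?_
  simp
  ring

theorem fderiv_dBar {c : ℝ} {f : AC r → ℂ} (hf : ContDiff ℝ ∞ f) (a : Idx r) (y w : AC r) :
    fderiv ℝ (dBar c a f) y w = fderiv ℝ (fun y => fderiv ℝ f y (Pi.single a 1)) y w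
      + Complex.I * fderiv ℝ (fun y => fderiv ℝ f y (Pi.single a Complex.I)) y w
      + c / 2 * (w a * f y + y a * fderiv ℝ f y w) := by
  have hd : ∀ v, HasFDerivAt (fun y => fderiv ℝ f y v) (fderiv ℝ (fun y => fderiv ℝ f y v) y) y :=
    fun v => ((contDiff_fderiv_const hf v).differentiable (by simp) y).hasFDerivAt
  have h := (((hd (Pi.single a 1)).add ((hd (Pi.single a Complex.I)).const_mul Complex.I))).add
    (((hasFDerivAt_coord a y).const_mul (c / 2 : ℂ)).mul
      (hf.differentiable (by simp) y).hasFDerivAt)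
  refine (DFunLike.congr_fun (HasFDerivAt.fderiv h) w).trans ?_
  simp
  ring

theorem dBar_dHol {c : ℝ} {f : AC r → ℂ} (hf : ContDiff ℝ ∞ f) (a b : Idx r) (y : AC r) :
    dBar c b (dHol c a f) y = dHol c a (dBar c b f) y - (if a = b then c else 0) * f y := by
  have h4 := Complex.I_mul_I
  rw [dBar, fderiv_dHol hf, fderiv_dHol hf, dHol, dHol, fderiv_dBar hf, fderiv_dBar hf, dBar,
    fderiv_fderiv_comm hf y (Pi.single a 1) (Pi.single b 1),
    fderiv_fderiv_comm hf y (Pi.single a 1) (Pi.single b Complex.I),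
    fderiv_fderiv_comm hf y (Pi.single a Complex.I) (Pi.single b 1),
    fderiv_fderiv_comm hf y (Pi.single a Complex.I) (Pi.single b Complex.I)]
  by_cases h : a = b
  · subst h
    simp
    linear_combination (c / 2 * f y ) * h4
  · simp [h, Ne.symm h]
    ring

theorem dHol_zero (c : ℝ) (a : Idx r) (y : AC r) : dHol c a (fun _ => 0) y = 0 := by
  simp [dHol]

theorem dBar_dHol_of_isHol {c : ℝ} {f : AC r → ℂ} (hf : ContDiff ℝ ∞ f) (h : IsHol c f) (a b : Idx r)
    (y : AC r) : dBar c b (dHol c a f) y = -(if a = b then c else 0) * f y := by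
  have e : dBar c b f = fun _ => 0 := funext fun y => ((isHol_iff c f).1 h).2 b y
  rw [dBar_dHol hf, e, dHol_zero]; push_cast; ring

theorem dBar_dHol_dHol_of_isHol {c : ℝ} {f : AC r → ℂ} (hf : ContDiff ℝ ∞ f) (h : IsHol c f) (a b : Idx r)
    (y : AC r) : dBar c b (dHol c a (dHol c a f)) y = -2 * (if a = b then c else 0) * dHol c a f y := by
  have e : dBar c b (dHol c a f) = fun y => ∑ _i ∈ ({0} : Finset ℕ), -(if a = b then (c : ℂ) else 0) * f y :=
    funext fun y => by rw [dBar_dHol_of_isHol hf h]; split_ifs <;> simp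
  rw [dBar_dHol (dHol_contDiff hf a), e, dHol_sum _ _ (fun _ => h.1)]
  split_ifs <;> simp
  ring

theorem dBar_mul {c : ℝ} {g f : AC r → ℂ} {y : AC r} {g' : AC r →L[ℝ] ℂ} (hg : HasFDerivAt g g' y)
    (hf : Differentiable ℝ f) (b : Idx r) : dBar c b (fun y => g y * f y) y =
      (g' (Pi.single b 1) + Complex.I * g' (Pi.single b Complex.I)) * f y + g y * dBar c b f y := by
  have h : fderiv ℝ (fun y => g y * f y) y = g y • fderiv ℝ f y + f y • g' :=
    (hg.mul (hf y).hasFDerivAt).fderiv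
  rw [dBar, dBar, h]
  simp
  ring

theorem dBar_coord_mul {c : ℝ} {f : AC r → ℂ} (hf : Differentiable ℝ f) (a b : Idx r) (y : AC r) :
    dBar c b (fun y => y a * f y) y = y a * dBar c b f y := by
  rw [dBar_mul (hasFDerivAt_coord a y) hf]
  by_cases h : a = b
  · subst h; simp
  · simp [h]

theorem dBar_conj_mul {c : ℝ} {f : AC r → ℂ} (hf : Differentiable ℝ f) (a b : Idx r) (y : AC r) :
    dBar c b (fun y => conj (y a) * f y) y = (if a = b then 2 else 0) * f y + conj (y a) * dBar c b f y := by
  rw [dBar_mul (hasFDerivAt_conj_apply a y) hf]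
  by_cases h : a = b
  · subst h; simp; left; norm_num
  · simp [h]

theorem dBar_sum {c : ℝ} {ι : Type*} (s : Finset ι) (k : ι → ℂ) {h : ι → AC r → ℂ}
    (hh : ∀ i, Differentiable ℝ (h i)) (b : Idx r) (y : AC r) :
    dBar c b (fun y => ∑ i ∈ s, k i * h i y) y = ∑ i ∈ s, k i * dBar c b (h i) y := by
  have e : fderiv ℝ (fun y => ∑ i ∈ s, k i * h i y) y = ∑ i ∈ s, k i • fderiv ℝ (h i) y := by
    rw [fderiv_fun_sum fun i _ => (hh i y).const_mul _]
    exact Finset.sum_congr rfl fun i _ => fderiv_const_mul (hh i y) _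
  simp only [dBar, e, ContinuousLinearMap.sum_apply, ContinuousLinearMap.smul_apply, smul_eq_mul,
    Finset.mul_sum, ← Finset.sum_add_distrib]
  exact Finset.sum_congr rfl fun i _ => by ring

theorem fderiv_of_isHol {c : ℝ} {f : AC r → ℂ} (h : IsHol c f) (y X : AC r) :
    fderiv ℝ f y X = ∑ a, (X a * dHol c a f y + c / 4 * (X a * conj (y a) - conj (X a) * y a) * f y) := by
  have h1 := sum_mul_basis (fderiv ℝ f y) X
  have h2 := h.2 X y
  have h3 : ∑ a, (X a * dHol c a f y + c / 4 * (X a * conj (y a) - conj (X a) * y a) * f y) =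
    (∑ a, X a * (fderiv ℝ f y (Pi.single a 1) - Complex.I * fderiv ℝ f y (Pi.single a Complex.I))) / 2
    - c / 4 * (∑ a, y a * conj (X a)) * f y := by
    rw [Finset.sum_div, Finset.mul_sum, Finset.sum_mul, ← Finset.sum_sub_distrib]
    refine Finset.sum_congr rfl fun a _ => ?_
    rw [dHol]; ring
  rw [h3, ← h1]
  linear_combination h2 / 2

/-- The covariant derivative of the connection in the coordinates `yco`, on holomorphic sections
which are constant in these coordinates. -/
def rFun (c : ℝ) (ν μ : Idx r → ℂ) (f : AC r → ℂ) (y : AC r) : ℂ :=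
  ∑ a, (ν a * (y a * dHol c a f y) + μ a * (conj (y a) * dHol c a f y)
    + c / 2 * ν a * (y a * (conj (y a) * f y)) + c / 4 * μ a * (conj (y a) * (conj (y a) * f y))
    - c / 4 * conj (μ a) * (y a * (y a * f y)) + μ a / c * dHol c a (dHol c a f) y)

theorem rFun_eq {c : ℝ} {f : AC r → ℂ} (h : IsHol c f) (V : ℂ) (y : AC r) :
    rFun c (yNu r τ V) (yMu r t τ V) f y = fderiv ℝ f y (yVar r t τ V y) +
      ∑ a, yMu r t τ V a / c * dHol c a (dHol c a f) y := by
  rw [fderiv_of_isHol h, rFun, ← Finset.sum_add_distrib]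
  refine Finset.sum_congr rfl fun a _ => ?_
  have : conj (yNu r τ V a) = - yNu r τ V a := by
    rcases a with j | j <;> simp [yNu, map_ofNat]
  simp only [yVar, map_add, map_mul, this, Complex.conj_conj]
  ring

theorem rFun_isHol {c : ℝ} (hc : c ≠ 0) {f : AC r → ℂ} (hf : ContDiff ℝ ∞ f) (h : IsHol c f)
    (ν μ : Idx r → ℂ) : IsHol c (rFun c ν μ f) := by
  have hc' : (c : ℂ) ≠ 0 := by exact_mod_cast hc
  have d0 : Differentiable ℝ f := h.1
  have d1 : ∀ a, Differentiable ℝ (dHol c a f) := fun a => (dHol_contDiff hf a).differentiable (by simp)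
  have d2 : ∀ a, Differentiable ℝ (dHol c a (dHol c a f)) := fun a =>
    (dHol_contDiff (dHol_contDiff hf a) a).differentiable (by simp)
  have dm : ∀ {g : AC r → ℂ} (a : Idx r), Differentiable ℝ g → Differentiable ℝ (fun y => y a * g y) :=
    fun a hg => Differentiable.mul (fun y => (hasFDerivAt_coord a y).differentiableAt) hg
  have dc : ∀ {g : AC r → ℂ} (a : Idx r), Differentiable ℝ g → Differentiable ℝ (fun y => conj (y a) * g y) :=
    fun a hg => Differentiable.mul (fun y => (hasFDerivAt_conj_apply a y).differentiableAt) hg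
  let k : Idx r → Fin 6 → ℂ := fun a => ![ν a, μ a, c / 2 * ν a, c / 4 * μ a, -(c / 4 * conj (μ a)), μ a / c]
  let g : Idx r → Fin 6 → AC r → ℂ := fun a => ![fun y => y a * dHol c a f y, fun y => conj (y a) * dHol c a f y,
    fun y => y a * (conj (y a) * f y), fun y => conj (y a) * (conj (y a) * f y), fun y => y a * (y a * f y),
    dHol c a (dHol c a f)]
  have hg : ∀ a i, Differentiable ℝ (g a i) := by
    intro a i
    fin_cases i
    · exact dm a (d1 a)
    · exact dc a (d1 a)
    · exact dm a (dc a d0)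
    · exact dc a (dc a d0)
    · exact dm a (dm a d0)
    · exact d2 a
  have e : rFun c ν μ f = fun y => ∑ p : Idx r × Fin 6, k p.1 p.2 * g p.1 p.2 y := by
    ext y
    rw [Fintype.sum_prod_type, rFun]
    refine Finset.sum_congr rfl fun a _ => ?_
    simp only [Fin.sum_univ_six, k, g]
    simp
    ring
  rw [isHol_iff, e]
  refine ⟨Differentiable.fun_sum fun p _ => (hg p.1 p.2).const_mul _, fun b y => ?_⟩
  rw [dBar_sum (h := fun p : Idx r × Fin 6 => g p.1 p.2) _ (fun p : Idx r × Fin 6 => k p.1 p.2) fun p => hg p.1 p.2, Fintype.sum_prod_type]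
  refine Finset.sum_eq_zero fun a _ => ?_
  have hb : dBar c b f y = 0 := ((isHol_iff c f).1 h).2 b y
  simp only [Fin.sum_univ_six, k, g]
  simp [dBar_coord_mul (d1 a), dBar_conj_mul (d1 a), dBar_coord_mul (dc a d0), dBar_conj_mul d0,
    dBar_conj_mul (dc a d0), dBar_coord_mul (dm a d0), dBar_coord_mul d0, dBar_dHol_of_isHol hf h,
    dBar_dHol_dHol_of_isHol hf h, hb]
  split_ifs
  · field_simp; ring
  · simp

end formulas
end GenusOne

end

noncomputable section
namespace GenusOne
open Filter

section operators
open ComplexConjugate LineDeriv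

variable {r : ℕ} {t τ : ℂ}

theorem hasTemperateGrowth_coord (a : Idx r) : (fun y : AC r => y a).HasTemperateGrowth :=
  (ContinuousLinearMap.proj a : AC r →L[ℝ] ℂ).hasTemperateGrowth

theorem hasTemperateGrowth_conj (a : Idx r) : (fun y : AC r => conj (y a)).HasTemperateGrowth :=
  (Complex.conjCLE.toContinuousLinearMap.comp (ContinuousLinearMap.proj a : AC r →L[ℝ] ℂ)).hasTemperateGrowth

/-- `dHol` on Schwartz functions. -/
def dHolS (c : ℝ) (a : Idx r) : 𝓢(AC r, ℂ) →L[ℂ] 𝓢(AC r, ℂ) :=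
  (2⁻¹ : ℂ) • (lineDerivOpCLM ℂ 𝓢(AC r, ℂ) (Pi.single a 1 : AC r) -
    Complex.I • lineDerivOpCLM ℂ 𝓢(AC r, ℂ) (Pi.single a Complex.I : AC r))
  - (c / 4 : ℂ) • SchwartzMap.smulLeftCLM ℂ (fun y : AC r => conj (y a))

theorem dHolS_apply (c : ℝ) (a : Idx r) (f : 𝓢(AC r, ℂ)) (y : AC r) : dHolS c a f y = dHol c a f y := by
  simp [dHolS, dHol, SchwartzMap.smulLeftCLM_apply_apply (hasTemperateGrowth_conj a),
    SchwartzMap.lineDerivOp_apply_eq_fderiv]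
  ring

theorem coe_dHolS (c : ℝ) (a : Idx r) (f : 𝓢(AC r, ℂ)) : (dHolS c a f : AC r → ℂ) = dHol c a f :=
  funext (dHolS_apply c a f)

/-- `rFun` on Schwartz functions. -/
def rOp (c : ℝ) (ν μ : Idx r → ℂ) : 𝓢(AC r, ℂ) →L[ℂ] 𝓢(AC r, ℂ) :=
  let M : Idx r → 𝓢(AC r, ℂ) →L[ℂ] 𝓢(AC r, ℂ) := fun a => SchwartzMap.smulLeftCLM ℂ (fun y : AC r => y a)
  let Mc : Idx r → 𝓢(AC r, ℂ) →L[ℂ] 𝓢(AC r, ℂ) := fun a => SchwartzMap.smulLeftCLM ℂ (fun y : AC r => conj (y a))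
  ∑ a, (ν a • (M a ∘L dHolS c a) + μ a • (Mc a ∘L dHolS c a) + (c / 2 * ν a) • (M a ∘L Mc a)
    + (c / 4 * μ a) • (Mc a ∘L Mc a) - (c / 4 * conj (μ a)) • (M a ∘L M a)
    + (μ a / c) • (dHolS c a ∘L dHolS c a))

theorem rOp_apply (c : ℝ) (ν μ : Idx r → ℂ) (f : 𝓢(AC r, ℂ)) (y : AC r) :
    rOp c ν μ f y = rFun c ν μ f y := by
  simp only [rOp, rFun, ContinuousLinearMap.sum_apply, SchwartzMap.sum_apply]
  refine Finset.sum_congr rfl fun a _ => ?_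
  simp [SchwartzMap.smulLeftCLM_apply_apply (hasTemperateGrowth_conj a),
    SchwartzMap.smulLeftCLM_apply_apply (hasTemperateGrowth_coord a), dHolS_apply, coe_dHolS]

theorem isHol_add {c : ℝ} {f g : AC r → ℂ} (hf : IsHol c f) (hg : IsHol c g) :
    IsHol c (fun y => f y + g y) := by
  refine ⟨hf.1.add hg.1, fun X y => ?_⟩
  have h1 := hf.2 X y
  have h2 := hg.2 X y
  have h3 : fderiv ℝ (fun y => f y + g y) y = fderiv ℝ f y + fderiv ℝ g y :=
    fderiv_fun_add (hf.1 y) (hg.1 y)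
  simp only [h3, add_apply] at *
  linear_combination h1 + h2

theorem isHol_smul {c : ℝ} (k : ℂ) {f : AC r → ℂ} (hf : IsHol c f) : IsHol c (fun y => k * f y) := by
  refine ⟨hf.1.const_mul k, fun X y => ?_⟩
  have h1 := hf.2 X y
  have h3 : fderiv ℝ (fun y => k * f y) y = k • fderiv ℝ f y := fderiv_const_mul (hf.1 y) k
  simp only [h3, smul_apply, smul_eq_mul] at *
  linear_combination k * h1

/-- Holomorphic Schwartz functions in the coordinates `yco`. -/
def HS (r : ℕ) (c : ℝ) : Submodule ℂ 𝓢(AC r, ℂ) where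
  carrier := {f | IsHol c f}
  add_mem' h1 h2 := isHol_add h1 h2
  zero_mem' := ⟨differentiable_const (0 : ℂ), fun X y => by
    have : fderiv ℝ ((0 : 𝓢(AC r, ℂ)) : AC r → ℂ) y = 0 := by
      exact congrFun fderiv_zero y
    rw [this]; simp⟩
  smul_mem' k _ h := isHol_smul k h

theorem continuous_schwartz_apply (y : AC r) : Continuous fun f : 𝓢(AC r, ℂ) => f y :=
  (SchwartzMap.toBoundedContinuousFunctionCLM ℂ (AC r) ℂ).continuous.eval_const y

theorem continuous_schwartz_fderiv_apply (y X : AC r) : Continuous fun f : 𝓢(AC r, ℂ) => fderiv ℝ f y X :=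
  (continuous_schwartz_apply y).comp (lineDerivOpCLM ℂ 𝓢(AC r, ℂ) X).continuous

theorem isClosed_HS (r : ℕ) (c : ℝ) : IsClosed (HS r c : Set 𝓢(AC r, ℂ)) := by
  have : (HS r c : Set 𝓢(AC r, ℂ)) = ⋂ (X : AC r) (y : AC r), {f : 𝓢(AC r, ℂ) | fderiv ℝ f y X +
      Complex.I * fderiv ℝ f y (Complex.I • X) + c / 2 * (∑ a, y a * conj (X a)) * f y = 0} := by
    ext f
    simp only [Set.mem_iInter]
    exact ⟨fun h => h.2, fun h => ⟨f.differentiable, h⟩⟩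
  rw [this]
  refine isClosed_iInter fun X => isClosed_iInter fun y => isClosed_eq ?_ continuous_const
  exact ((continuous_schwartz_fderiv_apply y X).add
    (continuous_const.mul (continuous_schwartz_fderiv_apply y _))).add
    (continuous_const.mul (continuous_schwartz_apply y))

instance (r : ℕ) (c : ℝ) : BaireSpace (HS r c) := schwartz_baireSpace (isClosed_HS r c)

instance (r : ℕ) (c : ℝ) : IsUniformAddGroup (HS r c) :=
  inferInstanceAs (IsUniformAddGroup (HS r c).toAddSubgroup)

theorem rOp_mem {c : ℝ} (hc : c ≠ 0) (ν μ : Idx r → ℂ) {f : 𝓢(AC r, ℂ)} (hf : f ∈ HS r c) :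
    rOp c ν μ f ∈ HS r c := by
  have := rFun_isHol hc (f.smooth ⊤) hf ν μ
  have e : (rOp c ν μ f : AC r → ℂ) = rFun c ν μ f := funext (rOp_apply c ν μ f)
  change IsHol c _
  rwa [e]

/-- `rOp` on holomorphic Schwartz functions. -/
def rHS {c : ℝ} (hc : c ≠ 0) (ν μ : Idx r → ℂ) : HS r c →L[ℂ] HS r c :=
  ((rOp c ν μ).comp (HS r c).subtypeL).codRestrict (HS r c) fun f => rOp_mem hc ν μ f.2

/-- The identification of the holomorphic Schwartz functions at `τ`. -/
def toSC (ht : t ≠ 0) (hτ : τ ∈ teich) : HS r ‖t‖ →L[ℂ] SC r τ t :=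
  ((SchwartzMap.compCLMOfContinuousLinearEquiv ℂ (yEquiv ht hτ)).comp (HS r ‖t‖).subtypeL).codRestrict
    (SC r τ t) fun f => (isHolomorphic_comp_yco ht hτ).2 f.2

theorem toSC_apply (ht : t ≠ 0) (hτ : τ ∈ teich) (f : HS r ‖t‖) (A : AC r) :
    (toSC ht hτ f).1 A = f.1 (yco t τ A) := rfl

/-- The inverse of `toSC`. -/
def ofSC (ht : t ≠ 0) (hτ : τ ∈ teich) : SC r τ t →L[ℂ] HS r ‖t‖ :=
  ((SchwartzMap.compCLMOfContinuousLinearEquiv ℂ (yEquiv ht hτ).symm).comp (SC r τ t).subtypeL).codRestrict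
    (HS r ‖t‖) fun f => by
      refine (isHolomorphic_comp_yco ht hτ).1 ?_
      have : (fun A => (SchwartzMap.compCLMOfContinuousLinearEquiv ℂ (yEquiv ht hτ).symm f.1) (yco t τ A)) = f.1 := by
        ext A
        exact congrArg f.1 (yinv_yco ht hτ A)
      change IsHolomorphic τ t fun A => (SchwartzMap.compCLMOfContinuousLinearEquiv ℂ (yEquiv ht hτ).symm f.1) (yco t τ A)
      rw [this]
      exact f.2

theorem ofSC_apply (ht : t ≠ 0) (hτ : τ ∈ teich) (f : SC r τ t) (y : AC r) :
    (ofSC ht hτ f).1 y = f.1 (yinv t τ y) := rfl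

theorem toSC_ofSC (ht : t ≠ 0) (hτ : τ ∈ teich) (f : SC r τ t) : toSC ht hτ (ofSC ht hτ f) = f := by
  apply Subtype.ext
  ext A
  rw [toSC_apply, ofSC_apply, yinv_yco ht hτ]

end operators

section dual
variable {r : ℕ} {t : ℂ}

theorem IsSmoothTest.comp_yinv (ht : t ≠ 0) {χ : ∀ τ : ℂ, SC r τ t} (hχ : IsSmoothTest χ) :
    RapidFamily (fun p : ℂ × AC r => (χ p.1).1 (yinv t p.1 p.2)) := by
  have hF : RapidFamily (fun p : ℂ × AC r => (χ p.1).1 p.2) := hχ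
  exact hF.comp_clm (fun τ => yinv t τ) (fun τ => yco t τ) yinv_contDiffOn yco_contDiffOn.continuousOn
    fun τ hτ A => yco_yinv ht hτ A

theorem RapidFamily.comp_yco (ht : t ≠ 0) {F : ℂ × AC r → ℂ} (hF : RapidFamily F) :
    RapidFamily (fun p : ℂ × AC r => F (p.1, yco t p.1 p.2)) :=
  hF.comp_clm (fun τ => yco t τ) (fun τ => yinv t τ) yco_contDiffOn yinv_contDiffOn.continuousOn
    fun τ hτ A => yinv_yco ht hτ A

open Classical in
/-- The family of test sections which is constant in the coordinates `yco`. -/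
def constFamily (ht : t ≠ 0) (f : HS r ‖t‖) (τ : ℂ) : SC r τ t :=
  if hτ : τ ∈ teich then toSC ht hτ f else 0

theorem constFamily_of_mem (ht : t ≠ 0) (f : HS r ‖t‖) {τ : ℂ} (hτ : τ ∈ teich) :
    constFamily ht f τ = toSC ht hτ f := dif_pos hτ

theorem constFamily_isSmoothTest (ht : t ≠ 0) (f : HS r ‖t‖) : IsSmoothTest (constFamily ht f) := by
  have h := (rapidFamily_comp_snd f.1).comp_yco ht
  refine RapidFamily.congr h ?_
  intro τ hτ A
  change (constFamily ht f τ).1 A = _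
  rw [constFamily_of_mem ht f hτ]
  rfl

/-- The covariant derivative of a family of test sections in the coordinates `yco`. -/
theorem covC_comp_yco (ht : t ≠ 0) {τ : ℂ} (hτ : τ ∈ teich) (V : ℂ) {F : ℂ × AC r → ℂ}
    (hF : ContDiffOn ℝ ∞ F (strip (AC r))) (hh : IsHol ‖t‖ fun y => F (τ, y)) {Φ : ℂ → AC r → ℂ}
    (hΦ : ∀ τ ∈ teich, ∀ A, Φ τ A = F (τ, yco t τ A)) (A : AC r) :
    covC t V Φ τ A = fderiv ℝ F (τ, yco t τ A) (V, 0) +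
      rFun ‖t‖ (yNu r τ V) (yMu r t τ V) (fun y => F (τ, y)) (yco t τ A) := by
  have hn : (‖t‖ : ℂ) ≠ 0 := by simpa using ht
  have hsm := contDiff_slice hF hτ
  have hd : HasFDerivAt F (fderiv ℝ F (τ, yco t τ A)) (τ, yco t τ A) :=
    ((strip_contDiffAt hF (mem_strip hτ _)).differentiableAt (by simp)).hasFDerivAt
  have h1 : fderiv ℝ (fun τ' => Φ τ' A) τ V = fderiv ℝ F (τ, yco t τ A) (V, yVar r t τ V (yco t τ A)) := by
    have e : (fun τ' => Φ τ' A) =ᶠ[𝓝 τ] fun τ' => F (τ', yco t τ' A) := by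
      filter_upwards [isOpen_teich.mem_nhds hτ] with τ' h using hΦ τ' h A
    have hy : HasFDerivAt (fun τ' => yco t τ' A) (fderiv ℝ (fun τ' => yco t τ' A) τ) τ :=
      ((yco_differentiableAt hτ).clm_apply (differentiableAt_const A)).hasFDerivAt
    have hp : HasFDerivAt (fun τ' : ℂ => (τ', yco t τ' A)) ((ContinuousLinearMap.id ℝ ℂ).prod (fderiv ℝ (fun τ' => yco t τ' A) τ)) τ :=
      (hasFDerivAt_id τ).prodMk hy
    rw [e.fderiv_eq]
    refine (DFunLike.congr_fun (HasFDerivAt.comp τ hd hp).fderiv V).trans ?_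
    simp [fderiv_yco hτ ht]
  have h2 : fderiv ℝ F (τ, yco t τ A) (V, yVar r t τ V (yco t τ A)) = fderiv ℝ F (τ, yco t τ A) (V, 0)
      + fderiv ℝ (fun y => F (τ, y)) (yco t τ A) (yVar r t τ V (yco t τ A)) := by
    have hp : HasFDerivAt (fun y : AC r => (τ, y)) (ContinuousLinearMap.inr ℝ ℂ (AC r)) (yco t τ A) :=
      hasFDerivAt_prodMk_right τ _
    have e : fderiv ℝ (fun y => F (τ, y)) (yco t τ A) = _ := (HasFDerivAt.comp (yco t τ A) hd hp).fderiv
    rw [e, ContinuousLinearMap.comp_apply, ContinuousLinearMap.inr_apply, ← map_add]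
    simp
  have h3 : Φ τ = fun A => (fun y => F (τ, y)) (yco t τ A) := funext fun A => hΦ τ hτ A
  rw [covC, h1, h2, uC, h3, laplaceC_comp_yco ht hτ V hsm, rFun_eq hh, Finset.sum_congr rfl
    (fun a _ => show 4 * yMu r t τ V a * dHol ‖t‖ a (dHol ‖t‖ a fun y => F (τ, y)) (yco t τ A) =
      4 * ‖t‖ * (yMu r t τ V a / ‖t‖ * dHol ‖t‖ a (dHol ‖t‖ a fun y => F (τ, y)) (yco t τ A)) by field_simp),
    ← Finset.mul_sum]
  field_simp
  ring

theorem exists_isDualC (ht : t ≠ 0) (S : ∀ τ : ℂ, SC' r τ t) (hS : IsSmoothDistC S) {τ : ℂ}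
    (hτ : τ ∈ teich) (V : ℂ) : ∃ S' : SC' r τ t, IsDualC V S τ S' := by
  classical
  have hn : ‖t‖ ≠ 0 := by simpa using ht
  let Q : ℂ → HS r ‖t‖ →L⋆[ℂ] ℂ := fun τ' => if h : τ' ∈ teich then (S τ').comp (toSC ht h) else 0
  have hQ0 : ∀ τ' (h : τ' ∈ teich) f, Q τ' f = S τ' (toSC ht h f) := fun τ' h f => by
    simp [Q, h]
  have hdiff : ∀ χ : ∀ τ : ℂ, SC r τ t, IsSmoothTest χ → DifferentiableAt ℝ (fun τ' => S τ' (χ τ')) τ :=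
    fun χ hχ => ((hS χ hχ).contDiffAt (isOpen_teich.mem_nhds hτ)).differentiableAt (by simp)
  have hQ : ∀ f, DifferentiableAt ℝ (fun τ' => Q τ' f) τ := by
    intro f
    refine (hdiff _ (constFamily_isSmoothTest ht f)).congr_of_eventuallyEq ?_
    filter_upwards [isOpen_teich.mem_nhds hτ] with τ' h
    rw [hQ0 τ' h, constFamily_of_mem ht f h]
  obtain ⟨D, hD⟩ := exists_deriv_functional Q τ V hQ
  let R := rHS (r := r) hn (yNu r τ V) (yMu r t τ V)
  refine ⟨(D - (Q τ).comp R).comp (ofSC ht hτ), fun χ hχ => ?_⟩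
  let F : ℂ × AC r → ℂ := fun p => (χ p.1).1 (yinv t p.1 p.2)
  have hF : RapidFamily F := hχ.comp_yinv ht
  let ξ : ℂ → HS r ‖t‖ := fun τ' => if h : τ' ∈ teich then ofSC ht h (χ τ') else 0
  have hξ : ∀ τ' ∈ teich, ∀ y, (ξ τ').1 y = F (τ', y) := fun τ' h y => by
    simp [ξ, h, F, ofSC_apply]
  let θ : 𝓢(AC r, ℂ) := (hF.fderiv_apply (V, 0)).slice hτ
  have hθ : Tendsto (fun n : ℕ => ((n : ℝ) : ℂ) • ((ξ (τ + (n : ℝ)⁻¹ • V)).1 - (ξ τ).1)) atTop (𝓝 θ) :=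
    hF.tendsto_slope hτ V (fun τ' => (ξ τ').1) hξ θ fun A => rfl
  have hθm : θ ∈ HS r ‖t‖ := (isClosed_HS r ‖t‖).mem_of_tendsto hθ
    (Eventually.of_forall fun n => (HS r ‖t‖).smul_mem _ ((HS r ‖t‖).sub_mem (ξ _).2 (ξ _).2))
  have hθ' : Tendsto (fun n : ℕ => ((n : ℝ) : ℂ) • (ξ (τ + (n : ℝ)⁻¹ • V) - ξ τ)) atTop
      (𝓝 (⟨θ, hθm⟩ : HS r ‖t‖)) := by
    rw [tendsto_subtype_rng]; exact hθ
  have hξτ : ∀ τ' (h : τ' ∈ teich), Q τ' (ξ τ') = S τ' (χ τ') := fun τ' h => by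
    rw [hQ0 τ' h]; simp [ξ, h, toSC_ofSC]
  have hev : (fun τ' => Q τ' (ξ τ')) =ᶠ[𝓝 τ] fun τ' => S τ' (χ τ') := by
    filter_upwards [isOpen_teich.mem_nhds hτ] with τ' h using hξτ τ' h
  have hprod := fderiv_functional_apply Q ξ τ V ⟨θ, hθm⟩ hQ hθ' ((hdiff χ hχ).congr_of_eventuallyEq hev)
  rw [hev.fderiv_eq] at hprod
  have hξ1 : ξ τ = ofSC ht hτ (χ τ) := by simp [ξ, hτ]
  refine ⟨toSC ht hτ (⟨θ, hθm⟩ + R (ξ τ)), fun A => ?_, ?_⟩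
  · have hsl : (fun y => F (τ, y)) = (ξ τ).1 := funext fun y => (hξ τ hτ y).symm
    rw [covC_comp_yco ht hτ V hF.1 (by rw [hsl]; exact (ξ τ).2) (F := F)]
    · rw [toSC_apply, hsl]
      change θ _ + rOp _ _ _ (ξ τ).1 _ = _
      rw [rOp_apply]; rfl
    · intro τ' h A
      simp [F, yinv_yco ht h]
  · rw [← hQ0, map_add, hprod, ← hD (ξ τ), hξ1]
    change D (ofSC ht hτ (χ τ)) - Q τ (R (ofSC ht hτ (χ τ))) = _
    ring

theorem isDualC_unique (ht : t ≠ 0) (S : ∀ τ : ℂ, SC' r τ t) {τ : ℂ}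
    (hτ : τ ∈ teich) (V : ℂ) {S₁ S₂ : SC' r τ t} (h₁ : IsDualC V S τ S₁) (h₂ : IsDualC V S τ S₂) :
    S₁ = S₂ := by
  ext χ
  have hc := constFamily_isSmoothTest ht (ofSC ht hτ χ)
  have hval : constFamily ht (ofSC ht hτ χ) τ = χ := by
    rw [constFamily_of_mem ht _ hτ, toSC_ofSC]
  obtain ⟨η₁, e₁, f₁⟩ := h₁ _ hc
  obtain ⟨η₂, e₂, f₂⟩ := h₂ _ hc
  have : η₁ = η₂ := Subtype.ext (SchwartzMap.ext fun A => (e₁ A).trans (e₂ A).symm)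
  rw [hval] at f₁ f₂
  rw [f₁, f₂, this]

end dual
end GenusOne

end

noncomputable section
namespace GenusOne
open Filter

section dualHW
open ComplexConjugate LineDeriv

variable {r : ℕ} {t τ : ℂ}

theorem hasTemperateGrowth_coord0 (a : Idx r) : (fun u : A0 r => (u a : ℂ)).HasTemperateGrowth :=
  (Complex.ofRealCLM.comp (ContinuousLinearMap.proj a : A0 r →L[ℝ] ℝ)).hasTemperateGrowth

/-- `pDer` on Schwartz functions. -/
def pDerS (k : ℝ) (z : ℂ) (j : Fin r) : S0 r →L[ℂ] S0 r :=
  lineDerivOpCLM ℂ (S0 r) (basis0 (Sum.inl j)) + z • lineDerivOpCLM ℂ (S0 r) (basis0 (Sum.inr j))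
    + (Complex.I / 2 * k) • (SchwartzMap.smulLeftCLM ℂ (fun u : A0 r => (u (Sum.inr j) : ℂ)) -
      z • SchwartzMap.smulLeftCLM ℂ (fun u : A0 r => (u (Sum.inl j) : ℂ)))

theorem omega_basis0_inl (u : A0 r) (j : Fin r) : omega u (basis0 (Sum.inl j)) = -u (Sum.inr j) := by
  simp [omega, basis0, Pi.single_apply]

theorem omega_basis0_inr (u : A0 r) (j : Fin r) : omega u (basis0 (Sum.inr j)) = u (Sum.inl j) := by
  simp [omega, basis0, Pi.single_apply]

theorem pDer_eq (k : ℝ) (z : ℂ) (j : Fin r) (ψ : A0 r → ℂ) (u : A0 r) : pDer k z j ψ u =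
    fderiv ℝ ψ u (basis0 (Sum.inl j)) + z * fderiv ℝ ψ u (basis0 (Sum.inr j)) +
    Complex.I / 2 * k * (u (Sum.inr j) - z * u (Sum.inl j)) * ψ u := by
  rw [pDer, nabla, nabla, omega_basis0_inl, omega_basis0_inr]
  push_cast; ring

theorem pDerS_apply (k : ℝ) (z : ℂ) (j : Fin r) (ψ : S0 r) (u : A0 r) :
    pDerS k z j ψ u = pDer k z j ψ u := by
  rw [pDer_eq]
  simp [pDerS, SchwartzMap.smulLeftCLM_apply_apply (hasTemperateGrowth_coord0 (r := r) _),
    SchwartzMap.lineDerivOp_apply_eq_fderiv]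
  ring

theorem coe_pDerS (k : ℝ) (z : ℂ) (j : Fin r) (ψ : S0 r) : (pDerS k z j ψ : A0 r → ℂ) = pDer k z j ψ :=
  funext (pDerS_apply k z j ψ)

/-- `-uHW / 2` on Schwartz functions. -/
def uOp (r : ℕ) (t V τ : ℂ) : S0 r →L[ℂ] S0 r :=
  (-(1 / 2) * (1 / star t * (Complex.I * conj V / (2 * τ.im ^ 2)))) •
      (∑ j : Fin r, pDerS t.re τ j ∘L pDerS t.re τ j)
    + (-(1 / 2) * (1 / t * (Complex.I * V / (2 * τ.im ^ 2)))) •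
      (∑ j : Fin r, pDerS t.re (conj τ) j ∘L pDerS t.re (conj τ) j)

theorem uOp_apply (hτ : τ ∈ teich) (V : ℂ) (ψ : S0 r) (u : A0 r) :
    uOp r t V τ ψ u = -(1 / 2) * uHW t V τ ψ u := by
  rw [uHW, laplaceG_eq hτ _ _ (ψ.smooth ⊤), laplaceGbar_eq hτ _ _ (ψ.smooth ⊤)]
  simp only [uOp, add_apply, smul_apply, ContinuousLinearMap.sum_apply,
    SchwartzMap.add_apply, SchwartzMap.smul_apply, SchwartzMap.sum_apply, ContinuousLinearMap.comp_apply,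
    pDerS_apply, coe_pDerS, smul_eq_mul]
  ring

theorem covHW_const (V : ℂ) (ψ : A0 r → ℂ) (u : A0 r) :
    covHW t V (fun _ => ψ) τ u = -(1 / 2) * uHW t V τ ψ u := by
  rw [covHW]
  simp

instance (r : ℕ) : BaireSpace (S0 r) := by
  have h : IsClosed ((⊤ : Submodule ℂ (S0 r)) : Set (S0 r)) := isClosed_univ
  have : CompleteSpace (S0 r) := schwartz_completeSpace
  have : (uniformity (S0 r)).IsCountablyGenerated :=
    IsUniformAddGroup.uniformity_countably_generated
  infer_instance

theorem exists_isDualHW (S : ℂ → S0' r) (hS : IsSmoothDist0 S) (hτ : τ ∈ teich) (V : ℂ) :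
    ∃ S' : S0' r, IsDualHW t V S τ S' := by
  obtain ⟨D, hD⟩ := exists_deriv_functional S τ V fun ψ =>
    ((hS ψ).contDiffAt (isOpen_teich.mem_nhds hτ)).differentiableAt (by simp)
  refine ⟨D - (S τ).comp (uOp r t V τ), fun ψ => ⟨uOp r t V τ ψ, fun A => ?_, ?_⟩⟩
  · rw [covHW_const, uOp_apply hτ]
  · rw [← hD]; rfl

theorem isDualHW_unique (S : ℂ → S0' r) (V : ℂ) {S₁ S₂ : S0' r} (h₁ : IsDualHW t V S τ S₁)
    (h₂ : IsDualHW t V S τ S₂) : S₁ = S₂ := by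
  ext ψ
  obtain ⟨η₁, e₁, f₁⟩ := h₁ ψ
  obtain ⟨η₂, e₂, f₂⟩ := h₂ ψ
  have : η₁ = η₂ := SchwartzMap.ext fun A => (e₁ A).trans (e₂ A).symm
  rw [f₁, f₂, this]

end dualHW

section kernel
open ComplexConjugate
variable {r : ℕ} {t τ : ℂ}

/-- The complex coordinates `(u_r - τ u_l) / √τ₂` of `A0`. -/
def uCo (τ : ℂ) (u : A0 r) (j : Fin r) : ℂ :=
  ((Real.sqrt τ.im)⁻¹ : ℝ) * (u (Sum.inr j) - τ * u (Sum.inl j))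

/-- The exponent of the Bargmann kernel. -/
def bExp (t τ : ℂ) (u : A0 r) (y : AC r) : ℂ :=
  ∑ j : Fin r, (-(‖t‖ / 4 : ℂ) * (y (Sum.inl j) * conj (y (Sum.inl j)) + y (Sum.inr j) * conj (y (Sum.inr j)))
    + ‖t‖ / 2 * (y (Sum.inl j) * y (Sum.inr j))
    - Complex.I / 2 * (t * uCo τ u j * y (Sum.inl j) + conj t * conj (uCo τ u j) * y (Sum.inr j))
    - (‖t‖ - Complex.I * t.im) / 4 * (uCo τ u j * conj (uCo τ u j)))

theorem coordP_eq (A : AC r) (a : Idx r) :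
    (coordP τ t A a : ℂ) = (coordZ τ t A a + conj (coordZ τ t A a)) / 2 := by
  simp [coordZ]; ring

theorem coordQ_eq (A : AC r) (a : Idx r) :
    (coordQ τ t A a : ℂ) = (coordZ τ t A a - conj (coordZ τ t A a)) * (-Complex.I / 2) := by
  simp [coordZ]
  have := Complex.I_mul_I
  linear_combination (coordQ τ t A a : ℂ) * this

theorem kernel_eq (ht : t ≠ 0) (hτ : τ ∈ teich) (u : A0 r) (A : AC r) :
    bargKernel τ t (coordQ τ t (incl r u)) A / frameRho τ t (incl r u) =
      Complex.exp (bExp t τ u (yco t τ A)) := by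
  rw [bargKernel, frameRho, ← Complex.exp_sub]
  congr 1
  have h2 : (((Real.sqrt 2)⁻¹ : ℝ) : ℂ) * (((Real.sqrt 2)⁻¹ : ℝ) : ℂ) = 1 / 2 := by
    rw [← Complex.ofReal_mul, ← mul_inv, Real.mul_self_sqrt (by norm_num)]; norm_num
  have hn2 : ∀ z : ℂ, ((‖z‖ : ℝ) : ℂ) ^ 2 = z * conj z := fun z => by
    rw [Complex.mul_conj, Complex.normSq_eq_norm_sq, Complex.ofReal_pow]
  push_cast
  simp only [hn2]
  simp only [Fintype.sum_sum_type, bExp]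
  simp only [coordP_eq, coordQ_eq, ← Finset.sum_add_distrib, ← Finset.sum_sub_distrib, Finset.mul_sum]
  refine Finset.sum_congr rfl fun j _ => ?_
  simp only [coordZ_inl ht hτ, coordZ_inr ht hτ]
  have hu : ∀ a, incl r u a = (u a : ℂ) := fun a => rfl
  have e1 : yco t τ (incl r u) (Sum.inl j) = (1 - conj (t / ‖t‖)) * conj (uCo τ u j) * (-Complex.I / 2) := by
    rw [yco_inl, uCo, hu, hu]; simp only [map_mul, map_sub, Complex.conj_ofReal]; ring
  have e2 : yco t τ (incl r u) (Sum.inr j) = (1 + t / ‖t‖) * uCo τ u j * (Complex.I / 2) := by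
    rw [yco_inr, uCo, hu, hu]; simp only [map_mul, map_sub, Complex.conj_ofReal]; ring
  have h1 := phase_mul_conj ht
  have h0 := phase_mul_norm ht
  have h0' : conj (t / ‖t‖) * ‖t‖ = conj t := by
    have := congrArg conj h0
    rwa [map_mul, Complex.conj_ofReal] at this
  have h8 : (t.im : ℂ) = (t - conj t) * (-Complex.I / 2) := by
    apply Complex.ext <;> simp <;> ring
  have h4 := Complex.I_mul_I
  rw [e1, e2, h8]
  simp only [map_mul, map_sub, map_add, Complex.conj_conj, Complex.conj_ofReal, map_div₀,
    map_neg, Complex.conj_I, map_ofNat, map_one] at h1 h0' ⊢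
  generalize (t / (‖t‖ : ℂ)) = κ at *
  generalize (conj t / (‖t‖ : ℂ)) = κ' at *
  generalize (‖t‖ : ℂ) = nt at *
  generalize (((Real.sqrt 2)⁻¹ : ℝ) : ℂ) = s at *
  generalize conj (uCo τ u j) = U' at *
  generalize uCo τ u j = U at *
  generalize conj (yco t τ A (Sum.inl j)) = a' at *
  generalize conj (yco t τ A (Sum.inr j)) = b' at *
  generalize yco t τ A (Sum.inl j) = a at *
  generalize yco t τ A (Sum.inr j) = b at *
  generalize Complex.I = i at *
  rw [← h0', ← h0]
  clear e1 e2 h0 h0' h8 hu hn2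
  grind

theorem bargmann_eq (ht : t ≠ 0) (hτ : τ ∈ teich) (ψ : A0 r → ℂ) (A : AC r) :
    bargmann τ t ψ A = (((‖t‖ / Real.pi) ^ ((r : ℝ) / 2) * (1 / 2) ^ r : ℝ) : ℂ) *
      ∫ u : A0 r, ψ u * Complex.exp (bExp t τ u (yco t τ A)) := by
  rw [bargmann]
  congr 2
  ext u
  rw [← kernel_eq ht hτ]; ring

theorem re_bExp_nonpos (ht : t ≠ 0) (u : A0 r) (y : AC r) : (bExp t τ u y).re ≤ 0 := by
  have key : bExp t τ u y + conj (bExp t τ u y) = -((‖t‖ / 2 : ℝ) : ℂ) * ∑ j : Fin r,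
      ((Complex.normSq (conj (y (Sum.inl j)) - y (Sum.inr j) + Complex.I * (t / ‖t‖) * uCo τ u j) : ℝ) : ℂ) := by
    rw [bExp, map_sum, ← Finset.sum_add_distrib, Finset.mul_sum]
    refine Finset.sum_congr rfl fun j _ => ?_
    rw [← Complex.mul_conj]
    have h1 := phase_mul_conj ht
    have h0 := phase_mul_norm ht
    have h0' : conj (t / ‖t‖) * ‖t‖ = conj t := by
      have := congrArg conj h0
      rwa [map_mul, Complex.conj_ofReal] at this
    have h4 := Complex.I_mul_I
    push_cast
    simp only [map_mul, map_sub, map_add, Complex.conj_conj, Complex.conj_ofReal, map_div₀,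
      map_neg, Complex.conj_I, map_ofNat, map_one] at h1 h0' ⊢
    generalize (t.im : ℂ) = s at *
    generalize (t / (‖t‖ : ℂ)) = κ at *
    generalize (conj t / (‖t‖ : ℂ)) = κ' at *
    generalize (‖t‖ : ℂ) = nt at *
    generalize conj (uCo τ u j) = U' at *
    generalize uCo τ u j = U at *
    generalize conj (y (Sum.inl j)) = a' at *
    generalize conj (y (Sum.inr j)) = b' at *
    generalize y (Sum.inl j) = a at *
    generalize y (Sum.inr j) = b at *
    generalize Complex.I = i at *
    rw [← h0', ← h0]
    clear h0 h0'
    grind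
  rw [Complex.add_conj, ← Complex.ofReal_sum, ← Complex.ofReal_neg, ← Complex.ofReal_mul,
    Complex.ofReal_inj] at key
  have : 0 ≤ ‖t‖ / 2 * ∑ j : Fin r,
      Complex.normSq (conj (y (Sum.inl j)) - y (Sum.inr j) + Complex.I * (t / ‖t‖) * uCo τ u j) :=
    mul_nonneg (by positivity) (Finset.sum_nonneg fun _ _ => Complex.normSq_nonneg _)
  linarith

theorem norm_exp_bExp_le (ht : t ≠ 0) (u : A0 r) (y : AC r) : ‖Complex.exp (bExp t τ u y)‖ ≤ 1 := by
  rw [Complex.norm_exp]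
  exact Real.exp_le_one_iff.2 (re_bExp_nonpos ht u y)

end kernel
end GenusOne

end

noncomputable section
namespace GenusOne
open Filter

section slowExtra
variable {X G : Type} [NormedAddCommGroup X] [NormedSpace ℝ X] [NormedAddCommGroup G] [NormedSpace ℝ G]

theorem SlowFamily.fderiv_apply {F : ℂ × X → G} (hF : SlowFamily F) (V : ℂ × X) :
    SlowFamily fun p => fderiv ℝ F p V := by
  have hF' : ContDiffOn ℝ ∞ (fderiv ℝ F) (strip X) := hF.1.fderiv_of_isOpen isOpen_strip (by simp)
  refine ⟨hF'.clm_apply contDiffOn_const, fun l τ₀ hτ₀ => ?_⟩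
  obtain ⟨N, C, hC⟩ := hF.2 (l + 1) τ₀ hτ₀
  refine ⟨N, C * ‖V‖, ?_⟩
  filter_upwards [hC, isOpen_teich.mem_nhds hτ₀] with τ h1 h2 A
  rw [← fderiv_iteratedFDeriv_apply isOpen_strip V l hF.1 _ (mem_strip h2 A)]
  have h3 : ‖fderiv ℝ (iteratedFDeriv ℝ l F) (τ, A) V‖ ≤
      ‖iteratedFDeriv ℝ (l + 1) F (τ, A)‖ * ‖V‖ := by
    rw [← norm_fderiv_iteratedFDeriv]
    exact ContinuousLinearMap.le_opNorm _ _
  calc _ ≤ ‖iteratedFDeriv ℝ (l + 1) F (τ, A)‖ * ‖V‖ := h3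
    _ ≤ (C * (1 + ‖A‖) ^ N) * ‖V‖ := by gcongr; exact h1 A
    _ = _ := by ring

theorem SlowFamily.const (c : G) : SlowFamily (fun _ : ℂ × X => c) :=
  slowFamily_comp_fst (c := fun _ => c) contDiffOn_const

end slowExtra

section kernel
open ComplexConjugate
variable {r : ℕ} {t τ : ℂ}

/-- The monomials in the Bargmann kernel. -/
def bMon (i : Fin r × Fin 6) (u : A0 r) : ℂ :=
  ![1, (u (Sum.inl i.1) : ℂ), u (Sum.inr i.1), u (Sum.inl i.1) * u (Sum.inl i.1),
    u (Sum.inl i.1) * u (Sum.inr i.1), u (Sum.inr i.1) * u (Sum.inr i.1)] i.2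

/-- The coefficients in the Bargmann kernel. -/
def bCoef (t : ℂ) (i : Fin r × Fin 6) : ℂ × AC r → ℂ :=
  ![fun p => (-(‖t‖ / 4 : ℂ)) * (p.2 (Sum.inl i.1) * conj (p.2 (Sum.inl i.1)) +
        p.2 (Sum.inr i.1) * conj (p.2 (Sum.inr i.1)))
      + (‖t‖ / 2 : ℂ) * (p.2 (Sum.inl i.1) * p.2 (Sum.inr i.1)),
    fun p => ((Complex.I / 2 * t) * (((Real.sqrt p.1.im)⁻¹ : ℝ) * p.1)) * p.2 (Sum.inl i.1) +
      ((Complex.I / 2 * conj t) * (((Real.sqrt p.1.im)⁻¹ : ℝ) * conj p.1)) * p.2 (Sum.inr i.1),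
    fun p => ((-(Complex.I / 2 * t)) * ((Real.sqrt p.1.im)⁻¹ : ℝ)) * p.2 (Sum.inl i.1) +
      ((-(Complex.I / 2 * conj t)) * ((Real.sqrt p.1.im)⁻¹ : ℝ)) * p.2 (Sum.inr i.1),
    fun p => -((‖t‖ - Complex.I * t.im) / 4) * (((Real.sqrt p.1.im)⁻¹ : ℝ) * ((Real.sqrt p.1.im)⁻¹ : ℝ) * (p.1 * conj p.1)),
    fun p => ((‖t‖ - Complex.I * t.im) / 4) * (((Real.sqrt p.1.im)⁻¹ : ℝ) * ((Real.sqrt p.1.im)⁻¹ : ℝ) * (p.1 + conj p.1)),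
    fun p => -((‖t‖ - Complex.I * t.im) / 4) * (((Real.sqrt p.1.im)⁻¹ : ℝ) * ((Real.sqrt p.1.im)⁻¹ : ℝ))] i.2

theorem bExp_eq_sum (u : A0 r) (p : ℂ × AC r) : bExp t p.1 u p.2 = ∑ i, bMon i u * bCoef t i p := by
  rw [bExp, Fintype.sum_prod_type]
  refine Finset.sum_congr rfl fun j _ => ?_
  simp only [Fin.sum_univ_six, bMon, bCoef, uCo]
  simp
  ring

theorem bCoef_slow (i : Fin r × Fin 6) : SlowFamily (bCoef t i) := by
  obtain ⟨j, i⟩ := i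
  have hc : ∀ a : Idx r, SlowFamily (fun p : ℂ × AC r => p.2 a) := fun a =>
    slowFamily_comp_snd (hasTemperateGrowth_coord a)
  have hcc : ∀ a : Idx r, SlowFamily (fun p : ℂ × AC r => conj (p.2 a)) := fun a =>
    slowFamily_comp_snd (hasTemperateGrowth_conj a)
  have hw := contDiffOn_ofReal contDiffOn_sqrt_im_inv
  have hcj : ContDiffOn ℝ ∞ (fun τ : ℂ => conj τ) teich := contDiff_conj'.contDiffOn
  have hfst : ∀ {c : ℂ → ℂ}, ContDiffOn ℝ ∞ c teich → SlowFamily (fun p : ℂ × AC r => c p.1) :=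
    fun h => slowFamily_comp_fst h
  fin_cases i
  · exact ((SlowFamily.const _).mul (((hc _).mul (hcc _)).add ((hc _).mul (hcc _)))).add
      ((SlowFamily.const _).mul ((hc _).mul (hc _)))
  · exact ((hfst (contDiffOn_const.mul (hw.mul contDiffOn_id))).mul (hc _)).add
      ((hfst (contDiffOn_const.mul (hw.mul hcj))).mul (hc _))
  · exact ((hfst (contDiffOn_const.mul hw)).mul (hc _)).add ((hfst (contDiffOn_const.mul hw)).mul (hc _))
  · exact hfst (contDiffOn_const.mul ((hw.mul hw).mul (contDiffOn_id.mul hcj)))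
  · exact hfst (contDiffOn_const.mul ((hw.mul hw).mul (contDiffOn_id.add hcj)))
  · exact hfst (contDiffOn_const.mul (hw.mul hw))

theorem bMon_temperate (i : Fin r × Fin 6) : (bMon i : A0 r → ℂ).HasTemperateGrowth := by
  obtain ⟨j, i⟩ := i
  have h := hasTemperateGrowth_coord0 (r := r)
  fin_cases i
  · exact Function.HasTemperateGrowth.const (1 : ℂ)
  · exact h _
  · exact h _
  · exact (h _).mul (h _)
  · exact (h _).mul (h _)
  · exact (h _).mul (h _)

/-- Integration of a section against the Bargmann kernel. -/
def bInt (t : ℂ) (ψ : A0 r → ℂ) (p : ℂ × AC r) : ℂ := ∫ u, ψ u * Complex.exp (bExp t p.1 u p.2)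

/-- Multiplication by a monomial. -/
def bMul (i : Fin r × Fin 6) : S0 r →L[ℂ] S0 r := SchwartzMap.smulLeftCLM ℂ (bMon i)

theorem bMul_apply (i : Fin r × Fin 6) (ψ : S0 r) (u : A0 r) : bMul i ψ u = bMon i u * ψ u :=
  SchwartzMap.smulLeftCLM_apply_apply (bMon_temperate i) ψ u

theorem contDiff_bExp (p : ℂ × AC r) : ContDiff ℝ ∞ (fun u : A0 r => bExp t p.1 u p.2) := by
  simp only [bExp_eq_sum]
  exact ContDiff.sum fun i _ => (bMon_temperate i).1.mul contDiff_const

theorem contDiff_exp_bExp (p : ℂ × AC r) : ContDiff ℝ ∞ (fun u : A0 r => Complex.exp (bExp t p.1 u p.2)) :=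
  (contDiff_bExp p).cexp

theorem integrable_bInt (ht : t ≠ 0) (ψ : S0 r) (p : ℂ × AC r) :
    Integrable (fun u => ψ u * Complex.exp (bExp t p.1 u p.2)) := by
  refine ψ.integrable.mono (ψ.continuous.mul (contDiff_exp_bExp p).continuous).aestronglyMeasurable
    (Eventually.of_forall fun u => ?_)
  rw [norm_mul]
  exact mul_le_of_le_one_right (norm_nonneg _) (norm_exp_bExp_le ht u p.2)

theorem norm_bInt_le (ht : t ≠ 0) (ψ : S0 r) (p : ℂ × AC r) : ‖bInt t ψ p‖ ≤ ∫ u, ‖ψ u‖ := by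
  refine norm_integral_le_of_norm_le ψ.integrable.norm (Eventually.of_forall fun u => ?_)
  rw [norm_mul]
  exact mul_le_of_le_one_right (norm_nonneg _) (norm_exp_bExp_le ht u p.2)

theorem bInt_add (ht : t ≠ 0) (ψ χ : S0 r) (p : ℂ × AC r) : bInt t (ψ + χ : S0 r) p = bInt t ψ p + bInt t χ p := by
  rw [bInt, bInt, bInt, ← integral_add (integrable_bInt ht ψ p) (integrable_bInt ht χ p)]
  exact integral_congr_ae (Eventually.of_forall fun u => by simp; ring)

theorem bInt_smul (c : ℂ) (ψ : S0 r) (p : ℂ × AC r) : bInt t (c • ψ : S0 r) p = c * bInt t ψ p := by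
  rw [bInt, bInt, ← integral_const_mul]
  exact integral_congr_ae (Eventually.of_forall fun u => by simp; ring)

/-- The derivative of the integrand of `bInt`. -/
def bIntegrand' (t : ℂ) (ψ : S0 r) (q : ℂ × AC r) (u : A0 r) : ℂ × AC r →L[ℝ] ℂ :=
  ∑ i, (bMul i ψ u * Complex.exp (bExp t q.1 u q.2)) • fderiv ℝ (bCoef t i) q

theorem hasFDerivAt_bCoef (i : Fin r × Fin 6) {p : ℂ × AC r} (hp : p ∈ strip (AC r)) :
    HasFDerivAt (bCoef t i) (fderiv ℝ (bCoef t i) p) p :=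
  ((strip_contDiffAt (bCoef_slow i).1 hp).differentiableAt (by simp)).hasFDerivAt

theorem hasFDerivAt_bIntegrand (ψ : S0 r) {q : ℂ × AC r} (hq : q ∈ strip (AC r)) (u : A0 r) :
    HasFDerivAt (fun q : ℂ × AC r => ψ u * Complex.exp (bExp t q.1 u q.2)) (bIntegrand' t ψ q u) q := by
  have h1 : HasFDerivAt (fun q : ℂ × AC r => bExp t q.1 u q.2) (∑ i, bMon i u • fderiv ℝ (bCoef t i) q) q := by
    simp only [bExp_eq_sum]
    exact HasFDerivAt.fun_sum fun i _ => (hasFDerivAt_bCoef i hq).const_mul _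
  refine (h1.cexp.const_mul (ψ u)).congr_fderiv ?_
  simp only [bIntegrand', Finset.smul_sum, smul_smul, bMul_apply]
  exact Finset.sum_congr rfl fun i _ => by congr 1; ring

theorem norm_bIntegrand'_le (ht : t ≠ 0) (ψ : S0 r) (q : ℂ × AC r) (u : A0 r) :
    ‖bIntegrand' t ψ q u‖ ≤ ∑ i, ‖bMul i ψ u‖ * ‖fderiv ℝ (bCoef t i) q‖ := by
  refine (norm_sum_le _ _).trans (Finset.sum_le_sum fun i _ => ?_)
  rw [norm_smul, norm_mul]
  gcongr
  exact mul_le_of_le_one_right (norm_nonneg _) (norm_exp_bExp_le ht u q.2)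

theorem continuous_bIntegrand' (ψ : S0 r) (p : ℂ × AC r) : Continuous (bIntegrand' t ψ p) := by
  unfold bIntegrand'
  exact continuous_finset_sum _ fun i _ =>
    ((bMul i ψ).continuous.mul (contDiff_exp_bExp p).continuous).smul continuous_const

theorem integral_bIntegrand' (ht : t ≠ 0) (ψ : S0 r) (p : ℂ × AC r) :
    ∫ u, bIntegrand' t ψ p u = ∑ i, bInt t (bMul i ψ) p • fderiv ℝ (bCoef t i) p := by
  unfold bIntegrand'
  rw [integral_finset_sum _ fun i _ => (integrable_bInt ht (bMul i ψ) p).smul_const _]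
  exact Finset.sum_congr rfl fun i _ => integral_smul_const _ _

theorem eventually_norm_fderiv_bCoef_lt {p : ℂ × AC r} (hp : p ∈ strip (AC r)) :
    ∀ᶠ q in 𝓝 p, ∀ i, ‖fderiv ℝ (bCoef t i) q‖ < ‖fderiv ℝ (bCoef t i) p‖ + 1 := by
  refine eventually_all.2 fun i => ?_
  have h1 : ContDiffOn ℝ ∞ (fderiv ℝ (bCoef t i)) (strip (AC r)) :=
    (bCoef_slow i).1.fderiv_of_isOpen (m := ∞) isOpen_strip (by simp)
  have h2 : ContinuousAt (fun p => ‖fderiv ℝ (bCoef t i) p‖) p :=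
    (h1.continuousOn.continuousAt (isOpen_strip.mem_nhds hp)).norm
  exact h2.eventually_lt continuousAt_const (by simp)

theorem hasFDerivAt_bInt (ht : t ≠ 0) (ψ : S0 r) {p : ℂ × AC r} (hp : p ∈ strip (AC r)) :
    HasFDerivAt (bInt t ψ) (∑ i, bInt t (bMul i ψ) p • fderiv ℝ (bCoef t i) p) p := by
  rw [← integral_bIntegrand' ht]
  have hs : {q | q ∈ strip (AC r) ∧ ∀ i, ‖fderiv ℝ (bCoef t i) q‖ < ‖fderiv ℝ (bCoef t i) p‖ + 1} ∈ 𝓝 p :=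
    inter_mem (isOpen_strip.mem_nhds hp) (eventually_norm_fderiv_bCoef_lt hp)
  refine hasFDerivAt_integral_of_dominated_of_fderiv_le (𝕜 := ℝ) (μ := volume)
    (bound := fun u => ∑ i, ‖bMul i ψ u‖ * (‖fderiv ℝ (bCoef t i) p‖ + 1)) hs
    (Eventually.of_forall fun q => (integrable_bInt ht ψ q).aestronglyMeasurable)
    (integrable_bInt ht ψ p) (continuous_bIntegrand' ψ p).aestronglyMeasurable
    (Eventually.of_forall fun u q hq => (norm_bIntegrand'_le ht ψ q u).trans ?_)
    (integrable_finset_sum _ fun i _ => (bMul i ψ).integrable.norm.mul_const _)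
    (Eventually.of_forall fun u q hq => hasFDerivAt_bIntegrand ψ hq.1 u)
  exact Finset.sum_le_sum fun i _ => mul_le_mul_of_nonneg_left (hq.2 i).le (norm_nonneg _)

/-- Integration by parts against the Bargmann kernel. -/
theorem bInt_lineDeriv (ht : t ≠ 0) (ψ : S0 r) {p : ℂ × AC r} (v : A0 r) (χ : S0 r)
    (hχ : ∀ u, χ u = ψ u * fderiv ℝ (fun u => bExp t p.1 u p.2) u v) :
    bInt t (fun u => fderiv ℝ ψ u v) p = -bInt t χ p := by
  have hE : ∀ u, fderiv ℝ (fun u => Complex.exp (bExp t p.1 u p.2)) u v =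
      Complex.exp (bExp t p.1 u p.2) * fderiv ℝ (fun u => bExp t p.1 u p.2) u v := fun u => by
    rw [(((contDiff_bExp p).differentiable (by simp) u).hasFDerivAt.cexp).fderiv]; simp
  have e : ∀ u, χ u * Complex.exp (bExp t p.1 u p.2) =
      ψ u * fderiv ℝ (fun u => Complex.exp (bExp t p.1 u p.2)) u v := fun u => by
    rw [hE, hχ]; ring
  have h := integral_mul_fderiv_eq_neg_fderiv_mul_of_integrable (μ := volume) (f := ψ)
    (g := fun u => Complex.exp (bExp t p.1 u p.2)) (v := v)
    (integrable_bInt ht (LineDeriv.lineDerivOpCLM ℂ (S0 r) v ψ) p)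
    (by simp only [← e]; exact integrable_bInt ht χ p) (integrable_bInt ht ψ p)
    (fun u _ => ψ.differentiableAt) (fun u _ => (contDiff_exp_bExp p).differentiable (by simp) u)
  rw [bInt, bInt]
  simp only [e]
  rw [h, neg_neg]

theorem uCo_add_inl (u : A0 r) (s : ℝ) (j i : Fin r) : uCo τ (u + s • basis0 (Sum.inl j)) i =
    uCo τ u i + s * (if j = i then -(((Real.sqrt τ.im)⁻¹ : ℝ) * τ) else 0) := by
  by_cases h : j = i
  · subst h; simp [uCo, basis0]; ring
  · simp [uCo, basis0, h, Ne.symm h]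

theorem uCo_add_inr (u : A0 r) (s : ℝ) (j i : Fin r) : uCo τ (u + s • basis0 (Sum.inr j)) i =
    uCo τ u i + s * (if j = i then (((Real.sqrt τ.im)⁻¹ : ℝ) : ℂ) else 0) := by
  by_cases h : j = i
  · subst h; simp [uCo, basis0]; ring
  · simp [uCo, basis0, h, Ne.symm h]

theorem fderiv_bExp (u : A0 r) (p : ℂ × AC r) (v : A0 r) (d : Fin r → ℂ)
    (hv : ∀ (s : ℝ) i, uCo p.1 (u + s • v) i = uCo p.1 u i + s * d i) :
    fderiv ℝ (fun u => bExp t p.1 u p.2) u v = ∑ i, (-(Complex.I / 2) * (t * d i * p.2 (Sum.inl i) +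
      conj t * conj (d i) * p.2 (Sum.inr i)) - (‖t‖ - Complex.I * t.im) / 4 *
        (d i * conj (uCo p.1 u i) + uCo p.1 u i * conj (d i))) := by
  rw [← ((contDiff_bExp p).differentiable (by simp) u).lineDeriv_eq_fderiv]
  refine HasDerivAt.deriv ?_
  simp only [bExp, hv]
  refine HasDerivAt.fun_sum fun i _ => ?_
  have h1 := hasDerivAt_affine (uCo p.1 u i) (d i)
  have h2 : HasDerivAt (fun s : ℝ => conj (uCo p.1 u i + s * d i)) (conj (d i)) 0 := by
    simpa using hasDerivAt_affine (conj (uCo p.1 u i)) (conj (d i))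
  have h3 := ((((h1.const_mul t).mul_const (p.2 (Sum.inl i))).add
    ((h2.const_mul (conj t)).mul_const (p.2 (Sum.inr i)))).const_mul (Complex.I / 2)).const_sub
    (-(‖t‖ / 4 : ℂ) * (p.2 (Sum.inl i) * conj (p.2 (Sum.inl i)) + p.2 (Sum.inr i) * conj (p.2 (Sum.inr i)))
    + ‖t‖ / 2 * (p.2 (Sum.inl i) * p.2 (Sum.inr i)))
  refine (h3.sub ((h1.mul h2).const_mul ((‖t‖ - Complex.I * t.im) / 4 : ℂ))).congr_deriv ?_
  simp

/-- Multiplication by `uCo`. -/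
def mulU (τ : ℂ) (j : Fin r) : S0 r →L[ℂ] S0 r := SchwartzMap.smulLeftCLM ℂ (fun u => uCo τ u j)

/-- Multiplication by the conjugate of `uCo`. -/
def mulUc (τ : ℂ) (j : Fin r) : S0 r →L[ℂ] S0 r := SchwartzMap.smulLeftCLM ℂ (fun u => conj (uCo τ u j))

theorem mulU_apply (τ : ℂ) (j : Fin r) (ψ : S0 r) (u : A0 r) : mulU τ j ψ u = uCo τ u j * ψ u := by
  refine SchwartzMap.smulLeftCLM_apply_apply ?_ ψ u
  exact (Function.HasTemperateGrowth.const _).mul ((hasTemperateGrowth_coord0 _).sub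
    ((Function.HasTemperateGrowth.const _).mul (hasTemperateGrowth_coord0 _)))

theorem mulUc_apply (τ : ℂ) (j : Fin r) (ψ : S0 r) (u : A0 r) : mulUc τ j ψ u = conj (uCo τ u j) * ψ u := by
  refine SchwartzMap.smulLeftCLM_apply_apply ?_ ψ u
  have : (fun u : A0 r => conj (uCo τ u j)) = fun u => (((Real.sqrt τ.im)⁻¹ : ℝ) : ℂ) *
      ((u (Sum.inr j) : ℂ) - conj τ * u (Sum.inl j)) := by
    ext u; simp [uCo]
  rw [this]
  exact (Function.HasTemperateGrowth.const _).mul ((hasTemperateGrowth_coord0 _).sub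
    ((Function.HasTemperateGrowth.const _).mul (hasTemperateGrowth_coord0 _)))

theorem pDer_uCo (hτ : τ ∈ teich) (k : ℝ) (j : Fin r) (ψ : A0 r → ℂ) (u : A0 r) : pDer k τ j ψ u =
    fderiv ℝ ψ u (basis0 (Sum.inl j)) + τ * fderiv ℝ ψ u (basis0 (Sum.inr j)) +
    Complex.I / 2 * k * Real.sqrt τ.im * uCo τ u j * ψ u := by
  have h3 := sqrt_im_mul_inv hτ
  rw [pDer_eq, uCo]
  linear_combination (-(Complex.I / 2 * k * (u (Sum.inr j) - τ * u (Sum.inl j)) * ψ u)) * h3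

theorem pDer_conj_uCo (hτ : τ ∈ teich) (k : ℝ) (j : Fin r) (ψ : A0 r → ℂ) (u : A0 r) : pDer k (conj τ) j ψ u =
    fderiv ℝ ψ u (basis0 (Sum.inl j)) + conj τ * fderiv ℝ ψ u (basis0 (Sum.inr j)) +
    Complex.I / 2 * k * Real.sqrt τ.im * conj (uCo τ u j) * ψ u := by
  have h3 := sqrt_im_mul_inv hτ
  rw [pDer_eq, uCo]
  simp only [map_mul, map_sub, Complex.conj_ofReal]
  linear_combination (-(Complex.I / 2 * k * (u (Sum.inr j) - conj τ * u (Sum.inl j)) * ψ u)) * h3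

theorem bInt_pDer (ht : t ≠ 0) (hτ : τ ∈ teich) (k : ℝ) (j : Fin r) (ψ : S0 r) (y : AC r) :
    bInt t (pDerS k τ j ψ) (τ, y) = Real.sqrt τ.im * (-(conj t * y (Sum.inr j) * bInt t ψ (τ, y)) +
      Complex.I / 2 * (‖t‖ - Complex.I * t.im + k) * bInt t (mulU τ j ψ) (τ, y)) := by
  have h2 := sqrt_im_mul_self hτ
  have h3 := sqrt_im_mul_inv hτ
  have h4 := Complex.I_mul_I
  let l := LineDeriv.lineDerivOpCLM ℂ (S0 r) (basis0 (Sum.inl j) : A0 r) ψ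
  let m := LineDeriv.lineDerivOpCLM ℂ (S0 r) (basis0 (Sum.inr j) : A0 r) ψ
  let w' : ℂ := ((Real.sqrt τ.im)⁻¹ : ℝ)
  let w : ℂ := (Real.sqrt τ.im : ℝ)
  have e1 := bInt_lineDeriv (t := t) (p := (τ, y)) ht ψ (basis0 (Sum.inl j))
    (((-(Complex.I / 2) * (t * (-(w' * τ)) * y (Sum.inl j) + conj t * conj (-(w' * τ)) * y (Sum.inr j)))) • ψ
      + (-((‖t‖ - Complex.I * t.im) / 4) * (-(w' * τ))) • mulUc τ j ψ
      + (-((‖t‖ - Complex.I * t.im) / 4) * conj (-(w' * τ))) • mulU τ j ψ) (fun u => by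
      rw [fderiv_bExp u (τ, y) _ _ (fun s i => uCo_add_inl u s j i),
        Finset.sum_eq_single j (fun i _ hi => by simp [Ne.symm hi]) (by simp)]
      simp [mulU_apply, mulUc_apply, w']
      ring)
  have e2 := bInt_lineDeriv (t := t) (p := (τ, y)) ht ψ (basis0 (Sum.inr j))
    (((-(Complex.I / 2) * (t * w' * y (Sum.inl j) + conj t * conj w' * y (Sum.inr j)))) • ψ
      + (-((‖t‖ - Complex.I * t.im) / 4) * w') • mulUc τ j ψ
      + (-((‖t‖ - Complex.I * t.im) / 4) * conj w') • mulU τ j ψ) (fun u => by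
      rw [fderiv_bExp u (τ, y) _ _ (fun s i => uCo_add_inr u s j i),
        Finset.sum_eq_single j (fun i _ hi => by simp [Ne.symm hi]) (by simp)]
      simp [mulU_apply, mulUc_apply, w']
      ring)
  have e3 : pDerS k τ j ψ = l + τ • m + (Complex.I / 2 * k * w) • mulU τ j ψ := by
    ext u
    rw [pDerS_apply, pDer_uCo hτ]
    simp only [SchwartzMap.add_apply, SchwartzMap.smul_apply, mulU_apply, smul_eq_mul]
    change _ = fderiv ℝ ψ u _ + τ * fderiv ℝ ψ u _ + _
    ring
  have e1' : bInt t l (τ, y) = _ := e1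
  have e2' : bInt t m (τ, y) = _ := e2
  rw [e3]
  simp only [bInt_add ht, bInt_smul] at e1' e2' ⊢
  rw [e1', e2']
  have hw : conj w' = w' := Complex.conj_ofReal _
  simp only [map_neg, map_mul, hw]
  change 2 * Complex.I * w ^ 2 = _ at h2
  change w * w' = 1 at h3
  change _ = w * _
  clear e1 e2 e1' e2' e3
  clear_value w w' l m
  generalize bInt t (mulU τ j ψ) (τ, y) = J1
  generalize bInt t (mulUc τ j ψ) (τ, y) = J2
  generalize bInt t ψ (τ, y) = J0
  generalize (t.im : ℂ) = s at *
  generalize (‖t‖ : ℂ) = n at *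
  generalize conj t = t' at *
  generalize conj τ = τ' at *
  generalize y (Sum.inl j) = a at *
  generalize y (Sum.inr j) = b at *
  generalize (k : ℂ) = k at *
  clear hw
  generalize Complex.I = i at *
  grind

theorem bInt_pDer_conj (ht : t ≠ 0) (hτ : τ ∈ teich) (k : ℝ) (j : Fin r) (ψ : S0 r) (y : AC r) :
    bInt t (pDerS k (conj τ) j ψ) (τ, y) = Real.sqrt τ.im * (t * y (Sum.inl j) * bInt t ψ (τ, y) -
      Complex.I / 2 * (‖t‖ - Complex.I * t.im - k) * bInt t (mulUc τ j ψ) (τ, y)) := by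
  have h2 := sqrt_im_mul_self hτ
  have h3 := sqrt_im_mul_inv hτ
  have h4 := Complex.I_mul_I
  let l := LineDeriv.lineDerivOpCLM ℂ (S0 r) (basis0 (Sum.inl j) : A0 r) ψ
  let m := LineDeriv.lineDerivOpCLM ℂ (S0 r) (basis0 (Sum.inr j) : A0 r) ψ
  let w' : ℂ := ((Real.sqrt τ.im)⁻¹ : ℝ)
  let w : ℂ := (Real.sqrt τ.im : ℝ)
  have e1 := bInt_lineDeriv (t := t) (p := (τ, y)) ht ψ (basis0 (Sum.inl j))
    (((-(Complex.I / 2) * (t * (-(w' * τ)) * y (Sum.inl j) + conj t * conj (-(w' * τ)) * y (Sum.inr j)))) • ψ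
      + (-((‖t‖ - Complex.I * t.im) / 4) * (-(w' * τ))) • mulUc τ j ψ
      + (-((‖t‖ - Complex.I * t.im) / 4) * conj (-(w' * τ))) • mulU τ j ψ) (fun u => by
      rw [fderiv_bExp u (τ, y) _ _ (fun s i => uCo_add_inl u s j i),
        Finset.sum_eq_single j (fun i _ hi => by simp [Ne.symm hi]) (by simp)]
      simp [mulU_apply, mulUc_apply, w']
      ring)
  have e2 := bInt_lineDeriv (t := t) (p := (τ, y)) ht ψ (basis0 (Sum.inr j))
    (((-(Complex.I / 2) * (t * w' * y (Sum.inl j) + conj t * conj w' * y (Sum.inr j)))) • ψ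
      + (-((‖t‖ - Complex.I * t.im) / 4) * w') • mulUc τ j ψ
      + (-((‖t‖ - Complex.I * t.im) / 4) * conj w') • mulU τ j ψ) (fun u => by
      rw [fderiv_bExp u (τ, y) _ _ (fun s i => uCo_add_inr u s j i),
        Finset.sum_eq_single j (fun i _ hi => by simp [Ne.symm hi]) (by simp)]
      simp [mulU_apply, mulUc_apply, w']
      ring)
  have e3 : pDerS k (conj τ) j ψ = l + conj τ • m + (Complex.I / 2 * k * w) • mulUc τ j ψ := by
    ext u
    rw [pDerS_apply, pDer_conj_uCo hτ]
    simp only [SchwartzMap.add_apply, SchwartzMap.smul_apply, mulUc_apply, smul_eq_mul]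
    change _ = fderiv ℝ ψ u _ + conj τ * fderiv ℝ ψ u _ + _
    ring
  have e1' : bInt t l (τ, y) = _ := e1
  have e2' : bInt t m (τ, y) = _ := e2
  rw [e3]
  simp only [bInt_add ht, bInt_smul] at e1' e2' ⊢
  rw [e1', e2']
  have hw : conj w' = w' := Complex.conj_ofReal _
  simp only [map_neg, map_mul, hw]
  change 2 * Complex.I * w ^ 2 = _ at h2
  change w * w' = 1 at h3
  change _ = w * _
  clear e1 e2 e1' e2' e3
  clear_value w w' l m
  generalize bInt t (mulU τ j ψ) (τ, y) = J1
  generalize bInt t (mulUc τ j ψ) (τ, y) = J2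
  generalize bInt t ψ (τ, y) = J0
  generalize (t.im : ℂ) = s at *
  generalize (‖t‖ : ℂ) = n at *
  generalize conj t = t' at *
  generalize conj τ = τ' at *
  generalize y (Sum.inl j) = a at *
  generalize y (Sum.inr j) = b at *
  generalize (k : ℂ) = k at *
  clear hw
  generalize Complex.I = i at *
  grind

end kernel
end GenusOne

end

noncomputable section
namespace GenusOne
open Filter

section schwartzSize
variable {E : Type} [NormedAddCommGroup E] [NormedSpace ℝ E]

/-- A finite sum of Schwartz seminorms. -/
def schwartzSize (k : Finset (ℕ × ℕ)) (ψ : 𝓢(E, ℂ)) : ℝ :=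
  ∑ i ∈ k, schwartzSeminormFamily ℂ E ℂ i ψ

theorem schwartzSize_nonneg (k : Finset (ℕ × ℕ)) (ψ : 𝓢(E, ℂ)) : 0 ≤ schwartzSize k ψ :=
  Finset.sum_nonneg fun _ _ => apply_nonneg _ _

theorem schwartzSize_directed (s : Finset (Finset (ℕ × ℕ))) :
    ∃ k', ∀ k ∈ s, ∀ ψ : 𝓢(E, ℂ), schwartzSize k ψ ≤ schwartzSize k' ψ := by
  classical
  exact ⟨s.biUnion id, fun k hk ψ => Finset.sum_le_sum_of_subset_of_nonneg
    (Finset.subset_biUnion_of_mem id hk) fun _ _ _ => apply_nonneg _ _⟩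

theorem Seminorm.exists_le_schwartzSize (q : Seminorm ℂ 𝓢(E, ℂ)) (hq : Continuous q) :
    ∃ k, ∃ C : ℝ, 0 ≤ C ∧ ∀ ψ, q ψ ≤ C * schwartzSize k ψ := by
  obtain ⟨s, C, -, h⟩ := Seminorm.bound_of_continuous (schwartz_withSeminorms ℂ E ℂ) q hq
  refine ⟨s, C, C.2, fun ψ => (h ψ).trans ?_⟩
  change (C : ℝ) * _ ≤ _
  refine mul_le_mul_of_nonneg_left ?_ C.2
  exact (Seminorm.finset_sup_le_sum _ s ψ).trans_eq (by
    rw [schwartzSize, ← Seminorm.coeFnAddMonoidHom_apply, map_sum, Finset.sum_apply]; rfl)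

theorem exists_schwartzSize_clm_le (T : 𝓢(E, ℂ) →L[ℂ] 𝓢(E, ℂ)) (k : Finset (ℕ × ℕ)) :
    ∃ k', ∃ C : ℝ, 0 ≤ C ∧ ∀ ψ, schwartzSize k (T ψ) ≤ C * schwartzSize k' ψ := by
  have hi : ∀ i, Continuous ((schwartzSeminormFamily ℂ E ℂ i).comp (T : 𝓢(E, ℂ) →ₗ[ℂ] 𝓢(E, ℂ))) := fun i =>
    ((schwartz_withSeminorms ℂ E ℂ).continuous_seminorm i).comp T.continuous
  choose s C hC h using fun i => Seminorm.exists_le_schwartzSize _ (hi i)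
  obtain ⟨k', hk'⟩ := schwartzSize_directed (E := E) (k.image s)
  refine ⟨k', ∑ i ∈ k, C i, Finset.sum_nonneg fun i _ => hC i, fun ψ => ?_⟩
  rw [Finset.sum_mul]
  refine Finset.sum_le_sum fun i hi => (h i ψ).trans (mul_le_mul_of_nonneg_left ?_ (hC i))
  exact hk' _ (Finset.mem_image_of_mem s hi) ψ

theorem exists_integral_norm_le_schwartzSize [MeasurableSpace E] [BorelSpace E] [SecondCountableTopology E]
    (μ : Measure E) [μ.HasTemperateGrowth] :
    ∃ k, ∃ C : ℝ, 0 ≤ C ∧ ∀ ψ : 𝓢(E, ℂ), ∫ u, ‖ψ u‖ ∂μ ≤ C * schwartzSize k ψ := by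
  let T := SchwartzMap.toLpCLM ℂ (E := E) ℂ 1 μ
  obtain ⟨k, C, hC, h⟩ := Seminorm.exists_le_schwartzSize
    ((normSeminorm ℂ (Lp ℂ 1 μ)).comp (T : 𝓢(E, ℂ) →ₗ[ℂ] Lp ℂ 1 μ)) (continuous_norm.comp T.continuous)
  refine ⟨k, C, hC, fun ψ => ?_⟩
  rw [← SchwartzMap.norm_toLp_one]
  exact h ψ

end schwartzSize

section kernel
open ComplexConjugate
variable {r : ℕ} {t τ : ℂ}

/-- The operators controlling the decay of the Bargmann transform. -/
def bDecay (i : Fin r × Fin 4) : S0 r →L[ℂ] S0 r :=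
  ![LineDeriv.lineDerivOpCLM ℂ (S0 r) (basis0 (Sum.inl i.1) : A0 r),
    LineDeriv.lineDerivOpCLM ℂ (S0 r) (basis0 (Sum.inr i.1) : A0 r), bMul (i.1, 1), bMul (i.1, 2)] i.2

theorem mulU_eq (τ : ℂ) (j : Fin r) (ψ : S0 r) : mulU τ j ψ =
    (((Real.sqrt τ.im)⁻¹ : ℝ) : ℂ) • bMul (j, 2) ψ + (-((((Real.sqrt τ.im)⁻¹ : ℝ) : ℂ) * τ)) • bMul (j, 1) ψ := by
  ext u
  simp [mulU_apply, bMul_apply, uCo, bMon]; ring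

theorem mulUc_eq (τ : ℂ) (j : Fin r) (ψ : S0 r) : mulUc τ j ψ =
    (((Real.sqrt τ.im)⁻¹ : ℝ) : ℂ) • bMul (j, 2) ψ + (-((((Real.sqrt τ.im)⁻¹ : ℝ) : ℂ) * conj τ)) • bMul (j, 1) ψ := by
  ext u
  simp [mulUc_apply, bMul_apply, uCo, bMon]; ring

theorem pDerS_zero (z : ℂ) (j : Fin r) (ψ : S0 r) : pDerS 0 z j ψ = bDecay (j, 0) ψ + z • bDecay (j, 1) ψ := by
  ext u
  simp [pDerS, bDecay]

theorem coord_inr_mul_bInt (ht : t ≠ 0) (hτ : τ ∈ teich) (j : Fin r) (ψ : S0 r) (y : AC r) :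
    conj t * (y (Sum.inr j) * bInt t ψ (τ, y)) = (((Real.sqrt τ.im)⁻¹ : ℝ) : ℂ) *
      (-(bInt t (bDecay (j, 0) ψ) (τ, y)) - τ * bInt t (bDecay (j, 1) ψ) (τ, y) +
        Complex.I / 2 * (‖t‖ - Complex.I * t.im) * (bInt t (bDecay (j, 3) ψ) (τ, y)
          - τ * bInt t (bDecay (j, 2) ψ) (τ, y))) := by
  have h := bInt_pDer ht hτ 0 j ψ y
  have h3 := sqrt_im_mul_inv hτ
  rw [pDerS_zero, mulU_eq] at h
  simp only [bInt_add ht, bInt_smul] at h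
  have e2 : bInt t (bDecay (j, 2) ψ) (τ, y) = bInt t (bMul (j, 1) ψ) (τ, y) := rfl
  have e3 : bInt t (bDecay (j, 3) ψ) (τ, y) = bInt t (bMul (j, 2) ψ) (τ, y) := rfl
  rw [e2, e3]
  generalize ((Real.sqrt τ.im : ℝ) : ℂ) = w at *
  generalize (((Real.sqrt τ.im)⁻¹ : ℝ) : ℂ) = w' at *
  simp only [Complex.ofReal_zero] at h
  linear_combination w' * h + (-(conj t * (y (Sum.inr j) * bInt t ψ (τ, y))) + Complex.I / 2 * (‖t‖ - Complex.I * t.im) * (w' * bInt t (bMul (j, 2) ψ) (τ, y) - w' * τ * bInt t (bMul (j, 1) ψ) (τ, y))) * h3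

theorem coord_inl_mul_bInt (ht : t ≠ 0) (hτ : τ ∈ teich) (j : Fin r) (ψ : S0 r) (y : AC r) :
    t * (y (Sum.inl j) * bInt t ψ (τ, y)) = (((Real.sqrt τ.im)⁻¹ : ℝ) : ℂ) *
      ((bInt t (bDecay (j, 0) ψ) (τ, y)) + conj τ * bInt t (bDecay (j, 1) ψ) (τ, y) +
        Complex.I / 2 * (‖t‖ - Complex.I * t.im) * (bInt t (bDecay (j, 3) ψ) (τ, y)
          - conj τ * bInt t (bDecay (j, 2) ψ) (τ, y))) := by
  have h := bInt_pDer_conj ht hτ 0 j ψ y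
  have h3 := sqrt_im_mul_inv hτ
  rw [pDerS_zero, mulUc_eq] at h
  simp only [bInt_add ht, bInt_smul] at h
  have e2 : bInt t (bDecay (j, 2) ψ) (τ, y) = bInt t (bMul (j, 1) ψ) (τ, y) := rfl
  have e3 : bInt t (bDecay (j, 3) ψ) (τ, y) = bInt t (bMul (j, 2) ψ) (τ, y) := rfl
  rw [e2, e3]
  generalize ((Real.sqrt τ.im : ℝ) : ℂ) = w at *
  generalize (((Real.sqrt τ.im)⁻¹ : ℝ) : ℂ) = w' at *
  simp only [Complex.ofReal_zero] at h
  linear_combination (-w') * h + (-(t * (y (Sum.inl j) * bInt t ψ (τ, y))) + Complex.I / 2 * (‖t‖ - Complex.I * t.im) * (w' * bInt t (bMul (j, 2) ψ) (τ, y) - w' * conj τ * bInt t (bMul (j, 1) ψ) (τ, y))) * h3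

/-- The bound for the coefficients in the decay estimate. -/
def bBound (t τ : ℂ) : ℝ := ‖t‖⁻¹ * ((Real.sqrt τ.im)⁻¹ * ((1 + ‖τ‖) * (1 + ‖(‖t‖ : ℂ) - Complex.I * t.im‖)))

theorem norm_combination_le {a b c d z m : ℂ} : ‖a + z * b + m * (d - z * c)‖ ≤
    (1 + ‖z‖) * (1 + ‖m‖) * (‖a‖ + ‖b‖ + ‖c‖ + ‖d‖) := by
  have h1 : ‖a + z * b + m * (d - z * c)‖ ≤ ‖a‖ + ‖z‖ * ‖b‖ + ‖m‖ * (‖d‖ + ‖z‖ * ‖c‖) := by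
    refine (norm_add_le _ _).trans (add_le_add ((norm_add_le _ _).trans_eq (by rw [norm_mul])) ?_)
    rw [norm_mul]
    gcongr
    exact (norm_sub_le _ _).trans_eq (by rw [norm_mul])
  refine h1.trans ?_
  have := norm_nonneg a; have := norm_nonneg b; have := norm_nonneg c; have := norm_nonneg d
  have := norm_nonneg z; have := norm_nonneg m
  have : 0 ≤ ‖z‖ * ‖a‖ + ‖b‖ + ‖c‖ + ‖d‖ + ‖z‖ * ‖c‖ + ‖z‖ * ‖d‖ + ‖m‖ * (‖a‖ + ‖b‖ + ‖c‖ + ‖z‖ * ‖a‖ + ‖z‖ * ‖b‖ + ‖z‖ * ‖d‖) := by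
    positivity
  nlinarith

theorem norm_coord_mul_bInt_le (ht : t ≠ 0) (hτ : τ ∈ teich) (a : Idx r) (ψ : S0 r) (y : AC r) :
    ‖y a‖ * ‖bInt t ψ (τ, y)‖ ≤ bBound t τ * ∑ i, ‖bInt t (bDecay i ψ) (τ, y)‖ := by
  have hn : 0 < ‖t‖ := norm_pos_iff.2 ht
  have hhalf : ‖Complex.I / 2 * ((‖t‖ : ℂ) - Complex.I * t.im)‖ ≤ ‖(‖t‖ : ℂ) - Complex.I * t.im‖ := by
    rw [norm_mul]
    refine mul_le_of_le_one_left (norm_nonneg _) ?_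
    simp; norm_num
  have hw : 0 ≤ (Real.sqrt τ.im)⁻¹ := by positivity
  have hsum : ∀ j : Fin r, ‖bInt t (bDecay (j, 0) ψ) (τ, y)‖ + ‖bInt t (bDecay (j, 1) ψ) (τ, y)‖ +
      ‖bInt t (bDecay (j, 2) ψ) (τ, y)‖ + ‖bInt t (bDecay (j, 3) ψ) (τ, y)‖ ≤
      ∑ i, ‖bInt t (bDecay i ψ) (τ, y)‖ := fun j => by
    rw [Fintype.sum_prod_type]
    refine le_trans (le_of_eq ?_) (Finset.single_le_sum (f := fun j => ∑ i : Fin 4, ‖bInt t (bDecay (j, i) ψ) (τ, y)‖)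
      (fun j _ => Finset.sum_nonneg fun _ _ => norm_nonneg _) (Finset.mem_univ j))
    rw [Fin.sum_univ_four]
  have fin : ∀ j : Fin r, ∀ {z : ℂ} {E : ℂ}, ‖z‖ = ‖τ‖ → ‖t‖ * (‖y a‖ * ‖bInt t ψ (τ, y)‖) = (Real.sqrt τ.im)⁻¹ * ‖E‖ →
      ‖E‖ ≤ (1 + ‖z‖) * (1 + ‖Complex.I / 2 * ((‖t‖ : ℂ) - Complex.I * t.im)‖) *
        (‖bInt t (bDecay (j, 0) ψ) (τ, y)‖ + ‖bInt t (bDecay (j, 1) ψ) (τ, y)‖ +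
      ‖bInt t (bDecay (j, 2) ψ) (τ, y)‖ + ‖bInt t (bDecay (j, 3) ψ) (τ, y)‖) →
      ‖y a‖ * ‖bInt t ψ (τ, y)‖ ≤ bBound t τ * ∑ i, ‖bInt t (bDecay i ψ) (τ, y)‖ := by
    intro j z E hz h1 h2
    have h3 : ‖y a‖ * ‖bInt t ψ (τ, y)‖ = ‖t‖⁻¹ * ((Real.sqrt τ.im)⁻¹ * ‖E‖) := by
      rw [← h1]; field_simp
    rw [h3, bBound, mul_assoc, mul_assoc]
    gcongr
    refine h2.trans ?_
    rw [hz]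
    gcongr
    exact hsum j
  rcases a with j | j
  · have h := congrArg norm (coord_inl_mul_bInt ht hτ j ψ y)
    rw [norm_mul, norm_mul, norm_mul, Complex.norm_real, Real.norm_of_nonneg hw] at h
    exact fin j (z := conj τ) (by simp) h norm_combination_le
  · have h := congrArg norm (coord_inr_mul_bInt ht hτ j ψ y)
    rw [norm_mul, norm_mul, norm_mul, Complex.norm_real, Real.norm_of_nonneg hw, RCLike.norm_conj] at h
    refine fin j (z := τ) rfl h ?_
    have h5 := norm_combination_le (a := -(bInt t (bDecay (j, 0) ψ) (τ, y))) (b := -bInt t (bDecay (j, 1) ψ) (τ, y))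
      (c := bInt t (bDecay (j, 2) ψ) (τ, y)) (d := bInt t (bDecay (j, 3) ψ) (τ, y)) (z := τ)
      (m := Complex.I / 2 * ((‖t‖ : ℂ) - Complex.I * t.im))
    rw [norm_neg, norm_neg, mul_neg, ← sub_eq_add_neg] at h5
    exact h5

theorem bInt_decay (ht : t ≠ 0) {τ₀ : ℂ} (hτ₀ : τ₀ ∈ teich) (m : ℕ) :
    ∃ k, ∃ C : ℝ, 0 ≤ C ∧ ∀ᶠ τ in 𝓝 τ₀, ∀ (ψ : S0 r) (A : AC r),
      (1 + ‖A‖) ^ m * ‖bInt t ψ (τ, A)‖ ≤ C * schwartzSize k ψ := by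
  induction m with
  | zero =>
    obtain ⟨k, C, hC, h⟩ := exists_integral_norm_le_schwartzSize (volume : Measure (A0 r))
    refine ⟨k, C, hC, Eventually.of_forall fun τ ψ A => ?_⟩
    rw [pow_zero, one_mul]
    exact (norm_bInt_le ht ψ _).trans (h ψ)
  | succ m ih =>
    obtain ⟨k, C, hC, h⟩ := ih
    choose s D hD hs using fun i : Fin r × Fin 4 => exists_schwartzSize_clm_le (bDecay i) k
    obtain ⟨k', hk'⟩ := schwartzSize_directed (E := A0 r) (insert k (Finset.univ.image s))
    have hB : ContinuousOn (fun τ => (bBound t τ : ℂ)) teich := by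
      have hw : ContinuousOn (fun τ : ℂ => (Real.sqrt τ.im)⁻¹) teich := contDiffOn_sqrt_im_inv.continuousOn
      exact Complex.continuous_ofReal.comp_continuousOn (continuousOn_const.mul (hw.mul (by fun_prop)))
    obtain ⟨M, hM⟩ := eventually_norm_le_of_continuousOn hB hτ₀
    refine ⟨k', C + Fintype.card (Idx r) * (|M| * ∑ i, C * D i), by
      have : 0 ≤ ∑ i, C * D i := Finset.sum_nonneg fun i _ => mul_nonneg hC (hD i)
      positivity, ?_⟩
    filter_upwards [h, hM, isOpen_teich.mem_nhds hτ₀] with τ h1 h2 hτ ψ A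
    have hA : ‖A‖ ≤ ∑ a, ‖A a‖ := (pi_norm_le_iff_of_nonneg (Finset.sum_nonneg fun _ _ => norm_nonneg _)).2
      fun a => Finset.single_le_sum (f := fun a => ‖A a‖) (fun _ _ => norm_nonneg _) (Finset.mem_univ a)
    have hbB : bBound t τ ≤ |M| := by
      refine le_trans (le_abs_self _) (le_trans ?_ (le_abs_self M))
      simpa using h2
    have hs2 : ∀ i, (1 + ‖A‖) ^ m * ‖bInt t (bDecay i ψ) (τ, A)‖ ≤ C * D i * schwartzSize k' ψ := fun i => by
      refine (h1 _ A).trans ?_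
      rw [mul_assoc]
      refine mul_le_mul_of_nonneg_left ((hs i ψ).trans (mul_le_mul_of_nonneg_left ?_ (hD i))) hC
      exact hk' _ (Finset.mem_insert_of_mem (Finset.mem_image_of_mem s (Finset.mem_univ i))) ψ
    have h0 : (1 + ‖A‖) ^ m * ‖bInt t ψ (τ, A)‖ ≤ C * schwartzSize k' ψ :=
      (h1 ψ A).trans (mul_le_mul_of_nonneg_left (hk' k (Finset.mem_insert_self _ _) ψ) hC)
    have h3 : ‖A‖ * ‖bInt t ψ (τ, A)‖ ≤ Fintype.card (Idx r) * (|M| * ∑ i, ‖bInt t (bDecay i ψ) (τ, A)‖) := by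
      calc ‖A‖ * ‖bInt t ψ (τ, A)‖ ≤ ∑ a, ‖A a‖ * ‖bInt t ψ (τ, A)‖ := by
            rw [← Finset.sum_mul]; gcongr
        _ ≤ ∑ _a : Idx r, |M| * ∑ i, ‖bInt t (bDecay i ψ) (τ, A)‖ :=
            Finset.sum_le_sum fun a _ => (norm_coord_mul_bInt_le ht hτ a ψ A).trans
              (mul_le_mul_of_nonneg_right hbB (Finset.sum_nonneg fun _ _ => norm_nonneg _))
        _ = _ := by simp [Finset.sum_const, nsmul_eq_mul]
    calc (1 + ‖A‖) ^ (m + 1) * ‖bInt t ψ (τ, A)‖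
        = (1 + ‖A‖) ^ m * ‖bInt t ψ (τ, A)‖ + (1 + ‖A‖) ^ m * (‖A‖ * ‖bInt t ψ (τ, A)‖) := by ring
      _ ≤ C * schwartzSize k' ψ + (1 + ‖A‖) ^ m *
          (Fintype.card (Idx r) * (|M| * ∑ i, ‖bInt t (bDecay i ψ) (τ, A)‖)) := by gcongr
      _ = C * schwartzSize k' ψ + Fintype.card (Idx r) *
          (|M| * ∑ i, (1 + ‖A‖) ^ m * ‖bInt t (bDecay i ψ) (τ, A)‖) := by rw [← Finset.mul_sum]; ring
      _ ≤ C * schwartzSize k' ψ + Fintype.card (Idx r) * (|M| * ∑ i, C * D i * schwartzSize k' ψ) := by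
          refine add_le_add le_rfl (mul_le_mul_of_nonneg_left (mul_le_mul_of_nonneg_left
            (Finset.sum_le_sum fun i _ => hs2 i) (abs_nonneg _)) (Nat.cast_nonneg _))
      _ = _ := by rw [← Finset.sum_mul]; ring

/-- The coordinate functionals of a basis, with complex values. -/
def coordFun (r : ℕ) (l : Fin (Module.finrank ℝ (ℂ × AC r))) : ℂ × AC r →L[ℝ] ℂ :=
  Complex.ofRealCLM.comp (LinearMap.toContinuousLinearMap ((Module.finBasis ℝ (ℂ × AC r)).coord l))

theorem clm_eq_sum_coordFun (L : ℂ × AC r →L[ℝ] ℂ) :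
    L = ∑ l, L (Module.finBasis ℝ (ℂ × AC r) l) • coordFun r l := by
  refine ContinuousLinearMap.ext fun p => ?_
  conv_lhs => rw [← (Module.finBasis ℝ (ℂ × AC r)).sum_repr p, map_sum]
  rw [ContinuousLinearMap.sum_apply]
  refine Finset.sum_congr rfl fun l _ => ?_
  simp [coordFun, mul_comm]

theorem hasFDerivAt_bInt_sum (ht : t ≠ 0) (ψ : S0 r) (p : ℂ × AC r) (hp : p ∈ strip (AC r)) :
    HasFDerivAt (bInt t ψ) (∑ i : (Fin r × Fin 6) × Fin (Module.finrank ℝ (ℂ × AC r)),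
      (fderiv ℝ (bCoef t i.1) p (Module.finBasis ℝ (ℂ × AC r) i.2) * bInt t (bMul i.1 ψ) p) • coordFun r i.2) p := by
  refine (hasFDerivAt_bInt ht ψ hp).congr_fderiv (ContinuousLinearMap.ext fun v => ?_)
  simp only [ContinuousLinearMap.sum_apply, ContinuousLinearMap.smul_apply, smul_eq_mul, Fintype.sum_prod_type]
  refine Finset.sum_congr rfl fun j _ => Finset.sum_congr rfl fun i _ => ?_
  have h := DFunLike.congr_fun (clm_eq_sum_coordFun (fderiv ℝ (bCoef t (j, i)) p)) v
  simp only [ContinuousLinearMap.sum_apply, ContinuousLinearMap.smul_apply, smul_eq_mul] at h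
  rw [h, Finset.mul_sum]
  exact Finset.sum_congr rfl fun l _ => by ring

theorem bInt_bound (ht : t ≠ 0) {τ₀ : ℂ} (hτ₀ : τ₀ ∈ teich) (l m : ℕ) :
    ∃ k, ∃ C : ℝ, 0 ≤ C ∧ ∀ᶠ τ in 𝓝 τ₀, ∀ (ψ : S0 r) (A : AC r),
      (1 + ‖A‖) ^ m * ‖iteratedFDeriv ℝ l (bInt t ψ) (τ, A)‖ ≤ C * schwartzSize k ψ :=
  bound_iteratedFDeriv_of_hasFDerivAt_sum (I := fun ψ : S0 r => bInt t ψ)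
    (T := fun i : (Fin r × Fin 6) × Fin (Module.finrank ℝ (ℂ × AC r)) => bMul i.1)
    (schwartzSize (E := A0 r)) schwartzSize_nonneg schwartzSize_directed
    (fun i k => exists_schwartzSize_clm_le (bMul i.1) k) (fun i => (bCoef_slow i.1).fderiv_apply _)
    (fun ψ p hp => hasFDerivAt_bInt_sum ht ψ p hp) hτ₀ (bInt_decay ht hτ₀) l m

theorem bInt_rapid (ht : t ≠ 0) (ψ : S0 r) : RapidFamily (bInt t ψ : ℂ × AC r → ℂ) := by
  refine ⟨contDiffOn_of_hasFDerivAt_sum (I := fun ψ : S0 r => bInt t ψ)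
    (T := fun i : (Fin r × Fin 6) × Fin (Module.finrank ℝ (ℂ × AC r)) => bMul i.1)
    (fun i => (bCoef_slow i.1).fderiv_apply _) (fun ψ p hp => hasFDerivAt_bInt_sum ht ψ p hp) ψ,
    fun m l τ₀ hτ₀ => ?_⟩
  obtain ⟨k, C, hC, h⟩ := bInt_bound (r := r) ht hτ₀ l m
  refine ⟨C * schwartzSize k ψ, ?_⟩
  filter_upwards [h] with τ h A
  refine le_trans ?_ (h ψ A)
  gcongr
  linarith [norm_nonneg A]

end kernel
end GenusOne

end

noncomputable section
namespace GenusOne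
open Filter

section kernel
open ComplexConjugate
variable {r : ℕ} {t τ : ℂ}

theorem fderiv_bCoef_eq (i : Fin r × Fin 6) {p : ℂ × AC r} (hp : p ∈ strip (AC r)) (v : ℂ × AC r) {c : ℂ}
    (h : HasDerivAt (fun s : ℝ => bCoef t i (p + s • v)) c 0) : fderiv ℝ (bCoef t i) p v = c := by
  rw [← (hasFDerivAt_bCoef i hp).differentiableAt.lineDeriv_eq_fderiv]
  exact h.deriv

theorem hasDerivAt_line_coord (y X : AC r) (a : Idx r) : HasDerivAt (fun s : ℝ => (y + s • X) a) (X a) 0 := by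
  simpa using hasDerivAt_affine (y a) (X a)

theorem hasDerivAt_line_conj (y X : AC r) (a : Idx r) :
    HasDerivAt (fun s : ℝ => conj ((y + s • X) a)) (conj (X a)) 0 := by
  simpa using hasDerivAt_affine (conj (y a)) (conj (X a))

theorem bMul_zero (j : Fin r) (ψ : S0 r) : bMul (j, 0) ψ = ψ := by
  ext u; simp [bMul_apply, bMon]

theorem fderiv_bInt_slice (ht : t ≠ 0) (hτ : τ ∈ teich) (ψ : S0 r) (y X : AC r) :
    fderiv ℝ (bInt t ψ) (τ, y) (0, X) = ∑ j : Fin r,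
      ((-(‖t‖ / 4 : ℂ) * (X (Sum.inl j) * conj (y (Sum.inl j)) + y (Sum.inl j) * conj (X (Sum.inl j)) +
        (X (Sum.inr j) * conj (y (Sum.inr j)) + y (Sum.inr j) * conj (X (Sum.inr j)))) +
        ‖t‖ / 2 * (X (Sum.inl j) * y (Sum.inr j) + y (Sum.inl j) * X (Sum.inr j))) * bInt t ψ (τ, y)
      - Complex.I / 2 * (t * X (Sum.inl j) * bInt t (mulU τ j ψ) (τ, y) +
        conj t * X (Sum.inr j) * bInt t (mulUc τ j ψ) (τ, y))) := by
  have hp : ((τ, y) : ℂ × AC r) ∈ strip (AC r) := mem_strip hτ y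
  refine (DFunLike.congr_fun (hasFDerivAt_bInt ht ψ hp).fderiv _).trans ?_
  simp only [ContinuousLinearMap.sum_apply, ContinuousLinearMap.smul_apply, smul_eq_mul, Fintype.sum_prod_type]
  refine Finset.sum_congr rfl fun j _ => ?_
  have hl := hasDerivAt_line_coord y X (Sum.inl j)
  have hr := hasDerivAt_line_coord y X (Sum.inr j)
  have hlc := hasDerivAt_line_conj y X (Sum.inl j)
  have hrc := hasDerivAt_line_conj y X (Sum.inr j)
  have e0 : fderiv ℝ (bCoef t (j, 0)) (τ, y) (0, X) =
      -(‖t‖ / 4 : ℂ) * (X (Sum.inl j) * conj (y (Sum.inl j)) + y (Sum.inl j) * conj (X (Sum.inl j)) +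
        (X (Sum.inr j) * conj (y (Sum.inr j)) + y (Sum.inr j) * conj (X (Sum.inr j)))) +
        ‖t‖ / 2 * (X (Sum.inl j) * y (Sum.inr j) + y (Sum.inl j) * X (Sum.inr j)) := by
    refine fderiv_bCoef_eq _ hp _ ?_
    refine ((((hl.mul hlc).add (hr.mul hrc)).const_mul (-(‖t‖ / 4 : ℂ))).add
      ((hl.mul hr).const_mul (‖t‖ / 2 : ℂ))).congr_deriv ?_
    simp
  have e1 : fderiv ℝ (bCoef t (j, 1)) (τ, y) (0, X) =
      ((Complex.I / 2 * t) * (((Real.sqrt τ.im)⁻¹ : ℝ) * τ)) * X (Sum.inl j) +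
      ((Complex.I / 2 * conj t) * (((Real.sqrt τ.im)⁻¹ : ℝ) * conj τ)) * X (Sum.inr j) := by
    refine fderiv_bCoef_eq _ hp _ ?_
    simp only [bCoef, Matrix.cons_val, Prod.smul_mk, Prod.mk_add_mk, smul_zero, add_zero]
    exact (hl.const_mul _).add (hr.const_mul _)
  have e2 : fderiv ℝ (bCoef t (j, 2)) (τ, y) (0, X) =
      ((-(Complex.I / 2 * t)) * ((Real.sqrt τ.im)⁻¹ : ℝ)) * X (Sum.inl j) +
      ((-(Complex.I / 2 * conj t)) * ((Real.sqrt τ.im)⁻¹ : ℝ)) * X (Sum.inr j) := by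
    refine fderiv_bCoef_eq _ hp _ ?_
    simp only [bCoef, Matrix.cons_val, Prod.smul_mk, Prod.mk_add_mk, smul_zero, add_zero]
    exact (hl.const_mul _).add (hr.const_mul _)
  have e3 : fderiv ℝ (bCoef t (j, 3)) (τ, y) (0, X) = 0 := by
    refine fderiv_bCoef_eq _ hp _ ?_
    simp only [bCoef, Matrix.cons_val, Prod.smul_mk, Prod.mk_add_mk, smul_zero, add_zero]
    exact hasDerivAt_const _ _
  have e4 : fderiv ℝ (bCoef t (j, 4)) (τ, y) (0, X) = 0 := by
    refine fderiv_bCoef_eq _ hp _ ?_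
    simp only [bCoef, Matrix.cons_val, Prod.smul_mk, Prod.mk_add_mk, smul_zero, add_zero]
    exact hasDerivAt_const _ _
  have e5 : fderiv ℝ (bCoef t (j, 5)) (τ, y) (0, X) = 0 := by
    refine fderiv_bCoef_eq _ hp _ ?_
    simp only [bCoef, Matrix.cons_val, Prod.smul_mk, Prod.mk_add_mk, smul_zero, add_zero]
    exact hasDerivAt_const _ _
  rw [Fin.sum_univ_six, e0, e1, e2, e3, e4, e5, mulU_eq, mulUc_eq, bMul_zero]
  simp only [bInt_add ht, bInt_smul]
  ring

theorem fderiv_bInt_teich (ht : t ≠ 0) (hτ : τ ∈ teich) (ψ : S0 r) (y : AC r) (V : ℂ) :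
    fderiv ℝ (bInt t ψ) (τ, y) (V, 0) = ∑ j : Fin r,
      (-(Complex.I / 2) * (t * y (Sum.inl j) * (Complex.I * V / (2 * τ.im) * bInt t (mulUc τ j ψ) (τ, y)
          - Complex.I * (V.re / (2 * τ.im)) * bInt t (mulU τ j ψ) (τ, y)) +
        conj t * y (Sum.inr j) * (conj (Complex.I * V / (2 * τ.im)) * bInt t (mulU τ j ψ) (τ, y)
          + Complex.I * (V.re / (2 * τ.im)) * bInt t (mulUc τ j ψ) (τ, y)))
      - (‖t‖ - Complex.I * t.im) / 4 * (Complex.I * V / (2 * τ.im) * bInt t (mulUc τ j (mulUc τ j ψ)) (τ, y) +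
          conj (Complex.I * V / (2 * τ.im)) * bInt t (mulU τ j (mulU τ j ψ)) (τ, y))) := by
  have hp : ((τ, y) : ℂ × AC r) ∈ strip (AC r) := mem_strip hτ y
  refine (DFunLike.congr_fun (hasFDerivAt_bInt ht ψ hp).fderiv _).trans ?_
  simp only [ContinuousLinearMap.sum_apply, ContinuousLinearMap.smul_apply, smul_eq_mul, Fintype.sum_prod_type]
  refine Finset.sum_congr rfl fun j _ => ?_
  have hw : HasDerivAt (fun s : ℝ => (((Real.sqrt (τ + s • V).im)⁻¹ : ℝ) : ℂ))
      (-(V.im / (2 * τ.im) : ℝ) * ((Real.sqrt τ.im)⁻¹ : ℝ)) 0 := by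
    simpa using hasDerivAt_sqrt_im_inv hτ V
  have hv : HasDerivAt (fun s : ℝ => τ + s • V) V 0 := by simpa using hasDerivAt_affine τ V
  have hvc : HasDerivAt (fun s : ℝ => conj (τ + s • V)) (conj V) 0 := by
    simpa using hasDerivAt_affine (conj τ) (conj V)
  have z0 : τ + (0 : ℝ) • V = τ := by simp
  have e0 : fderiv ℝ (bCoef t (j, 0)) (τ, y) (V, 0) = 0 := by
    refine fderiv_bCoef_eq _ hp _ ?_
    simp only [bCoef, Matrix.cons_val, Prod.smul_mk, Prod.mk_add_mk, smul_zero, add_zero]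
    exact hasDerivAt_const _ _
  generalize hw' : (((Real.sqrt τ.im)⁻¹ : ℝ) : ℂ) = w' at *
  generalize ha : (((-(V.im / (2 * τ.im)) : ℝ) : ℂ)) = a at *
  have e1 : fderiv ℝ (bCoef t (j, 1)) (τ, y) (V, 0) =
      ((Complex.I / 2 * t) * (a * w' * τ + w' * V)) * y (Sum.inl j) +
      ((Complex.I / 2 * conj t) * (a * w' * conj τ + w' * conj V)) * y (Sum.inr j) := by
    refine fderiv_bCoef_eq _ hp _ ?_
    simp only [bCoef, Matrix.cons_val, Prod.smul_mk, Prod.mk_add_mk, smul_zero, add_zero]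
    refine ((((hw.mul hv).const_mul (Complex.I / 2 * t)).mul_const (y (Sum.inl j))).add
      (((hw.mul hvc).const_mul (Complex.I / 2 * conj t)).mul_const (y (Sum.inr j)))).congr_deriv ?_
    simp only [z0, hw', ← ha]; push_cast; ring
  have e2 : fderiv ℝ (bCoef t (j, 2)) (τ, y) (V, 0) =
      ((-(Complex.I / 2 * t)) * (a * w')) * y (Sum.inl j) +
      ((-(Complex.I / 2 * conj t)) * (a * w')) * y (Sum.inr j) := by
    refine fderiv_bCoef_eq _ hp _ ?_
    simp only [bCoef, Matrix.cons_val, Prod.smul_mk, Prod.mk_add_mk, smul_zero, add_zero]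
    refine (((hw.const_mul (-(Complex.I / 2 * t))).mul_const (y (Sum.inl j))).add
      ((hw.const_mul (-(Complex.I / 2 * conj t))).mul_const (y (Sum.inr j)))).congr_deriv ?_
    rw [← ha]; push_cast; ring
  have e3 : fderiv ℝ (bCoef t (j, 3)) (τ, y) (V, 0) =
      -((‖t‖ - Complex.I * t.im) / 4) * (2 * a * w' * w' * (τ * conj τ) + w' * w' * (V * conj τ + τ * conj V)) := by
    refine fderiv_bCoef_eq _ hp _ ?_
    simp only [bCoef, Matrix.cons_val, Prod.smul_mk, Prod.mk_add_mk, smul_zero, add_zero]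
    refine (((hw.mul hw).mul (hv.mul hvc)).const_mul (-((‖t‖ - Complex.I * t.im) / 4))).congr_deriv ?_
    simp only [z0, hw', ← ha, Pi.mul_apply]; push_cast; ring
  have e4 : fderiv ℝ (bCoef t (j, 4)) (τ, y) (V, 0) =
      ((‖t‖ - Complex.I * t.im) / 4) * (2 * a * w' * w' * (τ + conj τ) + w' * w' * (V + conj V)) := by
    refine fderiv_bCoef_eq _ hp _ ?_
    simp only [bCoef, Matrix.cons_val, Prod.smul_mk, Prod.mk_add_mk, smul_zero, add_zero]
    refine (((hw.mul hw).mul (hv.add hvc)).const_mul (((‖t‖ - Complex.I * t.im) / 4))).congr_deriv ?_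
    simp only [z0, hw', ← ha, Pi.mul_apply, Pi.add_apply]; push_cast; ring
  have e5 : fderiv ℝ (bCoef t (j, 5)) (τ, y) (V, 0) =
      -((‖t‖ - Complex.I * t.im) / 4) * (2 * a * w' * w') := by
    refine fderiv_bCoef_eq _ hp _ ?_
    simp only [bCoef, Matrix.cons_val, Prod.smul_mk, Prod.mk_add_mk, smul_zero, add_zero]
    refine ((hw.mul hw).const_mul (-((‖t‖ - Complex.I * t.im) / 4))).congr_deriv ?_
    simp only [z0, hw', ← ha, Pi.mul_apply]; push_cast; ring
  have b3 : bMul (j, 1) (bMul (j, 1) ψ) = bMul (j, 3) ψ := by ext u; simp [bMul_apply, bMon]; ring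
  have b4 : bMul (j, 1) (bMul (j, 2) ψ) = bMul (j, 4) ψ := by ext u; simp [bMul_apply, bMon]; ring
  have b4' : bMul (j, 2) (bMul (j, 1) ψ) = bMul (j, 4) ψ := by ext u; simp [bMul_apply, bMon]; ring
  have b5 : bMul (j, 2) (bMul (j, 2) ψ) = bMul (j, 5) ψ := by ext u; simp [bMul_apply, bMon]; ring
  rw [Fin.sum_univ_six, e0, e1, e2, e3, e4, e5]
  simp only [mulU_eq, mulUc_eq, map_add, map_smul, b3, b4, b4', b5, bInt_add ht, bInt_smul, hw']
  have hpos : (τ.im : ℂ) ≠ 0 := by exact_mod_cast (ne_of_gt hτ)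
  have r1 : Complex.I * V / (2 * τ.im) = Complex.I / 2 * V * (τ.im : ℂ)⁻¹ := by field_simp
  have r2 : (V.re : ℂ) / (2 * τ.im) = (V + conj V) / 4 * (τ.im : ℂ)⁻¹ := by
    rw [Complex.add_conj]; push_cast; field_simp; norm_num
  have r3 : a = Complex.I / 4 * (V - conj V) * (τ.im : ℂ)⁻¹ := by
    rw [← ha, Complex.sub_conj]; push_cast; field_simp; linear_combination (-4 * V.im : ℂ) * Complex.I_sq
  have r4 : (τ - conj τ) * (τ.im : ℂ)⁻¹ = 2 * Complex.I := by
    rw [Complex.sub_conj]; push_cast; field_simp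
  have r5 := Complex.I_mul_I
  rw [r1, r2, r3]
  simp only [map_mul, map_div₀, Complex.conj_I, map_inv₀, Complex.conj_ofReal, map_ofNat]
  generalize (τ.im : ℂ)⁻¹ = d at *
  generalize bInt t (bMul (j, 1) ψ) (τ, y) = B1
  generalize bInt t (bMul (j, 2) ψ) (τ, y) = B2
  generalize bInt t (bMul (j, 3) ψ) (τ, y) = B3
  generalize bInt t (bMul (j, 4) ψ) (τ, y) = B4
  generalize bInt t (bMul (j, 5) ψ) (τ, y) = B5
  generalize ((‖t‖ : ℂ) - Complex.I * t.im) / 4 = σ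
  generalize y (Sum.inl j) = yl
  generalize y (Sum.inr j) = yr
  generalize conj τ = τ' at *
  generalize conj V = V' at *
  generalize conj t = t' at *
  generalize Complex.I = I at *
  clear e0 e1 e2 e3 e4 e5 b3 b4 b4' b5 hw hv hvc z0 r1 r2 r3 ha hw'
  grind
end kernel
end GenusOne

end

noncomputable section
namespace GenusOne
open Filter

section kernel
open ComplexConjugate
variable {r : ℕ} {t τ : ℂ}

theorem bInt_slice_contDiff (ht : t ≠ 0) (hτ : τ ∈ teich) (ψ : S0 r) :
    ContDiff ℝ ∞ (fun y => bInt t ψ (τ, y)) :=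
  contDiff_slice (bInt_rapid ht ψ).1 hτ

theorem fderiv_bInt_apply (ht : t ≠ 0) (hτ : τ ∈ teich) (ψ : S0 r) (y X : AC r) :
    fderiv ℝ (fun y => bInt t ψ (τ, y)) y X = fderiv ℝ (bInt t ψ) (τ, y) (0, X) := by
  have h := ((strip_contDiffAt (bInt_rapid ht ψ).1 (mem_strip hτ y)).differentiableAt (by simp)).hasFDerivAt
  have h2 : HasFDerivAt (fun y => bInt t ψ (τ, y)) ((fderiv ℝ (bInt t ψ) (τ, y)).comp (ContinuousLinearMap.inr ℝ ℂ (AC r))) y :=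
    h.comp y (hasFDerivAt_prodMk_right τ y)
  rw [h2.fderiv]; rfl

theorem bInt_isHol (ht : t ≠ 0) (hτ : τ ∈ teich) (ψ : S0 r) : IsHol ‖t‖ (fun y => bInt t ψ (τ, y)) := by
  refine ⟨(bInt_slice_contDiff ht hτ ψ).differentiable (by simp), fun X y => ?_⟩
  rw [fderiv_bInt_apply ht hτ, fderiv_bInt_apply ht hτ, fderiv_bInt_slice ht hτ, fderiv_bInt_slice ht hτ,
    Fintype.sum_sum_type, ← Finset.sum_add_distrib, Finset.mul_sum, Finset.mul_sum, Finset.sum_mul,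
    ← Finset.sum_add_distrib, ← Finset.sum_add_distrib]
  refine Finset.sum_eq_zero fun j _ => ?_
  simp only [Pi.smul_apply, smul_eq_mul, map_mul, Complex.conj_I]
  have := Complex.I_mul_I
  generalize Complex.I = I at *
  grind

theorem dHol_inl_bInt (ht : t ≠ 0) (hτ : τ ∈ teich) (ψ : S0 r) (j : Fin r) :
    dHol ‖t‖ (Sum.inl j) (fun y => bInt t ψ (τ, y)) = fun y =>
      ‖t‖ / 2 * (y (Sum.inr j) - conj (y (Sum.inl j))) * bInt t ψ (τ, y)
        + (-(Complex.I / 2 * t)) * bInt t (mulU τ j ψ) (τ, y) := by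
  funext y
  rw [dHol, fderiv_bInt_apply ht hτ, fderiv_bInt_apply ht hτ, fderiv_bInt_slice ht hτ, fderiv_bInt_slice ht hτ]
  rw [Finset.sum_eq_single j, Finset.sum_eq_single j]
  · simp
    have := Complex.I_mul_I
    generalize Complex.I = I at *
    grind
  · intro b _ hb; simp [hb]
  · simp
  · intro b _ hb; simp [hb]
  · simp

theorem dHol_inr_bInt (ht : t ≠ 0) (hτ : τ ∈ teich) (ψ : S0 r) (j : Fin r) :
    dHol ‖t‖ (Sum.inr j) (fun y => bInt t ψ (τ, y)) = fun y =>
      ‖t‖ / 2 * (y (Sum.inl j) - conj (y (Sum.inr j))) * bInt t ψ (τ, y)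
        + (-(Complex.I / 2 * conj t)) * bInt t (mulUc τ j ψ) (τ, y) := by
  funext y
  rw [dHol, fderiv_bInt_apply ht hτ, fderiv_bInt_apply ht hτ, fderiv_bInt_slice ht hτ, fderiv_bInt_slice ht hτ]
  rw [Finset.sum_eq_single j, Finset.sum_eq_single j]
  · simp
    have := Complex.I_mul_I
    generalize Complex.I = I at *
    grind
  · intro b _ hb; simp [hb]
  · simp
  · intro b _ hb; simp [hb]
  · simp

theorem dHol_mul_add {c : ℝ} {a b : Idx r} (hab : a ≠ b) {f g : AC r → ℂ} (hf : Differentiable ℝ f)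
    (hg : Differentiable ℝ g) (m k : ℂ) (y : AC r) :
    dHol c a (fun y => m * (y b - conj (y a)) * f y + k * g y) y =
      m * (y b - conj (y a)) * dHol c a f y + k * dHol c a g y := by
  have h : HasFDerivAt (fun y : AC r => m * (y b - conj (y a)) * f y + k * g y) _ y :=
    ((((hasFDerivAt_coord b y).sub (hasFDerivAt_conj_apply a y)).const_mul m).mul (hf y).hasFDerivAt).add
      ((hg y).hasFDerivAt.const_mul k)
  have e : ∀ v, fderiv ℝ (fun y : AC r => m * (y b - conj (y a)) * f y + k * g y) y v =
      m * (y b - conj (y a)) * fderiv ℝ f y v + f y * (m * (v b - conj (v a))) + k * fderiv ℝ g y v := fun v =>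
    (DFunLike.congr_fun h.fderiv v).trans (by simp)
  rw [dHol, e, e, dHol, dHol]
  simp [hab.symm]
  have := Complex.I_mul_I
  generalize Complex.I = I at *
  grind

theorem dHol_inl_inl_bInt (ht : t ≠ 0) (hτ : τ ∈ teich) (ψ : S0 r) (j : Fin r) (y : AC r) :
    dHol ‖t‖ (Sum.inl j) (dHol ‖t‖ (Sum.inl j) (fun y => bInt t ψ (τ, y))) y =
      (‖t‖ / 2 * (y (Sum.inr j) - conj (y (Sum.inl j)))) ^ 2 * bInt t ψ (τ, y)
        + 2 * (‖t‖ / 2 * (y (Sum.inr j) - conj (y (Sum.inl j)))) * (-(Complex.I / 2 * t)) * bInt t (mulU τ j ψ) (τ, y)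
        + (-(Complex.I / 2 * t)) ^ 2 * bInt t (mulU τ j (mulU τ j ψ)) (τ, y) := by
  have hd : ∀ ψ : S0 r, Differentiable ℝ (fun y => bInt t ψ (τ, y)) := fun ψ => (bInt_isHol ht hτ ψ).1
  rw [dHol_inl_bInt ht hτ, dHol_mul_add (by simp) (hd ψ) (hd (mulU τ j ψ)), dHol_inl_bInt ht hτ,
    dHol_inl_bInt ht hτ]
  ring

theorem dHol_inr_inr_bInt (ht : t ≠ 0) (hτ : τ ∈ teich) (ψ : S0 r) (j : Fin r) (y : AC r) :
    dHol ‖t‖ (Sum.inr j) (dHol ‖t‖ (Sum.inr j) (fun y => bInt t ψ (τ, y))) y =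
      (‖t‖ / 2 * (y (Sum.inl j) - conj (y (Sum.inr j)))) ^ 2 * bInt t ψ (τ, y)
        + 2 * (‖t‖ / 2 * (y (Sum.inl j) - conj (y (Sum.inr j)))) * (-(Complex.I / 2 * conj t)) * bInt t (mulUc τ j ψ) (τ, y)
        + (-(Complex.I / 2 * conj t)) ^ 2 * bInt t (mulUc τ j (mulUc τ j ψ)) (τ, y) := by
  have hd : ∀ ψ : S0 r, Differentiable ℝ (fun y => bInt t ψ (τ, y)) := fun ψ => (bInt_isHol ht hτ ψ).1
  rw [dHol_inr_bInt ht hτ, dHol_mul_add (by simp) (hd ψ) (hd (mulUc τ j ψ)), dHol_inr_bInt ht hτ,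
    dHol_inr_bInt ht hτ]
  ring

theorem hasFDerivAt_uCo (τ : ℂ) (j : Fin r) (u : A0 r) : HasFDerivAt (fun u : A0 r => uCo τ u j)
    ((((Real.sqrt τ.im)⁻¹ : ℝ) : ℂ) • ((Complex.ofRealCLM.comp (ContinuousLinearMap.proj (Sum.inr j) : A0 r →L[ℝ] ℝ)) -
      τ • (Complex.ofRealCLM.comp (ContinuousLinearMap.proj (Sum.inl j) : A0 r →L[ℝ] ℝ)))) u := by
  have h : ∀ a, HasFDerivAt (fun u : A0 r => (u a : ℂ)) (Complex.ofRealCLM.comp (ContinuousLinearMap.proj a : A0 r →L[ℝ] ℝ)) u :=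
    fun a => (Complex.ofRealCLM.comp (ContinuousLinearMap.proj a : A0 r →L[ℝ] ℝ)).hasFDerivAt
  exact ((h _).sub ((h _).const_mul τ)).const_mul _

theorem mulU_pDerS (k : ℝ) (j : Fin r) (ψ : S0 r) : mulU τ j (pDerS k τ j ψ) = pDerS k τ j (mulU τ j ψ) := by
  ext u
  have e : (mulU τ j ψ : A0 r → ℂ) = fun u => uCo τ u j * ψ u := funext (mulU_apply τ j ψ)
  have h := ((hasFDerivAt_uCo τ j u).mul (ψ.differentiableAt (x := u)).hasFDerivAt)
  have e2 : ∀ v, fderiv ℝ (fun u => uCo τ u j * ψ u) u v = uCo τ u j * fderiv ℝ ψ u v +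
      ψ u * ((((Real.sqrt τ.im)⁻¹ : ℝ) : ℂ) * (v (Sum.inr j) - τ * v (Sum.inl j))) := fun v =>
    (DFunLike.congr_fun h.fderiv v).trans (by simp)
  rw [mulU_apply, pDerS_apply, pDerS_apply, e, pDer_eq, pDer_eq, e2, e2]
  simp [basis0]
  ring

theorem mulUc_pDerS (k : ℝ) (j : Fin r) (ψ : S0 r) :
    mulUc τ j (pDerS k (conj τ) j ψ) = pDerS k (conj τ) j (mulUc τ j ψ) := by
  ext u
  have e : (mulUc τ j ψ : A0 r → ℂ) = fun u => conj (uCo τ u j) * ψ u := funext (mulUc_apply τ j ψ)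
  have hc : (fun u : A0 r => conj (uCo τ u j)) = fun u => (((Real.sqrt τ.im)⁻¹ : ℝ) : ℂ) *
      ((u (Sum.inr j) : ℂ) - conj τ * u (Sum.inl j)) := by
    ext u; simp [uCo]
  have hcc : ∀ a, HasFDerivAt (fun u : A0 r => (u a : ℂ)) (Complex.ofRealCLM.comp (ContinuousLinearMap.proj a : A0 r →L[ℝ] ℝ)) u :=
    fun a => (Complex.ofRealCLM.comp (ContinuousLinearMap.proj a : A0 r →L[ℝ] ℝ)).hasFDerivAt
  have h0 : HasFDerivAt (fun u : A0 r => conj (uCo τ u j))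
      ((((Real.sqrt τ.im)⁻¹ : ℝ) : ℂ) • ((Complex.ofRealCLM.comp (ContinuousLinearMap.proj (Sum.inr j) : A0 r →L[ℝ] ℝ)) -
      conj τ • (Complex.ofRealCLM.comp (ContinuousLinearMap.proj (Sum.inl j) : A0 r →L[ℝ] ℝ)))) u := by
    rw [hc]
    exact ((hcc _).sub ((hcc _).const_mul (conj τ))).const_mul _
  have h := (h0.mul (ψ.differentiableAt (x := u)).hasFDerivAt)
  have e2 : ∀ v, fderiv ℝ (fun u => conj (uCo τ u j) * ψ u) u v = conj (uCo τ u j) * fderiv ℝ ψ u v +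
      ψ u * ((((Real.sqrt τ.im)⁻¹ : ℝ) : ℂ) * (v (Sum.inr j) - conj τ * v (Sum.inl j))) := fun v =>
    (DFunLike.congr_fun h.fderiv v).trans (by simp)
  rw [mulUc_apply, pDerS_apply, pDerS_apply, e, pDer_eq, pDer_eq, e2, e2]
  simp [basis0]
  ring

theorem bInt_pDer_pDer (ht : t ≠ 0) (hτ : τ ∈ teich) (j : Fin r) (ψ : S0 r) (y : AC r) :
    bInt t (pDerS t.re τ j (pDerS t.re τ j ψ)) (τ, y) = τ.im *
      ((conj t * y (Sum.inr j)) ^ 2 * bInt t ψ (τ, y) - 2 * (conj t * y (Sum.inr j)) *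
        (Complex.I / 2 * (‖t‖ + conj t)) * bInt t (mulU τ j ψ) (τ, y) +
        (Complex.I / 2 * (‖t‖ + conj t)) ^ 2 * bInt t (mulU τ j (mulU τ j ψ)) (τ, y)) := by
  have hw : ((Real.sqrt τ.im : ℝ) : ℂ) ^ 2 = τ.im := by
    rw [← Complex.ofReal_pow, Real.sq_sqrt (le_of_lt hτ)]
  have hm : (‖t‖ : ℂ) - Complex.I * t.im + t.re = ‖t‖ + conj t := by
    have : conj t = t.re - t.im * Complex.I := by apply Complex.ext <;> simp
    rw [this]; ring
  rw [bInt_pDer ht hτ, mulU_pDerS, bInt_pDer ht hτ, bInt_pDer ht hτ, hm, ← hw]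
  ring

theorem bInt_pDer_conj_pDer_conj (ht : t ≠ 0) (hτ : τ ∈ teich) (j : Fin r) (ψ : S0 r) (y : AC r) :
    bInt t (pDerS t.re (conj τ) j (pDerS t.re (conj τ) j ψ)) (τ, y) = τ.im *
      ((t * y (Sum.inl j)) ^ 2 * bInt t ψ (τ, y) - 2 * (t * y (Sum.inl j)) *
        (Complex.I / 2 * (‖t‖ - t)) * bInt t (mulUc τ j ψ) (τ, y) +
        (Complex.I / 2 * (‖t‖ - t)) ^ 2 * bInt t (mulUc τ j (mulUc τ j ψ)) (τ, y)) := by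
  have hw : ((Real.sqrt τ.im : ℝ) : ℂ) ^ 2 = τ.im := by
    rw [← Complex.ofReal_pow, Real.sq_sqrt (le_of_lt hτ)]
  have hm : (‖t‖ : ℂ) - Complex.I * t.im - t.re = ‖t‖ - t := by
    linear_combination -Complex.re_add_im t
  rw [bInt_pDer_conj ht hτ, mulUc_pDerS, bInt_pDer_conj ht hτ, bInt_pDer_conj ht hτ, hm, ← hw]
  ring

theorem bInt_sum_smul (ht : t ≠ 0) {ι : Type*} (s : Finset ι) (f : ι → S0 r) (p : ℂ × AC r) :
    bInt t (∑ i ∈ s, f i : S0 r) p = ∑ i ∈ s, bInt t (f i) p := by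
  classical
  induction s using Finset.induction_on with
  | empty => simp [bInt]
  | insert a s ha ih => rw [Finset.sum_insert ha, Finset.sum_insert ha, bInt_add ht, ih]

/-- The Bargmann transform intertwines the connections on test sections. -/
theorem bInt_intertwines (ht : t ≠ 0) (hτ : τ ∈ teich) (V : ℂ) (ψ : S0 r) (y : AC r) :
    fderiv ℝ (bInt t ψ) (τ, y) (V, 0) + rFun ‖t‖ (yNu r τ V) (yMu r t τ V) (fun y => bInt t ψ (τ, y)) y =
      bInt t (uOp r t V τ ψ) (τ, y) := by
  have hu : uOp r t V τ ψ = (-(1 / 2) * (1 / star t * (Complex.I * conj V / (2 * τ.im ^ 2)))) •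
      (∑ j : Fin r, pDerS t.re τ j (pDerS t.re τ j ψ))
    + (-(1 / 2) * (1 / t * (Complex.I * V / (2 * τ.im ^ 2)))) •
      (∑ j : Fin r, pDerS t.re (conj τ) j (pDerS t.re (conj τ) j ψ)) := by
    simp [uOp]
  rw [hu, bInt_add ht, bInt_smul, bInt_smul, bInt_sum_smul ht, bInt_sum_smul ht, fderiv_bInt_teich ht hτ,
    rFun, Fintype.sum_sum_type, Finset.mul_sum, Finset.mul_sum, ← Finset.sum_add_distrib,
    ← Finset.sum_add_distrib, ← Finset.sum_add_distrib]
  refine Finset.sum_congr rfl fun j _ => ?_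
  rw [bInt_pDer_pDer ht hτ, bInt_pDer_conj_pDer_conj ht hτ, dHol_inl_inl_bInt ht hτ, dHol_inr_inr_bInt ht hτ,
    dHol_inl_bInt ht hτ, dHol_inr_bInt ht hτ]
  simp only [yNu, yMu, Sum.elim_inl, Sum.elim_inr]
  have hn : (‖t‖ : ℂ) ≠ 0 := by simpa using ht
  have hd : (τ.im : ℂ) ≠ 0 := by exact_mod_cast (ne_of_gt hτ)
  have ht' : conj t ≠ 0 := by simpa using ht
  have e1 : -(1 / 2) * (1 / star t * (Complex.I * conj V / (2 * τ.im ^ 2))) * τ.im =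
      conj (Complex.I * V / (2 * τ.im)) / (2 * conj t) := by
    simp; field_simp; rw [map_ofNat]; ring
  have e2 : -(1 / 2) * (1 / t * (Complex.I * V / (2 * τ.im ^ 2))) * τ.im =
      -(Complex.I * V / (2 * τ.im)) / (2 * t) := by
    field_simp
  have e3 : Complex.I * t.im = (t - conj t) / 2 := by rw [Complex.sub_conj]; push_cast; ring
  have hI := Complex.I_mul_I
  have htt : (‖t‖ : ℂ) * ‖t‖ = t * conj t := by
    rw [Complex.mul_conj, Complex.normSq_eq_norm_sq]; push_cast; ring
  have g1 : ∀ x : ℂ, -(1 / 2) * (1 / star t * (Complex.I * conj V / (2 * τ.im ^ 2))) * (τ.im * x) =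
      conj (Complex.I * V / (2 * τ.im)) / (2 * conj t) * x := fun x => by rw [← e1]; ring
  have g2 : ∀ x : ℂ, -(1 / 2) * (1 / t * (Complex.I * V / (2 * τ.im ^ 2))) * (τ.im * x) =
      -(Complex.I * V / (2 * τ.im)) / (2 * t) * x := fun x => by rw [← e2]; ring
  rw [g1, g2, e3]
  have g3 : conj (conj (t / ‖t‖) * conj (Complex.I * V / (2 * τ.im))) = t / ‖t‖ * (Complex.I * V / (2 * τ.im)) := by
    rw [map_mul, Complex.conj_conj, Complex.conj_conj]
  rw [g3]
  simp only [map_neg, map_mul (starRingEnd ℂ) (t / (‖t‖ : ℂ)), map_div₀ (starRingEnd ℂ) t, Complex.conj_ofReal]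
  generalize Complex.I * V / (2 * τ.im) = lam
  generalize conj lam = lam'
  generalize (V.re : ℂ) / (2 * τ.im) = nu
  generalize bInt t ψ (τ, y) = J0
  generalize bInt t (mulU τ j ψ) (τ, y) = J1
  generalize bInt t (mulUc τ j ψ) (τ, y) = J2
  generalize bInt t (mulU τ j (mulU τ j ψ)) (τ, y) = J3
  generalize bInt t (mulUc τ j (mulUc τ j ψ)) (τ, y) = J4
  generalize y (Sum.inl j) = a at *
  generalize y (Sum.inr j) = b at *
  generalize conj a = a' at *
  generalize conj b = b' at *
  generalize conj t = t' at *
  generalize (‖t‖ : ℂ) = n at *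
  generalize Complex.I = I at *
  clear e1 e2 e3 g1 g2 g3 hu hd
  obtain ⟨m, hm⟩ : ∃ m, n * m = 1 := ⟨n⁻¹, mul_inv_cancel₀ hn⟩
  have f1 : t / n = t * m := by field_simp; grind
  have f2 : t' / n = t' * m := by field_simp; grind
  have f3 : ∀ x, x / (2 * t) = x / 2 * (t' * m * m) := by intro x; field_simp; grind
  have f4 : ∀ x, x / (2 * t') = x / 2 * (t * m * m) := by intro x; field_simp; grind
  have f5 : ∀ x, x / n = x * m := by intro x; field_simp; grind
  rw [f1, f2, f3, f4, f5, f5]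
  clear f1 f2 f3 f4 f5
  have htm : t * t' * m * m = 1 := by grind
  grind

end kernel
end GenusOne

end

noncomputable section
namespace GenusOne
open Filter

section kernel
open ComplexConjugate
variable {r : ℕ} {t τ : ℂ}

theorem schwartzSize_le_card_mul {E : Type} [NormedAddCommGroup E] [NormedSpace ℝ E]
    (k : Finset (ℕ × ℕ)) (ψ : 𝓢(E, ℂ)) :
    schwartzSize k ψ ≤ k.card * k.sup (schwartzSeminormFamily ℂ E ℂ) ψ := by
  rw [schwartzSize, ← nsmul_eq_mul]
  exact Finset.sum_le_card_nsmul _ _ _ fun i hi => Seminorm.le_def.1 (Finset.le_sup hi) ψ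

/-- The Bargmann transform, without normalisation, in the coordinates `yco`. -/
def bargHS (r : ℕ) (ht : t ≠ 0) (hτ : τ ∈ teich) : S0 r →L[ℂ] HS r ‖t‖ :=
  (SchwartzMap.mkCLM (𝕜 := ℂ) (𝕜' := ℂ) (fun (ψ : S0 r) y => bInt t ψ (τ, y))
    (fun ψ χ y => bInt_add ht ψ χ (τ, y)) (fun c ψ y => bInt_smul c ψ (τ, y))
    (fun ψ => bInt_slice_contDiff ht hτ ψ) (fun n => by
      obtain ⟨k, C, hC, h⟩ := bInt_bound (r := r) ht hτ n.2 n.1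
      refine ⟨k, C * k.card, by positivity, fun ψ y => ?_⟩
      have h1 := h.self_of_nhds ψ y
      rw [mul_assoc]
      refine le_trans ?_ (h1.trans (mul_le_mul_of_nonneg_left (schwartzSize_le_card_mul k ψ) hC))
      gcongr
      · linarith [norm_nonneg y]
      · exact norm_iteratedFDeriv_slice_le (bInt_rapid ht ψ).1 hτ n.2 y)).codRestrict (HS r ‖t‖)
    fun ψ => bInt_isHol ht hτ ψ

/-- The normalisation of the Bargmann transform. -/
def bargConst (r : ℕ) (t : ℂ) : ℂ := (((‖t‖ / Real.pi) ^ ((r : ℝ) / 2) * (1 / 2) ^ r : ℝ) : ℂ)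

open Classical in
/-- The Bargmann transform as a continuous operator. -/
def bargOp (r : ℕ) (ht : t ≠ 0) (τ : ℂ) : S0 r →L[ℂ] SC r τ t :=
  if hτ : τ ∈ teich then bargConst r t • (toSC ht hτ).comp (bargHS r ht hτ) else 0

theorem bargOp_apply (ht : t ≠ 0) (hτ : τ ∈ teich) (ψ : S0 r) (A : AC r) :
    (bargOp r ht τ ψ).1 A = bInt t (bargConst r t • ψ : S0 r) (τ, yco t τ A) := by
  rw [bargOp, dif_pos hτ, bInt_smul]; rfl

theorem bargOp_eq_bargmann (ht : t ≠ 0) (hτ : τ ∈ teich) (ψ : S0 r) (A : AC r) :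
    (bargOp r ht τ ψ).1 A = bargmann τ t ψ A := by
  rw [bargOp_apply ht hτ, bInt_smul, bargmann_eq ht hτ]; rfl

theorem bargOp_isSmoothTest (ht : t ≠ 0) (ψ : S0 r) : IsSmoothTest (fun τ => bargOp r ht τ ψ) := by
  have h := (bInt_rapid ht (bargConst r t • ψ)).comp_yco ht
  refine RapidFamily.congr h ?_
  intro τ hτ A
  exact bargOp_apply ht hτ ψ A

theorem bargOp_transpose_smooth (ht : t ≠ 0) {S : ∀ τ : ℂ, SC' r τ t} (hS : IsSmoothDistC S) :
    IsSmoothDist0 (fun τ => (S τ).comp (bargOp r ht τ)) :=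
  fun ψ => hS _ (bargOp_isSmoothTest ht ψ)

theorem bargOp_transpose_dual (ht : t ≠ 0) {S : ∀ τ : ℂ, SC' r τ t} (hτ : τ ∈ teich) (V : ℂ) {S' : SC' r τ t}
    (hS' : IsDualC V S τ S') :
    IsDualHW t V (fun τ' => (S τ').comp (bargOp r ht τ')) τ (S'.comp (bargOp r ht τ)) := by
  intro ψ
  obtain ⟨η, h1, h2⟩ := hS' _ (bargOp_isSmoothTest ht ψ)
  refine ⟨uOp r t V τ ψ, fun A => by rw [uOp_apply hτ, covHW_const], ?_⟩
  have : η = bargOp r ht τ (uOp r t V τ ψ) := by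
    refine Subtype.ext (SchwartzMap.ext fun A => ?_)
    rw [h1, covC_comp_yco ht hτ V (bInt_rapid ht (bargConst r t • ψ)).1 (bInt_isHol ht hτ _)
      (fun τ hτ A => bargOp_apply ht hτ ψ A), bInt_intertwines ht hτ, bargOp_apply ht hτ, map_smul]
  rw [this] at h2
  exact h2

end kernel
end GenusOne

end

noncomputable section
namespace GenusOne
open Filter
open scoped ENNReal NNReal

section weights
variable {X : Type} [NormedAddCommGroup X] [NormedSpace ℝ X] [FiniteDimensional ℝ X] [MeasurableSpace X]
  [BorelSpace X] (μ : Measure X) [μ.IsAddHaarMeasure]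
variable {G : Type*} [NormedAddCommGroup G]

/-- A polynomially decaying weight. -/
def wt (N : ℕ) (A : X) : ℝ := ((1 + ‖A‖) ^ N)⁻¹

theorem wt_pos (N : ℕ) (A : X) : 0 < wt N A := by
  have := norm_nonneg A
  unfold wt; positivity

theorem continuous_wt (N : ℕ) : Continuous (wt N : X → ℝ) := by
  refine Continuous.inv₀ (by fun_prop) fun A => ?_
  have := norm_nonneg A
  positivity

theorem integrable_wt : Integrable (wt (Module.finrank ℝ X + 1) : X → ℝ) μ := by
  have h := integrable_one_add_norm (E := X) (μ := μ) (r := ((Module.finrank ℝ X + 1 : ℕ) : ℝ))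
    (by push_cast; linarith)
  refine h.congr (Eventually.of_forall fun A => ?_)
  have : 0 ≤ 1 + ‖A‖ := by linarith [norm_nonneg A]
  simp only [wt]
  rw [Real.rpow_neg this, Real.rpow_natCast]

theorem wt_le_of_dist_le (N : ℕ) {A B : X} (h : ‖A - B‖ ≤ 1) : wt N A ≤ 2 ^ N * wt N B := by
  have h1 : ‖B‖ ≤ ‖A‖ + 1 := by
    have := norm_sub_norm_le B A
    rw [norm_sub_rev] at this; linarith
  have hA := norm_nonneg A
  have hB := norm_nonneg B
  rw [wt, wt, ← inv_inv (2 ^ N : ℝ), ← mul_inv]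
  refine inv_anti₀ (by positivity) ?_
  rw [inv_mul_le_iff₀ (by positivity), ← mul_pow]
  gcongr
  linarith

theorem exists_tsum_wt_le (Γ : AddSubgroup X) [Countable Γ] {ε : ℝ} (hε : 0 < ε)
    (hΓ : ∀ l ∈ Γ, ‖l‖ < ε → l = 0) : ∃ C : ℝ≥0, ∀ A : X,
      ∑' l : Γ, ENNReal.ofReal (wt (Module.finrank ℝ X + 1) (l +ᵥ A)) ≤ C := by
  obtain ⟨μ, hμ⟩ : ∃ μ : Measure X, μ.IsAddHaarMeasure := ⟨Measure.addHaar, inferInstance⟩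
  let N := Module.finrank ℝ X + 1
  let δ := min (ε / 2) 1
  have hδ : 0 < δ := by positivity
  have hδ1 : δ ≤ 1 := min_le_right _ _
  have hδ2 : δ ≤ ε / 2 := min_le_left _ _
  set v := μ (Metric.ball (0 : X) δ) with hv
  have hv0 : v ≠ 0 := (Metric.measure_ball_pos μ _ hδ).ne'
  have hvt : v ≠ ⊤ := measure_ball_lt_top.ne
  have hI : ∫⁻ A, ENNReal.ofReal (wt N A) ∂μ < ⊤ := by
    have := (integrable_wt (X := X) μ).2
    rw [hasFiniteIntegral_iff_ofReal (Eventually.of_forall fun A => (wt_pos _ _).le)] at this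
    exact this
  set I := ∫⁻ A, ENNReal.ofReal (wt N A) ∂μ
  have hfin : v⁻¹ * (ENNReal.ofReal (2 ^ N) * I) ≠ ⊤ :=
    ENNReal.mul_ne_top (ENNReal.inv_ne_top.2 hv0) (ENNReal.mul_ne_top ENNReal.ofReal_ne_top hI.ne)
  refine ⟨(v⁻¹ * (ENNReal.ofReal (2 ^ N) * I)).toNNReal, fun A => ?_⟩
  rw [ENNReal.coe_toNNReal hfin]
  have hb : ∀ l : Γ, v * ENNReal.ofReal (wt N (l +ᵥ A)) ≤
      ENNReal.ofReal (2 ^ N) * ∫⁻ x in Metric.ball (l +ᵥ A) δ, ENNReal.ofReal (wt N x) ∂μ := by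
    intro l
    have e : v = μ (Metric.ball (l +ᵥ A) δ) := (Measure.addHaar_ball_center μ (l +ᵥ A) δ).symm
    rw [← lintegral_const_mul _ ((continuous_wt N).measurable.ennreal_ofReal), e, mul_comm,
      ← setLIntegral_const]
    refine setLIntegral_mono' Metric.isOpen_ball.measurableSet fun x hx => ?_
    rw [← ENNReal.ofReal_mul (by positivity)]
    refine ENNReal.ofReal_le_ofReal (wt_le_of_dist_le N ?_)
    rw [← dist_eq_norm, dist_comm]
    exact (Metric.mem_ball.1 hx).le.trans hδ1
  have hdisj : Pairwise (Function.onFun Disjoint fun l : Γ => Metric.ball (l +ᵥ A) δ) := by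
    intro l l' hll
    rw [Function.onFun, Set.disjoint_left]
    intro x h1 h2
    apply hll
    have : ((l : X) - l') = 0 := by
      refine hΓ _ (Γ.sub_mem l.2 l'.2) ?_
      have h3 : dist (l +ᵥ A) (l' +ᵥ A) < ε := by
        calc dist (l +ᵥ A) (l' +ᵥ A) ≤ dist x (l +ᵥ A) + dist x (l' +ᵥ A) := dist_triangle_left _ _ _
          _ < δ + δ := add_lt_add h1 h2
          _ ≤ ε := by linarith
      rw [dist_eq_norm] at h3
      simpa [AddSubgroup.vadd_def] using h3
    exact Subtype.ext (sub_eq_zero.1 this)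
  have key : v * ∑' l : Γ, ENNReal.ofReal (wt N (l +ᵥ A)) ≤ ENNReal.ofReal (2 ^ N) * I := by
    rw [← ENNReal.tsum_mul_left]
    refine (ENNReal.tsum_le_tsum hb).trans ?_
    rw [ENNReal.tsum_mul_left, ← lintegral_iUnion (fun l => Metric.isOpen_ball.measurableSet) hdisj]
    gcongr
    exact setLIntegral_le_lintegral _ _
  calc ∑' l : Γ, ENNReal.ofReal (wt N (l +ᵥ A)) = v⁻¹ * (v * ∑' l : Γ, ENNReal.ofReal (wt N (l +ᵥ A))) := by
        rw [← mul_assoc, ENNReal.inv_mul_cancel hv0 hvt, one_mul]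
    _ ≤ _ := by gcongr

theorem exists_lintegral_wt_mul_le (Γ : AddSubgroup X) [Countable Γ] {ε : ℝ} (hε : 0 < ε)
    (hΓ : ∀ l ∈ Γ, ‖l‖ < ε → l = 0) : ∃ C : ℝ≥0, ∀ D : Set X, IsAddFundamentalDomain Γ D μ →
      ∀ φ : X → G, AEStronglyMeasurable φ μ → (∀ l ∈ Γ, ∀ A, ‖φ (A + l)‖ = ‖φ A‖) →
        ∫⁻ A, ENNReal.ofReal (wt (Module.finrank ℝ X + 1) A) * ‖φ A‖ₑ ∂μ ≤ C * eLpNorm φ 2 (μ.restrict D) := by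
  let N := Module.finrank ℝ X + 1
  obtain ⟨C, hC⟩ := exists_tsum_wt_le Γ hε hΓ
  have hI : ∫⁻ A, ENNReal.ofReal (wt N A) ∂μ < ⊤ := by
    have := (integrable_wt (X := X) μ).2
    rw [hasFiniteIntegral_iff_ofReal (Eventually.of_forall fun A => (wt_pos _ _).le)] at this
    exact this
  set I := ∫⁻ A, ENNReal.ofReal (wt N A) ∂μ
  refine ⟨((C * I) ^ (1 / 2 : ℝ)).toNNReal, fun D hD φ hφ hper => ?_⟩
  rw [ENNReal.coe_toNNReal (ENNReal.rpow_ne_top_of_nonneg (by norm_num) (ENNReal.mul_ne_top ENNReal.coe_ne_top hI.ne))]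
  let S : X → ℝ≥0∞ := fun A => ∑' l : Γ, ENNReal.ofReal (wt N (l +ᵥ A))
  have hSm : Measurable S := Measurable.ennreal_tsum fun l =>
    ((continuous_wt N).comp (continuous_const_vadd l)).measurable.ennreal_ofReal
  have hφ' : AEMeasurable (fun A => ‖φ A‖ₑ) (μ.restrict D) := hφ.enorm.restrict
  have h1 : ∫⁻ A, ENNReal.ofReal (wt N A) * ‖φ A‖ₑ ∂μ = ∫⁻ A in D, (S * fun A => ‖φ A‖ₑ) A ∂μ := by
    rw [hD.lintegral_eq_tsum'']
    have e : ∀ (l : Γ) A, ENNReal.ofReal (wt N (l +ᵥ A)) * ‖φ (l +ᵥ A)‖ₑ = ENNReal.ofReal (wt N (l +ᵥ A)) * ‖φ A‖ₑ := by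
      intro l A
      congr 1
      have : l +ᵥ A = A + l := by rw [AddSubgroup.vadd_def, vadd_eq_add, add_comm]
      rw [this, ← ofReal_norm, hper l l.2, ofReal_norm]
    simp only [e]
    have hm : ∀ l : Γ, AEMeasurable (fun A => ENNReal.ofReal (wt N (l +ᵥ A)) * ‖φ A‖ₑ) (μ.restrict D) := fun l =>
      AEMeasurable.mul
        (((continuous_wt N).comp (continuous_const_vadd l)).measurable.ennreal_ofReal.aemeasurable) hφ'
    rw [← lintegral_tsum hm]
    simp only [ENNReal.tsum_mul_right, S, Pi.mul_apply]
  have h2 : ∫⁻ A in D, S A ^ (2 : ℝ) ∂μ ≤ C * I := by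
    calc ∫⁻ A in D, S A ^ (2 : ℝ) ∂μ ≤ ∫⁻ A in D, C * S A ∂μ := by
          refine lintegral_mono fun A => ?_
          rw [ENNReal.rpow_two, sq]
          gcongr
          exact hC A
      _ = C * I := by
          rw [lintegral_const_mul _ hSm]
          congr 1
          change _ = ∫⁻ A, ENNReal.ofReal (wt N A) ∂μ
          rw [hD.lintegral_eq_tsum'', lintegral_tsum]
          exact fun l => ((continuous_wt N).comp (continuous_const_vadd l)).measurable.ennreal_ofReal.aemeasurable
  rw [h1]
  refine (ENNReal.lintegral_mul_le_Lp_mul_Lq _ Real.HolderConjugate.two_two hSm.aemeasurable hφ').trans ?_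
  rw [eLpNorm_eq_lintegral_rpow_enorm_toReal (by norm_num) (by norm_num)]
  simp only [ENNReal.toReal_ofNat]
  gcongr

variable {F : Type*} [NormedAddCommGroup F] [NormedSpace ℝ F]

/-- Functions which are integrable against a polynomially decaying weight. -/
def SlowInt (f : X → F) : Prop := ∃ N : ℕ, Integrable (fun A => wt N A • f A) μ

variable {μ}

theorem slowInt_of_lintegral {f : X → F} (hf : AEStronglyMeasurable f μ) {N : ℕ}
    (h : ∫⁻ A, ENNReal.ofReal (wt N A) * ‖f A‖ₑ ∂μ < ⊤) : SlowInt μ f := by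
  refine ⟨N, (continuous_wt N).aestronglyMeasurable.smul hf, ?_⟩
  refine lt_of_le_of_lt (lintegral_mono fun A => ?_) h
  rw [enorm_smul, Real.enorm_eq_ofReal (wt_pos _ _).le]

theorem SlowInt.aestronglyMeasurable {f : X → F} (hf : SlowInt μ f) : AEStronglyMeasurable f μ := by
  obtain ⟨N, h⟩ := hf
  have := ((continuous_wt (X := X) N).inv₀ fun A => (wt_pos N A).ne').aestronglyMeasurable (μ := μ) |>.smul h.1
  refine this.congr (Eventually.of_forall fun A => ?_)
  simp [smul_smul, inv_mul_cancel₀ (wt_pos N A).ne']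

theorem SlowInt.locallyIntegrable {f : X → F} (hf : SlowInt μ f) : LocallyIntegrable f μ := by
  obtain ⟨N, h⟩ := hf
  have hc : Continuous fun A : X => (wt N A)⁻¹ := (continuous_wt (X := X) N).inv₀ fun A => (wt_pos N A).ne'
  have := h.locallyIntegrable.continuous_smul hc
  refine this.congr (Eventually.of_forall fun A => ?_)
  simp [smul_smul, inv_mul_cancel₀ (wt_pos N A).ne']

theorem wt_mul_pow (N M : ℕ) (A : X) : wt (N + M) A * (1 + ‖A‖) ^ M = wt N A := by
  have : 0 < 1 + ‖A‖ := by linarith [norm_nonneg A]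
  rw [wt, wt, pow_add]; field_simp

theorem wt_anti {N M : ℕ} (h : N ≤ M) (A : X) : wt M A ≤ wt N A := by
  have : 0 ≤ ‖A‖ := norm_nonneg A
  unfold wt
  gcongr
  linarith

theorem SlowInt.integrable_of_le {f : X → F} (hf : SlowInt μ f) : ∃ N₀, ∀ N ≥ N₀,
    Integrable (fun A => wt N A • f A) μ := by
  have hm := hf.aestronglyMeasurable
  obtain ⟨N, h⟩ := hf
  refine ⟨N, fun M hM => h.mono ((continuous_wt M).aestronglyMeasurable.smul hm) (Eventually.of_forall fun A => ?_)⟩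
  rw [norm_smul, norm_smul, Real.norm_of_nonneg (wt_pos _ _).le, Real.norm_of_nonneg (wt_pos _ _).le]
  gcongr
  exact wt_anti hM A

theorem SlowInt.add {f g : X → F} (hf : SlowInt μ f) (hg : SlowInt μ g) : SlowInt μ (fun A => f A + g A) := by
  obtain ⟨N, h⟩ := hf.integrable_of_le
  obtain ⟨M, h'⟩ := hg.integrable_of_le
  refine ⟨max N M, ((h (max N M) (le_max_left _ _)).add (h' (max N M) (le_max_right _ _))).congr
    (Eventually.of_forall fun A => ?_)⟩
  simp

theorem SlowInt.mono {f : X → F} {F' : Type*} [NormedAddCommGroup F'] [NormedSpace ℝ F'] {g : X → F'}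
    (hf : SlowInt μ f) (hg : AEStronglyMeasurable g μ) {C : ℝ} {M : ℕ}
    (h : ∀ A, ‖g A‖ ≤ C * (1 + ‖A‖) ^ M * ‖f A‖) : SlowInt μ g := by
  obtain ⟨N, hN⟩ := hf
  refine ⟨N + M, (hN.norm.const_mul C).mono ((continuous_wt _).aestronglyMeasurable.smul hg)
    (Eventually.of_forall fun A => ?_)⟩
  have hw := wt_pos (N + M) A
  rw [norm_smul, Real.norm_of_nonneg hw.le, norm_smul, Real.norm_of_nonneg (wt_pos N A).le]
  calc wt (N + M) A * ‖g A‖ ≤ wt (N + M) A * (C * (1 + ‖A‖) ^ M * ‖f A‖) := by gcongr; exact h A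
    _ = C * ((wt (N + M) A * (1 + ‖A‖) ^ M) * ‖f A‖) := by ring
    _ = C * (wt N A * ‖f A‖) := by rw [wt_mul_pow]
    _ ≤ _ := le_abs_self _

theorem slowInt_of_bound {f : X → F} (hf : AEStronglyMeasurable f μ) {C : ℝ} {M : ℕ}
    (h : ∀ A, ‖f A‖ ≤ C * (1 + ‖A‖) ^ M) : SlowInt μ f := by
  have h1 : SlowInt μ (fun _ : X => (1 : ℝ)) := ⟨Module.finrank ℝ X + 1, by simpa using integrable_wt μ⟩
  exact h1.mono hf (C := C) (M := M) fun A => by simpa using h A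

theorem SlowInt.mul_bound {f g : X → ℂ} (hf : SlowInt μ f) (hg : Continuous g) {C : ℝ} {M : ℕ}
    (h : ∀ A, ‖g A‖ ≤ C * (1 + ‖A‖) ^ M) : SlowInt μ (fun A => g A * f A) :=
  hf.mono (hg.aestronglyMeasurable.mul hf.aestronglyMeasurable) (C := C) (M := M) fun A => by
    rw [norm_mul]
    exact mul_le_mul_of_nonneg_right (h A) (norm_nonneg _)

theorem SlowInt.const_mul {f : X → ℂ} (c : ℂ) (hf : SlowInt μ f) : SlowInt μ (fun A => c * f A) :=
  hf.mul_bound (g := fun _ => c) continuous_const (C := ‖c‖) (M := 0) fun A => by simp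

theorem SlowInt.sum {ι : Type*} (s : Finset ι) {f : ι → X → F} (hf : ∀ i ∈ s, SlowInt μ (f i)) :
    SlowInt μ (fun A => ∑ i ∈ s, f i A) := by
  classical
  induction s using Finset.induction_on with
  | empty => exact ⟨0, by simp⟩
  | insert a s ha ih =>
    simp only [Finset.sum_insert ha]
    exact (hf a (Finset.mem_insert_self _ _)).add (ih fun i hi => hf i (Finset.mem_insert_of_mem hi))

theorem schwartz_weighted_bound (N : ℕ) (χ : 𝓢(X, ℂ)) (A : X) :
    ‖χ A‖ ≤ wt N A * (2 ^ N * (Finset.Iic (N, 0)).sup (schwartzSeminormFamily ℂ X ℂ) χ) := by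
  have h := SchwartzMap.one_add_le_sup_seminorm_apply (𝕜 := ℂ) (m := (N, 0)) (k := N) (n := 0) le_rfl le_rfl χ A
  rw [norm_iteratedFDeriv_zero] at h
  have hp : 0 < (1 + ‖A‖) ^ N := by have := norm_nonneg A; positivity
  rw [wt, ← div_eq_inv_mul, le_div_iff₀ hp, mul_comm]
  exact h

theorem norm_mul_schwartz_le (N : ℕ) (f : X → ℂ) (χ : 𝓢(X, ℂ)) (A : X) : ‖f A * star (χ A)‖ ≤
    (2 ^ N * (Finset.Iic (N, 0)).sup (schwartzSeminormFamily ℂ X ℂ) χ) * ‖wt N A • f A‖ := by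
  rw [norm_mul, norm_star, norm_smul, Real.norm_of_nonneg (wt_pos N A).le]
  calc ‖f A‖ * ‖χ A‖ ≤ ‖f A‖ * _ := mul_le_mul_of_nonneg_left (schwartz_weighted_bound N χ A) (norm_nonneg _)
    _ = _ := by ring

theorem SlowInt.integrable_mul_star {f : X → ℂ} (hf : SlowInt μ f) (χ : 𝓢(X, ℂ)) :
    Integrable (fun A => f A * star (χ A)) μ := by
  have hm := hf.aestronglyMeasurable
  obtain ⟨N, hN⟩ := hf
  refine (hN.norm.const_mul _).mono (hm.mul χ.continuous.star.aestronglyMeasurable)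
    (Eventually.of_forall fun A => (norm_mul_schwartz_le N f χ A).trans (le_abs_self _))

theorem SlowInt.exists_functional {f : X → ℂ} (hf : SlowInt μ f) :
    ∃ S : 𝓢(X, ℂ) →L⋆[ℂ] ℂ, ∀ χ, S χ = ∫ A, f A * star (χ A) ∂μ := by
  have hi := fun χ => hf.integrable_mul_star χ
  obtain ⟨N, hN⟩ := hf
  refine ⟨SchwartzMap.mkCLMtoNormedSpace (σ := starRingEnd ℂ) (fun χ : 𝓢(X, ℂ) => ∫ A, f A * star (χ A) ∂μ)
    (fun χ ξ => ?_) (fun c χ => ?_) ⟨Finset.Iic (N, 0), 2 ^ N * ∫ A, ‖wt N A • f A‖ ∂μ, by positivity, fun χ => ?_⟩,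
    fun χ => rfl⟩
  · rw [← integral_add (hi χ) (hi ξ)]
    simp [mul_add]
  · rw [smul_eq_mul, ← integral_const_mul]
    refine integral_congr_ae (Eventually.of_forall fun A => ?_)
    simp; ring
  · refine (norm_integral_le_integral_norm _).trans ?_
    rw [mul_right_comm, ← integral_const_mul]
    exact integral_mono (hi χ).norm (hN.norm.const_mul _) fun A => norm_mul_schwartz_le N f χ A

end weights

section regular
variable {r : ℕ} {t τ : ℂ}

theorem SlowInt.exists_isRegular0 {ψ : A0 r → ℂ} (h : SlowInt volume ψ) : ∃ S : S0' r, IsRegular0 S ψ := by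
  obtain ⟨S, hS⟩ := h.exists_functional
  exact ⟨S, fun χ => ⟨h.integrable_mul_star χ, hS χ⟩⟩

theorem SlowInt.exists_isRegularC {φ : AC r → ℂ} (h : SlowInt volume φ) : ∃ S : SC' r τ t, IsRegularC S φ := by
  obtain ⟨S, hS⟩ := h.exists_functional
  exact ⟨S.comp (SC r τ t).subtypeL, fun χ => ⟨h.integrable_mul_star χ.1, hS χ.1⟩⟩

theorem ae_eq_of_isRegular0 {ψ₁ ψ₂ : A0 r → ℂ} (h₁ : SlowInt volume ψ₁) (h₂ : SlowInt volume ψ₂) {S : S0' r}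
    (hS₁ : IsRegular0 S ψ₁) (hS₂ : IsRegular0 S ψ₂) : ψ₁ =ᵐ[volume] ψ₂ := by
  refine ae_eq_of_integral_contDiff_smul_eq h₁.locallyIntegrable h₂.locallyIntegrable fun g hg hc => ?_
  have hgc : ContDiff ℝ ∞ fun A => (g A : ℂ) := Complex.ofRealCLM.contDiff.comp hg
  have hcc : HasCompactSupport fun A => (g A : ℂ) := hc.comp_left (g := fun x : ℝ => (x : ℂ)) rfl
  have e : ∀ ψ : A0 r → ℂ, ∫ A, g A • ψ A = ∫ A, ψ A * star (hcc.toSchwartzMap hgc A) := fun ψ =>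
    integral_congr_ae (Eventually.of_forall fun A => by
      change g A • ψ A = ψ A * star (g A : ℂ)
      simp [mul_comm])
  rw [e, e, ← (hS₁ _).2, ← (hS₂ _).2]

end regular
end GenusOne

end

noncomputable section
namespace GenusOne
open Filter

section expimage
variable {𝔸 G : Type*} [NormedRing 𝔸] [NormedAlgebra ℝ 𝔸] [NormedAlgebra ℚ 𝔸] [FiniteDimensional ℝ 𝔸]
  [CompleteSpace 𝔸] [Group G] [TopologicalSpace G] [IsTopologicalGroup G] (ι : G →* 𝔸)

theorem commute_of_exp_smul_commute {X h : 𝔸}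
    (H : ∀ x : ℝ, NormedSpace.exp (x • X) * h = h * NormedSpace.exp (x • X)) : X * h = h * X := by
  have h1 := hasDerivAt_exp_smul_const X (0 : ℝ)
  simp only [zero_smul, NormedSpace.exp_zero, one_mul] at h1
  have h2 := h1.mul_const h
  have h3 := h1.const_mul h
  rw [show (fun x : ℝ => NormedSpace.exp (x • X) * h) = fun x => h * NormedSpace.exp (x • X) from funext H] at h2
  exact h2.unique h3

/-- The generators of the one-parameter subgroups in the image of `ι`. -/
def oneParam : Set 𝔸 := {X | ∀ x : ℝ, ∃ g, ι g = NormedSpace.exp (x • X)}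

variable {ι}

theorem oneParam_commute (hab : ∀ g h : G, g * h = h * g) {X Y : 𝔸} (hX : X ∈ oneParam ι)
    (hY : Y ∈ oneParam ι) : Commute X Y := by
  have h1 : ∀ x y : ℝ, NormedSpace.exp (x • X) * NormedSpace.exp (y • Y) =
      NormedSpace.exp (y • Y) * NormedSpace.exp (x • X) := fun x y => by
    obtain ⟨g, e1⟩ := hX x
    obtain ⟨h, e2⟩ := hY y
    rw [← e1, ← e2, ← map_mul, hab, map_mul]
  have h2 : ∀ y : ℝ, NormedSpace.exp (y • Y) * X = X * NormedSpace.exp (y • Y) := fun y =>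
    (commute_of_exp_smul_commute fun x => h1 x y).symm
  exact (commute_of_exp_smul_commute h2).symm

theorem exp_mem_of_mem_oneParam {X : 𝔸} (hX : X ∈ oneParam ι) : ∃ g, ι g = NormedSpace.exp X := by
  simpa using hX 1

/-- The limit direction of a sequence of small elements lies in the Lie algebra. -/
theorem mem_oneParam_of_tendsto [CompactSpace G] (hι : Continuous ι) {Y : ℕ → 𝔸} (h0 : ∀ k, Y k ≠ 0)
    (hY : Tendsto Y atTop (𝓝 0)) (hYT : ∀ k, ∃ g, ι g = NormedSpace.exp (Y k)) {Z : 𝔸}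
    (hZ : Tendsto (fun k => ‖Y k‖⁻¹ • Y k) atTop (𝓝 Z)) : Z ∈ oneParam ι := by
  have hTM : IsClosed {M : 𝔸 | ∃ g, ι g = M} := (isCompact_range hι).isClosed
  have pos : ∀ x : ℝ, 0 ≤ x → ∃ g, ι g = NormedSpace.exp (x • Z) := by
    intro x hx
    let m : ℕ → ℕ := fun k => ⌊x / ‖Y k‖⌋₊
    have hn : ∀ k, 0 < ‖Y k‖ := fun k => norm_pos_iff.2 (h0 k)
    have h1 : Tendsto (fun k => (m k • Y k)) atTop (𝓝 (x • Z)) := by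
      have h2 : Tendsto (fun k => x • (‖Y k‖⁻¹ • Y k)) atTop (𝓝 (x • Z)) := hZ.const_smul x
      have h3 : Tendsto (fun k => (m k • Y k) - x • (‖Y k‖⁻¹ • Y k)) atTop (𝓝 0) := by
        refine squeeze_zero_norm (fun k => ?_) (tendsto_norm_zero.comp hY)
        have e : (m k • Y k) - x • (‖Y k‖⁻¹ • Y k) = ((m k : ℝ) - x / ‖Y k‖) • Y k := by
          rw [sub_smul, smul_smul, div_eq_mul_inv, Nat.cast_smul_eq_nsmul]
        rw [e, norm_smul]
        refine mul_le_of_le_one_left (norm_nonneg _) ?_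
        have hq : 0 ≤ x / ‖Y k‖ := div_nonneg hx (hn k).le
        have f1 := Nat.floor_le hq
        have f2 := Nat.lt_floor_add_one (x / ‖Y k‖)
        rw [Real.norm_eq_abs, abs_le]
        constructor <;> simp only [m] <;> linarith
      have := h3.add h2
      simpa using this
    have h2 : Tendsto (fun k => NormedSpace.exp (m k • Y k)) atTop (𝓝 (NormedSpace.exp (x • Z))) :=
      (NormedSpace.exp_continuous.tendsto _).comp h1
    refine hTM.mem_of_tendsto h2 (Eventually.of_forall fun k => ?_)
    obtain ⟨g, e⟩ := hYT k
    exact ⟨g ^ m k, by rw [NormedSpace.exp_nsmul, ← e, map_pow]⟩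
  intro x
  rcases le_total 0 x with hx | hx
  · exact pos x hx
  · obtain ⟨g, e⟩ := pos (-x) (by linarith)
    refine ⟨g⁻¹, left_inv_eq_right_inv (a := ι g) (by rw [← map_mul, inv_mul_cancel, map_one]) ?_⟩
    rw [e, ← NormedSpace.exp_add_of_commute (by simp [Commute.neg_left]), neg_smul, neg_add_cancel,
      NormedSpace.exp_zero]

theorem exists_nhds_exp [CompactSpace G] (hι : Continuous ι) (p : Submodule ℝ (𝔸))
    (hp : ∀ X, X ∈ oneParam ι ↔ X ∈ p) {ε : ℝ} (hε : 0 < ε) :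
    ∃ W ∈ 𝓝 (1 : 𝔸), ∀ g, ι g ∈ W → ∃ X ∈ p, ‖X‖ < ε ∧ NormedSpace.exp X = ι g := by
  by_contra! H
  obtain ⟨q, hq⟩ := p.exists_isCompl
  let Φ : p × q → 𝔸 := fun z => NormedSpace.exp (z.1 : 𝔸) * NormedSpace.exp (z.2 : 𝔸)
  let L : p × q →L[ℝ] 𝔸 := p.subtypeL.comp (ContinuousLinearMap.fst ℝ p q) +
    q.subtypeL.comp (ContinuousLinearMap.snd ℝ p q)
  have hexp : HasStrictFDerivAt (NormedSpace.exp : 𝔸 → 𝔸) (1 : 𝔸 →L[ℝ] 𝔸) 0 := hasStrictFDerivAt_exp_zero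
  have d1 : HasStrictFDerivAt (fun z : p × q => NormedSpace.exp (z.1 : 𝔸))
      (p.subtypeL.comp (ContinuousLinearMap.fst ℝ p q)) 0 := by
    have h := HasStrictFDerivAt.comp (0 : p × q) (g := NormedSpace.exp) (f := fun z : p × q => (z.1 : 𝔸))
      (g' := (1 : 𝔸 →L[ℝ] 𝔸)) (by simpa using hexp)
      (p.subtypeL.comp (ContinuousLinearMap.fst ℝ p q)).hasStrictFDerivAt
    exact h
  have d2 : HasStrictFDerivAt (fun z : p × q => NormedSpace.exp (z.2 : 𝔸))
      (q.subtypeL.comp (ContinuousLinearMap.snd ℝ p q)) 0 := by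
    have h := HasStrictFDerivAt.comp (0 : p × q) (g := NormedSpace.exp) (f := fun z : p × q => (z.2 : 𝔸))
      (g' := (1 : 𝔸 →L[ℝ] 𝔸)) (by simpa using hexp)
      (q.subtypeL.comp (ContinuousLinearMap.snd ℝ p q)).hasStrictFDerivAt
    exact h
  have hΦ : HasStrictFDerivAt Φ L 0 := by
    refine (d1.mul' d2).congr_fderiv ?_
    refine ContinuousLinearMap.ext fun z => ?_
    simp [L, add_comm]
  have hL : L.range = ⊤ := by
    rw [eq_top_iff]
    rintro M -
    obtain ⟨x, hx, y, hy, rfl⟩ := Submodule.mem_sup.1 ((hq.sup_eq_top ▸ Submodule.mem_top : M ∈ p ⊔ q))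
    exact ⟨(⟨x, hx⟩, ⟨y, hy⟩), rfl⟩
  have hmap := hΦ.map_nhds_eq_of_surj hL
  have hΦ0 : Φ 0 = 1 := by simp [Φ]
  rw [hΦ0] at hmap
  have hk : ∀ k : ℕ, ∃ z : p × q, ‖z‖ < ε ∧ ‖z‖ < 1 / ((k : ℝ) + 1) ∧ z.2 ≠ 0 ∧
      ∃ g, ι g = NormedSpace.exp (z.2 : 𝔸) := by
    intro k
    have hW : Φ '' (Metric.ball 0 (min ε (1 / ((k : ℝ) + 1)))) ∈ 𝓝 (1 : 𝔸) := by
      rw [← hmap]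
      exact image_mem_map (Metric.ball_mem_nhds _ (lt_min hε (by positivity)))
    obtain ⟨g, ⟨z, hz, hzg⟩, hno⟩ := H _ hW
    rw [mem_ball_zero_iff, lt_min_iff] at hz
    refine ⟨z, hz.1, hz.2, fun h0 => ?_, ?_⟩
    · refine hno z.1 z.1.2 ?_ ?_
      · exact lt_of_le_of_lt (norm_fst_le z) hz.1
      · rw [← hzg]; simp [Φ, h0]
    · obtain ⟨h, e⟩ := exp_mem_of_mem_oneParam ((hp _).2 z.1.2)
      exact ⟨h⁻¹ * g, by rw [map_mul, ← hzg]; simp only [Φ]; rw [← e, ← mul_assoc, ← map_mul, inv_mul_cancel, map_one, one_mul]⟩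
  choose z hzε hz hz0 hzT using hk
  let Y : ℕ → q := fun k => (z k).2
  have hYn : ∀ k, Y k ≠ 0 := hz0
  have hsph : ∀ k, ‖Y k‖⁻¹ • Y k ∈ Metric.sphere (0 : q) 1 := fun k => by
    rw [mem_sphere_zero_iff_norm, norm_smul, norm_inv, norm_norm, inv_mul_cancel₀ (norm_ne_zero_iff.2 (hYn k))]
  obtain ⟨Z, hZ, φ, hφ, hlim⟩ := (isCompact_sphere (0 : q) 1).tendsto_subseq hsph
  have hY0 : Tendsto (fun k => (Y k : 𝔸)) atTop (𝓝 0) := by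
    refine squeeze_zero_norm (fun k => ?_) tendsto_one_div_add_atTop_nhds_zero_nat
    exact (norm_snd_le (z k)).trans (hz k).le
  have hmem : (Z : 𝔸) ∈ oneParam ι := by
    refine mem_oneParam_of_tendsto hι (Y := fun k => (Y (φ k) : 𝔸)) (fun k => ?_) (hY0.comp hφ.tendsto_atTop)
      (fun k => hzT (φ k)) ?_
    · simpa using hYn (φ k)
    · exact (continuous_subtype_val.tendsto Z).comp hlim
  have hZ0 : (Z : 𝔸) = 0 := by
    have := hq.disjoint
    rw [Submodule.disjoint_def] at this
    exact this _ ((hp _).1 hmem) Z.2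
  rw [mem_sphere_zero_iff_norm] at hZ
  have : ‖(Z : 𝔸)‖ = 1 := hZ
  rw [hZ0, norm_zero] at this
  exact zero_ne_one this

theorem exists_bound_exp_surjective [CompactSpace G] (hι : Continuous ι) [ConnectedSpace G]
    (hab : ∀ g h : G, g * h = h * g) (p : Submodule ℝ (𝔸)) (hp : ∀ X, X ∈ oneParam ι ↔ X ∈ p) :
    ∃ R : ℝ, ∀ g, ∃ X ∈ p, ‖X‖ < R ∧ NormedSpace.exp X = ι g := by
  have hadd : ∀ X ∈ p, ∀ Y ∈ p, NormedSpace.exp (X + Y) = NormedSpace.exp X * NormedSpace.exp Y :=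
    fun X hX Y hY => NormedSpace.exp_add_of_commute (oneParam_commute hab ((hp X).2 hX) ((hp Y).2 hY))
  let B : ℕ → Set G := fun m => {g | ∃ X ∈ p, ‖X‖ < m ∧ NormedSpace.exp X = ι g}
  have hB : ∀ m, IsOpen (B m) := fun m => by
    rw [isOpen_iff_mem_nhds]
    rintro g ⟨X, hX, hXm, hXg⟩
    obtain ⟨W, hW, h⟩ := exists_nhds_exp hι p hp (sub_pos.2 hXm)
    have : (fun g' : G => ι (g⁻¹ * g')) ⁻¹' W ∈ 𝓝 g := by
      refine (hι.comp (continuous_const.mul continuous_id)).continuousAt.preimage_mem_nhds ?_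
      simpa using hW
    filter_upwards [this] with g' hg'
    obtain ⟨Z, hZ, hZn, hZg⟩ := h _ hg'
    refine ⟨X + Z, p.add_mem hX hZ, lt_of_le_of_lt (norm_add_le _ _) (by linarith), ?_⟩
    rw [hadd X hX Z hZ, hXg, hZg, ← map_mul, mul_inv_cancel_left]
  let H : Subgroup G :=
    { carrier := {g | ∃ X ∈ p, NormedSpace.exp X = ι g}
      mul_mem' := by
        rintro g h ⟨X, hX, e⟩ ⟨Y, hY, e'⟩
        exact ⟨X + Y, p.add_mem hX hY, by rw [hadd X hX Y hY, e, e', map_mul]⟩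
      one_mem' := ⟨0, p.zero_mem, by simp⟩
      inv_mem' := by
        rintro g ⟨X, hX, e⟩
        refine ⟨-X, p.neg_mem hX, ?_⟩
        refine (left_inv_eq_right_inv (a := ι g) (by rw [← map_mul, inv_mul_cancel, map_one]) ?_).symm
        rw [← e, ← hadd X hX _ (p.neg_mem hX), add_neg_cancel, NormedSpace.exp_zero] }
  have hHo : IsOpen (H : Set G) := by
    refine Subgroup.isOpen_of_mem_nhds H (g := 1) ?_
    refine mem_of_superset ((hB 1).mem_nhds ⟨0, p.zero_mem, by simp, by simp⟩) ?_
    rintro g ⟨X, hX, -, e⟩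
    exact ⟨X, hX, e⟩
  have hHtop : (H : Set G) = Set.univ := IsClopen.eq_univ ⟨Subgroup.isClosed_of_isOpen H hHo, hHo⟩ ⟨1, H.one_mem⟩
  obtain ⟨m, hm⟩ := isCompact_univ.elim_directed_cover B hB (fun g _ => by
    have : g ∈ (H : Set G) := by rw [hHtop]; trivial
    obtain ⟨X, hX, e⟩ := this
    obtain ⟨m, hm⟩ := exists_nat_gt ‖X‖
    exact Set.mem_iUnion.2 ⟨m, X, hX, hm, e⟩) (by
    refine (monotone_nat_of_le_succ fun m => ?_).directed_le
    rintro g ⟨X, hX, hm, e⟩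
    exact ⟨X, hX, hm.trans_le (by push_cast; linarith), e⟩)
  exact ⟨m, fun g => hm (Set.mem_univ g)⟩

theorem exp_eq_one_small : ∃ ε > 0, ∀ X : 𝔸, ‖X‖ < ε → NormedSpace.exp X = 1 → X = 0 := by
  have h : HasFDerivAt (NormedSpace.exp : 𝔸 → 𝔸) (1 : 𝔸 →L[ℝ] 𝔸) 0 := hasFDerivAt_exp_zero
  have h2 := h.isLittleO.def (c := 1 / 2) (by norm_num)
  obtain ⟨ε, hε, h3⟩ := Metric.eventually_nhds_iff_ball.1 h2
  refine ⟨ε, hε, fun X hX hX1 => ?_⟩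
  have h4 := h3 X (by simpa using hX)
  rw [NormedSpace.exp_zero, hX1] at h4
  simp at h4
  have : ‖X‖ = 0 := by linarith [norm_nonneg X]
  exact norm_eq_zero.1 this

end expimage
end GenusOne

end

noncomputable section
namespace GenusOne
open Filter

theorem exists_bounded_fundamentalDomain {E : Type*} [NormedAddCommGroup E] [NormedSpace ℝ E]
    [FiniteDimensional ℝ E] [MeasurableSpace E] [BorelSpace E] (μ : Measure E) (Γ : AddSubgroup E) {ε : ℝ} (hε : 0 < ε)
    (hsep : ∀ l ∈ Γ, ‖l‖ < ε → l = 0) {R : ℝ} (hco : ∀ A, ∃ l ∈ Γ, ‖A - l‖ ≤ R) :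
    Countable Γ ∧ ∃ D : Set E, IsAddFundamentalDomain Γ D μ ∧ Bornology.IsBounded D := by
  let L : Submodule ℤ E := AddSubgroup.toIntSubmodule Γ
  have : DiscreteTopology L := by
    refine DiscreteTopology.of_forall_le_dist hε fun x y hxy => ?_
    by_contra! h
    rw [dist_eq_norm] at h
    exact hxy (Subtype.ext (sub_eq_zero.1 (hsep _ (Γ.sub_mem x.2 y.2) h)))
  have : IsZLattice ℝ L := ⟨by
    by_contra h
    obtain ⟨f, hf0, hf⟩ := Submodule.exists_le_ker_of_lt_top _ (lt_top_iff_ne_top.2 h)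
    refine hf0 (LinearMap.ext fun A => ?_)
    let g := LinearMap.toContinuousLinearMap f
    have hb : ∀ A, ‖g A‖ ≤ ‖g‖ * R := fun A => by
      obtain ⟨l, hl, h⟩ := hco A
      have h0 : f l = 0 := hf (Submodule.subset_span hl)
      have : g A = g (A - l) := by simp [g, h0]
      rw [this]
      exact (g.le_opNorm _).trans (by gcongr)
    by_contra hA
    have hA' : 0 < ‖g A‖ := norm_pos_iff.2 hA
    obtain ⟨m, hm⟩ := exists_nat_gt (‖g‖ * R / ‖g A‖)
    rw [div_lt_iff₀ hA'] at hm
    have := hb ((m : ℝ) • A)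
    rw [map_smul, norm_smul, Real.norm_natCast] at this
    linarith⟩
  let b := Module.Free.chooseBasis ℤ L
  exact ⟨inferInstanceAs (Countable L), _, ZLattice.isAddFundamentalDomain b μ, ZSpan.fundamentalDomain_isBounded _⟩

section torus
variable {n r : ℕ} {T : Subgroup (U n)} {B : Mat n →ₗ[ℝ] Mat n →ₗ[ℝ] ℝ} {e : Fin r → Mat n}

theorem compactSpace_U : CompactSpace (U n) := by
  have h1 : IsClosed (unitary (Mat n) : Set (Mat n)) := isClosed_unitary
  have h2 : IsCompact {M : Mat n | ∀ i j, M i j ∈ Metric.closedBall (0 : ℂ) 1} := by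
    have h : IsCompact (Set.univ.pi fun _ : Fin n => Set.univ.pi fun _ : Fin n => Metric.closedBall (0 : ℂ) 1) :=
      isCompact_univ_pi fun _ => isCompact_univ_pi fun _ => isCompact_closedBall _ _
    have h3 : {M : Mat n | ∀ i j, M i j ∈ Metric.closedBall (0 : ℂ) 1} =
      (Set.univ.pi fun _ : Fin n => Set.univ.pi fun _ : Fin n => Metric.closedBall (0 : ℂ) 1) :=
        Set.ext fun (M : Fin n → Fin n → ℂ) => ⟨fun h i _ j _ => h i j, fun h i j => h i trivial j trivial⟩
    rw [h3]; exact h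
  refine isCompact_iff_compactSpace.1 (h2.of_isClosed_subset h1 fun M hM i j => ?_)
  rw [mem_closedBall_zero_iff]
  exact entry_norm_bound_of_unitary hM i j

/-- The element of the Lie algebra of `T` with given coordinates. -/
def frameSum (e : Fin r → Mat n) : (Fin r → ℝ) →ₗ[ℝ] Mat n := Fintype.linearCombination ℝ e

theorem comp_incl (u : A0 r) : comp e (incl r u) =
    (frameSum e fun j => u (Sum.inl j), frameSum e fun j => u (Sum.inr j)) := by
  simp [comp, incl, frameSum, Fintype.linearCombination_apply]

theorem range_frameSum (he : IsOrthonormalFrame T B e) (X : Mat n) : X ∈ lieAlg T ↔ X ∈ LinearMap.range (frameSum e) := by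
  rw [he.1, frameSum, Fintype.range_linearCombination]

theorem pairing_frameSum (he : IsOrthonormalFrame T B e) (c : Fin r → ℝ) (i : Fin r) : B (frameSum e c) (e i) = c i := by
  simp [frameSum, Fintype.linearCombination_apply, he.2]

theorem ker_frameSum (he : IsOrthonormalFrame T B e) : LinearMap.ker (frameSum e) = ⊥ := by
  rw [LinearMap.ker_eq_bot']
  intro c hc
  ext i
  rw [← pairing_frameSum he c i, hc]; simp

theorem exp_frameSum_add (he : IsOrthonormalFrame T B e) (hab : ∀ g ∈ T, ∀ h ∈ T, g * h = h * g) (c d : Fin r → ℝ) :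
    NormedSpace.exp (frameSum e (c + d)) = NormedSpace.exp (frameSum e c) * NormedSpace.exp (frameSum e d) := by
  letI : NormedRing (Mat n) := Matrix.linftyOpNormedRing
  letI : NormedAlgebra ℝ (Mat n) := Matrix.linftyOpNormedAlgebra
  letI : NormedAlgebra ℚ (Mat n) := Matrix.linftyOpNormedAlgebra
  have : CompleteSpace (Mat n) := FiniteDimensional.complete ℝ (Mat n)
  let ι : T →* Mat n := (unitary (Mat n)).subtype.comp T.subtype
  have hp : ∀ c, frameSum e c ∈ oneParam ι := fun c x => by
    obtain ⟨g, hg, h⟩ := (range_frameSum he _).2 ⟨c, rfl⟩ x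
    exact ⟨⟨g, hg⟩, h⟩
  rw [map_add]
  refine NormedSpace.exp_add_of_commute (oneParam_commute (ι := ι) (fun g h => Subtype.ext (hab g g.2 h h.2)) (hp c) (hp d))

theorem exists_bound_frameSum (he : IsOrthonormalFrame T B e) (hT : IsClosed (T : Set (U n)))
    (hc : IsConnected (T : Set (U n))) (hab : ∀ g ∈ T, ∀ h ∈ T, g * h = h * g) :
    ∃ R : ℝ, ∀ g ∈ T, ∃ c : Fin r → ℝ, ‖c‖ ≤ R ∧ NormedSpace.exp (frameSum e c) = (g : Mat n) := by
  letI : NormedRing (Mat n) := Matrix.linftyOpNormedRing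
  letI : NormedAlgebra ℝ (Mat n) := Matrix.linftyOpNormedAlgebra
  letI : NormedAlgebra ℚ (Mat n) := Matrix.linftyOpNormedAlgebra
  have : CompleteSpace (Mat n) := FiniteDimensional.complete ℝ (Mat n)
  let ι : T →* Mat n := (unitary (Mat n)).subtype.comp T.subtype
  have := compactSpace_U (n := n)
  have : CompactSpace T := isCompact_iff_compactSpace.1 hT.isCompact
  have : ConnectedSpace T := isConnected_iff_connectedSpace.1 hc
  have hι : Continuous ι := continuous_subtype_val.comp continuous_subtype_val
  have hp : ∀ X, X ∈ oneParam ι ↔ X ∈ LinearMap.range (frameSum e) := fun X => by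
    rw [← range_frameSum he]
    exact ⟨fun h x => (h x).elim fun g hg => ⟨g, g.2, hg⟩, fun h x => (h x).elim fun g hg => ⟨⟨g, hg.1⟩, hg.2⟩⟩
  obtain ⟨R, hR⟩ := exists_bound_exp_surjective hι (fun g h => Subtype.ext (hab g g.2 h h.2)) (LinearMap.range (frameSum e)) hp
  obtain ⟨C, -, hC⟩ := (frameSum e).exists_antilipschitzWith (ker_frameSum he)
  refine ⟨C * R, fun g hg => ?_⟩
  obtain ⟨-, ⟨c, rfl⟩, hX, hexp⟩ := hR ⟨g, hg⟩
  refine ⟨c, ?_, hexp⟩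
  have := hC.le_mul_dist c 0
  rw [map_zero, dist_zero_right, dist_zero_right] at this
  exact this.trans (by gcongr)

theorem exists_frameSum_small (he : IsOrthonormalFrame T B e) :
    ∃ ε > 0, ∀ c : Fin r → ℝ, ‖c‖ < ε → NormedSpace.exp (frameSum e c) = 1 → c = 0 := by
  letI : NormedRing (Mat n) := Matrix.linftyOpNormedRing
  letI : NormedAlgebra ℝ (Mat n) := Matrix.linftyOpNormedAlgebra
  letI : NormedAlgebra ℚ (Mat n) := Matrix.linftyOpNormedAlgebra
  have : CompleteSpace (Mat n) := FiniteDimensional.complete ℝ (Mat n)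
  obtain ⟨ε, hε, h⟩ := exp_eq_one_small (𝔸 := Mat n)
  have hc : Continuous (frameSum e) := LinearMap.continuous_of_finiteDimensional _
  have h0 : ∀ᶠ c in 𝓝 (0 : Fin r → ℝ), ‖frameSum e c‖ < ε :=
    (hc.norm.tendsto 0).eventually (gt_mem_nhds (by simpa using hε))
  obtain ⟨δ, hδ, h1⟩ := Metric.eventually_nhds_iff_ball.1 h0
  refine ⟨δ, hδ, fun c hc he' => ?_⟩
  have := h _ (h1 c (by simpa using hc)) he'
  exact LinearMap.ker_eq_bot'.1 (ker_frameSum he) c this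

variable {K : Subgroup (U n)}

theorem mem_lattice (he : IsOrthonormalFrame T B e) (hT : IsMaximalTorus K T) {u : A0 r} : u ∈ lattice e ↔
    NormedSpace.exp (frameSum e fun j => u (Sum.inl j)) = 1 ∧ NormedSpace.exp (frameSum e fun j => u (Sum.inr j)) = 1 := by
  have hab := hT.1.2.2.2
  have h0 : NormedSpace.exp (frameSum e fun _ => 0) = 1 := by
    rw [show (fun _ => 0 : Fin r → ℝ) = 0 from rfl, map_zero, NormedSpace.exp_zero]
  refine ⟨fun h => ?_, fun h => AddSubgroup.subset_closure (by simpa [comp_incl] using h)⟩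
  induction h using AddSubgroup.closure_induction with
  | mem x hx => simpa [comp_incl] using hx
  | zero => exact ⟨h0, h0⟩
  | add x y _ _ hx hy =>
    have h1 := exp_frameSum_add he hab (fun j => x (Sum.inl j)) (fun j => y (Sum.inl j))
    have h2 := exp_frameSum_add he hab (fun j => x (Sum.inr j)) (fun j => y (Sum.inr j))
    rw [hx.1, hy.1, mul_one] at h1
    rw [hx.2, hy.2, mul_one] at h2
    exact ⟨h1, h2⟩
  | neg x _ hx =>
    have h1 := exp_frameSum_add he hab (fun j => x (Sum.inl j)) (-fun j => x (Sum.inl j))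
    have h2 := exp_frameSum_add he hab (fun j => x (Sum.inr j)) (-fun j => x (Sum.inr j))
    rw [hx.1, one_mul, add_neg_cancel, map_zero, NormedSpace.exp_zero] at h1
    rw [hx.2, one_mul, add_neg_cancel, map_zero, NormedSpace.exp_zero] at h2
    exact ⟨h1.symm, h2.symm⟩

theorem lattice_separated (he : IsOrthonormalFrame T B e) (hT : IsMaximalTorus K T) :
    ∃ ε > 0, ∀ l ∈ lattice e, ‖l‖ < ε → l = 0 := by
  obtain ⟨ε, hε, h⟩ := exists_frameSum_small he
  refine ⟨ε, hε, fun l hl hn => ?_⟩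
  rw [mem_lattice he hT] at hl
  have h1 := h _ (((pi_norm_le_iff_of_nonneg (norm_nonneg l)).2 fun j => norm_le_pi_norm l (Sum.inl j)).trans_lt hn) hl.1
  have h2 := h _ (((pi_norm_le_iff_of_nonneg (norm_nonneg l)).2 fun j => norm_le_pi_norm l (Sum.inr j)).trans_lt hn) hl.2
  ext (j | j)
  · exact congrFun h1 j
  · exact congrFun h2 j

theorem lattice_cocompact (he : IsOrthonormalFrame T B e) (hT : IsMaximalTorus K T) :
    ∃ R : ℝ, ∀ A : A0 r, ∃ l ∈ lattice e, ‖A - l‖ ≤ R := by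
  have hab := hT.1.2.2.2
  obtain ⟨R, hR⟩ := exists_bound_frameSum he hT.1.2.1 hT.1.2.2.1 hab
  have key : ∀ a : Fin r → ℝ, ∃ c : Fin r → ℝ, ‖c‖ ≤ R ∧ NormedSpace.exp (frameSum e (a - c)) = 1 := by
    intro a
    obtain ⟨g, hg, h⟩ := (range_frameSum he _).2 ⟨a, rfl⟩ 1
    obtain ⟨c, hc, h2⟩ := hR g hg
    refine ⟨c, hc, ?_⟩
    rw [one_smul, ← h2] at h
    have h1 := exp_frameSum_add he hab (-c) c
    rw [neg_add_cancel, map_zero, NormedSpace.exp_zero] at h1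
    rw [sub_eq_neg_add, exp_frameSum_add he hab, ← h, h1]
  refine ⟨R, fun A => ?_⟩
  obtain ⟨c, hc, h1⟩ := key fun j => A (Sum.inl j)
  obtain ⟨d, hd, h2⟩ := key fun j => A (Sum.inr j)
  refine ⟨A - Sum.elim c d, (mem_lattice he hT).2 ⟨h1, h2⟩, ?_⟩
  rw [sub_sub_cancel, pi_norm_le_iff_of_nonneg ((norm_nonneg _).trans hc)]
  rintro (j | j)
  · exact (norm_le_pi_norm c j).trans hc
  · exact (norm_le_pi_norm d j).trans hd

theorem norm_incl (u : A0 r) : ‖incl r u‖ = ‖u‖ := by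
  simp [incl, Pi.norm_def]

theorem exists_lattice_data (he : IsOrthonormalFrame T B e) (hT : IsMaximalTorus K T) :
    Countable (lattice e) ∧ ∃ D : Set (A0 r), IsAddFundamentalDomain (lattice e) D volume ∧ Bornology.IsBounded D := by
  obtain ⟨ε, hε, h⟩ := lattice_separated he hT
  obtain ⟨R, hR⟩ := lattice_cocompact he hT
  exact exists_bounded_fundamentalDomain volume _ hε h hR

theorem latticeC_data (he : IsOrthonormalFrame T B e) (hT : IsMaximalTorus K T) :
    Countable (latticeC e) ∧ ∃ ε > 0, ∀ l ∈ latticeC e, ‖l‖ < ε → l = 0 := by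
  constructor
  · have := (exists_lattice_data he hT).1
    exact (Set.Countable.image (Set.to_countable (lattice e : Set (A0 r))) (incl r)).to_subtype
  · obtain ⟨ε, hε, h⟩ := lattice_separated he hT
    refine ⟨ε, hε, ?_⟩
    rintro _ ⟨l, hl, rfl⟩ hn
    have : l = 0 := h l hl (by simpa [norm_incl] using hn)
    simp [this]

end torus
end GenusOne

end

noncomputable section
namespace GenusOne
open Filter
open scoped ENNReal NNReal

section param
variable {X : Type} [NormedAddCommGroup X] [NormedSpace ℝ X] [FiniteDimensional ℝ X]
  [MeasurableSpace X] [BorelSpace X] {μ : Measure X} [μ.IsAddHaarMeasure]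

theorem slice_contDiffAt {G : Type} [NormedAddCommGroup G] [NormedSpace ℝ G] {F : ℂ × X → G}
    (hF : ContDiffOn ℝ ∞ F (strip X)) {τ : ℂ} (hτ : τ ∈ teich) (A : X) :
    ContDiffAt ℝ ∞ (fun τ' => F (τ', A)) τ :=
  (strip_contDiffAt hF (mem_strip hτ A)).comp τ (f := fun τ' => (τ', A)) (by fun_prop)

theorem fderiv_slice {G : Type} [NormedAddCommGroup G] [NormedSpace ℝ G] {F : ℂ × X → G}
    (hF : ContDiffOn ℝ ∞ F (strip X)) {τ : ℂ} (hτ : τ ∈ teich) (A : X) :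
    fderiv ℝ (fun τ' => F (τ', A)) τ = (fderiv ℝ F (τ, A)).comp (ContinuousLinearMap.inl ℝ ℂ X) := by
  have h1 : HasFDerivAt (fun τ' : ℂ => (τ', A)) (ContinuousLinearMap.inl ℝ ℂ X) τ :=
    (hasFDerivAt_id τ).prodMk (hasFDerivAt_const A τ)
  exact (((strip_contDiffAt hF (mem_strip hτ A)).differentiableAt (by simp)).hasFDerivAt.comp τ h1).fderiv

theorem contDiffOn_fderiv_slice {G : Type} [NormedAddCommGroup G] [NormedSpace ℝ G] {F : ℂ × X → G}
    (hF : ContDiffOn ℝ ∞ F (strip X)) :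
    ContDiffOn ℝ ∞ (fun p : ℂ × X => fderiv ℝ (fun τ' => F (τ', p.2)) p.1) (strip X) := by
  have h := (hF.fderiv_of_isOpen isOpen_strip (m := ∞) (by simp)).clm_comp
    (contDiffOn_const (c := ContinuousLinearMap.inl ℝ ℂ X))
  exact h.congr fun p hp => fderiv_slice hF hp.1 p.2

theorem continuousOn_iteratedFDeriv_slice (m : ℕ) : ∀ {G : Type} [NormedAddCommGroup G] [NormedSpace ℝ G]
    {F : ℂ × X → G}, ContDiffOn ℝ ∞ F (strip X) →
      ContinuousOn (fun p : ℂ × X => iteratedFDeriv ℝ m (fun τ' => F (τ', p.2)) p.1) (strip X) := by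
  induction m with
  | zero =>
    intro G _ _ F hF
    simp only [iteratedFDeriv_zero_eq_comp]
    exact (continuousMultilinearCurryFin0 ℝ ℂ G).symm.continuous.comp_continuousOn hF.continuousOn
  | succ m ih =>
    intro G _ _ F hF
    have h := ih (contDiffOn_fderiv_slice hF)
    simp only [iteratedFDeriv_succ_eq_comp_right]
    exact (continuousMultilinearCurryRightEquiv' ℝ m ℂ G).symm.continuous.comp_continuousOn h

theorem continuous_slice {G : Type} [TopologicalSpace G] {F : ℂ × X → G} (hF : ContinuousOn F (strip X))
    {τ : ℂ} (hτ : τ ∈ teich) : Continuous fun A => F (τ, A) :=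
  continuousOn_univ.1 (hF.comp (by fun_prop) fun A _ => mem_strip hτ A)

variable (μ) in
/-- Smooth families whose derivatives along Teichmüller space are integrable, locally uniformly. -/
def L1Family {G : Type} [NormedAddCommGroup G] [NormedSpace ℝ G] (F : ℂ × X → G) : Prop :=
  ContDiffOn ℝ ∞ F (strip X) ∧ ∀ m : ℕ, ∀ τ₀ ∈ teich, ∃ C : ℝ≥0, ∀ᶠ τ in 𝓝 τ₀,
    ∫⁻ A, ‖iteratedFDeriv ℝ m (fun τ' => F (τ', A)) τ‖ₑ ∂μ ≤ C

theorem L1Family.fderiv {G : Type} [NormedAddCommGroup G] [NormedSpace ℝ G] {F : ℂ × X → G} (hF : L1Family μ F) :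
    L1Family μ fun p : ℂ × X => fderiv ℝ (fun τ' => F (τ', p.2)) p.1 := by
  refine ⟨contDiffOn_fderiv_slice hF.1, fun m τ₀ hτ₀ => ?_⟩
  obtain ⟨C, hC⟩ := hF.2 (m + 1) τ₀ hτ₀
  refine ⟨C, ?_⟩
  filter_upwards [hC] with τ h
  refine le_trans (le_of_eq (lintegral_congr fun A => ?_)) h
  rw [← ofReal_norm_eq_enorm, ← ofReal_norm_eq_enorm, norm_iteratedFDeriv_fderiv]

theorem L1Family.integrable {G : Type} [NormedAddCommGroup G] [NormedSpace ℝ G] {F : ℂ × X → G} (hF : L1Family μ F)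
    {τ : ℂ} (hτ : τ ∈ teich) : Integrable (fun A => F (τ, A)) μ := by
  obtain ⟨C, hC⟩ := hF.2 0 τ hτ
  refine ⟨(continuous_slice hF.1.continuousOn hτ).aestronglyMeasurable, lt_of_le_of_lt ?_ (ENNReal.coe_lt_top (r := C))⟩
  refine le_trans (le_of_eq (lintegral_congr fun A => ?_)) hC.self_of_nhds
  rw [← ofReal_norm_eq_enorm, ← ofReal_norm_eq_enorm, norm_iteratedFDeriv_zero]

theorem enorm_taylor_le {G : Type} [NormedAddCommGroup G] [NormedSpace ℝ G] [CompleteSpace G] {f : ℂ → G}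
    (hf : ContDiffOn ℝ ∞ f teich) {τ h : ℂ} (hh : ∀ s ∈ Set.Icc (0 : ℝ) 1, τ + s • h ∈ teich) :
    ‖f (τ + h) - f τ - fderiv ℝ f τ h‖ₑ ≤
      ‖h‖ₑ ^ 2 * ∫⁻ s in Set.Ioc (0 : ℝ) 1, ‖iteratedFDeriv ℝ 2 f (τ + s • h)‖ₑ := by
  have hf' : ContDiffOn ℝ ∞ (fderiv ℝ f) teich := hf.fderiv_of_isOpen isOpen_teich (by simp)
  have hf'' : ContDiffOn ℝ ∞ (fderiv ℝ (fderiv ℝ f)) teich := hf'.fderiv_of_isOpen isOpen_teich (by simp)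
  let g : ℝ → G := fun s => f (τ + s • h) + (1 - s) • fderiv ℝ f (τ + s • h) h
  let g' : ℝ → G := fun s => (1 - s) • fderiv ℝ (fderiv ℝ f) (τ + s • h) h h
  have hg : ∀ s ∈ Set.uIcc (0 : ℝ) 1, HasDerivAt g (g' s) s := by
    intro s hs
    rw [Set.uIcc_of_le zero_le_one] at hs
    have hm := isOpen_teich.mem_nhds (hh s hs)
    have c : HasDerivAt (fun s : ℝ => τ + s • h) h s := by
      simpa using ((hasDerivAt_id s).smul_const h).const_add τ
    have d1 : HasDerivAt (fun s : ℝ => f (τ + s • h)) (_root_.fderiv ℝ f (τ + s • h) h) s :=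
      ((hf.contDiffAt hm).differentiableAt (by simp)).hasFDerivAt.comp_hasDerivAt s c
    have d2 : HasDerivAt (fun s : ℝ => _root_.fderiv ℝ f (τ + s • h)) (_root_.fderiv ℝ (_root_.fderiv ℝ f) (τ + s • h) h) s :=
      ((hf'.contDiffAt hm).differentiableAt (by simp)).hasFDerivAt.comp_hasDerivAt s c
    have d2' : HasDerivAt (fun s : ℝ => _root_.fderiv ℝ f (τ + s • h) h)
        (_root_.fderiv ℝ (_root_.fderiv ℝ f) (τ + s • h) h h) s := by
      simpa using d2.clm_apply (hasDerivAt_const s h)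
    have d3 := d1.add (((hasDerivAt_id s).const_sub 1).smul d2')
    refine d3.congr_deriv ?_
    simp [g']
  have hcont : ContinuousOn (fun s : ℝ => τ + s • h) (Set.uIcc 0 1) := by fun_prop
  have hmaps : Set.MapsTo (fun s : ℝ => τ + s • h) (Set.uIcc 0 1) teich := fun s hs => by
    rw [Set.uIcc_of_le zero_le_one] at hs; exact hh s hs
  have hgc : ContinuousOn g' (Set.uIcc 0 1) := by
    have := hf''.continuousOn.comp hcont hmaps
    refine ContinuousOn.smul (by fun_prop) ((this.clm_apply continuousOn_const).clm_apply continuousOn_const)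
  have key := intervalIntegral.integral_eq_sub_of_hasDerivAt hg hgc.intervalIntegrable
  have e : f (τ + h) - f τ - fderiv ℝ f τ h = ∫ s in (0 : ℝ)..1, g' s := by
    rw [key]; simp [g, sub_sub]
  rw [e, intervalIntegral.integral_of_le zero_le_one]
  refine (enorm_integral_le_lintegral_enorm _).trans ?_
  rw [← lintegral_const_mul' _ _ (by simp)]
  refine lintegral_mono_ae ((ae_restrict_iff' measurableSet_Ioc).2 (Eventually.of_forall fun s hs => ?_))
  rw [← ofReal_norm_eq_enorm, ← ofReal_norm_eq_enorm, ← ofReal_norm_eq_enorm, ← ENNReal.ofReal_pow (norm_nonneg _),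
    ← ENNReal.ofReal_mul (by positivity)]
  refine ENNReal.ofReal_le_ofReal ?_
  have hs1 : ‖(1 - s : ℝ)‖ ≤ 1 := by
    rw [Real.norm_eq_abs, abs_le]; constructor <;> linarith [hs.1, hs.2]
  have h2 : ‖iteratedFDeriv ℝ 2 f (τ + s • h)‖ = ‖fderiv ℝ (fderiv ℝ f) (τ + s • h)‖ := by
    rw [← norm_iteratedFDeriv_fderiv, ← norm_iteratedFDeriv_fderiv, norm_iteratedFDeriv_zero]
  rw [h2, norm_smul]
  calc _ ≤ 1 * (‖fderiv ℝ (fderiv ℝ f) (τ + s • h)‖ * ‖h‖ * ‖h‖) := by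
        gcongr
        exact ContinuousLinearMap.le_opNorm₂ _ _ _
    _ = _ := by ring

theorem L1Family.hasFDerivAt {G : Type} [NormedAddCommGroup G] [NormedSpace ℝ G] [CompleteSpace G] {F : ℂ × X → G}
    (hF : L1Family μ F) {τ : ℂ} (hτ : τ ∈ teich) :
    HasFDerivAt (fun τ => ∫ A, F (τ, A) ∂μ) (∫ A, _root_.fderiv ℝ (fun τ' => F (τ', A)) τ ∂μ) τ := by
  obtain ⟨C, hC⟩ := hF.2 2 τ hτ
  obtain ⟨δ, hδ, hball⟩ := Metric.eventually_nhds_iff_ball.1 (hC.and (isOpen_teich.mem_nhds hτ))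
  have hbound : ∀ᶠ h in 𝓝 (0 : ℂ), ‖(∫ A, F (τ + h, A) ∂μ) - (∫ A, F (τ, A) ∂μ) -
      (∫ A, _root_.fderiv ℝ (fun τ' => F (τ', A)) τ ∂μ) h‖ ≤ C * ‖h‖ ^ 2 := by
    filter_upwards [Metric.ball_mem_nhds (0 : ℂ) hδ] with h hh
    rw [mem_ball_zero_iff] at hh
    have hp : ∀ s ∈ Set.Icc (0 : ℝ) 1, τ + s • h ∈ Metric.ball τ δ := fun s hs => by
      rw [mem_ball_iff_norm, add_sub_cancel_left, norm_smul, Real.norm_of_nonneg hs.1]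
      exact lt_of_le_of_lt (mul_le_of_le_one_left (norm_nonneg _) hs.2) hh
    have hT : ∀ s ∈ Set.Icc (0 : ℝ) 1, τ + s • h ∈ teich := fun s hs => (hball _ (hp s hs)).2
    have hτh : τ + h ∈ teich := by simpa using hT 1 (by simp)
    have i1 := hF.integrable hτh
    have i2 := hF.integrable hτ
    have i3 : Integrable (fun A => _root_.fderiv ℝ (fun τ' => F (τ', A)) τ) μ := hF.fderiv.integrable hτ
    have e : (∫ A, F (τ + h, A) ∂μ) - (∫ A, F (τ, A) ∂μ) - (∫ A, _root_.fderiv ℝ (fun τ' => F (τ', A)) τ ∂μ) h =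
        ∫ A, (F (τ + h, A) - F (τ, A) - _root_.fderiv ℝ (fun τ' => F (τ', A)) τ h) ∂μ := by
      rw [ContinuousLinearMap.integral_apply i3, ← integral_sub i1 i2]
      exact (integral_sub (i1.sub i2) (i3.apply_continuousLinearMap h)).symm
    rw [e]
    have h0 : ∫⁻ A, ‖F (τ + h, A) - F (τ, A) - _root_.fderiv ℝ (fun τ' => F (τ', A)) τ h‖ₑ ∂μ ≤ ‖h‖ₑ ^ 2 * C := by
      calc _ ≤ ∫⁻ A, (‖h‖ₑ ^ 2 * ∫⁻ s in Set.Ioc (0 : ℝ) 1, ‖iteratedFDeriv ℝ 2 (fun τ' => F (τ', A)) (τ + s • h)‖ₑ) ∂μ :=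
            lintegral_mono fun A => enorm_taylor_le (f := fun τ' => F (τ', A))
              (fun τ' hτ' => (slice_contDiffAt hF.1 hτ' A).contDiffWithinAt) hT
        _ = ‖h‖ₑ ^ 2 * ∫⁻ s in Set.Ioc (0 : ℝ) 1, ∫⁻ A, ‖iteratedFDeriv ℝ 2 (fun τ' => F (τ', A)) (τ + s • h)‖ₑ ∂μ := by
            rw [lintegral_const_mul' _ _ (by simp), lintegral_lintegral_swap]
            have hc : ContinuousOn (fun q : X × ℝ => ‖iteratedFDeriv ℝ 2 (fun τ' => F (τ', q.1)) (τ + q.2 • h)‖ₑ)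
                (Set.univ ×ˢ Set.Ioc 0 1) := by
              refine ((continuousOn_iteratedFDeriv_slice 2 hF.1).comp (f := fun q : X × ℝ => (τ + q.2 • h, q.1))
                (by fun_prop) fun q hq => mem_strip (hT _ (Set.Ioc_subset_Icc_self hq.2)) _).enorm
            have := hc.aemeasurable (μ := μ.prod volume) (MeasurableSet.univ.prod measurableSet_Ioc)
            rw [← Measure.prod_restrict, Measure.restrict_univ] at this
            exact this
        _ ≤ ‖h‖ₑ ^ 2 * ∫⁻ s in Set.Ioc (0 : ℝ) 1, C := by
            refine mul_le_mul' le_rfl (setLIntegral_mono' measurableSet_Ioc fun s hs => ?_)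
            exact (hball _ (hp s (Set.Ioc_subset_Icc_self hs))).1
        _ = ‖h‖ₑ ^ 2 * C := by simp
    have h1 := (enorm_integral_le_lintegral_enorm _).trans h0
    rw [← ofReal_norm_eq_enorm, ← ofReal_norm_eq_enorm, ← ENNReal.ofReal_pow (norm_nonneg _),
      ← ENNReal.ofReal_coe_nnreal, ← ENNReal.ofReal_mul (by positivity),
      ENNReal.ofReal_le_ofReal_iff (by positivity), mul_comm] at h1
    exact h1
  rw [hasFDerivAt_iff_isLittleO_nhds_zero]
  refine Asymptotics.IsBigO.trans_isLittleO (g := fun h : ℂ => ‖h‖ ^ 2) (Asymptotics.IsBigO.of_bound C ?_) ?_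
  · filter_upwards [hbound] with h hh
    rwa [Real.norm_of_nonneg (by positivity : (0 : ℝ) ≤ ‖h‖ ^ 2)]
  · exact Asymptotics.isLittleO_norm_pow_id one_lt_two

theorem L1Family.contDiffOn {F : ℂ × X → ℂ} (hF : L1Family μ F) : ContDiffOn ℝ ∞ (fun τ => ∫ A, F (τ, A) ∂μ) teich := by
  rw [contDiffOn_infty]
  intro n
  suffices H : ∀ n : ℕ, ∀ {G : Type} [NormedAddCommGroup G] [NormedSpace ℝ G] [CompleteSpace G] {F : ℂ × X → G},
      L1Family μ F → ContDiffOn ℝ n (fun τ => ∫ A, F (τ, A) ∂μ) teich from H n hF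
  clear hF F n
  intro n
  induction n with
  | zero =>
    intro G _ _ _ F hF
    exact contDiffOn_zero.2 fun τ hτ => (hF.hasFDerivAt hτ).continuousAt.continuousWithinAt
  | succ n ih =>
    intro G _ _ _ F hF
    push_cast
    rw [contDiffOn_succ_iff_fderiv_of_isOpen isOpen_teich]
    refine ⟨fun τ hτ => (hF.hasFDerivAt hτ).differentiableAt.differentiableWithinAt, by simp, ?_⟩
    exact (ih hF.fderiv).congr fun τ hτ => (hF.hasFDerivAt hτ).fderiv

variable (μ) in
/-- Smooth families whose derivatives along Teichmüller space are integrable against a polynomial weight,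
locally uniformly. -/
def SlowL1Family (F : ℂ × X → ℂ) : Prop :=
  ContDiffOn ℝ ∞ F (strip X) ∧ ∃ N : ℕ, ∀ m : ℕ, ∀ τ₀ ∈ teich, ∃ C : ℝ≥0, ∀ᶠ τ in 𝓝 τ₀,
    ∫⁻ A, ENNReal.ofReal (wt N A) * ‖iteratedFDeriv ℝ m (fun τ' => F (τ', A)) τ‖ₑ ∂μ ≤ C

theorem SlowL1Family.fderiv {F : ℂ × X → ℂ} (hF : SlowL1Family μ F) {τ : ℂ} (hτ : τ ∈ teich) (V : ℂ) :
    SlowInt μ fun A => _root_.fderiv ℝ (fun τ' => F (τ', A)) τ V := by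
  obtain ⟨h1, N, h⟩ := hF
  obtain ⟨C, hC⟩ := h 1 τ hτ
  have : SlowInt μ fun A => _root_.fderiv ℝ (fun τ' => F (τ', A)) τ := by
    refine slowInt_of_lintegral (N := N) (continuous_slice (contDiffOn_fderiv_slice h1).continuousOn hτ).aestronglyMeasurable
      (lt_of_le_of_lt ?_ (ENNReal.coe_lt_top (r := C)))
    refine le_trans (le_of_eq (lintegral_congr fun A => ?_)) hC.self_of_nhds
    rw [← ofReal_norm_eq_enorm, ← ofReal_norm_eq_enorm, ← norm_iteratedFDeriv_fderiv, norm_iteratedFDeriv_zero]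
  refine this.mono (this.aestronglyMeasurable.apply_continuousLinearMap V) (C := ‖V‖) (M := 0) fun A => ?_
  rw [pow_zero, mul_one, mul_comm]
  exact ContinuousLinearMap.le_opNorm _ _

theorem norm_iteratedFDeriv_slice_fst_le {F : ℂ × X → ℂ} (hF : ContDiffOn ℝ ∞ F (strip X)) {τ : ℂ}
    (hτ : τ ∈ teich) (l : ℕ) (A : X) :
    ‖iteratedFDeriv ℝ l (fun τ' => F (τ', A)) τ‖ ≤ ‖iteratedFDeriv ℝ l F (τ, A)‖ := by
  let g : ℂ × X → ℂ := fun p => F ((0, A) + p)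
  have hg : ∀ q, iteratedFDeriv ℝ l g q = iteratedFDeriv ℝ l F ((0, A) + q) := fun q =>
    iteratedFDeriv_comp_add_left l _ q
  let S : Set (ℂ × X) := (fun p => (0, A) + p) ⁻¹' strip X
  have hS : IsOpen S := isOpen_strip.preimage (by fun_prop)
  have hgS : ContDiffOn ℝ ∞ g S := hF.comp (by fun_prop) (fun p hp => hp)
  have hmem : ContinuousLinearMap.inl ℝ ℂ X τ ∈ S := by simpa [S] using mem_strip hτ A
  have hS' : IsOpen (ContinuousLinearMap.inl ℝ ℂ X ⁻¹' S) := hS.preimage (by fun_prop)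
  have := (ContinuousLinearMap.inl ℝ ℂ X).iteratedFDerivWithin_comp_right hgS hS.uniqueDiffOn
    hS'.uniqueDiffOn hmem (i := l) (by exact_mod_cast le_top)
  rw [iteratedFDerivWithin_of_isOpen l hS' hmem, iteratedFDerivWithin_of_isOpen l hS hmem, hg] at this
  have h1 : (g ∘ ContinuousLinearMap.inl ℝ ℂ X) = fun τ' => F (τ', A) := by
    ext A; simp [g]
  rw [h1] at this
  rw [this]
  refine (ContinuousMultilinearMap.norm_compContinuousLinearMap_le _ _).trans ?_
  simp only [ContinuousLinearMap.inl_apply, Prod.mk_add_mk, zero_add, add_zero]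
  exact mul_le_of_le_one_right (norm_nonneg _) (Finset.prod_le_one (fun _ _ => norm_nonneg _)
    fun _ _ => ContinuousLinearMap.norm_inl_le_one ℝ ℂ X)

theorem SlowL1Family.mul_star {F : ℂ × X → ℂ} (hF : SlowL1Family μ F) {χ : ℂ × X → ℂ} (hχ : RapidFamily χ) :
    L1Family μ fun p => F p * star (χ p) := by
  obtain ⟨h1, N, h⟩ := hF
  have hs : ContDiffOn ℝ ∞ (fun p => star (χ p)) (strip X) :=
    (starL' ℝ : ℂ ≃L[ℝ] ℂ).contDiff.comp_contDiffOn hχ.1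
  refine ⟨h1.mul hs, fun m τ₀ hτ₀ => ?_⟩
  choose C hC using fun i => h i τ₀ hτ₀
  obtain ⟨M, hM, hb⟩ := hχ.bound N m hτ₀
  refine ⟨∑ i ∈ Finset.range (m + 1), (m.choose i) * M.toNNReal * C i, ?_⟩
  have hC' : ∀ᶠ τ in 𝓝 τ₀, ∀ i ∈ Finset.range (m + 1),
      ∫⁻ A, ENNReal.ofReal (wt N A) * ‖iteratedFDeriv ℝ i (fun τ' => F (τ', A)) τ‖ₑ ∂μ ≤ C i :=
    (Filter.eventually_all_finset _).2 fun i _ => hC i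
  filter_upwards [hC', hb, isOpen_teich.mem_nhds hτ₀] with τ hCτ hbτ hτ
  have key : ∀ A, ‖iteratedFDeriv ℝ m (fun τ' => F (τ', A) * star (χ (τ', A))) τ‖ₑ ≤
      ∑ i ∈ Finset.range (m + 1), ENNReal.ofReal (m.choose i * M) *
        (ENNReal.ofReal (wt N A) * ‖iteratedFDeriv ℝ i (fun τ' => F (τ', A)) τ‖ₑ) := by
    intro A
    have hχb : ∀ j ≤ m, ‖iteratedFDeriv ℝ j (fun τ' => star (χ (τ', A))) τ‖ ≤ M * wt N A := fun j hj => by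
      have e := (starₗᵢ ℝ : ℂ ≃ₗᵢ[ℝ] ℂ).norm_iteratedFDeriv_comp_left (fun τ' => χ (τ', A)) τ j
      have e2 := norm_iteratedFDeriv_slice_fst_le hχ.1 hτ j A
      have e3 := hbτ A j hj
      have hp : 0 < (1 + ‖A‖) ^ N := by have := norm_nonneg A; positivity
      rw [wt, ← div_eq_mul_inv, le_div_iff₀ hp, mul_comm]
      refine le_trans ?_ e3
      gcongr
      exact (le_of_eq e).trans e2
    have f1 : ContDiffOn ℝ m (fun τ' => F (τ', A)) teich := fun τ' hτ' =>
      ((slice_contDiffAt h1 hτ' A).of_le (by exact_mod_cast le_top)).contDiffWithinAt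
    have f2 : ContDiffOn ℝ m (fun τ' => star (χ (τ', A))) teich := fun τ' hτ' =>
      ((slice_contDiffAt hs hτ' A).of_le (by exact_mod_cast le_top)).contDiffWithinAt
    have := norm_iteratedFDerivWithin_mul_le f1 f2 isOpen_teich.uniqueDiffOn hτ (n := m) le_rfl
    simp only [fun i f => iteratedFDerivWithin_of_isOpen (𝕜 := ℝ) (f := (f : ℂ → ℂ)) i isOpen_teich hτ] at this
    rw [← ofReal_norm_eq_enorm]
    calc _ ≤ ENNReal.ofReal (∑ i ∈ Finset.range (m + 1), (m.choose i * M) * (wt N A * ‖iteratedFDeriv ℝ i (fun τ' => F (τ', A)) τ‖)) := by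
          refine ENNReal.ofReal_le_ofReal (this.trans (Finset.sum_le_sum fun i hi => ?_))
          have := hχb (m - i) (Nat.sub_le _ _)
          calc _ ≤ m.choose i * ‖iteratedFDeriv ℝ i (fun τ' => F (τ', A)) τ‖ * (M * wt N A) := by gcongr
            _ = _ := by ring
      _ = _ := by
          rw [ENNReal.ofReal_sum_of_nonneg fun i _ => by have := wt_pos N A; positivity]
          refine Finset.sum_congr rfl fun i _ => ?_
          rw [ENNReal.ofReal_mul (by positivity), ENNReal.ofReal_mul (wt_pos N A).le, ofReal_norm_eq_enorm]
  refine (lintegral_mono key).trans ?_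
  rw [lintegral_finsetSum']
  · push_cast
    refine Finset.sum_le_sum fun i hi => ?_
    rw [lintegral_const_mul' _ _ ENNReal.ofReal_ne_top, ENNReal.ofReal_mul (by positivity), ENNReal.ofReal_natCast]
    gcongr
    · rfl
    · exact hCτ i hi
  · intro i _
    have := continuous_slice (continuousOn_iteratedFDeriv_slice i h1) hτ
    exact (((continuous_wt N).measurable.ennreal_ofReal.mul this.enorm.measurable).const_mul _).aemeasurable

end param
end GenusOne

end

noncomputable section
namespace GenusOne
open Filter
open scoped ENNReal NNReal

section periodic
variable {X : Type} [NormedAddCommGroup X] [NormedSpace ℝ X] [FiniteDimensional ℝ X]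
  [MeasurableSpace X] [BorelSpace X] {μ : Measure X} [μ.IsAddHaarMeasure] {Γ : AddSubgroup X} {F : ℂ × X → ℂ}

theorem slowL1Family_of_periodic [Countable Γ] {ε : ℝ} (hε : 0 < ε) (hΓ : ∀ l ∈ Γ, ‖l‖ < ε → l = 0)
    (hF : ContDiffOn ℝ ∞ F (strip X))
    (hper : ∀ l ∈ Γ, ∀ A, ∃ c : ℂ, ‖c‖ = 1 ∧ ∀ τ ∈ teich, F (τ, A + l) = c * F (τ, A)) {D : Set X}
    (hD : IsAddFundamentalDomain Γ D μ) (hb : ∀ m : ℕ, ∀ τ₀ ∈ teich, ∃ C : ℝ≥0, ∀ᶠ τ in 𝓝 τ₀,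
      eLpNorm (fun A => iteratedFDeriv ℝ m (fun τ' => F (τ', A)) τ) 2 (μ.restrict D) ≤ C) : SlowL1Family μ F := by
  refine ⟨hF, Module.finrank ℝ X + 1, fun m τ₀ hτ₀ => ?_⟩
  obtain ⟨C, hC⟩ := exists_lintegral_wt_mul_le (G := ContinuousMultilinearMap ℝ (fun _ : Fin m => ℂ) ℂ) μ Γ hε hΓ
  obtain ⟨C', hC'⟩ := hb m τ₀ hτ₀
  refine ⟨C * C', ?_⟩
  filter_upwards [hC', isOpen_teich.mem_nhds hτ₀] with τ h hτ
  refine (hC D hD _ (continuous_slice (continuousOn_iteratedFDeriv_slice m hF) hτ).aestronglyMeasurable fun l hl A => ?_).trans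
    (by push_cast; gcongr)
  obtain ⟨c, hc, hcF⟩ := hper l hl A
  have h1 : (fun τ' => F (τ', A + l)) =ᶠ[𝓝 τ] (c • fun τ' => F (τ', A)) := by
    filter_upwards [isOpen_teich.mem_nhds hτ] with τ' hτ'
    exact hcF τ' hτ'
  simp only [(h1.iteratedFDeriv ℝ m).eq_of_nhds]
  rw [iteratedFDeriv_const_smul_apply ((slice_contDiffAt hF hτ A).of_le (by exact_mod_cast le_top)), norm_smul, hc, one_mul]

theorem slowL1Family_of_periodic_of_isBounded [Countable Γ] {ε : ℝ} (hε : 0 < ε) (hΓ : ∀ l ∈ Γ, ‖l‖ < ε → l = 0)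
    (hF : ContDiffOn ℝ ∞ F (strip X))
    (hper : ∀ l ∈ Γ, ∀ A, ∃ c : ℂ, ‖c‖ = 1 ∧ ∀ τ ∈ teich, F (τ, A + l) = c * F (τ, A)) {D : Set X}
    (hD : IsAddFundamentalDomain Γ D μ) (hDb : Bornology.IsBounded D) : SlowL1Family μ F := by
  refine slowL1Family_of_periodic hε hΓ hF hper hD fun m τ₀ hτ₀ => ?_
  obtain ⟨R, hR⟩ := hDb.subset_closedBall 0
  obtain ⟨δ, hδ, hball⟩ := Metric.nhds_basis_closedBall.mem_iff.1 (isOpen_teich.mem_nhds hτ₀)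
  have hK : IsCompact (Metric.closedBall τ₀ δ ×ˢ Metric.closedBall (0 : X) R) :=
    (isCompact_closedBall _ _).prod (isCompact_closedBall _ _)
  obtain ⟨C, hC⟩ := hK.exists_bound_of_continuousOn
    ((continuousOn_iteratedFDeriv_slice m hF).mono (Set.prod_mono hball (Set.subset_univ _)))
  refine ⟨((μ.restrict (Metric.closedBall (0 : X) R) Set.univ) ^ (2 : ℝ≥0∞).toReal⁻¹ * ENNReal.ofReal C).toNNReal, ?_⟩
  filter_upwards [Metric.closedBall_mem_nhds τ₀ hδ] with τ hτ
  rw [ENNReal.coe_toNNReal]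
  · refine (eLpNorm_mono_measure _ (Measure.restrict_mono hR le_rfl)).trans (eLpNorm_le_of_ae_bound ?_)
    exact ae_restrict_of_forall_mem Metric.isClosed_closedBall.measurableSet fun A hA => hC (τ, A) ⟨hτ, hA⟩
  · refine ENNReal.mul_ne_top (ENNReal.rpow_ne_top_of_nonneg (by simp) ?_) ENNReal.ofReal_ne_top
    rw [Measure.restrict_apply_univ]
    exact (isCompact_closedBall (0 : X) R).measure_lt_top.ne

end periodic

section sections
variable {n r : ℕ} {K T : Subgroup (U n)} {B : Mat n →ₗ[ℝ] Mat n →ₗ[ℝ] ℝ} {e : Fin r → Mat n} {t τ : ℂ}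

theorem norm_multiplier (l : A0 r) (A : AC r) : ‖multiplier t l A‖ = 1 := by
  rw [multiplier, Complex.norm_exp]
  simp

theorem norm_equivariant0 {ψ : A0 r → ℂ} (h : IsEquivariant0 K T e t ψ) : ∀ l ∈ lattice e, ∀ A, ‖ψ (A + l)‖ = ‖ψ A‖ :=
  fun l hl A => by rw [h.1 l hl, norm_mul, norm_multiplier, one_mul]

theorem norm_equivariantC {φ : AC r → ℂ} (h : IsEquivariantC K T e t φ) : ∀ l ∈ latticeC e, ∀ A, ‖φ (A + l)‖ = ‖φ A‖ := by
  rintro _ ⟨l, hl, rfl⟩ A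
  exact (congrArg norm (h.1 l hl A)).trans (by rw [norm_mul, norm_multiplier, one_mul])

theorem isL2Section_of_bounded (he : IsOrthonormalFrame T B e) (hT : IsMaximalTorus K T) {ψ : A0 r → ℂ}
    (hm : AEStronglyMeasurable ψ volume) (hψ : IsEquivariant0 K T e t ψ) (hb : ∃ C : ℝ, ∀ A, ‖ψ A‖ ≤ C) :
    IsL2Section K T e t ψ := by
  obtain ⟨-, D, hD, hDb⟩ := exists_lattice_data he hT
  obtain ⟨C, hC⟩ := hb
  have : IsFiniteMeasure (volume.restrict D) := isFiniteMeasure_restrict.2 hDb.measure_lt_top.ne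
  exact ⟨hm, hψ, D, hD, MemLp.of_bound hm.restrict C (Eventually.of_forall hC)⟩

theorem slowInt_of_isL2Section (he : IsOrthonormalFrame T B e) (hT : IsMaximalTorus K T) {ψ : A0 r → ℂ}
    (hψ : IsL2Section K T e t ψ) : SlowInt volume ψ := by
  have := (exists_lattice_data he hT).1
  obtain ⟨ε, hε, hs⟩ := lattice_separated he hT
  obtain ⟨C, hC⟩ := exists_lintegral_wt_mul_le (G := ℂ) volume (lattice e) hε hs
  obtain ⟨hm, hψ, D, hD, hL⟩ := hψ
  exact slowInt_of_lintegral hm ((hC D hD ψ hm (norm_equivariant0 hψ)).trans_lt (ENNReal.mul_lt_top ENNReal.coe_lt_top hL.2))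

theorem slowInt_of_isL2Holomorphic (he : IsOrthonormalFrame T B e) (hT : IsMaximalTorus K T) {φ : AC r → ℂ}
    (hφ : IsL2Holomorphic K T e τ t φ) : SlowInt volume φ := by
  obtain ⟨_, ε, hε, hs⟩ := latticeC_data he hT
  obtain ⟨C, hC⟩ := exists_lintegral_wt_mul_le (G := ℂ) volume (latticeC e) hε hs
  obtain ⟨hh, hφ, D, hD, hL⟩ := hφ
  have hm := hh.1.continuous.aestronglyMeasurable (μ := volume)
  exact slowInt_of_lintegral hm ((hC D hD φ hm (norm_equivariantC hφ)).trans_lt (ENNReal.mul_lt_top ENNReal.coe_lt_top hL.2))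

theorem slowL1Family_of_isSmoothFamily0 (he : IsOrthonormalFrame T B e) (hT : IsMaximalTorus K T) {Ψ : ℂ → A0 r → ℂ}
    (hΨ : IsSmoothFamily0 K T e t Ψ) : SlowL1Family volume fun p : ℂ × A0 r => Ψ p.1 p.2 := by
  obtain ⟨_, D, hD, hDb⟩ := exists_lattice_data he hT
  obtain ⟨ε, hε, hs⟩ := lattice_separated he hT
  exact slowL1Family_of_periodic_of_isBounded hε hs hΨ.1
    (fun l hl A => ⟨_, norm_multiplier l _, fun τ hτ => (hΨ.2 τ hτ).1 l hl A⟩) hD hDb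

theorem slowL1Family_of_isSmoothFamilyC (he : IsOrthonormalFrame T B e) (hT : IsMaximalTorus K T) {Φ : ℂ → AC r → ℂ}
    (hΦ : IsSmoothFamilyC K T e t Φ) : SlowL1Family volume fun p : ℂ × AC r => Φ p.1 p.2 := by
  obtain ⟨_, ε, hε, hs⟩ := latticeC_data he hT
  obtain ⟨h1, h2, D, hD, h3⟩ := hΦ
  refine slowL1Family_of_periodic hε hs h1 ?_ hD h3
  rintro _ ⟨l, hl, rfl⟩ A
  exact ⟨_, norm_multiplier l _, fun τ hτ => (h2 τ hτ).2.1 l hl A⟩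

theorem slowInt_of_isSmoothFamilyC (he : IsOrthonormalFrame T B e) (hT : IsMaximalTorus K T) {Φ : ℂ → AC r → ℂ}
    (hΦ : IsSmoothFamilyC K T e t Φ) (hτ : τ ∈ teich) : SlowInt volume (Φ τ) := by
  obtain ⟨h1, N, h⟩ := slowL1Family_of_isSmoothFamilyC he hT hΦ
  obtain ⟨C, hC⟩ := h 0 τ hτ
  refine slowInt_of_lintegral (N := N) (continuous_slice h1.continuousOn hτ).aestronglyMeasurable
    (lt_of_le_of_lt ?_ (ENNReal.coe_lt_top (r := C)))
  refine le_trans (le_of_eq (lintegral_congr fun A => ?_)) hC.self_of_nhds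
  rw [← ofReal_norm_eq_enorm (iteratedFDeriv ℝ 0 _ _), norm_iteratedFDeriv_zero, ofReal_norm_eq_enorm]

end sections
end GenusOne

end

noncomputable section
namespace GenusOne
open Filter ComplexConjugate

section ibp
variable {X : Type} [NormedAddCommGroup X] [NormedSpace ℝ X] [FiniteDimensional ℝ X]
  [MeasurableSpace X] [BorelSpace X] {μ : Measure X} [μ.IsAddHaarMeasure]

theorem integrable_mul_star_fderiv {f : X → ℂ} (h : SlowInt μ f) (χ : 𝓢(X, ℂ)) (v : X) :
    Integrable (fun A => f A * star (fderiv ℝ χ A v)) μ := by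
  refine (h.integrable_mul_star (LineDeriv.lineDerivOpCLM ℂ 𝓢(X, ℂ) v χ)).congr (Eventually.of_forall fun A => ?_)
  simp [SchwartzMap.lineDerivOp_apply_eq_fderiv]

theorem integral_fderiv_mul_star {f : X → ℂ} (hd : Differentiable ℝ f) (h : SlowInt μ f) {v : X}
    (h' : SlowInt μ fun A => fderiv ℝ f A v) (χ : 𝓢(X, ℂ)) :
    ∫ A, f A * star (fderiv ℝ χ A v) ∂μ = -∫ A, fderiv ℝ f A v * star (χ A) ∂μ := by
  have hs : ∀ A, fderiv ℝ (fun A => star (χ A)) A v = star (fderiv ℝ χ A v) := fun A => by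
    rw [fderiv_star]; rfl
  have := integral_mul_fderiv_eq_neg_fderiv_mul_of_integrable (μ := μ) (f := f) (g := fun A => star (χ A)) (v := v)
    (h'.integrable_mul_star χ) (by simpa only [hs] using integrable_mul_star_fderiv h χ v) (h.integrable_mul_star χ)
    (fun A _ => hd A) (fun A _ => χ.differentiableAt.star)
  simpa only [hs] using this

end ibp

section quasi
variable {n r : ℕ} {K T : Subgroup (U n)} {B : Mat n →ₗ[ℝ] Mat n →ₗ[ℝ] ℝ} {e : Fin r → Mat n} {t τ : ℂ}

/-- Equivariance under the lattice. -/
def QuasiPeriodic (e : Fin r → Mat n) (t : ℂ) (ψ : A0 r → ℂ) : Prop :=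
  ∀ l ∈ lattice e, ∀ A, ψ (A + l) = multiplier t l (incl r A) * ψ A

theorem omegaT_incl (l A : A0 r) : omegaT t (incl r l) (incl r A) = t.re * omega l A := by
  have : omegaC (incl r l) (incl r A) = (omega l A : ℂ) := by simp [omegaC, omega, incl]
  rw [omegaT, this]; simp

theorem hasFDerivAt_multiplier (l A : A0 r) : ∃ L : A0 r →L[ℝ] ℂ,
    HasFDerivAt (fun A => multiplier t l (incl r A)) L A ∧
      ∀ X, L X = multiplier t l (incl r A) * (Complex.I / 2 * (t.re * omega l X)) := by
  let ℓ : A0 r →ₗ[ℝ] ℝ := ∑ j : Fin r, (l (Sum.inl j) • LinearMap.proj (Sum.inr j) - l (Sum.inr j) • LinearMap.proj (Sum.inl j))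
  have hℓ : ∀ X, ℓ X = omega l X := fun X => by simp [ℓ, omega]
  have h1 : HasFDerivAt (fun A => (t.re * ∑ j : Fin r, l (Sum.inl j) * l (Sum.inr j) + t.re * ℓ A : ℝ))
      (t.re • LinearMap.toContinuousLinearMap ℓ) A :=
    ((LinearMap.toContinuousLinearMap ℓ).hasFDerivAt.const_mul t.re).const_add _
  have h2 := (Complex.ofRealCLM.hasFDerivAt.comp A h1).const_mul (Complex.I / 2)
  refine ⟨_, h2.cexp.congr_of_eventuallyEq (Eventually.of_forall fun A => ?_), fun X => ?_⟩
  · simp only [multiplier, omegaT_incl, ← hℓ]; rfl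
  · rw [multiplier, omegaT_incl, ← hℓ]
    simp [← hℓ]

theorem QuasiPeriodic.nabla {ψ : A0 r → ℂ} (h : QuasiPeriodic e t ψ) (hd : Differentiable ℝ ψ) (X : A0 r) :
    QuasiPeriodic e t (nabla t.re X ψ) := by
  intro l hl A
  obtain ⟨L, hL, hLX⟩ := hasFDerivAt_multiplier (t := t) l A
  have h1 : HasFDerivAt (fun A => ψ (A + l)) (fderiv ℝ ψ (A + l)) A := (hasFDerivAt_comp_add_right l).2 (hd _).hasFDerivAt
  have h2 := hL.mul (hd A).hasFDerivAt
  have h3 := h1.unique (h2.congr_of_eventuallyEq (Eventually.of_forall (h l hl)))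
  have h4 : omega (A + l) X = omega A X + omega l X := by
    simp only [omega, ← Finset.sum_add_distrib]
    exact Finset.sum_congr rfl fun j _ => by simp; ring
  rw [GenusOne.nabla, GenusOne.nabla, h3, h l hl, h4]
  simp only [add_apply, smul_apply, smul_eq_mul, hLX]
  push_cast
  ring

theorem QuasiPeriodic.pDer {ψ : A0 r → ℂ} (h : QuasiPeriodic e t ψ) (hd : Differentiable ℝ ψ) (z : ℂ) (j : Fin r) :
    QuasiPeriodic e t (pDer t.re z j ψ) := by
  intro l hl A
  rw [GenusOne.pDer, GenusOne.pDer, h.nabla hd _ l hl, h.nabla hd _ l hl]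
  ring

theorem QuasiPeriodic.slowInt (he : IsOrthonormalFrame T B e) (hT : IsMaximalTorus K T) {ψ : A0 r → ℂ}
    (h : QuasiPeriodic e t ψ) (hc : Continuous ψ) : SlowInt volume ψ := by
  obtain ⟨R, hR⟩ := lattice_cocompact he hT
  obtain ⟨C, hC⟩ := (isCompact_closedBall (0 : A0 r) R).exists_bound_of_continuousOn hc.continuousOn
  refine slowInt_of_bound hc.aestronglyMeasurable (C := C) (M := 0) fun A => ?_
  obtain ⟨l, hl, hA⟩ := hR A
  have := h l hl (A - l)
  rw [sub_add_cancel] at this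
  rw [this, norm_mul, norm_multiplier, one_mul, pow_zero, mul_one]
  exact hC _ (by simpa using hA)

theorem QuasiPeriodic.slowInt_fderiv (he : IsOrthonormalFrame T B e) (hT : IsMaximalTorus K T) {ψ : A0 r → ℂ}
    (h : QuasiPeriodic e t ψ) (hd : ContDiff ℝ ∞ ψ) (a : Idx r) : SlowInt volume fun A => fderiv ℝ ψ A (basis0 a) := by
  have h1 := (h.nabla (hd.differentiable (by simp)) (basis0 a)).slowInt he hT (nabla_contDiff _ _ hd).continuous
  have h2 : SlowInt volume fun A => (Complex.I / 2 * ((t.re * omega A (basis0 a) : ℝ) : ℂ)) * ψ A := by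
    have hc : Continuous fun A : A0 r => omega A (basis0 a) := by unfold omega; fun_prop
    refine (h.slowInt he hT hd.continuous).mul_bound (by fun_prop) (C := |t.re|) (M := 1) fun A => ?_
    have : |omega A (basis0 a)| ≤ ‖A‖ := by
      rcases a with j | j
      · rw [omega_basis0_inl, abs_neg]; exact norm_le_pi_norm A _
      · rw [omega_basis0_inr]; exact norm_le_pi_norm A _
    rw [norm_mul, Complex.norm_real, norm_mul, Real.norm_eq_abs, Real.norm_eq_abs, pow_one]
    have hn := norm_nonneg A
    have : ‖(Complex.I / 2 : ℂ)‖ ≤ 1 := by simp; norm_num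
    calc _ ≤ 1 * (|t.re| * (1 + ‖A‖)) := by gcongr; linarith
      _ = _ := one_mul _
  refine (h1.add h2).mono (by exact (contDiff_fderiv_const hd _).continuous.aestronglyMeasurable) (C := 1) (M := 0) fun A => ?_
  rw [pow_zero, one_mul, one_mul, GenusOne.nabla, sub_add_cancel]

theorem QuasiPeriodic.integral_pDer (he : IsOrthonormalFrame T B e) (hT : IsMaximalTorus K T) {ψ : A0 r → ℂ}
    (h : QuasiPeriodic e t ψ) (hd : ContDiff ℝ ∞ ψ) (z : ℂ) (j : Fin r) (χ : S0 r) :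
    ∫ A, GenusOne.pDer t.re z j ψ A * star (χ A) = -∫ A, ψ A * star (pDerS t.re (conj z) j χ A) := by
  have hs := h.slowInt he hT hd.continuous
  have hp := (h.pDer (hd.differentiable (by simp)) z j).slowInt he hT (pDer_contDiff _ _ _ hd).continuous
  have hl := h.slowInt_fderiv he hT hd (Sum.inl j)
  have hr := h.slowInt_fderiv he hT hd (Sum.inr j)
  have hdd := hd.differentiable (by simp)
  have e1 := integral_fderiv_mul_star hdd hs hl χ
  have e2 := integral_fderiv_mul_star hdd hs hr χ
  have i1 := hl.integrable_mul_star χ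
  have i2 := integrable_mul_star_fderiv hs χ (basis0 (Sum.inl j))
  have i3 := hr.integrable_mul_star χ
  have i4 := integrable_mul_star_fderiv hs χ (basis0 (Sum.inr j))
  rw [eq_neg_iff_add_eq_zero, ← integral_add (hp.integrable_mul_star χ) (hs.integrable_mul_star _)]
  have key : ∀ A, GenusOne.pDer t.re z j ψ A * star (χ A) + ψ A * star (pDerS t.re (conj z) j χ A) =
      (fderiv ℝ ψ A (basis0 (Sum.inl j)) * star (χ A) + ψ A * star (fderiv ℝ χ A (basis0 (Sum.inl j)))) +
      z * (fderiv ℝ ψ A (basis0 (Sum.inr j)) * star (χ A) + ψ A * star (fderiv ℝ χ A (basis0 (Sum.inr j)))) := by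
    intro A
    rw [pDerS_apply, pDer_eq, pDer_eq]
    simp only [Complex.star_def, map_add, map_mul, map_sub, Complex.conj_conj, Complex.conj_ofReal, map_div₀, Complex.conj_I,
      map_ofNat]
    ring
  have j1 : ∫ A, (fderiv ℝ ψ A (basis0 (Sum.inl j)) * star (χ A) + ψ A * star (fderiv ℝ χ A (basis0 (Sum.inl j)))) = 0 := by
    rw [integral_add i1 i2, e1, add_neg_cancel]
  have j2 : ∫ A, (fderiv ℝ ψ A (basis0 (Sum.inr j)) * star (χ A) + ψ A * star (fderiv ℝ χ A (basis0 (Sum.inr j)))) = 0 := by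
    rw [integral_add i3 i4, e2, add_neg_cancel]
  rw [integral_congr_ae (Eventually.of_forall key)]
  refine (integral_add (i1.add i2) ((i3.add i4).const_mul z)).trans ?_
  rw [integral_const_mul]
  refine (congrArg₂ (fun x y => x + z * y) j1 j2).trans ?_
  ring

theorem QuasiPeriodic.integral_uHW (he : IsOrthonormalFrame T B e) (hT : IsMaximalTorus K T) (hτ : τ ∈ teich) (V : ℂ)
    {ψ : A0 r → ℂ} (h : QuasiPeriodic e t ψ) (hd : ContDiff ℝ ∞ ψ) (χ : S0 r) :
    SlowInt volume (fun A => -(1 / 2) * uHW t V τ ψ A) ∧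
    ∫ A, -(1 / 2) * uHW t V τ ψ A * star (χ A) = -∫ A, ψ A * star (uOp r t V τ χ A) := by
  have hdz : ∀ z j, ContDiff ℝ ∞ (GenusOne.pDer t.re z j ψ) := fun z j => pDer_contDiff _ z j hd
  have hpz : ∀ z j, QuasiPeriodic e t (GenusOne.pDer t.re z j ψ) := fun z j => h.pDer (hd.differentiable (by simp)) z j
  have hpp : ∀ z j, SlowInt volume (GenusOne.pDer t.re z j (GenusOne.pDer t.re z j ψ)) := fun z j =>
    ((hpz z j).pDer ((hdz z j).differentiable (by simp)) z j).slowInt he hT (pDer_contDiff _ z j (hdz z j)).continuous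
  have hs := h.slowInt he hT hd.continuous
  let a : ℂ := -(1 / 2) * (1 / star t * (Complex.I * conj V / (2 * τ.im ^ 2)))
  let b : ℂ := -(1 / 2) * (1 / t * (Complex.I * V / (2 * τ.im ^ 2)))
  have hab : conj a = -b := by
    simp only [a, b, Complex.star_def, map_neg, map_mul, map_div₀, map_one, map_ofNat, map_pow, Complex.conj_conj,
      Complex.conj_ofReal, Complex.conj_I]; ring
  have hba : conj b = -a := by rw [← neg_eq_iff_eq_neg.2 hab]; simp
  have hu : ∀ A, -(1 / 2) * uHW t V τ ψ A = a * ∑ j, GenusOne.pDer t.re τ j (GenusOne.pDer t.re τ j ψ) A +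
      b * ∑ j, GenusOne.pDer t.re (conj τ) j (GenusOne.pDer t.re (conj τ) j ψ) A := fun A => by
    rw [uHW, laplaceG_eq hτ _ _ hd, laplaceGbar_eq hτ _ _ hd]; simp only [a, b]; ring
  have hχ : ∀ A, uOp r t V τ χ A = a * ∑ j, pDerS t.re τ j (pDerS t.re τ j χ) A +
      b * ∑ j, pDerS t.re (conj τ) j (pDerS t.re (conj τ) j χ) A := fun A => by
    simp [uOp, a, b]
  have hint : ∀ z j, ∫ A, GenusOne.pDer t.re z j (GenusOne.pDer t.re z j ψ) A * star (χ A) =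
      ∫ A, ψ A * star (pDerS t.re (conj z) j (pDerS t.re (conj z) j χ) A) := fun z j => by
    rw [(hpz z j).integral_pDer he hT (hdz z j), h.integral_pDer he hT hd, neg_neg]
  have hsum : SlowInt volume (fun A => -(1 / 2) * uHW t V τ ψ A) := by
    simp only [hu]
    exact ((SlowInt.sum _ fun j _ => hpp τ j).const_mul a).add ((SlowInt.sum _ fun j _ => hpp (conj τ) j).const_mul b)
  refine ⟨hsum, ?_⟩
  have l1 : ∀ A, -(1 / 2) * uHW t V τ ψ A * star (χ A) =
      a * (∑ j, GenusOne.pDer t.re τ j (GenusOne.pDer t.re τ j ψ) A * star (χ A)) +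
      b * ∑ j, GenusOne.pDer t.re (conj τ) j (GenusOne.pDer t.re (conj τ) j ψ) A * star (χ A) := fun A => by
    rw [hu, ← Finset.sum_mul, ← Finset.sum_mul]; ring
  have l2 : ∀ A, ψ A * star (uOp r t V τ χ A) =
      -(b * (∑ j, ψ A * star (pDerS t.re τ j (pDerS t.re τ j χ) A)) +
      a * ∑ j, ψ A * star (pDerS t.re (conj τ) j (pDerS t.re (conj τ) j χ) A)) := fun A => by
    rw [hχ, ← Finset.mul_sum, ← Finset.mul_sum]
    simp only [Complex.star_def, map_add, map_mul, map_sum, hab, hba]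
    ring
  simp only [l1, l2]
  rw [integral_add ((integrable_finsetSum _ fun j _ => (hpp τ j).integrable_mul_star χ).const_mul a)
      ((integrable_finsetSum _ fun j _ => (hpp (conj τ) j).integrable_mul_star χ).const_mul b),
    integral_neg, neg_neg,
    integral_add ((integrable_finsetSum _ fun j _ => hs.integrable_mul_star _).const_mul b)
      ((integrable_finsetSum _ fun j _ => hs.integrable_mul_star _).const_mul a),
    integral_const_mul, integral_const_mul, integral_const_mul, integral_const_mul,
    integral_finsetSum _ (fun j _ => (hpp τ j).integrable_mul_star χ),
    integral_finsetSum _ (fun j _ => (hpp (conj τ) j).integrable_mul_star χ),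
    integral_finsetSum _ (fun j _ => hs.integrable_mul_star _), integral_finsetSum _ (fun j _ => hs.integrable_mul_star _)]
  simp only [hint, Complex.conj_conj]
  ring

theorem isSmoothDist0_of_isSmoothFamily0 (he : IsOrthonormalFrame T B e) (hT : IsMaximalTorus K T) {Ψ : ℂ → A0 r → ℂ}
    (hΨ : IsSmoothFamily0 K T e t Ψ) {S : ℂ → S0' r} (hS : ∀ τ ∈ teich, IsRegular0 (S τ) (Ψ τ)) : IsSmoothDist0 S :=
  fun χ => ((slowL1Family_of_isSmoothFamily0 he hT hΨ).mul_star (rapidFamily_comp_snd χ)).contDiffOn.congr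
    fun τ hτ => (hS τ hτ χ).2

theorem exists_isDualHW_isRegular0 (he : IsOrthonormalFrame T B e) (hT : IsMaximalTorus K T) {Ψ : ℂ → A0 r → ℂ}
    (hΨ : IsSmoothFamily0 K T e t Ψ) {S : ℂ → S0' r} (hS : ∀ τ ∈ teich, IsRegular0 (S τ) (Ψ τ)) (hτ : τ ∈ teich) (V : ℂ) :
    ∃ S' : S0' r, IsDualHW t V S τ S' ∧ IsRegular0 S' (covHW t V Ψ τ) := by
  have hΨ1 := slowL1Family_of_isSmoothFamily0 he hT hΨ
  obtain ⟨S', hS'⟩ := exists_isDualHW (t := t) S (isSmoothDist0_of_isSmoothFamily0 he hT hΨ hS) hτ V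
  refine ⟨S', hS', fun χ => ?_⟩
  have hq : QuasiPeriodic e t (Ψ τ) := (hΨ.2 τ hτ).1
  have hd : ContDiff ℝ ∞ (Ψ τ) := contDiff_slice hΨ.1 hτ
  obtain ⟨hu, hint⟩ := hq.integral_uHW he hT hτ V hd χ
  have hV := hΨ1.fderiv hτ V
  have hcov : ∀ A, covHW t V Ψ τ A * star (χ A) =
      fderiv ℝ (fun τ' => Ψ τ' A) τ V * star (χ A) + -(1 / 2) * uHW t V τ (Ψ τ) A * star (χ A) := fun A => by
    rw [covHW]; ring
  simp only [hcov]
  refine ⟨(hV.integrable_mul_star χ).add (hu.integrable_mul_star χ), ?_⟩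
  rw [integral_add (hV.integrable_mul_star χ) (hu.integrable_mul_star χ), hint]
  obtain ⟨η, hη, h⟩ := hS' χ
  have hηu : η = uOp r t V τ χ := by
    ext A; rw [hη, covHW_const, uOp_apply hτ]
  rw [h, (hS τ hτ η).2, hηu, ← sub_eq_add_neg]
  congr 1
  have hF := hΨ1.mul_star (rapidFamily_comp_snd χ)
  have h1 : (fun τ' => S τ' χ) =ᶠ[𝓝 τ] fun τ' => ∫ A, Ψ τ' A * star (χ A) := by
    filter_upwards [isOpen_teich.mem_nhds hτ] with τ' hτ'
    exact (hS τ' hτ' χ).2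
  rw [h1.fderiv_eq, (hF.hasFDerivAt hτ).fderiv, ContinuousLinearMap.integral_apply (hF.fderiv.integrable hτ)]
  refine integral_congr_ae (Eventually.of_forall fun A => ?_)
  have hdτ := (slice_contDiffAt hΨ.1 hτ A).differentiableAt (by simp)
  refine (DFunLike.congr_fun (hdτ.hasFDerivAt.mul_const (star (χ A))).fderiv V).trans ?_
  simp [mul_comm]

end quasi
end GenusOne

end

noncomputable section
namespace GenusOne
open Filter ComplexConjugate

section coherent
variable {r : ℕ} {c : ℝ}

/-- The standard Hermitian product. -/
def herm (z w : AC r) : ℂ := ∑ a, z a * conj (w a)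

theorem conj_herm (z w : AC r) : conj (herm z w) = herm w z := by
  simp [herm, mul_comm]

theorem herm_self (z : AC r) : herm z z = ((∑ a, ‖z a‖ ^ 2 : ℝ) : ℂ) := by
  simp [herm, Complex.mul_conj, Complex.normSq_eq_norm_sq]

theorem sq_norm_le_sum (y : AC r) : ‖y‖ ^ 2 ≤ ∑ a, ‖y a‖ ^ 2 := by
  rw [← Real.le_sqrt (norm_nonneg _) (by positivity), pi_norm_le_iff_of_nonneg (Real.sqrt_nonneg _)]
  exact fun a => Real.le_sqrt_of_sq_le (Finset.single_le_sum (f := fun a => ‖y a‖ ^ 2) (fun _ _ => by positivity) (Finset.mem_univ a))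

theorem continuous_herm {X : Type*} [TopologicalSpace X] {f g : X → AC r} (hf : Continuous f) (hg : Continuous g) :
    Continuous fun x => herm (f x) (g x) := by
  unfold herm
  exact continuous_finsetSum _ fun a _ => ((continuous_apply a).comp hf).mul
    (Complex.continuous_conj.comp ((continuous_apply a).comp hg))

/-- The coherent state at `w`. -/
def coherent (c : ℝ) (w y : AC r) : ℂ := Complex.exp (-(c / 4) * herm y y + c / 2 * herm y w)

theorem hasFDerivAt_coherent (w y : AC r) : HasFDerivAt (coherent c w)
    (∑ i : Idx r ⊕ Idx r, (Sum.elim (fun a => -(c / 4 : ℂ) * conj (y a) + c / 2 * conj (w a)) (fun a => -(c / 4 : ℂ) * y a) i *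
      coherent c w y) • (Sum.elim (fun a => (ContinuousLinearMap.proj a : AC r →L[ℝ] ℂ))
        (fun a => Complex.conjCLE.toContinuousLinearMap.comp (ContinuousLinearMap.proj a : AC r →L[ℝ] ℂ)) i)) y := by
  have h1 : HasFDerivAt (fun y : AC r => herm y y) _ y :=
    HasFDerivAt.fun_sum fun a _ => (hasFDerivAt_coord a y).mul (hasFDerivAt_conj_apply a y)
  have h2 : HasFDerivAt (fun y : AC r => herm y w) _ y :=
    HasFDerivAt.fun_sum fun a _ => (hasFDerivAt_coord a y).mul_const (conj (w a))
  have h := ((h1.const_mul (-(c / 4 : ℂ))).add (h2.const_mul (c / 2 : ℂ))).cexp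
  refine h.congr_fderiv (ContinuousLinearMap.ext fun X => ?_)
  simp only [ContinuousLinearMap.sum_apply, Fintype.sum_sum_type, Sum.elim_inl, Sum.elim_inr, add_apply, smul_apply,
    ← Finset.sum_add_distrib, smul_eq_mul, Finset.mul_sum]
  refine Finset.sum_congr rfl fun a _ => ?_
  simp [coherent]
  ring

theorem norm_coherent_le (hc : 0 < c) (w : AC r) (m : ℕ) : ∃ C : ℝ, ∀ y, (1 + ‖y‖) ^ m * ‖coherent c w y‖ ≤ C := by
  let M : ℝ := c / 2 * ∑ a, ‖w a‖
  refine ⟨m.factorial * Real.exp (1 + (1 + M) ^ 2 / c + M + 1), fun y => ?_⟩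
  have hy := norm_nonneg y
  have h1 : (1 + ‖y‖) ^ m ≤ m.factorial * Real.exp (1 + ‖y‖) := by
    have := Real.pow_div_factorial_le_exp (1 + ‖y‖) (by positivity) m
    rwa [div_le_iff₀ (by positivity), mul_comm] at this
  have h2 : ‖coherent c w y‖ ≤ Real.exp (-(c / 4) * ‖y‖ ^ 2 + M * ‖y‖ + (M + 1)) := by
    have e1 : (-(c / 4) * herm y y + c / 2 * herm y w : ℂ).re ≤ -(c / 4) * ‖y‖ ^ 2 + M * ‖y‖ := by
      have e2 : ((herm y w).re) ≤ ‖y‖ * ∑ a, ‖w a‖ := by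
        refine (Complex.re_le_norm _).trans ((norm_sum_le _ _).trans ?_)
        rw [Finset.mul_sum]
        refine Finset.sum_le_sum fun a _ => ?_
        rw [norm_mul, RCLike.norm_conj]
        gcongr
        exact norm_le_pi_norm y a
      have e3 := sq_norm_le_sum y
      have e4 : (-(c / 4) * herm y y + c / 2 * herm y w : ℂ).re = -(c / 4) * (∑ a, ‖y a‖ ^ 2) + c / 2 * (herm y w).re := by
        rw [herm_self, show (-(c / 4) * ((∑ a, ‖y a‖ ^ 2 : ℝ) : ℂ) + c / 2 * herm y w : ℂ) =
          ((-(c / 4) * (∑ a, ‖y a‖ ^ 2) : ℝ) : ℂ) + ((c / 2 : ℝ) : ℂ) * herm y w by push_cast; ring,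
          Complex.add_re, Complex.re_ofReal_mul, Complex.ofReal_re]
      rw [e4]
      have e5 := mul_le_mul_of_nonneg_left e2 (by positivity : 0 ≤ c / 2)
      have e6 := mul_le_mul_of_nonneg_left e3 (by positivity : 0 ≤ c / 4)
      simp only [M]
      linarith
    rw [coherent, Complex.norm_exp]
    refine Real.exp_le_exp.2 (e1.trans ?_)
    have : 0 ≤ M := by positivity
    linarith
  refine (mul_le_mul h1 h2 (norm_nonneg _) (by positivity)).trans ?_
  rw [mul_assoc, ← Real.exp_add]
  refine mul_le_mul_of_nonneg_left (Real.exp_le_exp.2 ?_) (by positivity)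
  have : (1 + M) * ‖y‖ ≤ (1 + M) ^ 2 / c + (c / 4) * ‖y‖ ^ 2 := by
    have : 0 ≤ ((1 + M) - c / 2 * ‖y‖) ^ 2 / c := by positivity
    have e : ((1 + M) - c / 2 * ‖y‖) ^ 2 / c = (1 + M) ^ 2 / c - (1 + M) * ‖y‖ + (c / 4) * ‖y‖ ^ 2 := by
      field_simp; ring
    linarith
  linarith

theorem rapidFamily_coherent (hc : 0 < c) (w : AC r) : RapidFamily fun p : ℂ × AC r => coherent c w p.2 := by
  let g : Idx r ⊕ Idx r → ℂ × AC r → ℂ := fun i p =>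
    Sum.elim (fun a => -(c / 4 : ℂ) * conj (p.2 a) + c / 2 * conj (w a)) (fun a => -(c / 4 : ℂ) * p.2 a) i
  let L : Idx r ⊕ Idx r → (ℂ × AC r →L[ℝ] ℂ) := fun i =>
    (Sum.elim (fun a => (ContinuousLinearMap.proj a : AC r →L[ℝ] ℂ))
        (fun a => Complex.conjCLE.toContinuousLinearMap.comp (ContinuousLinearMap.proj a : AC r →L[ℝ] ℂ)) i).comp
      (ContinuousLinearMap.snd ℝ ℂ (AC r))
  have hg : ∀ i, SlowFamily (g i) := by
    rintro (a | a)
    · refine slowFamily_comp_snd (f := fun y : AC r => -(c / 4 : ℂ) * conj (y a) + c / 2 * conj (w a)) ?_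
      exact ((Function.HasTemperateGrowth.const _).mul (hasTemperateGrowth_conj a)).add (Function.HasTemperateGrowth.const _)
    · exact slowFamily_comp_snd (f := fun y : AC r => -(c / 4 : ℂ) * y a)
        ((Function.HasTemperateGrowth.const _).mul (hasTemperateGrowth_coord a))
  have hI : ∀ _u : Unit, ∀ p ∈ strip (AC r), HasFDerivAt (fun p : ℂ × AC r => coherent c w p.2)
      (∑ i, (g i p * coherent c w p.2) • L i) p := fun _ p _ => by
    refine ((hasFDerivAt_coherent w p.2).comp p hasFDerivAt_snd).congr_fderiv (ContinuousLinearMap.ext fun X => ?_)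
    simp [g, L]
  refine ⟨contDiffOn_of_hasFDerivAt_sum (P := Unit) (T := fun _ u => u) (I := fun _ p => coherent c w p.2) hg hI (),
    fun m l τ₀ hτ₀ => ?_⟩
  obtain ⟨-, C, hC0, hC⟩ := bound_iteratedFDeriv_of_hasFDerivAt_sum (P := Unit) (κ := Unit) (T := fun _ u => u)
    (I := fun _ p => coherent c w p.2) (fun _ _ => 1) (fun _ _ => zero_le_one) (fun s => ⟨(), fun _ _ _ => le_rfl⟩)
    (fun _ _ => ⟨(), 1, zero_le_one, fun _ => by norm_num⟩) hg hI hτ₀ (fun m => by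
      obtain ⟨C, hC⟩ := norm_coherent_le hc w m
      exact ⟨(), C, le_trans (by positivity) (hC 0), Eventually.of_forall fun τ _ A => by rw [mul_one]; exact hC A⟩) l m
  refine ⟨C, ?_⟩
  filter_upwards [hC] with τ h A
  refine le_trans ?_ ((h () A).trans_eq (mul_one C))
  gcongr
  linarith [norm_nonneg A]

theorem exists_coherent_schwartz (hc : 0 < c) (w : AC r) : ∃ f : HS r c, ∀ y, f.1 y = coherent c w y := by
  have hI : Complex.I ∈ teich := by simp [teich]
  refine ⟨⟨(rapidFamily_coherent hc w).slice hI, fun y => (hasFDerivAt_coherent w y).differentiableAt, fun X y => ?_⟩, fun y => rfl⟩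
  change fderiv ℝ (coherent c w) y X + Complex.I * fderiv ℝ (coherent c w) y (Complex.I • X) +
    c / 2 * (∑ a, y a * conj (X a)) * coherent c w y = 0
  have h4 := Complex.I_mul_I
  rw [(hasFDerivAt_coherent w y).fderiv, Finset.mul_sum, Finset.sum_mul]
  simp only [ContinuousLinearMap.sum_apply, Fintype.sum_sum_type, ← Finset.sum_add_distrib, Finset.mul_sum]
  refine Finset.sum_eq_zero fun a _ => ?_
  simp
  grind

end coherent

section line
variable {r : ℕ} {c : ℝ} {f : AC r → ℂ}

/-- The exponent of `lineFun`. -/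
def lineExp (c : ℝ) (w v : AC r) (ζ : ℂ) : ℂ := c / 4 * (ζ * conj ζ * herm v v + conj ζ * herm w v - ζ * herm v w)

/-- The entire function given by the restriction of a holomorphic section to a complex line through `w`. -/
def lineFun (c : ℝ) (f : AC r → ℂ) (w v : AC r) (ζ : ℂ) : ℂ := f (w + ζ • v) * Complex.exp (lineExp c w v ζ)

theorem hasFDerivAt_lineExp (w v : AC r) (ζ : ℂ) : HasFDerivAt (𝕜 := ℝ) (lineExp c w v)
    ((c / 4 : ℂ) • ((herm v v * conj ζ - herm v w) • (ContinuousLinearMap.id ℝ ℂ) +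
      (herm v v * ζ + herm w v) • Complex.conjCLE.toContinuousLinearMap)) ζ := by
  have h0 : HasFDerivAt (𝕜 := ℝ) (fun ζ : ℂ => ζ) (ContinuousLinearMap.id ℝ ℂ) ζ := hasFDerivAt_id ζ
  have h1 : HasFDerivAt (𝕜 := ℝ) (fun ζ : ℂ => conj ζ) Complex.conjCLE.toContinuousLinearMap ζ :=
    Complex.conjCLE.toContinuousLinearMap.hasFDerivAt
  have h := ((((h0.mul h1).mul_const (herm v v)).add (h1.mul_const (herm w v))).sub (h0.mul_const (herm v w))).const_mul (c / 4 : ℂ)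
  refine h.congr_fderiv (ContinuousLinearMap.ext fun X => ?_)
  simp
  ring

theorem hasDerivAt_lineFun (hf : IsHol c f) (w v : AC r) (ζ : ℂ) : HasDerivAt (lineFun c f w v)
    ((∑ a, v a * dHol c a f (w + ζ • v) + c / 2 * conj ζ * herm v v * f (w + ζ • v)) * Complex.exp (lineExp c w v ζ)) ζ := by
  have h1 : HasFDerivAt (𝕜 := ℝ) (fun ζ : ℂ => w + ζ • v) ((ContinuousLinearMap.id ℝ ℂ).smulRight v) ζ :=
    (((ContinuousLinearMap.id ℝ ℂ).smulRight v).hasFDerivAt).const_add w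
  have h2 := (hf.1 (w + ζ • v)).hasFDerivAt.comp ζ h1
  have h3 := h2.mul (hasFDerivAt_lineExp (c := c) w v ζ).cexp
  rw [hasDerivAt_iff_hasFDerivAt]
  refine hasFDerivAt_of_restrictScalars ℝ h3 (ContinuousLinearMap.ext fun h => ?_)
  have h4 : fderiv ℝ f (w + ζ • v) (h • v) = h * ∑ a, v a * dHol c a f (w + ζ • v) +
      c / 4 * (h * (herm v w + conj ζ * herm v v) - conj h * (herm w v + ζ * herm v v)) * f (w + ζ • v) := by
    rw [fderiv_of_isHol hf]
    simp only [herm, Finset.mul_sum, ← Finset.sum_add_distrib, Finset.sum_mul, ← Finset.sum_sub_distrib]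
    refine Finset.sum_congr rfl fun a _ => ?_
    simp
    ring
  simp only [ContinuousLinearMap.coe_restrictScalars', ContinuousLinearMap.toSpanSingleton_apply, add_apply, smul_apply,
    ContinuousLinearMap.comp_apply, ContinuousLinearMap.smulRight_apply, ContinuousLinearMap.id_apply, smul_eq_mul,
    Function.comp_apply, h4, ContinuousLinearEquiv.coe_coe, Complex.conjCLE_apply]
  ring

end line
end GenusOne

end

noncomputable section
namespace GenusOne
open Filter ComplexConjugate

section mean
variable {r : ℕ} {c : ℝ} {f : AC r → ℂ}

theorem measurePreserving_smul {u : ℂ} (hu : ‖u‖ = 1) : MeasurePreserving (fun z : AC r => u • z) volume volume := by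
  have h : MeasurePreserving (fun z : ℂ => u * z) volume volume :=
    (rotation (⟨u, mem_sphere_zero_iff_norm.2 hu⟩ : Circle)).measurePreserving
  exact volume_preserving_pi fun _ => h

theorem lineFun_smul (w v : AC r) (ζ : ℂ) : lineFun c f w (ζ • v) 1 = lineFun c f w v ζ := by
  have h1 : herm (ζ • v) (ζ • v) = ζ * conj ζ * herm v v := by
    simp only [herm, Finset.mul_sum]; exact Finset.sum_congr rfl fun a _ => by simp; ring
  have h2 : herm w (ζ • v) = conj ζ * herm w v := by
    simp only [herm, Finset.mul_sum]; exact Finset.sum_congr rfl fun a _ => by simp; ring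
  have h3 : herm (ζ • v) w = ζ * herm v w := by
    simp only [herm, Finset.mul_sum]; exact Finset.sum_congr rfl fun a _ => by simp; ring
  simp only [lineFun, lineExp, h1, h2, h3, one_smul, map_one, one_mul, mul_one]

theorem lineFun_zero (w v : AC r) : lineFun c f w v 0 = f w := by simp [lineFun, lineExp]

theorem differentiable_lineFun (hf : IsHol c f) (w v : AC r) : Differentiable ℂ (lineFun c f w v) :=
  fun ζ => (hasDerivAt_lineFun hf w v ζ).differentiableAt

theorem continuous_lineFun_one (hf : IsHol c f) (w : AC r) : Continuous fun v => lineFun c f w v 1 := by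
  have h1 := hf.1.continuous
  have h2 : Continuous fun v : AC r => herm v v := continuous_herm continuous_id continuous_id
  have h3 : Continuous fun v : AC r => herm w v := continuous_herm continuous_const continuous_id
  have h4 : Continuous fun v : AC r => herm v w := continuous_herm continuous_id continuous_const
  unfold lineFun lineExp
  fun_prop

theorem integral_radial_mul_lineFun (hf : IsHol c f) (w : AC r) {h : AC r → ℂ} (hm : Measurable h)
    (hrot : ∀ u : ℂ, ‖u‖ = 1 → ∀ z, h (u • z) = h z) (hi : Integrable fun z => h z * lineFun c f w z 1) :
    ∫ z, h z * lineFun c f w z 1 = (∫ z, h z) * f w := by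
  let P : AC r → ℂ := fun z => h z * lineFun c f w z 1
  have hPm : Measurable P := hm.mul (continuous_lineFun_one hf w).measurable
  have hu : ∀ θ : ℝ, ‖circleMap 0 1 θ‖ = 1 := fun θ => by simp
  have hP : ∀ θ z, P (circleMap 0 1 θ • z) = h z * lineFun c f w z (circleMap 0 1 θ) := fun θ z => by
    simp only [P]; rw [hrot _ (hu θ), lineFun_smul]
  have hmp := fun θ => measurePreserving_smul (r := r) (hu θ)
  have hme : ∀ θ, MeasurableEmbedding fun z : AC r => circleMap 0 1 θ • z := fun θ =>
    (Homeomorph.smulOfNeZero (circleMap 0 1 θ) (by rw [← norm_ne_zero_iff, hu]; exact one_ne_zero)).measurableEmbedding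
  have hjm : Measurable fun q : ℝ × AC r => P (circleMap 0 1 q.1 • q.2) := by
    refine hPm.comp (Continuous.measurable ?_)
    exact ((continuous_circleMap 0 1).comp continuous_fst).smul continuous_snd
  have hint : Integrable (Function.uncurry fun (θ : ℝ) (z : AC r) => P (circleMap 0 1 θ • z))
      ((volume.restrict (Set.uIoc 0 (2 * Real.pi))).prod volume) := by
    refine (integrable_prod_iff hjm.aestronglyMeasurable).2 ⟨Eventually.of_forall fun θ => ?_, ?_⟩
    · exact (hmp θ).integrable_comp_of_integrable hi
    · have : ∀ θ : ℝ, ∫ z, ‖P (circleMap 0 1 θ • z)‖ = ∫ z, ‖P z‖ := fun θ =>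
        (hmp θ).integral_comp (hme θ) fun z => ‖P z‖
      simp only [Function.uncurry, this]
      have : IsFiniteMeasure (volume.restrict (Set.uIoc (0 : ℝ) (2 * Real.pi))) := by
        rw [Set.uIoc_of_le (by positivity)]; infer_instance
      exact integrable_const _
  have h1 := intervalIntegral_integral_swap hint
  have h2 : ∀ θ : ℝ, ∫ z, P (circleMap 0 1 θ • z) = ∫ z, P z := fun θ => (hmp θ).integral_comp (hme θ) P
  have h3 : ∀ z, ∫ θ in (0 : ℝ)..(2 * Real.pi), P (circleMap 0 1 θ • z) = h z * ((2 * Real.pi : ℝ) * f w) := fun z => by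
    simp only [hP, intervalIntegral.integral_const_mul]
    have h4 := (differentiable_lineFun hf w z).diffContOnCl.circleAverage (c := 0) (R := 1)
    rw [lineFun_zero, Real.circleAverage_def, inv_smul_eq_iff₀ (by positivity)] at h4
    rw [h4, Complex.real_smul]
  simp only [h2, h3, intervalIntegral.integral_const, integral_mul_const, sub_zero, Complex.real_smul] at h1
  have hpi : ((2 * Real.pi : ℝ) : ℂ) ≠ 0 := by exact_mod_cast (by positivity : (2 * Real.pi) ≠ 0)
  refine mul_left_cancel₀ hpi (h1.trans ?_)
  ring

theorem norm_lineFun (w v : AC r) (ζ : ℂ) : ‖lineFun c f w v ζ‖ = ‖f (w + ζ • v)‖ * Real.exp (c / 4 * (‖ζ‖ ^ 2 * ∑ a, ‖v a‖ ^ 2)) := by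
  have : (lineExp c w v ζ).re = c / 4 * (‖ζ‖ ^ 2 * ∑ a, ‖v a‖ ^ 2) := by
    have h1 : (conj ζ * herm w v - ζ * herm v w).re = 0 := by
      have : conj ζ * herm w v = conj (ζ * herm v w) := by rw [map_mul, conj_herm]
      rw [this]; simp
    rw [lineExp, show (c / 4 : ℂ) = ((c / 4 : ℝ) : ℂ) by push_cast; ring, Complex.re_ofReal_mul, add_sub_assoc, Complex.add_re,
      h1, add_zero, herm_self, Complex.mul_conj, Complex.normSq_eq_norm_sq, ← Complex.ofReal_mul, Complex.ofReal_re]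
  rw [lineFun, norm_mul, Complex.norm_exp, this]

/-- Holomorphic sections of weighted class `L¹` grow polynomially. -/
theorem exists_bound_of_isHol (hc : 0 < c) (hf : IsHol c f) (hs : SlowInt volume f) : ∃ (C : ℝ) (N : ℕ), ∀ w, ‖f w‖ ≤ C * (1 + ‖w‖) ^ N := by
  obtain ⟨N, hN⟩ := hs
  let h : AC r → ℂ := (Metric.closedBall (0 : AC r) 1).indicator fun _ => 1
  have hmB : MeasurableSet (Metric.closedBall (0 : AC r) 1) := Metric.isClosed_closedBall.measurableSet
  let v : ℝ := volume.real (Metric.closedBall (0 : AC r) 1)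
  have hv : 0 < v := ENNReal.toReal_pos (Metric.measure_closedBall_pos _ _ one_pos).ne' (isCompact_closedBall _ _).measure_lt_top.ne
  let E : ℝ := Real.exp (c / 4 * Fintype.card (Idx r))
  let J : ℝ := ∫ y, ‖wt N y • f y‖
  refine ⟨2 ^ N * E * J / v, N, fun w => ?_⟩
  have e1 : ∀ z, h z * lineFun c f w z 1 = (Metric.closedBall (0 : AC r) 1).indicator (fun z => lineFun c f w z 1) z := fun z => by
    by_cases hz : z ∈ Metric.closedBall (0 : AC r) 1 <;> simp [h, hz]
  have hi : IntegrableOn (fun z => lineFun c f w z 1) (Metric.closedBall (0 : AC r) 1) :=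
    (continuous_lineFun_one hf w).continuousOn.integrableOn_compact (isCompact_closedBall _ _)
  have key := integral_radial_mul_lineFun hf w (h := h) (measurable_const.indicator hmB) (fun u hu z => by
    simp only [h, Set.indicator, mem_closedBall_zero_iff, norm_smul, hu, one_mul]) (by
    simp only [e1]; exact hi.integrable_indicator hmB)
  simp only [e1] at key
  rw [integral_indicator hmB, integral_indicator hmB, setIntegral_const, Complex.real_smul, mul_one] at key
  have hw := wt_pos N w
  have htr : Integrable (fun z => ‖wt N (w + z) • f (w + z)‖) := hN.norm.comp_add_left w
  have h2 : wt N w * (v * ‖f w‖) ≤ 2 ^ N * E * J := by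
    have : v * ‖f w‖ = ‖(v : ℂ) * f w‖ := by rw [norm_mul, Complex.norm_real, Real.norm_of_nonneg hv.le]
    rw [this, ← key, ← Real.norm_of_nonneg hw.le, ← Complex.norm_real, ← norm_mul, ← integral_const_mul]
    refine (norm_integral_le_integral_norm _).trans ?_
    calc _ ≤ ∫ z in Metric.closedBall (0 : AC r) 1, 2 ^ N * E * ‖wt N (w + z) • f (w + z)‖ := by
          refine setIntegral_mono_on (hi.const_mul _).norm (htr.const_mul _).integrableOn hmB fun z hz => ?_
          rw [mem_closedBall_zero_iff] at hz
          have h3 : wt N w ≤ 2 ^ N * wt N (w + z) := wt_le_of_dist_le N (by simpa using hz)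
          have h4 : ∑ a, ‖z a‖ ^ 2 ≤ Fintype.card (Idx r) := by
            rw [← nsmul_one, ← Finset.card_univ]
            refine Finset.sum_le_card_nsmul _ _ _ fun a _ => pow_le_one₀ (norm_nonneg _) ((norm_le_pi_norm z a).trans hz)
          have h5 := wt_pos N (w + z)
          rw [norm_mul, Complex.norm_real, Real.norm_of_nonneg hw.le, norm_lineFun, norm_smul, Real.norm_of_nonneg h5.le]
          simp only [norm_one, one_pow, one_mul, one_smul]
          calc _ ≤ 2 ^ N * wt N (w + z) * (‖f (w + z)‖ * E) := by simp only [E]; gcongr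
            _ = _ := by ring
      _ ≤ ∫ z, 2 ^ N * E * ‖wt N (w + z) • f (w + z)‖ :=
          setIntegral_le_integral (htr.const_mul _) (Eventually.of_forall fun z => by positivity)
      _ = 2 ^ N * E * J := by
          rw [integral_const_mul, integral_add_left_eq_self (fun y => ‖wt N y • f y‖) w]
  have hp : 0 < (1 + ‖w‖) ^ N := by have := norm_nonneg w; positivity
  rw [wt, inv_mul_le_iff₀ hp] at h2
  rw [div_mul_eq_mul_div, le_div_iff₀ hv]
  linarith

/-- Holomorphic sections are determined by their products with the coherent states. -/
theorem eq_zero_of_isHol (hc : 0 < c) (hf : IsHol c f) (hs : SlowInt volume f)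
    (h0 : ∀ χ : HS r c, ∫ y, f y * star (χ.1 y) = 0) (w : AC r) : f w = 0 := by
  obtain ⟨χ, hχ⟩ := exists_coherent_schwartz hc w
  obtain ⟨χ₀, hχ₀⟩ := exists_coherent_schwartz (r := r) hc 0
  let g : AC r → ℝ := fun z => -(c / 2) * ∑ a, ‖z a‖ ^ 2
  let h : AC r → ℂ := fun z => ((Real.exp (g z) : ℝ) : ℂ)
  have hgc : Continuous g := by fun_prop
  have hint : Integrable fun z => Real.exp (g z) := by
    refine (χ₀.1.integrable (μ := volume)).mono (by fun_prop) (Eventually.of_forall fun z => ?_)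
    rw [hχ₀, coherent, Complex.norm_exp, Real.norm_of_nonneg (Real.exp_pos _).le]
    refine Real.exp_le_exp.2 ?_
    have : 0 ≤ ∑ a, ‖z a‖ ^ 2 := by positivity
    have e : (-(c / 4) * herm z z + c / 2 * herm z 0 : ℂ) = ((-(c / 4) * ∑ a, ‖z a‖ ^ 2 : ℝ) : ℂ) := by
      rw [herm_self]; simp [herm]
    rw [e, Complex.ofReal_re]
    simp only [g]
    nlinarith
  have e1 : ∀ z, f (w + z) * star (χ.1 (w + z)) = (Real.exp (c / 4 * ∑ a, ‖w a‖ ^ 2) : ℝ) * (h z * lineFun c f w z 1) := by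
    intro z
    have h1 : herm (w + z) (w + z) = herm w w + herm z z + herm w z + herm z w := by
      simp only [herm, ← Finset.sum_add_distrib]; exact Finset.sum_congr rfl fun a _ => by simp; ring
    have h2 : herm (w + z) w = herm w w + herm z w := by
      simp only [herm, ← Finset.sum_add_distrib]; exact Finset.sum_congr rfl fun a _ => by simp; ring
    rw [hχ, coherent, Complex.star_def, ← Complex.exp_conj, h1, h2]
    simp only [h, lineFun, lineExp, map_add, map_mul, map_neg, map_div₀, Complex.conj_ofReal, map_ofNat, conj_herm, g,
      one_smul, map_one]
    rw [Complex.ofReal_exp, Complex.ofReal_exp, mul_left_comm _ (f (w + z)), mul_left_comm _ (f (w + z)), ← Complex.exp_add,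
      ← Complex.exp_add]
    congr 2
    push_cast
    have h3 := herm_self w
    have h4 := herm_self z
    push_cast at h3 h4
    rw [← h3, ← h4]
    ring
  have hne : ((Real.exp (c / 4 * ∑ a, ‖w a‖ ^ 2) : ℝ) : ℂ) ≠ 0 := by exact_mod_cast (Real.exp_pos _).ne'
  have hi : Integrable fun z => h z * lineFun c f w z 1 := by
    have := ((hs.integrable_mul_star χ.1).comp_add_left w)
    simp only [e1] at this
    exact (integrable_const_mul_iff (IsUnit.mk0 _ hne) _).1 this
  have key := integral_radial_mul_lineFun hf w (h := h) (by fun_prop) (fun u hu z => by simp [h, g, hu]) hi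
  have h5 : ∫ z, h z * lineFun c f w z 1 = 0 := by
    have := h0 χ
    rw [← integral_add_left_eq_self _ w] at this
    simp only [e1, integral_const_mul] at this
    exact (mul_eq_zero.1 this).resolve_left hne
  rw [h5, integral_complex_ofReal] at key
  refine (mul_eq_zero.1 key.symm).resolve_left ?_
  exact_mod_cast (integral_exp_pos hint).ne'

end mean
end GenusOne

end

noncomputable section
namespace GenusOne
open Filter ComplexConjugate

section transport
variable {X : Type} [NormedAddCommGroup X] [NormedSpace ℝ X] [FiniteDimensional ℝ X]
  [MeasurableSpace X] [BorelSpace X] {μ : Measure X} [μ.IsAddHaarMeasure]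

theorem exists_map_equiv (L : X ≃L[ℝ] X) : ∃ a : ℝ, 0 < a ∧ μ.map L = ENNReal.ofReal a • μ := by
  have h : LinearMap.det (L.toLinearEquiv : X →ₗ[ℝ] X) ≠ 0 := L.toLinearEquiv.isUnit_det'.ne_zero
  exact ⟨_, abs_pos.2 (inv_ne_zero h), Measure.map_linearMap_addHaar_eq_smul_addHaar μ h⟩

theorem integrable_comp_equiv {f : X → ℂ} (hf : Integrable f μ) (L : X ≃L[ℝ] X) : Integrable (fun A => f (L A)) μ := by
  obtain ⟨a, ha, h⟩ := exists_map_equiv (μ := μ) L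
  have := hf.smul_measure (ENNReal.ofReal_ne_top (r := a))
  rw [← h] at this
  exact (L.toHomeomorph.measurableEmbedding.integrable_map_iff).1 this

theorem integral_comp_equiv_eq_zero_iff {f : X → ℂ} (L : X ≃L[ℝ] X) : ∫ A, f (L A) ∂μ = 0 ↔ ∫ A, f A ∂μ = 0 := by
  obtain ⟨a, ha, h⟩ := exists_map_equiv (μ := μ) L
  have e := L.toHomeomorph.measurableEmbedding.integral_map (μ := μ) f
  have e' : μ.map L.toHomeomorph = ENNReal.ofReal a • μ := h
  rw [e', integral_smul_measure, ENNReal.toReal_ofReal ha.le] at e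
  change _ = ∫ A, f (L A) ∂μ at e
  rw [← e, smul_eq_zero]
  exact ⟨fun h => h.resolve_left ha.ne', Or.inr⟩

theorem SlowInt.comp_equiv {f : X → ℂ} (hf : SlowInt μ f) (L : X ≃L[ℝ] X) : SlowInt μ fun A => f (L A) := by
  obtain ⟨N, h⟩ := hf
  have h1 := integrable_comp_equiv h L
  have h2 : SlowInt μ fun A => wt N (L A) • f (L A) := ⟨0, by simpa [wt] using h1⟩
  have e : ∀ A, ‖f (L A)‖ = (1 + ‖L A‖) ^ N * ‖wt N (L A) • f (L A)‖ := fun A => by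
    have : 0 < 1 + ‖L A‖ := by positivity
    rw [norm_smul, Real.norm_of_nonneg (wt_pos _ _).le, wt]; field_simp
  refine h2.mono ?_ (C := (1 + ‖(L : X →L[ℝ] X)‖) ^ N) (M := N) fun A => ?_
  · have hc : Continuous fun A : X => (wt N (L A))⁻¹ :=
      ((continuous_wt (X := X) N).comp L.continuous).inv₀ fun A => (wt_pos N (L A)).ne'
    refine (hc.aestronglyMeasurable.smul h1.1).congr (Eventually.of_forall fun A => ?_)
    exact inv_smul_smul₀ (wt_pos N (L A)).ne' _
  · rw [e, ← mul_pow]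
    refine mul_le_mul_of_nonneg_right (pow_le_pow_left₀ (by positivity) ?_ N) (norm_nonneg _)
    have := (L : X →L[ℝ] X).le_opNorm A
    have h3 := norm_nonneg A
    have h4 := norm_nonneg (L : X →L[ℝ] X)
    change ‖L A‖ ≤ _ at this
    nlinarith

end transport

section uniqueness
variable {r : ℕ} {t τ : ℂ}

theorem isHol_comp_yinv (ht : t ≠ 0) (hτ : τ ∈ teich) {φ : AC r → ℂ} (h : IsHolomorphic τ t φ) :
    IsHol ‖t‖ fun y => φ (yinv t τ y) := by
  refine (isHolomorphic_comp_yco ht hτ).1 ?_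
  simpa only [yinv_yco ht hτ] using h

/-- Holomorphic sections are determined by their distributions. -/
theorem eq_of_isRegularC (ht : t ≠ 0) (hτ : τ ∈ teich) {φ₁ φ₂ : AC r → ℂ} (h₁ : IsHolomorphic τ t φ₁)
    (h₂ : IsHolomorphic τ t φ₂) (hs₁ : SlowInt volume φ₁) (hs₂ : SlowInt volume φ₂) {S : SC' r τ t}
    (hS₁ : IsRegularC S φ₁) (hS₂ : IsRegularC S φ₂) : φ₁ = φ₂ := by
  let φ : AC r → ℂ := fun A => φ₁ A + -1 * φ₂ A
  have hφ : IsHolomorphic τ t φ := isHolomorphic_add h₁ (isHolomorphic_smul (-1) h₂)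
  have hs : SlowInt volume φ := hs₁.add (hs₂.const_mul (-1))
  have h0 : ∀ χ : HS r ‖t‖, ∫ y, φ (yinv t τ y) * star (χ.1 y) = 0 := fun χ => by
    refine (integral_comp_equiv_eq_zero_iff (yEquiv ht hτ)).1 ?_
    change ∫ A, φ (yinv t τ (yco t τ A)) * star (χ.1 (yco t τ A)) = 0
    simp only [yinv_yco ht hτ, ← toSC_apply ht hτ]
    obtain ⟨i₁, e₁⟩ := hS₁ (toSC ht hτ χ)
    obtain ⟨i₂, e₂⟩ := hS₂ (toSC ht hτ χ)
    have : ∀ A, φ A * star ((toSC ht hτ χ).1 A) = φ₁ A * star ((toSC ht hτ χ).1 A) - φ₂ A * star ((toSC ht hτ χ).1 A) := fun A => by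
      simp only [φ]; ring
    simp only [this]
    rw [integral_sub i₁ i₂, ← e₁, ← e₂, sub_self]
  have hc : 0 < ‖t‖ := norm_pos_iff.2 ht
  ext A
  have := eq_zero_of_isHol hc (isHol_comp_yinv ht hτ hφ) (hs.comp_equiv (yEquiv ht hτ).symm) h0 (yco t τ A)
  rw [yinv_yco ht hτ] at this
  simp only [φ] at this
  linear_combination this

end uniqueness

section growth
variable {r : ℕ} {c : ℝ} {f g : AC r → ℂ}

/-- Functions of polynomial growth. -/
def PolyBdd (f : AC r → ℂ) : Prop := ∃ (C : ℝ) (N : ℕ), ∀ w, ‖f w‖ ≤ C * (1 + ‖w‖) ^ N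

theorem PolyBdd.nonneg (hf : PolyBdd f) : ∃ (C : ℝ) (N : ℕ), 0 ≤ C ∧ ∀ w, ‖f w‖ ≤ C * (1 + ‖w‖) ^ N := by
  obtain ⟨C, N, h⟩ := hf
  exact ⟨C, N, by simpa using (norm_nonneg _).trans (h 0), h⟩

theorem PolyBdd.add (hf : PolyBdd f) (hg : PolyBdd g) : PolyBdd fun w => f w + g w := by
  obtain ⟨C, N, hC, h⟩ := hf.nonneg
  obtain ⟨D, M, hD, h'⟩ := hg.nonneg
  refine ⟨C + D, max N M, fun w => (norm_add_le _ _).trans ?_⟩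
  have h1 : 1 ≤ 1 + ‖w‖ := by linarith [norm_nonneg w]
  rw [add_mul]
  refine add_le_add ((h w).trans ?_) ((h' w).trans ?_)
  · exact mul_le_mul_of_nonneg_left (pow_le_pow_right₀ h1 (le_max_left _ _)) hC
  · exact mul_le_mul_of_nonneg_left (pow_le_pow_right₀ h1 (le_max_right _ _)) hD

theorem PolyBdd.mul (hf : PolyBdd f) (hg : PolyBdd g) : PolyBdd fun w => f w * g w := by
  obtain ⟨C, N, hC, h⟩ := hf.nonneg
  obtain ⟨D, M, hD, h'⟩ := hg.nonneg
  refine ⟨C * D, N + M, fun w => ?_⟩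
  rw [norm_mul, pow_add, mul_mul_mul_comm]
  exact mul_le_mul (h w) (h' w) (norm_nonneg _) (by positivity)

theorem polyBdd_const (a : ℂ) : PolyBdd fun _ : AC r => a := ⟨‖a‖, 0, fun w => by simp⟩

theorem polyBdd_coord (a : Idx r) : PolyBdd fun w : AC r => w a :=
  ⟨1, 1, fun w => by linarith [norm_le_pi_norm w a]⟩

theorem polyBdd_conj (a : Idx r) : PolyBdd fun w : AC r => conj (w a) :=
  ⟨1, 1, fun w => by rw [Complex.norm_conj]; linarith [norm_le_pi_norm w a]⟩

theorem PolyBdd.sum {ι : Type*} (s : Finset ι) {f : ι → AC r → ℂ} (hf : ∀ i, PolyBdd (f i)) :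
    PolyBdd fun w => ∑ i ∈ s, f i w := by
  classical
  induction s using Finset.induction_on with
  | empty => simpa using polyBdd_const 0
  | insert a s ha ih => simpa only [Finset.sum_insert ha] using (hf a).add ih

theorem PolyBdd.slowInt (hf : PolyBdd f) (hc : Continuous f) : SlowInt volume f := by
  obtain ⟨C, N, h⟩ := hf
  exact slowInt_of_bound hc.aestronglyMeasurable h

/-- Cauchy's estimate. -/
theorem PolyBdd.dHol (hf : PolyBdd f) (h : IsHol c f) (a : Idx r) : PolyBdd (dHol c a f) := by
  obtain ⟨C, N, hC, hb⟩ := hf.nonneg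
  refine ⟨C * 2 ^ N * Real.exp (c / 4), N, fun w => ?_⟩
  have h1 := hasDerivAt_lineFun h w (Pi.single a 1) 0
  have h2 : deriv (lineFun c f w (Pi.single a 1)) 0 = GenusOne.dHol c a f w := by
    rw [h1.deriv]
    simp [lineExp, Pi.single_apply]
  rw [← h2]
  refine (Complex.norm_deriv_le_of_forall_mem_sphere_norm_le one_pos (differentiable_lineFun h w _).diffContOnCl
    (C := C * 2 ^ N * Real.exp (c / 4) * (1 + ‖w‖) ^ N) fun ζ hζ => ?_).trans_eq (div_one _)
  have hζ1 : ‖ζ‖ = 1 := by simpa using hζ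
  have h3 : ∑ b, ‖(Pi.single a 1 : AC r) b‖ ^ 2 = 1 := by
    rw [Finset.sum_eq_single a] <;> simp +contextual [Pi.single_apply]
  have h4 : ‖w + ζ • (Pi.single a 1 : AC r)‖ ≤ ‖w‖ + 1 := by
    refine (norm_add_le _ _).trans ?_
    rw [norm_smul, hζ1, Pi.norm_single]; simp
  have h5 : (1 + ‖w + ζ • (Pi.single a 1 : AC r)‖) ^ N ≤ 2 ^ N * (1 + ‖w‖) ^ N := by
    rw [← mul_pow]
    exact pow_le_pow_left₀ (by positivity) (by linarith [norm_nonneg w]) N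
  rw [norm_lineFun, h3, hζ1, one_pow, one_mul, mul_one]
  calc _ ≤ C * (2 ^ N * (1 + ‖w‖) ^ N) * Real.exp (c / 4) := by
        refine mul_le_mul_of_nonneg_right ((hb _).trans (mul_le_mul_of_nonneg_left h5 hC)) (Real.exp_pos _).le
    _ = _ := by ring

theorem PolyBdd.fderiv (hf : PolyBdd f) (h : IsHol c f) (X : AC r) : PolyBdd fun y => fderiv ℝ f y X := by
  simp only [fderiv_of_isHol h]
  refine PolyBdd.sum _ fun a => ((polyBdd_const _).mul (hf.dHol h a)).add (PolyBdd.mul ?_ hf)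
  have e : (fun y : AC r => (c / 4 : ℂ) * (X a * conj (y a) - conj (X a) * y a)) = fun y =>
      c / 4 * X a * conj (y a) + -(c / 4 * conj (X a)) * y a := by ext y; ring
  rw [e]
  exact ((polyBdd_const _).mul (polyBdd_conj a)).add ((polyBdd_const _).mul (polyBdd_coord a))

/-- The holomorphic correction of `dHol`. -/
def holDer (c : ℝ) (a : Idx r) (f : AC r → ℂ) (y : AC r) : ℂ := dHol c a f y + c / 2 * (conj (y a) * f y)

theorem holDer_contDiff (hf : ContDiff ℝ ∞ f) (a : Idx r) : ContDiff ℝ ∞ (holDer c a f) :=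
  (dHol_contDiff hf a).add (contDiff_const.mul ((contDiff_conj_apply a).mul hf))

theorem isHol_holDer (hf : ContDiff ℝ ∞ f) (h : IsHol c f) (a : Idx r) : IsHol c (holDer c a f) := by
  refine (isHol_iff c _).2 ⟨(holDer_contDiff hf a).differentiable (by simp), fun b y => ?_⟩
  have h1 := dBar_dHol_of_isHol hf h a b y
  have h2 := dBar_conj_mul (c := c) (hf.differentiable (by simp)) a b y
  rw [((isHol_iff c f).1 h).2 b y] at h2
  have hd1 : DifferentiableAt ℝ (dHol c a f) y := (dHol_contDiff hf a).differentiable (by simp) y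
  have hd2 : DifferentiableAt ℝ (fun y : AC r => conj (y a) * f y) y :=
    ((contDiff_conj_apply a).mul hf).differentiable (by simp) y
  have h3 : _root_.fderiv ℝ (holDer c a f) y = _ := (hd1.hasFDerivAt.add (hd2.hasFDerivAt.const_mul (c / 2 : ℂ))).fderiv
  have h4 : dBar c b (holDer c a f) y = dBar c b (dHol c a f) y + c / 2 * dBar c b (fun y => conj (y a) * f y) y := by
    simp only [dBar, h3, holDer, add_apply, smul_apply, smul_eq_mul]; ring
  rw [h4, h1, h2]
  split_ifs <;> simp <;> ring

end growth
end GenusOne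

end

noncomputable section
namespace GenusOne
open Filter ComplexConjugate

section pairing
variable {r : ℕ} {c : ℝ} {f g : AC r → ℂ}

theorem integral_linear_combination {X : Type*} [MeasurableSpace X] {μ : Measure X} {u v w : X → ℂ} (hu : Integrable u μ)
    (hv : Integrable v μ) (hw : Integrable w μ) (a b d : ℂ) :
    ∫ y, (a * u y + b * v y + d * w y) ∂μ = a * ∫ y, u y ∂μ + b * ∫ y, v y ∂μ + d * ∫ y, w y ∂μ := by
  have h : Integrable (fun y => a * u y + b * v y) μ := (hu.const_mul a).add (hv.const_mul b)
  rw [integral_add h (hw.const_mul d), integral_add (hu.const_mul a) (hv.const_mul b)]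
  simp only [integral_const_mul]

theorem integrable_mul_star_conj_mul (hg : SlowInt volume g) (a : Idx r) (χ : 𝓢(AC r, ℂ)) :
    Integrable fun y => c / 4 * conj (y a) * g y * star (χ y) := by
  refine (hg.mul_bound (g := fun y : AC r => (c / 4 : ℂ) * conj (y a)) (by fun_prop) (C := ‖(c / 4 : ℂ)‖) (M := 1)
    fun y => ?_).integrable_mul_star χ
  rw [norm_mul, Complex.norm_conj, pow_one]
  exact mul_le_mul_of_nonneg_left (by linarith [norm_le_pi_norm y a]) (norm_nonneg _)

theorem integral_dHol_mul_star (hd : Differentiable ℝ g) (hg : SlowInt volume g)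
    (h' : ∀ v, SlowInt volume fun y => fderiv ℝ g y v) (a : Idx r) (χ : 𝓢(AC r, ℂ)) :
    ∫ y, dHol c a g y * star (χ y) = -(1 / 2) * ∫ y, g y * star (dBar c a χ y) := by
  have i1 := (h' (Pi.single a 1)).integrable_mul_star χ
  have i2 := (h' (Pi.single a Complex.I)).integrable_mul_star χ
  have i3 := integrable_mul_star_conj_mul (c := c) hg a χ
  have j1 := integrable_mul_star_fderiv hg χ (Pi.single a 1)
  have j2 := integrable_mul_star_fderiv hg χ (Pi.single a Complex.I)
  have k1 := integral_fderiv_mul_star hd hg (h' (Pi.single a 1)) χ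
  have k2 := integral_fderiv_mul_star hd hg (h' (Pi.single a Complex.I)) χ
  have e1 : ∀ y, dHol c a g y * star (χ y) = 1 / 2 * (fderiv ℝ g y (Pi.single a 1) * star (χ y)) +
      -(Complex.I / 2) * (fderiv ℝ g y (Pi.single a Complex.I) * star (χ y)) + -1 * (c / 4 * conj (y a) * g y * star (χ y)) := fun y => by
    rw [dHol]; ring
  have e2 : ∀ y, g y * star (dBar c a χ y) = 1 * (g y * star (fderiv ℝ χ y (Pi.single a 1))) +
      -Complex.I * (g y * star (fderiv ℝ χ y (Pi.single a Complex.I))) + 2 * (c / 4 * conj (y a) * g y * star (χ y)) := fun y => by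
    simp [dBar]; ring
  simp only [e1, e2]
  rw [integral_linear_combination i1 i2 i3, integral_linear_combination j1 j2 i3, k1, k2]
  ring

theorem integral_mul_star_dHol (hd : Differentiable ℝ g) (hg : SlowInt volume g)
    (h' : ∀ v, SlowInt volume fun y => fderiv ℝ g y v) (a : Idx r) (χ : 𝓢(AC r, ℂ)) :
    ∫ y, g y * star (dHol c a χ y) = -(1 / 2) * ∫ y, dBar c a g y * star (χ y) := by
  have i1 := (h' (Pi.single a 1)).integrable_mul_star χ
  have i2 := (h' (Pi.single a Complex.I)).integrable_mul_star χ
  have i3 : Integrable fun y => c / 4 * y a * g y * star (χ y) := by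
    refine (hg.mul_bound (g := fun y : AC r => (c / 4 : ℂ) * y a) (by fun_prop) (C := ‖(c / 4 : ℂ)‖) (M := 1)
      fun y => ?_).integrable_mul_star χ
    rw [norm_mul, pow_one]
    exact mul_le_mul_of_nonneg_left (by linarith [norm_le_pi_norm y a]) (norm_nonneg _)
  have j1 := integrable_mul_star_fderiv hg χ (Pi.single a 1)
  have j2 := integrable_mul_star_fderiv hg χ (Pi.single a Complex.I)
  have k1 := integral_fderiv_mul_star hd hg (h' (Pi.single a 1)) χ
  have k2 := integral_fderiv_mul_star hd hg (h' (Pi.single a Complex.I)) χ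
  have e1 : ∀ y, dBar c a g y * star (χ y) = 1 * (fderiv ℝ g y (Pi.single a 1) * star (χ y)) +
      Complex.I * (fderiv ℝ g y (Pi.single a Complex.I) * star (χ y)) + 2 * (c / 4 * y a * g y * star (χ y)) := fun y => by
    rw [dBar]; ring
  have e2 : ∀ y, g y * star (dHol c a χ y) = 1 / 2 * (g y * star (fderiv ℝ χ y (Pi.single a 1))) +
      Complex.I / 2 * (g y * star (fderiv ℝ χ y (Pi.single a Complex.I))) + -1 * (c / 4 * y a * g y * star (χ y)) := fun y => by
    simp [dHol]; ring
  simp only [e1, e2]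
  rw [integral_linear_combination i1 i2 i3, integral_linear_combination j1 j2 i3, k1, k2]
  ring

theorem polyBdd_fderiv_dHol (hf : ContDiff ℝ ∞ f) (h : IsHol c f) (hb : PolyBdd f) (a : Idx r) (v : AC r) :
    PolyBdd fun y => fderiv ℝ (dHol c a f) y v := by
  have hh := isHol_holDer hf h a
  have hhb : PolyBdd (holDer c a f) := (hb.dHol h a).add ((polyBdd_const _).mul ((polyBdd_conj a).mul hb))
  have e : dHol c a f = fun y => holDer c a f y + -(c / 2 : ℂ) * (conj (y a) * f y) := by
    ext y; rw [holDer]; ring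
  have e1 : ∀ y, fderiv ℝ (dHol c a f) y v = fderiv ℝ (holDer c a f) y v +
      -(c / 2 : ℂ) * (conj (y a) * fderiv ℝ f y v + conj (v a) * f y) := fun y => by
    rw [e]
    refine (DFunLike.congr_fun (((hh.1 y).hasFDerivAt).add
      (((hasFDerivAt_conj_apply a y).mul (h.1 y).hasFDerivAt).const_mul (-(c / 2 : ℂ)))).fderiv v).trans ?_
    simp
    ring
  simp only [e1]
  exact (hhb.fderiv hh v).add ((polyBdd_const _).mul (((polyBdd_conj a).mul (hb.fderiv h v)).add ((polyBdd_const _).mul hb)))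

theorem slowInt_dHol_dHol (hc : 0 < c) (hf : ContDiff ℝ ∞ f) (h : IsHol c f) (hs : SlowInt volume f) (a : Idx r) :
    SlowInt volume (dHol c a (dHol c a f)) := by
  have hb : PolyBdd f := exists_bound_of_isHol hc h hs
  refine PolyBdd.slowInt ?_ (dHol_contDiff (dHol_contDiff hf a) a).continuous
  have e : dHol c a (dHol c a f) = fun y => (1 / 2 * fderiv ℝ (dHol c a f) y (Pi.single a 1) +
      -(Complex.I / 2) * fderiv ℝ (dHol c a f) y (Pi.single a Complex.I)) + -(c / 4 : ℂ) * (conj (y a) * dHol c a f y) := by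
    ext y; rw [dHol]; ring
  rw [e]
  exact (((polyBdd_const _).mul (polyBdd_fderiv_dHol hf h hb a _)).add ((polyBdd_const _).mul
    (polyBdd_fderiv_dHol hf h hb a _))).add ((polyBdd_const _).mul ((polyBdd_conj a).mul (hb.dHol h a)))

theorem integral_dHol_dHol_mul_star (hc : 0 < c) (hf : ContDiff ℝ ∞ f) (h : IsHol c f) (hs : SlowInt volume f) (a : Idx r)
    (χ : HS r c) : ∫ y, dHol c a (dHol c a f) y * star (χ.1 y) = 0 := by
  have hb : PolyBdd f := exists_bound_of_isHol hc h hs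
  have hd := dHol_contDiff (c := c) hf a
  rw [integral_dHol_mul_star (hd.differentiable (by simp)) ((hb.dHol h a).slowInt hd.continuous)
    (fun v => (polyBdd_fderiv_dHol hf h hb a v).slowInt (contDiff_fderiv_const hd v).continuous)]
  have : ∀ y, dBar c a χ.1 y = 0 := ((isHol_iff c _).1 χ.2).2 a
  simp [this]

theorem integral_mul_star_dHol_dHol (hc : 0 < c) (hf : ContDiff ℝ ∞ f) (h : IsHol c f) (hs : SlowInt volume f) (a : Idx r)
    (χ : 𝓢(AC r, ℂ)) : ∫ y, f y * star (dHol c a (dHol c a χ) y) = 0 := by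
  have hb : PolyBdd f := exists_bound_of_isHol hc h hs
  rw [← coe_dHolS c a χ, integral_mul_star_dHol h.1 hs
    (fun v => (hb.fderiv h v).slowInt (contDiff_fderiv_const hf v).continuous)]
  simp [((isHol_iff c f).1 h).2 a]

end pairing

section connection
variable {n r : ℕ} {K T : Subgroup (U n)} {B : Mat n →ₗ[ℝ] Mat n →ₗ[ℝ] ℝ} {e : Fin r → Mat n} {t τ : ℂ}

theorem laplaceC_eq_comp_yinv (ht : t ≠ 0) (hτ : τ ∈ teich) (V : ℂ) {φ : AC r → ℂ} (hφ : ContDiff ℝ ∞ φ) (A : AC r) :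
    laplaceC t V τ φ A = ∑ a, 4 * yMu r t τ V a * dHol ‖t‖ a (dHol ‖t‖ a fun y => φ (yinv t τ y)) (yco t τ A) := by
  have := laplaceC_comp_yco ht hτ V (hφ.comp (yinv t τ).contDiff) A
  simpa only [Function.comp_apply, yinv_yco ht hτ, Function.comp_def] using this

theorem slowInt_laplaceC (ht : t ≠ 0) (hτ : τ ∈ teich) (V : ℂ) {φ : AC r → ℂ} (hφ : ContDiff ℝ ∞ φ)
    (h : IsHolomorphic τ t φ) (hs : SlowInt volume φ) : SlowInt volume (laplaceC t V τ φ) := by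
  have hc : 0 < ‖t‖ := norm_pos_iff.2 ht
  have e : laplaceC t V τ φ = _ := funext (laplaceC_eq_comp_yinv ht hτ V hφ)
  rw [e]
  exact SlowInt.sum _ fun a _ => SlowInt.const_mul _ ((slowInt_dHol_dHol hc (hφ.comp (yinv t τ).contDiff)
    (isHol_comp_yinv ht hτ h) (hs.comp_equiv (yEquiv ht hτ).symm) a).comp_equiv (yEquiv ht hτ))

theorem integral_laplaceC_mul_star (ht : t ≠ 0) (hτ : τ ∈ teich) (V : ℂ) {φ : AC r → ℂ} (hφ : ContDiff ℝ ∞ φ)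
    (h : IsHolomorphic τ t φ) (hs : SlowInt volume φ) (χ : SC r τ t) : ∫ A, laplaceC t V τ φ A * star (χ.1 A) = 0 := by
  have hc : 0 < ‖t‖ := norm_pos_iff.2 ht
  have hf : ContDiff ℝ ∞ fun y => φ (yinv t τ y) := hφ.comp (yinv t τ).contDiff
  have hh := isHol_comp_yinv ht hτ h
  have hs' : SlowInt volume fun y => φ (yinv t τ y) := hs.comp_equiv (yEquiv ht hτ).symm
  refine (integral_comp_equiv_eq_zero_iff (yEquiv ht hτ).symm).1 ?_
  change ∫ y, laplaceC t V τ φ (yinv t τ y) * star (χ.1 (yinv t τ y)) = 0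
  simp only [laplaceC_eq_comp_yinv ht hτ V hφ, yco_yinv ht hτ, ← ofSC_apply ht hτ, Finset.sum_mul, mul_assoc]
  rw [integral_finset_sum _ fun a _ => (((slowInt_dHol_dHol hc hf hh hs' a).integrable_mul_star _).const_mul _).const_mul _]
  refine Finset.sum_eq_zero fun a _ => ?_
  rw [integral_const_mul, integral_const_mul]
  rw [integral_dHol_dHol_mul_star hc hf hh hs' a (ofSC ht hτ χ), mul_zero, mul_zero]

theorem integral_mul_star_laplaceC (ht : t ≠ 0) (hτ : τ ∈ teich) (V : ℂ) {φ : AC r → ℂ} (hφ : ContDiff ℝ ∞ φ)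
    (h : IsHolomorphic τ t φ) (hs : SlowInt volume φ) (χ : SC r τ t) : ∫ A, φ A * star (laplaceC t V τ χ.1 A) = 0 := by
  have hc : 0 < ‖t‖ := norm_pos_iff.2 ht
  have hf : ContDiff ℝ ∞ fun y => φ (yinv t τ y) := hφ.comp (yinv t τ).contDiff
  have hh := isHol_comp_yinv ht hτ h
  have hs' : SlowInt volume fun y => φ (yinv t τ y) := hs.comp_equiv (yEquiv ht hτ).symm
  refine (integral_comp_equiv_eq_zero_iff (yEquiv ht hτ).symm).1 ?_
  change ∫ y, φ (yinv t τ y) * star (laplaceC t V τ χ.1 (yinv t τ y)) = 0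
  have e : ∀ y, φ (yinv t τ y) * star (laplaceC t V τ χ.1 (yinv t τ y)) = ∑ a, conj (4 * yMu r t τ V a) *
      (φ (yinv t τ y) * star (dHolS ‖t‖ a (dHolS ‖t‖ a (ofSC ht hτ χ).1) y)) := fun y => by
    rw [laplaceC_eq_comp_yinv ht hτ V (χ.1.smooth ⊤), yco_yinv ht hτ, star_sum, Finset.mul_sum]
    refine Finset.sum_congr rfl fun a _ => ?_
    rw [dHolS_apply, coe_dHolS, star_mul']
    simp only [← ofSC_apply ht hτ]
    simp only [Complex.star_def]
    ring
  simp only [e]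
  rw [integral_finset_sum _ fun a _ => (hs'.integrable_mul_star _).const_mul _]
  refine Finset.sum_eq_zero fun a _ => ?_
  rw [integral_const_mul]
  simp only [dHolS_apply, coe_dHolS]
  rw [integral_mul_star_dHol_dHol hc hf hh hs' a (ofSC ht hτ χ).1, mul_zero]

theorem isSmoothDistC_of_isSmoothFamilyC (he : IsOrthonormalFrame T B e) (hT : IsMaximalTorus K T) {Φ : ℂ → AC r → ℂ}
    (hΦ : IsSmoothFamilyC K T e t Φ) {S : ∀ τ : ℂ, SC' r τ t} (hS : ∀ τ ∈ teich, IsRegularC (S τ) (Φ τ)) : IsSmoothDistC S :=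
  fun χ hχ => (SlowL1Family.mul_star (slowL1Family_of_isSmoothFamilyC he hT hΦ) (χ := fun p => (χ p.1).1 p.2) hχ).contDiffOn.congr
    fun τ hτ => (hS τ hτ (χ τ)).2

theorem exists_isDualC_isRegularC (he : IsOrthonormalFrame T B e) (hT : IsMaximalTorus K T) (ht : t ≠ 0) {Φ : ℂ → AC r → ℂ}
    (hΦ : IsSmoothFamilyC K T e t Φ) {S : ∀ τ : ℂ, SC' r τ t} (hS : ∀ τ ∈ teich, IsRegularC (S τ) (Φ τ)) (hτ : τ ∈ teich) (V : ℂ) :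
    ∃ S' : SC' r τ t, IsDualC V S τ S' ∧ IsRegularC S' (covC t V Φ τ) := by
  have hΦ1 := slowL1Family_of_isSmoothFamilyC he hT hΦ
  obtain ⟨S', hS'⟩ := exists_isDualC ht S (isSmoothDistC_of_isSmoothFamilyC he hT hΦ hS) hτ V
  refine ⟨S', hS', fun χ => ?_⟩
  have hs := slowInt_of_isSmoothFamilyC he hT hΦ hτ
  have hd : ContDiff ℝ ∞ (Φ τ) := contDiff_slice hΦ.1 hτ
  have hh := (hΦ.2.1 τ hτ).1
  have hL := slowInt_laplaceC ht hτ V hd hh hs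
  have hV := hΦ1.fderiv hτ V
  have hcov : ∀ A, covC t V Φ τ A * star (χ.1 A) = fderiv ℝ (fun τ' => Φ τ' A) τ V * star (χ.1 A) +
      1 / (4 * (‖t‖ : ℂ)) * (laplaceC t V τ (Φ τ) A * star (χ.1 A)) := fun A => by
    rw [covC, uC]; ring
  have i1 := hV.integrable_mul_star χ.1
  have i2 := (hL.integrable_mul_star χ.1).const_mul (1 / (4 * (‖t‖ : ℂ)))
  simp only [hcov]
  refine ⟨i1.add i2, ?_⟩
  rw [integral_add i1 i2, integral_const_mul, integral_laplaceC_mul_star ht hτ V hd hh hs, mul_zero, add_zero]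
  have hc := constFamily_isSmoothTest ht (ofSC ht hτ χ)
  have hval : constFamily ht (ofSC ht hτ χ) τ = χ := by rw [constFamily_of_mem ht _ hτ, toSC_ofSC]
  obtain ⟨η, hη, h⟩ := hS' _ hc
  rw [hval] at h
  let χt : ℂ × AC r → ℂ := fun p => (constFamily ht (ofSC ht hτ χ) p.1).1 p.2
  have hχt : RapidFamily χt := hc
  have hχτ : ∀ A, χt (τ, A) = χ.1 A := fun A => by simp only [χt, hval]
  have hF : L1Family volume fun p : ℂ × AC r => Φ p.1 p.2 * star (χt p) := hΦ1.mul_star hχt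
  have h1 : (fun τ' => S τ' (constFamily ht (ofSC ht hτ χ) τ')) =ᶠ[𝓝 τ] fun τ' => ∫ A, Φ τ' A * star (χt (τ', A)) := by
    filter_upwards [isOpen_teich.mem_nhds hτ] with τ' hτ'
    exact (hS τ' hτ' _).2
  have h2 : fderiv ℝ (fun τ' => ∫ A, Φ τ' A * star (χt (τ', A))) τ V =
      ∫ A, fderiv ℝ (fun τ' => Φ τ' A * star (χt (τ', A))) τ V := by
    rw [(hF.hasFDerivAt hτ).fderiv, ContinuousLinearMap.integral_apply (hF.fderiv.integrable hτ)]
  let θ : 𝓢(AC r, ℂ) := (hχt.fderiv_apply (V, 0)).slice hτ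
  have hθ : ∀ A, fderiv ℝ (fun τ' => χt (τ', A)) τ V = θ A := fun A => by
    rw [fderiv_slice hχt.1 hτ]; rfl
  have h3 : ∀ A, fderiv ℝ (fun τ' => Φ τ' A * star (χt (τ', A))) τ V =
      fderiv ℝ (fun τ' => Φ τ' A) τ V * star (χ.1 A) + Φ τ A * star (θ A) := fun A => by
    have hdΦ := (slice_contDiffAt hΦ.1 hτ A).differentiableAt (by simp)
    have hdχ := (slice_contDiffAt hχt.1 hτ A).differentiableAt (by simp)
    have hst : HasFDerivAt (fun τ' => star (χt (τ', A))) _ τ := hdχ.hasFDerivAt.star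
    refine (DFunLike.congr_fun (hdΦ.hasFDerivAt.mul hst).fderiv V).trans ?_
    simp [hχτ, ← hθ]
    ring
  have h4 : ∀ A, Φ τ A * star (η.1 A) = Φ τ A * star (θ A) +
      conj (1 / (4 * (‖t‖ : ℂ))) * (Φ τ A * star (laplaceC t V τ χ.1 A)) := fun A => by
    have e1 : fderiv ℝ (fun τ' => (constFamily ht (ofSC ht hτ χ) τ').1 A) τ V = θ A := hθ A
    rw [hη, covC, e1, hval, uC]
    simp [map_ofNat]
    ring
  have i3 := hs.integrable_mul_star θ
  have i4 : Integrable fun A => conj (1 / (4 * (‖t‖ : ℂ))) * (Φ τ A * star (laplaceC t V τ χ.1 A)) := by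
    have := ((hS τ hτ η).1).sub i3
    refine this.congr (Eventually.of_forall fun A => ?_)
    simp only [Pi.sub_apply, h4]
    ring
  rw [h, h1.fderiv_eq, h2, (hS τ hτ η).2]
  simp only [h3, h4]
  rw [integral_add i1 i3, integral_add i3 i4, integral_const_mul, integral_mul_star_laplaceC ht hτ V hd hh hs]
  ring

end connection
end GenusOne

end

open GenusOne in
theorem theorem3 {n r : ℕ} (K T : Subgroup (U n))
    (hKclosed : IsClosed (K : Set (U n))) (hKsc : SimplyConnectedSpace K)
    (hT : IsMaximalTorus K T)
    (B : Mat n →ₗ[ℝ] Mat n →ₗ[ℝ] ℝ) (hB : IsInvariantPairing K B)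
    (e : Fin r → Mat n) (he : IsOrthonormalFrame T B e)
    (k : ℕ) (hk : 0 < k) (t : ℂ) (ht : t.re = k) :
    -- bounded sections over the compact moduli space are `L²`
    (∀ ψ : A0 r → ℂ, AEStronglyMeasurable ψ volume → IsEquivariant0 K T e t ψ →
      (∃ C : ℝ, ∀ A, ‖ψ A‖ ≤ C) → IsL2Section K T e t ψ) ∧
    -- `L²` sections embed as regular distributions
    (∀ ψ : A0 r → ℂ, IsL2Section K T e t ψ → ∃ S : S0' r, IsRegular0 S ψ) ∧
    (∀ (ψ₁ ψ₂ : A0 r → ℂ) (S : S0' r), IsL2Section K T e t ψ₁ → IsL2Section K T e t ψ₂ →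
      IsRegular0 S ψ₁ → IsRegular0 S ψ₂ → ψ₁ =ᵐ[volume] ψ₂) ∧
    (∀ τ ∈ teich, ∀ φ : AC r → ℂ, IsL2Holomorphic K T e τ t φ →
      ∃ S : SC' r τ t, IsRegularC S φ) ∧
    (∀ τ ∈ teich, ∀ (φ₁ φ₂ : AC r → ℂ) (S : SC' r τ t),
      IsL2Holomorphic K T e τ t φ₁ → IsL2Holomorphic K T e τ t φ₂ →
      IsRegularC S φ₁ → IsRegularC S φ₂ → φ₁ = φ₂) ∧
    -- the dual connections are well defined
    (∀ S : ℂ → S0' r, IsSmoothDist0 S → ∀ τ ∈ teich, ∀ V : ℂ, ∃! S' : S0' r,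
      IsDualHW t V S τ S') ∧
    (∀ S : ∀ τ : ℂ, SC' r τ t, IsSmoothDistC S → ∀ τ ∈ teich, ∀ V : ℂ, ∃! S' : SC' r τ t,
      IsDualC V S τ S') ∧
    -- the transpose of the Bargmann transform intertwines the dual connections
    (∃ Barg : ∀ τ : ℂ, S0 r →L[ℂ] SC r τ t,
      (∀ τ ∈ teich, ∀ (ψ : S0 r) (A : AC r), (Barg τ ψ).1 A = bargmann τ t ψ A) ∧
      ∀ S : ∀ τ : ℂ, SC' r τ t, IsSmoothDistC S →
        IsSmoothDist0 (fun τ => (S τ).comp (Barg τ)) ∧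
        ∀ τ ∈ teich, ∀ (V : ℂ) (S' : SC' r τ t), IsDualC V S τ S' →
          IsDualHW t V (fun τ' => (S τ').comp (Barg τ')) τ (S'.comp (Barg τ))) ∧
    -- on sections over the moduli spaces, the dual connections are the original ones
    (∀ (Ψ : ℂ → A0 r → ℂ) (S : ℂ → S0' r), IsSmoothFamily0 K T e t Ψ →
      (∀ τ ∈ teich, IsRegular0 (S τ) (Ψ τ)) → IsSmoothDist0 S ∧
      ∀ τ ∈ teich, ∀ V : ℂ, ∃ S' : S0' r, IsDualHW t V S τ S' ∧
        IsRegular0 S' (covHW t V Ψ τ)) ∧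
    (∀ (Φ : ℂ → AC r → ℂ) (S : ∀ τ : ℂ, SC' r τ t), IsSmoothFamilyC K T e t Φ →
      (∀ τ ∈ teich, IsRegularC (S τ) (Φ τ)) → IsSmoothDistC S ∧
      ∀ τ ∈ teich, ∀ V : ℂ, ∃ S' : SC' r τ t, IsDualC V S τ S' ∧
        IsRegularC S' (covC t V Φ τ)) := by
  have ht0 : t ≠ 0 := by
    rintro rfl
    simp only [Complex.zero_re] at ht
    exact hk.ne (by exact_mod_cast ht)
  refine ⟨fun ψ hm hψ hC => isL2Section_of_bounded he hT hm hψ hC,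
    fun ψ hψ => (slowInt_of_isL2Section he hT hψ).exists_isRegular0,
    fun ψ₁ ψ₂ S h₁ h₂ hS₁ hS₂ =>
      ae_eq_of_isRegular0 (slowInt_of_isL2Section he hT h₁) (slowInt_of_isL2Section he hT h₂) hS₁ hS₂,
    fun τ _ φ hφ => (slowInt_of_isL2Holomorphic he hT hφ).exists_isRegularC,
    fun τ hτ φ₁ φ₂ S h₁ h₂ hS₁ hS₂ => eq_of_isRegularC ht0 hτ h₁.1 h₂.1 (slowInt_of_isL2Holomorphic he hT h₁)
      (slowInt_of_isL2Holomorphic he hT h₂) hS₁ hS₂,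
    fun S hS τ hτ V => existsUnique_of_exists_of_unique (exists_isDualHW S hS hτ V)
      fun S₁ S₂ h₁ h₂ => isDualHW_unique S V h₁ h₂,
    fun S hS τ hτ V => existsUnique_of_exists_of_unique (exists_isDualC ht0 S hS hτ V)
      fun S₁ S₂ h₁ h₂ => isDualC_unique ht0 S hτ V h₁ h₂,
    ⟨bargOp r ht0, fun τ hτ ψ A => bargOp_eq_bargmann ht0 hτ ψ A, fun S hS =>
      ⟨bargOp_transpose_smooth ht0 hS, fun τ hτ V S' hS' => bargOp_transpose_dual ht0 hτ V hS'⟩⟩,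
    fun Ψ S hΨ hS => ⟨isSmoothDist0_of_isSmoothFamily0 he hT hΨ hS, fun τ hτ V =>
      exists_isDualHW_isRegular0 he hT hΨ hS hτ V⟩,
    fun Φ S hΦ hS => ⟨isSmoothDistC_of_isSmoothFamilyC he hT hΦ hS, fun τ hτ V =>
      exists_isDualC_isRegularC he hT ht0 hΦ hS hτ V⟩⟩
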